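/- **Games.** An arena is a finite non-empty directed graph $A=(V,E)$ without dead ends whose nodes are partitioned between a system player and an environment player. A Manna-Pnueli (MP) game $G=(A,(\Gamma,\gamma,\varphi))$ has in addition a finite set $\Gamma$ of events with $|\Gamma|\le|V|$, a labelling $\gamma:V\to2^\Gamma$, and a positive Boolean formula $\varphi$ (with constants $\top,\bot$) over atoms $\mathsf{GF}\,a$ ($a$ occurs infinitely often), $\mathsf{FG}\,a$ ($a$ occurs from some point on always), $\mathsf F\,a$ ($a$ occurs at least once), $\mathsf G\,a$ ($a$ occurs always), $a\in\Gamma$. The system player wins an infinite play $\pi=v_0v_1\dots$ if the sequence $\gamma(v_0)\gamma(v_1)\dots$ satisfies $\varphi$; otherwise the environment player wins. Different atoms of $\varphi$ use different events. Let $n=|V|$, let $\Gamma_{\mathsf F},\Gamma_{\mathsf G},\Gamma_{\mathsf{EL}}$ be the sets of events in atoms $\mathsf F\,a$, in atoms $\mathsf G\,a$, and in atoms $\mathsf{GF}\,a$ or $\mathsf{FG}\,a$, and let $k=|\Gamma_{\mathsf{EL}}|$ (Emerson-Lei events) and $d=|\Gamma_{\mathsf F}\cup\Gamma_{\mathsf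 G}|$ (local events). Let $|\varphi|$ be the number of nodes of the syntax tree of $\varphi$. Solving a game means computing the sets of nodes won by the two players together with (finite-memory) strategies that win all these nodes. Time is counted on unit-cost random access machines with addition and subtraction; the game, including $\varphi$, is given explicitly. **Reduction.** The arena $A'$ has nodes $(v,L)\in V\times2^{\Gamma_{\mathsf F}\cup\Gamma_{\mathsf G}}$, owned by the owner of $v$, with edges from $(v,L)$ to $(w,\mathsf{upd}(v,L))$ for $(v,w)\in E$, where $\mathsf{upd}(v,L)=((L\cap\gamma(v))\cap\Gamma_{\mathsf G})\cup((L\cup\gamma(v))\cap\Gamma_{\mathsf F})$. The Emerson-Lei (EL) game $G_1$ over $A'$ has labelling $\gamma'(v,L)=(\gamma(v)\cap\Gamma_{\mathsf{EL}})\cup L$ and the formula obtained from $\varphi$ by replacing all atoms $\mathsf F\,a$ and $\mathsf G\,a$ by $\mathsf{GF}\,a$. An arena *has memory for local events* if on every infinite path, each $a\in\Gamma_{\mathsf F}$ occurs at least once iff it occurs from some point on always, and each $a\in\Gamma_{\mathsf G}$ is missing at least once iff it is missing from some point on always. **Corollary.** 1. MP games can be solved in time $$\mathcal O\big((k+d)!\cdot(n\cdot2^d)^{k+d+2}+2^{k+d}\cdot|\varphi|\big),$$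 hence in time $\mathcal O((k+d)!\cdot(n\cdot2^d)^{k+d+2})$ if $|\varphi|\le2n^2$ (in particular if $\varphi$ is constant-free and each event occurs only once in it). The computed strategies have at most $(k+d)!\cdot2^d$ memory values. 2. MP games over arenas that have memory for local events can be solved in time $\mathcal O((k+d)!\cdot n^{k+d+2}+2^{k+d}\cdot|\varphi|)$, hence in time $\mathcal O((k+d)!\cdot n^{k+d+2})$ if $|\varphi|\le2n^2$. The computed strategies have at most $(k+d)!$ memory values. 3. For $n\ge2$ and $1\le k+d\le n$, $(k+d)!\cdot n^{k+d+2}\in2^{\mathcal O((k+d)\log n)}$, and, if also $d\ge1$, $(k+d)!\cdot(n\cdot2^d)^{k+d+2}\in2^{\mathcal O(d(k+d)\log n)}$. 4. A player wins $v$ in $G$ iff that player wins $(v,\Gamma_{\mathsf G})$ in $G_1$. Winning strategies need at most $(k+d)!$ memory values: for each player there is a strategy with at most $(k+d)!$ memory values that wins all nodes won by that player (a) in $G_1$; (b) in $G$, if the arena of $G$ has memory for local events; (c) in $G$ for arbitrary arenas, except possibly if $k=0$ and $d\in\{2,3\}$. Constants in $\mathcal O$ and algorithms do not depend on the game. -/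

import Mathlib

namespace MannaPnueli

/-! ## Formulas -/

/-- The four shapes of temporal atoms of Manna-Pnueli formulas. -/
inductive TempOp
  | GF
  | FG
  | F
  | G

/-- Manna-Pnueli formulas over a set `Γ` of events: positive Boolean formulas over the atoms
`GF a`, `FG a`, `F a`, `G a`. -/
inductive MPFormula (Γ : Type*)
  | tt : MPFormula Γ
  | ff : MPFormula Γ
  | atom : TempOp → Γ → MPFormula Γ
  | and : MPFormula Γ → MPFormula Γ → MPFormula Γ
  | or : MPFormula Γ → MPFormula Γ → MPFormula Γ

/-- Evaluation of an atom on an infinite sequence of sets of events. -/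
def TempOp.Holds {Γ : Type*} (w : ℕ → Set Γ) (a : Γ) : TempOp → Prop
  | .GF => ∀ i, ∃ j, i < j ∧ a ∈ w j
  | .FG => ∃ i, ∀ j, i < j → a ∈ w j
  | .F => ∃ i, a ∈ w i
  | .G => ∀ i, a ∈ w i

namespace MPFormula

variable {Γ : Type*}

/-- Evaluation of a formula on an infinite sequence of sets of events. -/
def Sat (w : ℕ → Set Γ) : MPFormula Γ → Prop
  | tt => True
  | ff => False
  | atom o a => o.Holds w a
  | and p q => p.Sat w ∧ q.Sat w
  | or p q => p.Sat w ∨ q.Sat w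

/-- The atom with operator `o` and event `a` occurs in the formula. -/
def Occurs (o : TempOp) (a : Γ) : MPFormula Γ → Prop
  | tt => False
  | ff => False
  | atom o' a' => o = o' ∧ a = a'
  | and p q => p.Occurs o a ∨ q.Occurs o a
  | or p q => p.Occurs o a ∨ q.Occurs o a

/-- Different atoms of the formula use different events. -/
def UniqueEvents (φ : MPFormula Γ) : Prop :=
  ∀ (a : Γ) (o o' : TempOp), φ.Occurs o a → φ.Occurs o' a → o = o'

/-- The events that occur in atoms `F a`. -/
def fEvents (φ : MPFormula Γ) : Set Γ := {a | φ.Occurs .F a}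

/-- The events that occur in atoms `G a`. -/
def gEvents (φ : MPFormula Γ) : Set Γ := {a | φ.Occurs .G a}

/-- The Emerson-Lei events of the formula. -/
def elEvents (φ : MPFormula Γ) : Set Γ := {a | φ.Occurs .GF a ∨ φ.Occurs .FG a}

/-- The local events of the formula: those that occur, but only in atoms `F a` or `G a`. -/
def localEvents (φ : MPFormula Γ) : Set Γ := (φ.fEvents ∪ φ.gEvents) \ φ.elEvents

/-- Number of Emerson-Lei events. -/
noncomputable def numEL (φ : MPFormula Γ) : ℕ := φ.elEvents.ncard

/-- Number of local events. -/
noncomputable def numLocal (φ : MPFormula Γ) : ℕ := φ.localEvents.ncard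

/-- Number of nodes of the syntax tree. -/
def size : MPFormula Γ → ℕ
  | tt => 1
  | ff => 1
  | atom _ _ => 1
  | and p q => p.size + q.size + 1
  | or p q => p.size + q.size + 1

/-- Replace all atoms `F a` and `G a` by `GF a`. -/
def toEL : MPFormula Γ → MPFormula Γ
  | tt => tt
  | ff => ff
  | atom .FG a => atom .FG a
  | atom _ a => atom .GF a
  | and p q => and p.toEL q.toEL
  | or p q => or p.toEL q.toEL

end MPFormula

/-! ## Games and strategies -/

/-- The two players: system and environment. -/
inductive Player
  | sys
  | env

/-- Game arenas: directed graphs without dead ends whose nodes are partitioned into the set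
`sysNodes` of system nodes and its complement, the set of environment nodes. -/
structure Arena (V : Type*) where
  sysNodes : Set V
  edge : V → V → Prop
  total : ∀ v, ∃ w, edge v w

namespace Arena

variable {V : Type*}

/-- `A.Owns P v`: the node `v` is controlled by player `P`. -/
def Owns (A : Arena V) : Player → V → Prop
  | .sys, v => v ∈ A.sysNodes
  | .env, v => v ∉ A.sysNodes

/-- Infinite plays. -/
def IsPlay (A : Arena V) (π : ℕ → V) : Prop := ∀ i, A.edge (π i) (π (i + 1))

end Arena

/-- Strategies for player `P`: `move [v₀, …, vₙ₋₁] vₙ` is the successor of `vₙ` chosen after the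
history `v₀ … vₙ`. Values at nodes of the other player are irrelevant. -/
structure Strategy {V : Type*} (A : Arena V) (P : Player) where
  move : List V → V → V
  legal : ∀ h v, A.Owns P v → A.edge v (move h v)

/-- The play `π` is compatible with the strategy. -/
def Strategy.Compatible {V : Type*} {A : Arena V} {P : Player} (σ : Strategy A P)
    (π : ℕ → V) : Prop :=
  ∀ i, A.Owns P (π i) → π (i + 1) = σ.move ((List.range i).map π) (π i)

/-- Finite-memory strategies with set `M` of memory values: the memory starts with `init`, is
updated along the visited nodes by `upd`, and the next move depends on the current memory value and
the current node. -/
structure MemStrategy {V : Type*} (A : Arena V) (P : Player) (M : Type*) where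
  init : M
  upd : M → V → M
  next : M → V → V
  legal : ∀ q v, A.Owns P v → A.edge v (next q v)

/-- The strategy described by a finite-memory strategy. -/
def MemStrategy.toStrategy {V M : Type*} {A : Arena V} {P : Player} (τ : MemStrategy A P M) :
    Strategy A P where
  move h v := τ.next (h.foldl τ.upd τ.init) v
  legal _ v hv := τ.legal _ v hv

/-- Manna-Pnueli games: an arena together with a Manna-Pnueli objective, given by a labelling of the
nodes with sets of events and a Manna-Pnueli formula. Emerson-Lei games are those whose formula has
no atoms `F a` and `G a`. -/
structure MPGame (V Γ : Type*) extends Arena V where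
  label : V → Set Γ
  formula : MPFormula Γ

namespace MPGame

variable {V Γ : Type*}

/-- The play `π` is winning for player `P`. -/
def WinningPlay (G : MPGame V Γ) (π : ℕ → V) : Player → Prop
  | .sys => G.formula.Sat fun i => G.label (π i)
  | .env => ¬ G.formula.Sat fun i => G.label (π i)

/-- The strategy `σ` wins the node `v` for player `P`. -/
def Wins (G : MPGame V Γ) {P : Player} (σ : Strategy G.toArena P) (v : V) : Prop :=
  ∀ π : ℕ → V, G.IsPlay π → π 0 = v → σ.Compatible π → G.WinningPlay π P

/-- The set of nodes won by player `P`. -/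
def winRegion (G : MPGame V Γ) (P : Player) : Set V :=
  {v | ∃ σ : Strategy G.toArena P, G.Wins σ v}

/-- Player `P` has a strategy with at most `B` memory values that wins all nodes won by `P`. -/
def MemoryAtMost (G : MPGame V Γ) (P : Player) (B : ℕ) : Prop :=
  ∃ m ≤ B, ∃ τ : MemStrategy G.toArena P (Fin m), ∀ v ∈ G.winRegion P, G.Wins τ.toStrategy v

/-- The arena has memory for the local events: an infinite path visits an `F`-event at least once
iff it eventually always has the event, and it misses a `G`-event at least once iff it eventually
always misses the event. -/
def HasLocalMemory (G : MPGame V Γ) : Prop :=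
  ∀ π : ℕ → V, G.IsPlay π →
    (∀ a ∈ G.formula.fEvents,
      ((∃ i, a ∈ G.label (π i)) ↔ ∃ i, ∀ j, i < j → a ∈ G.label (π j))) ∧
    (∀ a ∈ G.formula.gEvents,
      ((∃ i, a ∉ G.label (π i)) ↔ ∃ i, ∀ j, i < j → a ∉ G.label (π j)))

/-! ### The reduction to Emerson-Lei games -/

/-- Memory values: sets of `F`- and `G`-events. -/
abbrev LocalMemory (G : MPGame V Γ) : Type _ :=
  {L : Set Γ // L ⊆ G.formula.fEvents ∪ G.formula.gEvents}

/-- Memory update: remove the `G`-events that do not occur at `v`, and add the `F`-events that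
occur at `v`. -/
def updMemory (G : MPGame V Γ) (v : V) (L : G.LocalMemory) : G.LocalMemory :=
  ⟨((L.1 ∩ G.label v) ∩ G.formula.gEvents) ∪ ((L.1 ∪ G.label v) ∩ G.formula.fEvents), by
    rintro a (h | h)
    · exact Or.inr h.2
    · exact Or.inl h.2⟩

/-- The initial memory value: no `F`-event has occurred, no `G`-event has been missed. -/
def initMemory (G : MPGame V Γ) : G.LocalMemory :=
  ⟨G.formula.gEvents, Set.subset_union_right⟩

/-- The arena augmented with memory for local events. -/
def augArena (G : MPGame V Γ) : Arena (V × G.LocalMemory) where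
  sysNodes := {x | x.1 ∈ G.sysNodes}
  edge x y := G.edge x.1 y.1 ∧ y.2 = G.updMemory x.1 x.2
  total x := by
    obtain ⟨w, hw⟩ := G.total x.1
    exact ⟨(w, G.updMemory x.1 x.2), hw, rfl⟩

/-- The Emerson-Lei game over the augmented arena in which the local events, read off the memory,
are treated as Emerson-Lei events. -/
def elGame (G : MPGame V Γ) : MPGame (V × G.LocalMemory) Γ where
  toArena := G.augArena
  label x := (G.label x.1 ∩ G.formula.elEvents) ∪ x.2.1
  formula := G.formula.toEL

end MPGame

/-! ## Random access machines

Time is measured on unit-cost random access machines with addition and truncated subtraction,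
programmed in a structured language. The memory consists of scalar variables and of arrays, all
holding natural numbers; a program is a finite object and mentions finitely many of them. -/

/-- Contents of the memory: `arr a i` is the cell with index `i` of the array `a`. -/
structure Store where
  var : ℕ → ℕ
  arr : ℕ → ℕ → ℕ

/-- Overwrite a variable. -/
def Store.setVar (s : Store) (x n : ℕ) : Store :=
  { s with var := Function.update s.var x n }

/-- Overwrite one cell of an array. -/
def Store.setArr (s : Store) (a i n : ℕ) : Store :=
  { s with arr := Function.update s.arr a (Function.update (s.arr a) i n) }

/-- Expressions. -/
inductive Expr
  | const : ℕ → Expr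
  | var : ℕ → Expr
  | get : ℕ → Expr → Expr
  | add : Expr → Expr → Expr
  | sub : Expr → Expr → Expr

/-- Value of an expression; `get a e` reads the array `a` at the index given by `e`. -/
def Expr.eval (s : Store) : Expr → ℕ
  | const c => c
  | var x => s.var x
  | get a e => s.arr a (e.eval s)
  | add e f => e.eval s + f.eval s
  | sub e f => e.eval s - f.eval s

/-- Commands: `call j` calls the parameterless procedure with number `j` of the program. -/
inductive Cmd
  | skip : Cmd
  | assign : ℕ → Expr → Cmd
  | store : ℕ → Expr → Expr → Cmd
  | seq : Cmd → Cmd → Cmd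
  | cond : Expr → Cmd → Cmd → Cmd
  | loop : Expr → Cmd → Cmd
  | call : ℕ → Cmd

/-- A program: a main command and a finite list of (possibly recursive) procedures. -/
structure Program where
  main : Cmd
  procs : List Cmd

/-- `Exec ps c s s' t`: the command `c`, started with memory `s`, terminates after `t` steps with
memory `s'`. Assignments, tests and calls take one step each; the expressions of a fixed program
have bounded size. -/
inductive Exec (ps : List Cmd) : Cmd → Store → Store → ℕ → Prop
  | skip (s : Store) : Exec ps .skip s s 1
  | assign (s : Store) (x : ℕ) (e : Expr) :
      Exec ps (.assign x e) s (s.setVar x (e.eval s)) 1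
  | store (s : Store) (a : ℕ) (i e : Expr) :
      Exec ps (.store a i e) s (s.setArr a (i.eval s) (e.eval s)) 1
  | seq {c c' : Cmd} {s s' s'' : Store} {t t' : ℕ} :
      Exec ps c s s' t → Exec ps c' s' s'' t' → Exec ps (.seq c c') s s'' (t + t')
  | condTrue {e : Expr} {c c' : Cmd} {s s' : Store} {t : ℕ} :
      e.eval s ≠ 0 → Exec ps c s s' t → Exec ps (.cond e c c') s s' (t + 1)
  | condFalse {e : Expr} {c c' : Cmd} {s s' : Store} {t : ℕ} :
      e.eval s = 0 → Exec ps c' s s' t → Exec ps (.cond e c c') s s' (t + 1)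
  | loopTrue {e : Expr} {c : Cmd} {s s' s'' : Store} {t t' : ℕ} :
      e.eval s ≠ 0 → Exec ps c s s' t → Exec ps (.loop e c) s' s'' t' →
      Exec ps (.loop e c) s s'' (t + t' + 1)
  | loopFalse {e : Expr} {c : Cmd} {s : Store} :
      e.eval s = 0 → Exec ps (.loop e c) s s 1
  | call {j : ℕ} {c : Cmd} {s s' : Store} {t : ℕ} :
      ps[j]? = some c → Exec ps c s s' t → Exec ps (.call j) s s' (t + 1)

/-- The program halts on `s` after `t` steps with memory `s'`. -/
def Program.Halts (p : Program) (s s' : Store) (t : ℕ) : Prop := Exec p.procs p.main s s' t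

/-! ## Representation of games and of their solutions in memory -/

/-- Codes of the operators of formulas. -/
def TempOp.code : TempOp → ℕ
  | .GF => 4
  | .FG => 5
  | .F => 6
  | .G => 7

/-- Formulas in postfix notation, as lists of pairs (operator, event). -/
def MPFormula.code {g : ℕ} : MPFormula (Fin g) → List (ℕ × ℕ)
  | .tt => [(0, 0)]
  | .ff => [(1, 0)]
  | .and p q => p.code ++ q.code ++ [(2, 0)]
  | .or p q => p.code ++ q.code ++ [(3, 0)]
  | .atom o a => [(o.code, a.val)]

open Classical in
/-- Truth values as numbers. -/
noncomputable def bit (p : Prop) : ℕ := if p then 1 else 0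

namespace MPGame

variable {n g : ℕ}

/-- The memory that holds the game as input. Variables 0, 1, 2: number of nodes, number of events,
size of the formula. Array 0: ownership of the nodes. Array 1: adjacency matrix. Array 2: labels of
the nodes. Arrays 3 and 4: the formula in postfix notation. Everything else is 0. -/
noncomputable def input (G : MPGame (Fin n) (Fin g)) : Store where
  var
    | 0 => n
    | 1 => g
    | 2 => G.formula.size
    | _ => 0
  arr
    | 0 => fun i => bit (∃ v : Fin n, i = v.val ∧ v ∈ G.sysNodes)
    | 1 => fun i => bit (∃ v w : Fin n, i = v.val * n + w.val ∧ G.edge v w)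
    | 2 => fun i => bit (∃ (v : Fin n) (a : Fin g), i = v.val * g + a.val ∧ a ∈ G.label v)
    | 3 => fun i => (G.formula.code.getD i (0, 0)).1
    | 4 => fun i => (G.formula.code.getD i (0, 0)).2
    | _ => fun _ => 0

/-- Variable that holds the number of memory values of the computed strategy of player `P`. -/
def outSize : Player → ℕ
  | .sys => 0
  | .env => 1

/-- Array that holds the memory updates of the computed strategy of player `P`. -/
def outUpd : Player → ℕ
  | .sys => 1
  | .env => 3

/-- Array that holds the moves of the computed strategy of player `P`. -/
def outNext : Player → ℕ
  | .sys => 2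
  | .env => 4

/-- The memory `s` holds a solution of the game: array 0 contains for each node its winner (1 for
the system player, 0 for the environment player), and for each player the tables of a strategy
with at most `B` memory values (0 being the initial one) that wins all nodes won by that player. -/
def SolutionIn (G : MPGame (Fin n) (Fin g)) (B : ℕ) (s : Store) : Prop :=
  (∀ v : Fin n, (v ∈ G.winRegion .sys ↔ s.arr 0 v.val = 1) ∧
    (v ∈ G.winRegion .env ↔ s.arr 0 v.val = 0)) ∧
  ∀ P : Player, s.var (outSize P) ≤ B ∧
    ∃ τ : MemStrategy G.toArena P (Fin (s.var (outSize P))),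
      τ.init.val = 0 ∧
      (∀ q v, (τ.upd q v).val = s.arr (outUpd P) (q.val * n + v.val)) ∧
      (∀ q v, G.Owns P v → (τ.next q v).val = s.arr (outNext P) (q.val * n + v.val)) ∧
      ∀ v ∈ G.winRegion P, G.Wins τ.toStrategy v

/-- On input `G`, the program computes a solution of `G` with strategies that have at most `B`
memory values, in at most `T` steps. -/
def SolvedWithin (G : MPGame (Fin n) (Fin g)) (p : Program) (B T : ℕ) : Prop :=
  ∃ (s : Store) (t : ℕ), p.Halts G.input s t ∧ t ≤ T ∧ G.SolutionIn B s

end MPGame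

end MannaPnueli

open MannaPnueli

namespace MannaPnueli

/-! ## A program logic with time bounds -/

-- Algorithm, determinacy and memory bounds all come from one recursive procedure for Emerson-Lei
-- games in the manner of McNaughton and Zielonka. It is written as a program of the machine and
-- verified with a program logic that carries time bounds (`Run`).
--
-- Let `C` be the set of colors left in a subgame on `Z`, and let `P` be the player who wins if
-- exactly the colors of `C` recur. For `c ∈ C`, remove the attractor of `P` to `c`, and solve the
-- rest, which has one color less. If the opponent wins a node there, these wins persist in `Z`,
-- because `P` has no move from the rest into its own attractor (`Board.Sol.extend`); the opponent's
-- attractor to them is removed, and all colors are treated anew. If the opponent wins nothing for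
-- any color, then `P` wins all of `Z` by attracting the play to the colors in cyclic order, with
-- one block of `(|C| - 1)!` memory values per color: either the cycle goes on forever and all
-- colors recur, or the play finally stays in one of the subgames that `P` wins (`Board.Sol.cycle`).
-- Hence `|C|!` memory values suffice. Pieces of the opponent fit into the same table, so a single
-- table of updates and moves serves both players. The correctness proof is in `run_step` and
-- `run_solve`.
--
-- Attractors take quadratic time. A level runs through at most `(N + 1) * |C|` iterations, since
-- each removal costs a node; the recurrence yields `K! * (N + 1) ^ (K + 2)` up to a constant
-- (`solveTime_le`), and `N + 1` may be replaced by `N` as `K ≤ N` (`succ_pow_le`).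
--
-- For the reduction, call the presence of an event of an atom `GF` or `F`, and the absence of an
-- event of an atom `FG` or `G`, a hit. The truth value of the formula depends only on which
-- Emerson-Lei events are hit infinitely often and which local events are hit at all
-- (`MPGame.sat_iff`). A memory of past hits is monotone, so "hit at all" becomes "infinitely often
-- remembered as hit" (`MPGame.sat_iff_elGame_sat`). The program works on the product with this
-- memory, whose nodes are numbers `l * n + v` with a bit mask `l` (`MPGame.sat_iff_prod`,
-- `MPGame.solutionIn_of_output`). If the arena has memory for local events, a single hit entails
-- infinitely many, and no product is needed.
--
-- For abstract finite arenas, solutions are obtained by running the verified program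
-- (`exists_sol`). The bound `(k + d)!` for games without memory in the arena comes from layers, the
-- parts of the augmented arena with constant memory: there local atoms are constants, and `k!`
-- values suffice (`MPGame.exists_layered_sol`). Together with the memory for local events this
-- makes `2 ^ d * k!`, which exceeds `(k + d)!` just for `k = 0` and `d` from 1 to 3; the case `d =
-- 1` has a direct argument (`MPGame.memoryAtMost_one`).

infixr:60 " ;; " => Cmd.seq
infix:61 " ::= " => Cmd.assign

section

instance : OfNat Expr 0 := ⟨.const 0⟩
instance : OfNat Expr 1 := ⟨.const 1⟩
instance : Add Expr := ⟨.add⟩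
instance : Sub Expr := ⟨.sub⟩

@[simp] theorem Expr.eval_const (s : Store) (n : ℕ) : (Expr.const n).eval s = n := rfl
@[simp] theorem Expr.eval_zero (s : Store) : (0 : Expr).eval s = 0 := rfl
@[simp] theorem Expr.eval_one (s : Store) : (1 : Expr).eval s = 1 := rfl
@[simp] theorem Expr.eval_var (s : Store) (x : ℕ) : (Expr.var x).eval s = s.var x := rfl
@[simp] theorem Expr.eval_get (s : Store) (a : ℕ) (e : Expr) :
    (Expr.get a e).eval s = s.arr a (e.eval s) := rfl
@[simp] theorem Expr.eval_add (s : Store) (e f : Expr) : (e + f).eval s = e.eval s + f.eval s := rfl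
@[simp] theorem Expr.eval_sub (s : Store) (e f : Expr) : (e - f).eval s = e.eval s - f.eval s := rfl

@[simp] theorem Store.setVar_var (s : Store) (x n y : ℕ) :
    (s.setVar x n).var y = if y = x then n else s.var y := by
  simp [Store.setVar, Function.update_apply]
@[simp] theorem Store.setVar_arr (s : Store) (x n : ℕ) : (s.setVar x n).arr = s.arr := rfl
@[simp] theorem Store.setArr_var (s : Store) (a i n : ℕ) : (s.setArr a i n).var = s.var := rfl
@[simp] theorem Store.setArr_arr (s : Store) (a i n b : ℕ) :
    (s.setArr a i n).arr b = if b = a then Function.update (s.arr a) i n else s.arr b := by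
  simp [Store.setArr, Function.update_apply]

/-- The command `c` terminates from `s` within `T` steps in a memory that satisfies `Q`. -/
def Run (ps : List Cmd) (c : Cmd) (s : Store) (T : ℕ) (Q : Store → Prop) : Prop :=
  ∃ s' t, Exec ps c s s' t ∧ t ≤ T ∧ Q s'

variable {ps : List Cmd} {c c' : Cmd} {s s' s'' : Store} {T T' T₁ T₂ : ℕ} {Q Q' : Store → Prop}

theorem Run.mono (h : Run ps c s T Q) (hT : T ≤ T') : Run ps c s T' Q := by
  obtain ⟨s', t, h1, h2, h3⟩ := h
  exact ⟨s', t, h1, h2.trans hT, h3⟩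

theorem Run.imp (h : Run ps c s T Q) (hQ : ∀ s', Q s' → Q' s') : Run ps c s T Q' := by
  obtain ⟨s', t, h1, h2, h3⟩ := h
  exact ⟨s', t, h1, h2, hQ _ h3⟩

theorem Run.skip (h : Q s) : Run ps .skip s 1 Q := ⟨s, 1, .skip s, le_rfl, h⟩

theorem Run.assign {x : ℕ} {e : Expr} (h : Q (s.setVar x (e.eval s))) :
    Run ps (x ::= e) s 1 Q := ⟨_, 1, .assign s x e, le_rfl, h⟩

theorem Run.store {a : ℕ} {i e : Expr} (h : Q (s.setArr a (i.eval s) (e.eval s))) :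
    Run ps (.store a i e) s 1 Q := ⟨_, 1, .store s a i e, le_rfl, h⟩

theorem Run.seq (h : Run ps c s T₁ (fun s' => Run ps c' s' T₂ Q)) :
    Run ps (c ;; c') s (T₁ + T₂) Q := by
  obtain ⟨s', t, h1, h2, s'', t', h3, h4, h5⟩ := h
  exact ⟨s'', t + t', .seq h1 h3, add_le_add h2 h4, h5⟩

theorem Run.seq_imp {R : Store → Prop} (h : Run ps c s T₁ R)
    (h' : ∀ s', R s' → Run ps c' s' T₂ Q) : Run ps (c ;; c') s (T₁ + T₂) Q :=
  Run.seq (h.imp h')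

theorem Run.cond {e : Expr} (h : e.eval s ≠ 0 → Run ps c s T Q)
    (h' : e.eval s = 0 → Run ps c' s T Q) : Run ps (.cond e c c') s (T + 1) Q := by
  by_cases he : e.eval s = 0
  · obtain ⟨s', t, h1, h2, h3⟩ := h' he
    exact ⟨s', t + 1, .condFalse he h1, by omega, h3⟩
  · obtain ⟨s', t, h1, h2, h3⟩ := h he
    exact ⟨s', t + 1, .condTrue he h1, by omega, h3⟩

theorem Run.call {j : ℕ} (hj : ps[j]? = some c) (h : Run ps c s T Q) :
    Run ps (.call j) s (T + 1) Q := by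
  obtain ⟨s', t, h1, h2, h3⟩ := h
  exact ⟨s', t + 1, .call hj h1, by omega, h3⟩

/-- The index `k` bounds the remaining iterations, and the body may lower it by any positive amount;
this suits loops that are governed by a progress measure. Each unit pays for a body and its test,
and the last summand pays for the final test. -/
theorem Run.loop {e : Expr} {I : ℕ → Store → Prop} {Tb : ℕ}
    (step : ∀ k s, I k s → e.eval s ≠ 0 → Run ps c s Tb (fun s' => ∃ k' < k, I k' s'))
    (done : ∀ k s, I k s → e.eval s = 0 → Q s) (k : ℕ) (h : I k s) :
    Run ps (.loop e c) s (k * (Tb + 1) + 1) Q := by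
  induction k using Nat.strong_induction_on generalizing s with
  | _ k ih =>
    by_cases he : e.eval s = 0
    · exact ⟨s, 1, .loopFalse he, by omega, done k s h he⟩
    · obtain ⟨s', t, h1, h2, k', hk, h3⟩ := step k s h he
      obtain ⟨s'', t', h4, h5, h6⟩ := ih k' hk h3
      refine ⟨s'', t + t' + 1, .loopTrue he h1 h4, ?_, h6⟩
      have : (k' + 1) * (Tb + 1) ≤ k * (Tb + 1) := Nat.mul_le_mul_right _ hk
      rw [Nat.add_mul] at this
      omega

/-- Commands without loops and calls. -/
def Cmd.straight : Cmd → Bool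
  | .skip => true
  | .assign _ _ => true
  | .store _ _ _ => true
  | .seq c c' => c.straight && c'.straight
  | .cond _ c c' => c.straight && c'.straight
  | .loop _ _ => false
  | .call _ => false

/-- Effect of a command without loops and calls. -/
def Cmd.den : Cmd → Store → Store
  | .skip, s => s
  | .assign x e, s => s.setVar x (e.eval s)
  | .store a i e, s => s.setArr a (i.eval s) (e.eval s)
  | .seq c c', s => c'.den (c.den s)
  | .cond e c c', s => if e.eval s = 0 then c'.den s else c.den s
  | .loop _ _, s => s
  | .call _, s => s

/-- Time bound of a command without loops and calls. -/
def Cmd.cost : Cmd → ℕ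
  | .skip => 1
  | .assign _ _ => 1
  | .store _ _ _ => 1
  | .seq c c' => c.cost + c'.cost
  | .cond _ c c' => max c.cost c'.cost + 1
  | .loop _ _ => 0
  | .call _ => 0

theorem Run.of_straight (hc : c.straight = true) : Run ps c s c.cost (fun s' => s' = c.den s) := by
  induction c generalizing s with
  | skip => exact Run.skip rfl
  | assign x e => exact Run.assign rfl
  | store a i e => exact Run.store rfl
  | seq c c' ih ih' =>
    simp only [Cmd.straight, Bool.and_eq_true] at hc
    refine Run.seq ((ih hc.1).imp ?_)
    rintro _ rfl
    exact ih' hc.2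
  | cond e c c' ih ih' =>
    simp only [Cmd.straight, Bool.and_eq_true] at hc
    refine Run.cond (fun h => ?_) (fun h => ?_)
    · simp only [Cmd.den, h, if_false]
      exact (ih hc.1).mono (le_max_left _ _)
    · simp only [Cmd.den, h, if_true]
      exact (ih' hc.2).mono (le_max_right _ _)
  | loop => simp [Cmd.straight] at hc
  | call => simp [Cmd.straight] at hc

/-- Loop-free code is a function on memories, so its correctness becomes a computation with
`Cmd.den`; only loops and calls need invariants. -/
theorem Run.straight (T : ℕ) (hc : c.straight = true) (hT : c.cost ≤ T) (h : Q (c.den s)) :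
    Run ps c s T Q :=
  ((Run.of_straight hc).mono hT).imp (by rintro _ rfl; exact h)

/-- All variables outside `vs` and all arrays outside `as` are the same in both memories. -/
structure Frame (vs as : List ℕ) (s s' : Store) : Prop where
  var : ∀ x, x ∉ vs → s'.var x = s.var x
  arr : ∀ a, a ∉ as → s'.arr a = s.arr a

theorem Frame.refl (vs as : List ℕ) (s : Store) : Frame vs as s s := ⟨fun _ _ => rfl, fun _ _ => rfl⟩

theorem Frame.trans {vs as : List ℕ} (h : Frame vs as s s') (h' : Frame vs as s' s'') :
    Frame vs as s s'' :=
  ⟨fun x hx => (h'.var x hx).trans (h.var x hx), fun a ha => (h'.arr a ha).trans (h.arr a ha)⟩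

/-- The inclusions are Boolean tests on literal lists, so that `rfl` proves them at each use. -/
theorem Frame.weaken {vs as vs' as' : List ℕ} (h : Frame vs as s s')
    (hv : vs.all (fun x => decide (x ∈ vs')) = true)
    (ha : as.all (fun x => decide (x ∈ as')) = true) : Frame vs' as' s s' := by
  simp only [List.all_eq_true, decide_eq_true_eq] at hv ha
  exact ⟨fun x hx => h.var x fun h => hx (hv x h), fun a hx => h.arr a fun h => hx (ha a h)⟩

theorem Frame.setVar {vs as : List ℕ} (h : Frame vs as s s') {x : ℕ} (hx : x ∈ vs) (n : ℕ) :
    Frame vs as s (s'.setVar x n) :=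
  ⟨fun y hy => by
    rw [Store.setVar_var, if_neg (by rintro rfl; exact hy hx)]
    exact h.var y hy, h.arr⟩

theorem Frame.setArr {vs as : List ℕ} (h : Frame vs as s s') {a : ℕ} (ha : a ∈ as) (i n : ℕ) :
    Frame vs as s (s'.setArr a i n) :=
  ⟨h.var, fun b hb => by
    rw [Store.setArr_arr, if_neg (by rintro rfl; exact hb ha)]
    exact h.arr b hb⟩

/-- The command has no calls, assigns only variables in `vs` and arrays in `as`. -/
def Cmd.within (vs as : List ℕ) : Cmd → Bool
  | .skip => true
  | .assign x _ => decide (x ∈ vs)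
  | .store a _ _ => decide (a ∈ as)
  | .seq c c' => c.within vs as && c'.within vs as
  | .cond _ c c' => c.within vs as && c'.within vs as
  | .loop _ c => c.within vs as
  | .call _ => false

/-- What a command may write can be read off its syntax. Calls are excluded; the effect of the
recursive solver is described by `Effect` instead. -/
theorem Exec.frame {vs as : List ℕ} {t : ℕ} (h : Exec ps c s s' t)
    (hc : c.within vs as = true) : Frame vs as s s' := by
  induction h with
  | skip => exact Frame.refl _ _ _
  | assign s x e => exact (Frame.refl _ _ _).setVar (by simpa [Cmd.within] using hc) _
  | store s a i e => exact (Frame.refl _ _ _).setArr (by simpa [Cmd.within] using hc) _ _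
  | seq h1 h2 ih1 ih2 =>
    simp only [Cmd.within, Bool.and_eq_true] at hc
    exact (ih1 hc.1).trans (ih2 hc.2)
  | condTrue he h ih =>
    simp only [Cmd.within, Bool.and_eq_true] at hc
    exact ih hc.1
  | condFalse he h ih =>
    simp only [Cmd.within, Bool.and_eq_true] at hc
    exact ih hc.2
  | loopTrue he h1 h2 ih1 ih2 => exact (ih1 hc).trans (ih2 hc)
  | loopFalse => exact Frame.refl _ _ _
  | call => simp [Cmd.within] at hc

theorem Run.frame (vs as : List ℕ) (h : Run ps c s T Q) (hc : c.within vs as = true) :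
    Run ps c s T (fun s' => Frame vs as s s' ∧ Q s') := by
  obtain ⟨s', t, h1, h2, h3⟩ := h
  exact ⟨s', t, h1, h2, h1.frame hc, h3⟩

/-- Execute `c` for `i = 0, 1, …`, up to the value of `e` (exclusive). -/
def Cmd.forTo (i : ℕ) (e : Expr) (c : Cmd) : Cmd :=
  i ::= 0 ;; .loop (e - .var i) (c ;; i ::= .var i + 1)

/-- The counter belongs to the loop: `hi` keeps the body from writing it, and after the body the
invariant speaks of the memory in which the counter is already `j + 1`. The frame relative to the
start takes care of unchanged memory, so `I` has to describe only what changes. -/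
theorem Run.forTo {i : ℕ} {e : Expr} (vs as : List ℕ) (n Tb : ℕ) (I : ℕ → Store → Prop)
    (hc : c.within vs as = true) (hi : decide (i ∉ vs) = true)
    (he : ∀ s', Frame (i :: vs) as s s' → e.eval s' = n)
    (h0 : I 0 (s.setVar i 0))
    (hs : ∀ j < n, ∀ s', Frame (i :: vs) as s s' → s'.var i = j → I j s' →
      Run ps c s' Tb (fun s'' => I (j + 1) (s''.setVar i (j + 1))))
    (hq : ∀ s', Frame (i :: vs) as s s' → s'.var i = n → I n s' → Q s') :
    Run ps (.forTo i e c) s (n * (Tb + 2) + 2) Q := by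
  have hi : i ∉ vs := of_decide_eq_true hi
  have hT : n * (Tb + 2) + 2 = 1 + (n * (Tb + 1 + 1) + 1) := by ring
  rw [hT, Cmd.forTo]
  refine Run.seq (Run.assign ?_)
  refine Run.loop (I := fun k s' => Frame (i :: vs) as s s' ∧ ∃ j, j + k = n ∧ s'.var i = j ∧ I j s')
    ?_ ?_ n ⟨(Frame.refl _ _ _).setVar (by simp) _, 0, by simp, by simp, h0⟩
  · rintro k s' ⟨hf, j, hj, hv, hI⟩ hne
    simp only [Expr.eval_sub, he s' hf, Expr.eval_var, hv] at hne
    refine Run.seq (((hs j (by omega) s' hf hv hI).frame vs as hc).imp ?_)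
    rintro s'' ⟨hf', hI'⟩
    have hv' : s''.var i = j := by rw [hf'.var i hi, hv]
    refine Run.assign ⟨k - 1, by omega, ?_, j + 1, by omega, by simp [hv'], ?_⟩
    · refine Frame.setVar (hf.trans ?_) (by simp) _
      exact ⟨fun x hx => hf'.var x (by simp at hx; tauto), hf'.arr⟩
    · simpa [hv'] using hI'
  · rintro k s' ⟨hf, j, hj, hv, hI⟩ h0
    simp only [Expr.eval_sub, he s' hf, Expr.eval_var, hv] at h0
    have : j = n := by omega
    subst this
    exact hq s' hf hv hI

end

section

/-! ## Joint finite-memory strategies for prefix-independent objectives -/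

/-- A game graph. `own v = true` means that `v` belongs to the system player. -/
structure Board (V : Type*) where
  own : V → Bool
  edge : V → V → Prop

namespace Board

variable {V M : Type*}

/-- The truth value of the objective does not depend on the first node of a play. -/
def PrefixIndep (Φ : (ℕ → V) → Prop) : Prop := ∀ π, Φ (fun i => π (i + 1)) ↔ Φ π

theorem PrefixIndep.shift {Φ : (ℕ → V) → Prop} (h : PrefixIndep Φ) (n : ℕ) (π : ℕ → V) :
    Φ (fun i => π (i + n)) ↔ Φ π := by
  induction n with
  | zero => rfl
  | succ n ih =>
    rw [← ih, ← h (fun i => π (i + n))]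
    simp only [add_assoc, add_comm 1 n]

/-- Player `b` wins the play `π`. -/
def Won (Φ : (ℕ → V) → Prop) (b : Bool) (π : ℕ → V) : Prop := Φ π ↔ b = true

theorem Won.of_shift {Φ : (ℕ → V) → Prop} (h : PrefixIndep Φ) {n : ℕ} {b : Bool} {π : ℕ → V}
    (hw : Won Φ b (fun i => π (i + n))) : Won Φ b π := (h.shift n π).symm.trans hw

/-- The play `π` with memory values `q` follows the memory update `up` and, at the nodes of
player `b`, the moves `nx`. -/
structure Follows (D : Board V) (b : Bool) (up : M → V → M) (nx : M → V → V)
    (π : ℕ → V) (q : ℕ → M) : Prop where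
  edge : ∀ i, D.edge (π i) (π (i + 1))
  mem : ∀ i, q (i + 1) = up (q i) (π i)
  move : ∀ i, D.own (π i) = b → π (i + 1) = nx (q i) (π i)

theorem Follows.shift {D : Board V} {b : Bool} {up : M → V → M} {nx : M → V → V}
    {π : ℕ → V} {q : ℕ → M} (h : D.Follows b up nx π q) (n : ℕ) :
    D.Follows b up nx (fun i => π (i + n)) (fun i => q (i + n)) :=
  ⟨fun i => by simpa [add_right_comm] using h.edge (i + n),
    fun i => by simpa [add_right_comm] using h.mem (i + n),
    fun i hi => by simpa [add_right_comm] using h.move (i + n) hi⟩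

/-- `win`, `up`, `nx` describe the winning regions and winning strategies of both players in the
subgame on `X`, with the set `B` of memory values, each of which may be the initial one. -/
structure Sol (D : Board V) (Φ : (ℕ → V) → Prop) (X : Set V) (B : Set M) (win : V → Bool)
    (up : M → V → M) (nx : M → V → V) : Prop where
  legal : ∀ v ∈ X, ∀ q ∈ B, D.edge v (nx q v) ∧ nx q v ∈ X
  mem : ∀ v ∈ X, ∀ q ∈ B, up q v ∈ B
  stay : ∀ v ∈ X, ∀ q ∈ B, D.own v = win v → win (nx q v) = win v
  trap : ∀ v ∈ X, D.own v ≠ win v → ∀ w ∈ X, D.edge v w → win w = win v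
  wins : ∀ b π q, D.Follows b up nx π q → (∀ i, π i ∈ X) → (∀ i, q i ∈ B) →
    (∀ i, win (π i) = b) → Won Φ b π

/-- `A` is the attractor of player `b` to `T` in the subgame on `Z`, and `ch` contains attracting
moves. -/
structure IsAttr (D : Board V) (b : Bool) (Z T A : Set V) (ch : V → V) : Prop where
  sub : A ⊆ Z
  target : T ⊆ A
  trap : ∀ v ∈ Z, v ∉ A → D.own v = b → ∀ w ∈ Z, D.edge v w → w ∉ A
  total : ∀ v ∈ Z, v ∉ A → ∃ w ∈ Z, w ∉ A ∧ D.edge v w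
  legal : ∀ v ∈ Z, D.edge v (ch v) ∧ ch v ∈ Z
  rank : ∃ rk : V → ℕ, ∀ v ∈ A, v ∉ T →
    (D.own v = b → ch v ∈ A ∧ rk (ch v) < rk v) ∧
    (D.own v ≠ b → ∀ w ∈ Z, D.edge v w → w ∈ A ∧ rk w < rk v)

variable {D : Board V} {Φ : (ℕ → V) → Prop} {b : Bool} {Z T A : Set V} {ch : V → V}

/-- Off the target, each step inside the attractor lowers the rank, whoever moves. Attracting moves
are required only until the first visit to `T`, because there a strategy may do something else. -/
theorem IsAttr.reach (h : D.IsAttr b Z T A ch) {π : ℕ → V} (hπ : ∀ i, D.edge (π i) (π (i + 1)))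
    (hZ : ∀ i, π i ∈ Z) {n : ℕ}
    (hch : ∀ i, n ≤ i → π i ∈ A → (∀ k, n ≤ k → k ≤ i → π k ∉ T) → D.own (π i) = b →
      π (i + 1) = ch (π i)) (hn : π n ∈ A) : ∃ j, n ≤ j ∧ π j ∈ T := by
  obtain ⟨rk, hrk⟩ := h.rank
  by_contra! hT
  have key : ∀ k, π (n + k) ∈ A ∧ rk (π (n + k)) + k ≤ rk (π n) := by
    intro k
    induction k with
    | zero => exact ⟨hn, le_rfl⟩
    | succ k ih =>
      rw [← add_assoc n k 1]
      obtain ⟨h1, h2⟩ := hrk _ ih.1 (hT _ (by omega))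
      by_cases ho : D.own (π (n + k)) = b
      · have := hch (n + k) (by omega) ih.1 (fun i hi _ => hT i hi) ho
        obtain ⟨h3, h4⟩ := h1 ho
        rw [← this] at h3 h4
        exact ⟨h3, by have := ih.2; omega⟩
      · obtain ⟨h3, h4⟩ := h2 ho _ (hZ (n + k + 1)) (hπ _)
        exact ⟨h3, by have := ih.2; omega⟩
  have := (key (rk (π n) + 1)).2
  omega

/-- If the opponent-closed subgame on `Y` has the solution `win₁`, `up₁`, `nx₁`, then the nodes won
by `b` in it, together with their attractor, are won by `b`. -/
theorem Sol.extend {Y : Set V} {B B₁ : Set M} {win win₁ : V → Bool} {up up₁ : M → V → M}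
    {nx nx₁ : M → V → V} (hΦ : PrefixIndep Φ) (hYZ : Y ⊆ Z)
    (hY : ∀ v ∈ Y, D.own v ≠ b → ∀ w ∈ Z, D.edge v w → w ∈ Y)
    (h₁ : D.Sol Φ Y B₁ win₁ up₁ nx₁) (hB : B₁ ⊆ B)
    (hA : D.IsAttr b Z {v | v ∈ Y ∧ win₁ v = b} A ch)
    (hwin : ∀ v ∈ A, win v = b)
    (hW : ∀ v ∈ Y, win₁ v = b → ∀ q ∈ B, ∃ q₀ ∈ B₁, (q ∈ B₁ → q₀ = q) ∧
      up q v = up₁ q₀ v ∧ nx q v = nx₁ q₀ v)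
    (hA' : ∀ v ∈ A, ¬ (v ∈ Y ∧ win₁ v = b) → ∀ q ∈ B, up q v ∈ B ∧ nx q v = ch v)
    (h : D.Sol Φ (Z \ A) B win up nx) : D.Sol Φ Z B win up nx := by
  have hWA : ∀ v ∈ Y, win₁ v = b → v ∈ A := fun v hv hb => hA.target ⟨hv, hb⟩
  refine ⟨?_, ?_, ?_, ?_, ?_⟩
  · intro v hv q hq
    by_cases hvA : v ∈ A
    · by_cases hvW : v ∈ Y ∧ win₁ v = b
      · obtain ⟨q₀, hq₀, -, -, h2⟩ := hW v hvW.1 hvW.2 q hq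
        rw [h2]
        exact ⟨(h₁.legal v hvW.1 q₀ hq₀).1, hYZ (h₁.legal v hvW.1 q₀ hq₀).2⟩
      · rw [(hA' v hvA hvW q hq).2]
        exact hA.legal v hv
    · exact ⟨(h.legal v ⟨hv, hvA⟩ q hq).1, (h.legal v ⟨hv, hvA⟩ q hq).2.1⟩
  · intro v hv q hq
    by_cases hvA : v ∈ A
    · by_cases hvW : v ∈ Y ∧ win₁ v = b
      · obtain ⟨q₀, hq₀, -, h2, -⟩ := hW v hvW.1 hvW.2 q hq
        rw [h2]
        exact hB (h₁.mem v hvW.1 q₀ hq₀)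
      · exact (hA' v hvA hvW q hq).1
    · exact h.mem v ⟨hv, hvA⟩ q hq
  · intro v hv q hq ho
    by_cases hvA : v ∈ A
    · rw [hwin v hvA] at ho ⊢
      by_cases hvW : v ∈ Y ∧ win₁ v = b
      · obtain ⟨q₀, hq₀, -, -, h2⟩ := hW v hvW.1 hvW.2 q hq
        rw [h2]
        refine hwin _ (hWA _ (h₁.legal v hvW.1 q₀ hq₀).2 ?_)
        rw [h₁.stay v hvW.1 q₀ hq₀ (by rw [ho, hvW.2]), hvW.2]
      · rw [(hA' v hvA hvW q hq).2]
        obtain ⟨rk, hrk⟩ := hA.rank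
        exact hwin _ ((hrk v hvA hvW).1 ho).1
    · exact h.stay v ⟨hv, hvA⟩ q hq ho
  · intro v hv ho w hw he
    by_cases hvA : v ∈ A
    · rw [hwin v hvA] at ho ⊢
      by_cases hvW : v ∈ Y ∧ win₁ v = b
      · have hwY := hY v hvW.1 ho w hw he
        refine hwin _ (hWA _ hwY ?_)
        rw [h₁.trap v hvW.1 (by rw [hvW.2]; exact ho) w hwY he, hvW.2]
      · obtain ⟨rk, hrk⟩ := hA.rank
        exact hwin _ ((hrk v hvA hvW).2 ho w hw he).1
    · by_cases hwA : w ∈ A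
      · by_cases hb : D.own v = b
        · exact absurd hwA (hA.trap v hv hvA hb w hw he)
        · rw [hwin w hwA]
          -- A node outside the attractor with a move into it belongs to the opponent of `b`; as it
          -- does not belong to its own winner, that winner is `b`.
          cases h1 : D.own v <;> cases h2 : win v <;> cases b <;> simp_all
      · exact h.trap v ⟨hv, hvA⟩ ho w ⟨hw, hwA⟩ he
  · intro b' π q hf hX hq hb
    -- A play that meets `A` is attracted to the part of `Y` won by `b`, and never leaves it again;
    -- all other plays belong to the subgame on `Z \ A`.
    by_cases hex : ∃ n, π n ∈ A
    · obtain ⟨n, hn⟩ := hex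
      obtain rfl : b' = b := by rw [← hb n, hwin _ hn]
      have hW' : ∃ j, n ≤ j ∧ π j ∈ {v | v ∈ Y ∧ win₁ v = b'} := by
        refine hA.reach hf.edge hX (fun i hi hiA hiT ho => ?_) hn
        rw [hf.move i ho, (hA' _ hiA (hiT i hi le_rfl) _ (hq i)).2]
      obtain ⟨j, -, hj⟩ := hW'
      have step : ∀ i, π i ∈ {v | v ∈ Y ∧ win₁ v = b'} →
          π (i + 1) ∈ {v | v ∈ Y ∧ win₁ v = b'} ∧ q (i + 1) ∈ B₁ := by
        rintro i ⟨hi1, hi2⟩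
        obtain ⟨q₀, hq₀, -, h2, h3⟩ := hW _ hi1 hi2 _ (hq i)
        refine ⟨?_, by rw [hf.mem, h2]; exact h₁.mem _ hi1 _ hq₀⟩
        by_cases ho : D.own (π i) = b'
        · rw [hf.move i ho, h3]
          exact ⟨(h₁.legal _ hi1 _ hq₀).2, by rw [h₁.stay _ hi1 _ hq₀ (by rw [ho, hi2]), hi2]⟩
        · have := hY _ hi1 ho _ (hX (i + 1)) (hf.edge i)
          exact ⟨this, by rw [h₁.trap _ hi1 (by rw [hi2]; exact ho) _ this (hf.edge i), hi2]⟩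
      -- The shift is `j + 1` and not `j`: at `j` the memory value may still lie outside `B₁`, and
      -- the update at that node brings it into `B₁`.
      have all : ∀ k, π (k + (j + 1)) ∈ {v | v ∈ Y ∧ win₁ v = b'} ∧ q (k + (j + 1)) ∈ B₁ := by
        intro k
        induction k with
        | zero => simpa using step j hj
        | succ k ih =>
          have := step _ ih.1
          rwa [show k + (j + 1) + 1 = k + 1 + (j + 1) by ring] at this
      refine Won.of_shift hΦ (n := j + 1) (h₁.wins b' _ (fun k => q (k + (j + 1))) ?_
        (fun k => (all k).1.1) (fun k => (all k).2) (fun k => (all k).1.2))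
      have hfs := hf.shift (j + 1)
      refine ⟨hfs.edge, fun k => ?_, fun k hk => ?_⟩
      · obtain ⟨q₀, hq₀, h1, h2, h3⟩ := hW _ (all k).1.1 (all k).1.2 _ (hq (k + (j + 1)))
        rw [← h1 (all k).2, ← h2]
        exact hfs.mem k
      · obtain ⟨q₀, hq₀, h1, h2, h3⟩ := hW _ (all k).1.1 (all k).1.2 _ (hq (k + (j + 1)))
        rw [← h1 (all k).2, ← h3]
        exact hfs.move k hk
    · push Not at hex
      exact h.wins b' π q hf (fun i => ⟨hX i, hex i⟩) hq hb

/-- If `b` wins after the removal of the attractor to any of the sets `T i`, `i < m`, and every play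
that visits all these sets infinitely often, then `b` wins by visiting them in a cyclic order, as
long as this is possible. -/
theorem Sol.cycle {B : Set M} {m : ℕ} (blk : M → ℕ) {T A : ℕ → Set V} {ch : ℕ → V → V}
    {win : V → Bool} {win' : ℕ → V → Bool} {up : M → V → M} {nx : M → V → V}
    (hΦ : PrefixIndep Φ) (hB : ∀ q ∈ B, blk q < m)
    (hA : ∀ i < m, D.IsAttr b Z (T i) (A i) (ch i))
    (h : ∀ i < m, D.Sol Φ (Z \ A i) {q | q ∈ B ∧ blk q = i} (win' i) up nx)
    (hwin' : ∀ i < m, ∀ v ∈ Z, v ∉ A i → win' i v = b)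
    (hwin : ∀ v ∈ Z, win v = b)
    (htab : ∀ i < m, ∀ v ∈ A i, ∀ q ∈ B, blk q = i → nx q v = ch i v ∧ up q v ∈ B ∧
      (v ∉ T i → blk (up q v) = i) ∧ (v ∈ T i → blk (up q v) = (i + 1) % m))
    (hobj : ∀ π : ℕ → V, (∀ i, D.edge (π i) (π (i + 1))) → (∀ i, π i ∈ Z) →
      (∀ i < m, ∀ n, ∃ j, n ≤ j ∧ π j ∈ T i) → Won Φ b π) :
    D.Sol Φ Z B win up nx := by
  have hleg : ∀ v ∈ Z, ∀ q ∈ B, D.edge v (nx q v) ∧ nx q v ∈ Z := by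
    intro v hv q hq
    by_cases hvA : v ∈ A (blk q)
    · rw [(htab _ (hB q hq) v hvA q hq rfl).1]
      exact (hA _ (hB q hq)).legal v hv
    · have := (h _ (hB q hq)).legal v ⟨hv, hvA⟩ q ⟨hq, rfl⟩
      exact ⟨this.1, this.2.1⟩
  refine ⟨hleg, ?_, ?_, ?_, ?_⟩
  · intro v hv q hq
    by_cases hvA : v ∈ A (blk q)
    · exact (htab _ (hB q hq) v hvA q hq rfl).2.1
    · exact ((h _ (hB q hq)).mem v ⟨hv, hvA⟩ q ⟨hq, rfl⟩).1
  · intro v hv q hq _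
    rw [hwin v hv, hwin _ (hleg v hv q hq).2]
  · intro v hv _ w hw _
    rw [hwin v hv, hwin w hw]
  · intro b' π q hf hX hq hb
    obtain rfl : b' = b := by rw [← hb 0, hwin _ (hX 0)]
    have keep : ∀ i, π i ∉ T (blk (q i)) → blk (q (i + 1)) = blk (q i) := by
      intro i hi
      rw [hf.mem i]
      by_cases hvA : π i ∈ A (blk (q i))
      · exact (htab _ (hB _ (hq i)) _ hvA _ (hq i) rfl).2.2.1 hi
      · exact ((h _ (hB _ (hq i))).mem _ ⟨hX i, hvA⟩ _ ⟨hq i, rfl⟩).2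
    -- Either the target of the current block is met again and again, and the block index runs
    -- through the whole cycle; or the block is constant from some point on, and the play stays
    -- outside its attractor.
    by_cases hfreq : ∀ n, ∃ j, n ≤ j ∧ π j ∈ T (blk (q j))
    · refine hobj π hf.edge hX fun i hi n => ?_
      have first : ∀ n, ∃ j, n ≤ j ∧ π j ∈ T (blk (q j)) ∧ blk (q j) = blk (q n) := by
        intro n
        classical
        have hex : ∃ k, π (n + k) ∈ T (blk (q (n + k))) := by
          obtain ⟨j, hj, h'⟩ := hfreq n
          exact ⟨j - n, by rwa [Nat.add_sub_cancel' hj]⟩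
        refine ⟨n + Nat.find hex, by omega, Nat.find_spec hex, ?_⟩
        have : ∀ k ≤ Nat.find hex, blk (q (n + k)) = blk (q n) := by
          intro k
          induction k with
          | zero => simp
          | succ k ih =>
            intro hk
            rw [← add_assoc, keep _ (Nat.find_min hex hk), ih (by omega)]
        exact this _ le_rfl
      have many : ∀ d n, ∃ j, n ≤ j ∧ π j ∈ T (blk (q j)) ∧ blk (q j) = (blk (q n) + d) % m := by
        intro d n
        induction d with
        | zero =>
          obtain ⟨j, h1, h2, h3⟩ := first n
          exact ⟨j, h1, h2, by rw [h3, add_zero, Nat.mod_eq_of_lt (hB _ (hq n))]⟩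
        | succ d ih =>
          obtain ⟨j, h1, h2, h3⟩ := ih
          obtain ⟨j', h4, h5, h6⟩ := first (j + 1)
          refine ⟨j', by omega, h5, ?_⟩
          have hjA := (hA _ (hB _ (hq j))).target h2
          rw [h6, hf.mem j, (htab _ (hB _ (hq j)) _ hjA _ (hq j) rfl).2.2.2 h2, h3, ← add_assoc,
            Nat.mod_add_mod]
      -- So many turns lead from the block of `q n` to block `i`; the summand `m` keeps the
      -- truncated subtraction exact.
      obtain ⟨j, h1, h2, h3⟩ := many (i + m - blk (q n)) n
      have hlt := hB _ (hq n)
      rw [show blk (q n) + (i + m - blk (q n)) = i + m by omega, Nat.add_mod_right,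
        Nat.mod_eq_of_lt hi] at h3
      exact ⟨j, h1, h3 ▸ h2⟩
    · push Not at hfreq
      obtain ⟨n, hn⟩ := hfreq
      have const : ∀ k, blk (q (n + k)) = blk (q n) := by
        intro k
        induction k with
        | zero => rfl
        | succ k ih => rw [← add_assoc, keep _ (hn _ (by omega)), ih]
      have const' : ∀ j, n ≤ j → blk (q j) = blk (q n) := fun j hj => by
        rw [← const (j - n), Nat.add_sub_cancel' hj]
      have hi := hB _ (hq n)
      -- Inside the attractor, the moves would lead to the target, which is not met any more.
      have out : ∀ j, n ≤ j → π j ∉ A (blk (q n)) := by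
        intro j hj hjA
        obtain ⟨j', h1, h2⟩ := (hA _ hi).reach hf.edge hX (n := j) (fun i h1 h2 _ ho => by
          rw [hf.move i ho]
          exact (htab _ hi _ h2 _ (hq i) (const' i (by omega))).1) hjA
        exact hn j' (by omega) (by rwa [const' j' (by omega)])
      refine Won.of_shift hΦ (n := n) ((h _ hi).wins b' _ _ (hf.shift n)
        (fun k => ⟨hX _, out _ (by omega)⟩) (fun k => ⟨hq _, const' _ (by omega)⟩)
        (fun k => hwin' _ hi _ (hX _) (out _ (by omega))))

end Board

end

section

/-! ## Computing attractors in quadratic time -/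

open Classical in
/-- The number of elements of a set that are smaller than `N`. -/
noncomputable def countP (p : ℕ → Prop) (N : ℕ) : ℕ := ((Finset.range N).filter p).card

theorem countP_zero {p : ℕ → Prop} : countP p 0 = 0 := by simp [countP]

open Classical in
theorem countP_succ {p : ℕ → Prop} {N : ℕ} :
    countP p (N + 1) = countP p N + if p N then 1 else 0 := by
  rw [countP, Finset.range_add_one, Finset.filter_insert]
  split_ifs with h
  · rw [Finset.card_insert_of_notMem (by simp), countP]
  · rfl

open Classical in
theorem countP_le {p : ℕ → Prop} {N : ℕ} : countP p N ≤ N := by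
  simpa using! Finset.card_filter_le (Finset.range N) p

theorem countP_eq_succ_of_remove {p p' : ℕ → Prop} {u N : ℕ} (hu : u < N) (hp : p u)
    (h : ∀ w, p' w ↔ p w ∧ w ≠ u) : countP p N = countP p' N + 1 := by
  classical
  have : (Finset.range N).filter p' = ((Finset.range N).filter p).erase u := by
    ext w; simp [h]; tauto
  rw [countP, countP, this, Finset.card_erase_add_one (by simp [hu, hp])]

open Classical in
theorem countP_eq_zero_iff {p : ℕ → Prop} {N : ℕ} : countP p N = 0 ↔ ∀ w < N, ¬ p w := by
  rw [countP, Finset.card_eq_zero, Finset.filter_eq_empty_iff]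
  simp

open Classical in
theorem countP_lt {p p' : ℕ → Prop} {N u : ℕ} (h : ∀ w < N, p' w → p w) (hu : u < N)
    (hp : p u) (hp' : ¬ p' u) : countP p' N < countP p N := by
  refine Finset.card_lt_card (Finset.ssubset_iff_subset_ne.2 ⟨?_, ?_⟩)
  · intro w
    simp only [Finset.mem_filter, Finset.mem_range]
    exact fun hw => ⟨hw.1, h w hw.1 hw.2⟩
  · intro heq
    have : u ∈ (Finset.range N).filter p := by simp [hu, hp]
    rw [← heq] at this
    simp [hp'] at this

/-- Invariant of the attractor computation: after `r` rounds, `att` is the part of the attractor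
found so far, `cnt v` is the number of moves from `v` that have to be covered before `v` belongs to
the attractor, and `ch` contains the chosen moves. -/
structure AttrInv (D : Board ℕ) (b : Bool) (N : ℕ) (Z T : Set ℕ) (r : ℕ) (att cnt ch : ℕ → ℕ) :
    Prop where
  sub : ∀ v < N, att v ≠ 0 → v ∈ Z
  legal : ∀ v ∈ Z, D.edge v (ch v) ∧ ch v ∈ Z
  target : ∀ v ∈ Z, v ∈ T → cnt v = 0
  own : ∀ v ∈ Z, v ∉ T → D.own v = b →
    (cnt v = 1 ∧ ∀ w ∈ Z, D.edge v w → att w = 0) ∨ (cnt v = 0 ∧ att (ch v) ≠ 0)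
  opp : ∀ v ∈ Z, v ∉ T → D.own v ≠ b →
    cnt v = countP (fun w => D.edge v w ∧ w ∈ Z ∧ att w = 0) N
  rank : ∃ rk : ℕ → ℕ, ∀ v < N, att v ≠ 0 → rk v < r ∧ (v ∉ T →
    (D.own v = b → att (ch v) ≠ 0 ∧ rk (ch v) < rk v) ∧
    (D.own v ≠ b → ∀ w ∈ Z, D.edge v w → att w ≠ 0 ∧ rk w < rk v))
  progress : r ≤ countP (fun v => att v ≠ 0) N ∨ ∀ v ∈ Z, att v = 0 → cnt v ≠ 0

namespace AttrInv

variable {D : Board ℕ} {b : Bool} {N : ℕ} {Z T : Set ℕ} {r : ℕ} {att cnt ch : ℕ → ℕ}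

/-- After `N` rounds no unmarked node with counter zero is left: otherwise all numbers below `N`
would be marked. A counter that stays positive says that an own node has no move into the attractor,
and that a node of the opponent has a move that avoids it. -/
theorem isAttr (hZ : ∀ v ∈ Z, v < N) (hT : T ⊆ Z) (h : AttrInv D b N Z T N att cnt ch) :
    D.IsAttr b Z T {v | v < N ∧ att v ≠ 0} ch := by
  classical
  have hp : ∀ v ∈ Z, att v = 0 → cnt v ≠ 0 := by
    rcases h.progress with hp | hp
    · intro v hv h0
      have : countP (fun v => att v ≠ 0) N < countP (fun _ => True) N :=
        countP_lt (fun _ _ _ => trivial) (hZ v hv) trivial (by simpa)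
      have := countP_le (p := fun _ => True) (N := N)
      omega
    · exact hp
  have hTA : ∀ v ∈ T, att v ≠ 0 := fun v hv h0 => hp v (hT hv) h0 (h.target v (hT hv) hv)
  have nA : ∀ v ∈ Z, v ∉ {v | v < N ∧ att v ≠ 0} → att v = 0 := by
    intro v hv h
    by_contra h'
    exact h ⟨hZ v hv, h'⟩
  have trap : ∀ v ∈ Z, att v = 0 → D.own v = b → ∀ w ∈ Z, D.edge v w → att w = 0 := by
    intro v hv h0 ho
    rcases h.own v hv (fun h' => hTA v h' h0) ho with h1 | h1
    · exact h1.2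
    · exact absurd h1.1 (hp v hv h0)
  refine ⟨fun v hv => h.sub v hv.1 hv.2, fun v hv => ⟨hZ v (hT hv), hTA v hv⟩, ?_, ?_, h.legal, ?_⟩
  · intro v hv hvA ho w hw he hwA
    exact hwA.2 (trap v hv (nA v hv hvA) ho w hw he)
  · intro v hv hvA
    have h0 := nA v hv hvA
    by_cases ho : D.own v = b
    · obtain ⟨h1, h2⟩ := h.legal v hv
      exact ⟨ch v, h2, fun h => h.2 (trap v hv h0 ho _ h2 h1), h1⟩
    · have h1 := hp v hv h0
      rw [h.opp v hv (fun h' => hTA v h' h0) ho, Ne, countP_eq_zero_iff] at h1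
      push Not at h1
      obtain ⟨w, hw, h2, h3, h4⟩ := h1
      exact ⟨w, h3, fun h => h.2 h4, h2⟩
  · obtain ⟨rk, hrk⟩ := h.rank
    refine ⟨rk, fun v hv hvT => ⟨fun ho => ?_, fun ho w hw he => ?_⟩⟩
    · obtain ⟨h1, h2⟩ := ((hrk v hv.1 hv.2).2 hvT).1 ho
      exact ⟨⟨hZ _ (h.legal v (h.sub v hv.1 hv.2)).2, h1⟩, h2⟩
    · obtain ⟨h1, h2⟩ := ((hrk v hv.1 hv.2).2 hvT).2 ho w hw he
      exact ⟨⟨hZ _ hw, h1⟩, h2⟩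

theorem idle (h : AttrInv D b N Z T r att cnt ch) (hp : ∀ v ∈ Z, att v = 0 → cnt v ≠ 0) :
    AttrInv D b N Z T (r + 1) att cnt ch := by
  obtain ⟨rk, hrk⟩ := h.rank
  exact { h with
    rank := ⟨rk, fun v hv ha => ⟨(hrk v hv ha).1.trans (by omega), (hrk v hv ha).2⟩⟩
    progress := Or.inr hp }

/-- The new node gets the rank `r`, above all earlier ranks. Counters that are zero are not touched
again, so a chosen move is never overwritten, and a decrement for an opponent's node accounts for
exactly the move to the new node. -/
theorem step (hZ : ∀ v ∈ Z, v < N) (h : AttrInv D b N Z T r att cnt ch) {u : ℕ} (hu : u ∈ Z)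
    (hau : att u = 0) (hcu : cnt u = 0) {cnt' ch' : ℕ → ℕ}
    (hown : ∀ v < N, D.edge v u → cnt v ≠ 0 → D.own v = b → cnt' v = 0 ∧ ch' v = u)
    (hopp : ∀ v < N, D.edge v u → cnt v ≠ 0 → D.own v ≠ b → cnt' v = cnt v - 1 ∧ ch' v = ch v)
    (hsame : ∀ v < N, ¬ (D.edge v u ∧ cnt v ≠ 0) → cnt' v = cnt v ∧ ch' v = ch v) :
    AttrInv D b N Z T (r + 1) (Function.update att u 1) cnt' ch' := by
  classical
  have huN := hZ u hu
  have hatt : ∀ w, Function.update att u 1 w = 0 ↔ att w = 0 ∧ w ≠ u := by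
    intro w
    by_cases hw : w = u <;> simp [hw]
  have hatt' : ∀ w, Function.update att u 1 w ≠ 0 ↔ att w ≠ 0 ∨ w = u := by
    intro w; rw [Ne, hatt]; tauto
  have hc0 : ∀ v < N, cnt v = 0 → cnt' v = 0 ∧ ch' v = ch v := by
    intro v hv h0
    have := hsame v hv (by tauto)
    exact ⟨this.1.trans h0, this.2⟩
  refine ⟨?_, ?_, ?_, ?_, ?_, ?_, ?_⟩
  · intro v hv ha
    rcases (hatt' v).1 ha with ha | rfl
    · exact h.sub v hv ha
    · exact hu
  · intro v hv
    by_cases hc : D.edge v u ∧ cnt v ≠ 0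
    · by_cases ho : D.own v = b
      · rw [(hown v (hZ v hv) hc.1 hc.2 ho).2]; exact ⟨hc.1, hu⟩
      · rw [(hopp v (hZ v hv) hc.1 hc.2 ho).2]; exact h.legal v hv
    · rw [(hsame v (hZ v hv) hc).2]; exact h.legal v hv
  · intro v hv hT
    exact (hc0 v (hZ v hv) (h.target v hv hT)).1
  · intro v hv hT ho
    by_cases hc : D.edge v u ∧ cnt v ≠ 0
    · obtain ⟨h1, h2⟩ := hown v (hZ v hv) hc.1 hc.2 ho
      right
      rw [h1, h2, hatt']
      simp
    · obtain ⟨h1, h2⟩ := hsame v (hZ v hv) hc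
      rw [h1, h2]
      rcases h.own v hv hT ho with h3 | h3
      · left
        refine ⟨h3.1, fun w hw he => (hatt w).2 ⟨h3.2 w hw he, ?_⟩⟩
        rintro rfl
        exact hc ⟨he, by omega⟩
      · right
        exact ⟨h3.1, (hatt' _).2 (Or.inl h3.2)⟩
  · intro v hv hT ho
    have h1 := h.opp v hv hT ho
    by_cases he : D.edge v u
    · have h2 := countP_eq_succ_of_remove (p := fun w => D.edge v w ∧ w ∈ Z ∧ att w = 0)
        (p' := fun w => D.edge v w ∧ w ∈ Z ∧ Function.update att u 1 w = 0) huN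
        ⟨he, hu, hau⟩ (fun w => by rw [hatt]; tauto)
      rw [(hopp v (hZ v hv) he (by omega) ho).1, h1, h2]
      rfl
    · rw [(hsame v (hZ v hv) (by tauto)).1, h1]
      congr 1
      ext w
      rw [hatt]
      have : D.edge v w → w ≠ u := by rintro h rfl; exact he h
      tauto
  · obtain ⟨rk, hrk⟩ := h.rank
    refine ⟨Function.update rk u r, fun v hv ha => ?_⟩
    have old : ∀ w, att w ≠ 0 → Function.update rk u r w = rk w := by
      intro w hw
      rw [Function.update_of_ne]
      rintro rfl
      exact hw hau
    have lt : ∀ w ∈ Z, att w ≠ 0 → rk w < r := fun w hw h => (hrk w (hZ w hw) h).1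
    by_cases hvu : v = u
    · subst hvu
      rw [Function.update_self]
      refine ⟨by omega, fun hT => ⟨fun ho => ?_, fun ho w hw he => ?_⟩⟩
      · rcases h.own v hu hT ho with h3 | h3
        · omega
        · rw [(hc0 v huN hcu).2, old _ h3.2, hatt']
          exact ⟨Or.inl h3.2, lt _ (h.legal v hu).2 h3.2⟩
      · have h3 := h.opp v hu hT ho
        rw [hcu] at h3
        have h4 := countP_eq_zero_iff.1 h3.symm w (hZ w hw)
        have h5 : att w ≠ 0 := fun h0 => h4 ⟨he, hw, h0⟩
        rw [hatt', old w h5]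
        exact ⟨Or.inl h5, lt w hw h5⟩
    · have ha' : att v ≠ 0 := ((hatt' v).1 ha).resolve_right hvu
      obtain ⟨h1, h2⟩ := hrk v hv ha'
      rw [old v ha']
      refine ⟨by omega, fun hT => ⟨fun ho => ?_, fun ho w hw he => ?_⟩⟩
      · obtain ⟨h3, h4⟩ := (h2 hT).1 ho
        have hvZ := h.sub v hv ha'
        have h5 : cnt v = 0 := by
          rcases h.own v hvZ hT ho with h6 | h6
          · exact absurd (h6.2 _ (h.legal v hvZ).2 (h.legal v hvZ).1) h3
          · exact h6.1
        rw [(hc0 v hv h5).2, old _ h3, hatt']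
        exact ⟨Or.inl h3, h4⟩
      · obtain ⟨h3, h4⟩ := (h2 hT).2 ho w hw he
        rw [old w h3, hatt']
        exact ⟨Or.inl h3, h4⟩
  · rcases h.progress with hp | hp
    · left
      have := countP_eq_succ_of_remove (p := fun v => Function.update att u 1 v ≠ 0)
        (p' := fun v => att v ≠ 0) huN (by simp) (fun w => by
          rw [hatt']
          constructor
          · intro h; exact ⟨Or.inl h, by rintro rfl; exact h hau⟩
          · tauto)
      omega
    · exact absurd hcu (hp u hu hau)

end AttrInv

end

/-! ## Variables and arrays -/

-- Conventions of the solver: `vLV` is the level of the recursion, i.e. the number of colors left;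
-- `vMask` encodes their set as a sum of powers of two, and `aWint` is the truth table of the
-- objective, indexed by such sums. `vPL` is the player under consideration. The array `aXS` has one
-- row of `vN` cells per level for the node set of the subgame, and `vXO` is the offset of the
-- current row. `aCL` lists the colors; for each level, `aJJ` counts the colors treated so far,
-- `aQB` is the first memory value of the level, and `aQJ` that of the current block. `aUpd` and
-- `aNxt` are the strategy tables, `aWin` holds the winners, and `aAtt`, `aCnt`, `aCh`, `aTgt`
-- belong to attractors.
local notation "vN" => (10 : ℕ)
local notation "vLV" => (11 : ℕ)
local notation "vMask" => (12 : ℕ)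
local notation "vPL" => (13 : ℕ)
local notation "vXO" => (14 : ℕ)
local notation "aOwn" => (20 : ℕ)
local notation "aEdg" => (21 : ℕ)
local notation "aRow" => (22 : ℕ)
local notation "aCol" => (23 : ℕ)
local notation "aFact" => (24 : ℕ)
local notation "aPow" => (25 : ℕ)
local notation "aWint" => (26 : ℕ)
local notation "aXS" => (30 : ℕ)
local notation "aCL" => (31 : ℕ)
local notation "aUpd" => (32 : ℕ)
local notation "aNxt" => (33 : ℕ)
local notation "aWin" => (34 : ℕ)
local notation "aAtt" => (35 : ℕ)
local notation "aCnt" => (36 : ℕ)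
local notation "aCh" => (37 : ℕ)
local notation "aTgt" => (38 : ℕ)
local notation "aJJ" => (39 : ℕ)
local notation "aQB" => (40 : ℕ)
local notation "aQJ" => (41 : ℕ)
local notation "vK" => (43 : ℕ)
local notation "vLoc" => (44 : ℕ)
local notation "vDD" => (45 : ℕ)
local notation "vM" => (46 : ℕ)
local notation "vPK" => (47 : ℕ)
local notation "aKind" => (50 : ℕ)
local notation "aEv" => (51 : ℕ)
local notation "aIdx" => (52 : ℕ)
local notation "aRN" => (53 : ℕ)
local notation "aRG" => (54 : ℕ)
local notation "aHalf" => (55 : ℕ)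
local notation "aPar" => (56 : ℕ)
local notation "aNode" => (57 : ℕ)
local notation "aLay" => (58 : ℕ)
local notation "aLupd" => (59 : ℕ)
local notation "aBits" => (60 : ℕ)
local notation "aStk" => (61 : ℕ)
local notation "aRowM" => (62 : ℕ)

/-! ### Programs for attractors -/

section

/-- Nonzero iff the values differ. -/
def neq (e f : Expr) : Expr := (e - f) + (f - e)

theorem eval_neq {s : Store} {e f : Expr} : (neq e f).eval s = 0 ↔ e.eval s = f.eval s := by
  simp [neq]; omega

/-- The memory contains the game graph. -/
structure GraphIn (D : Board ℕ) (N : ℕ) (s : Store) : Prop where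
  size : s.var vN = N
  own : ∀ v < N, s.arr aOwn v = (D.own v).toNat
  edge : ∀ v < N, ∀ w < N, s.arr aEdg (v * N + w) ≠ 0 ↔ D.edge v w
  row : ∀ v ≤ N, s.arr aRow v = v * N

theorem GraphIn.frame {D : Board ℕ} {N : ℕ} {s s' : Store} {vs as : List ℕ} (h : GraphIn D N s)
    (hf : Frame vs as s s') (hv : decide (vN ∉ vs) = true)
    (ha : decide (aOwn ∉ as ∧ aEdg ∉ as ∧ aRow ∉ as) = true) : GraphIn D N s' := by
  have hv := of_decide_eq_true hv
  obtain ⟨h1, h2, h3⟩ := of_decide_eq_true ha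
  constructor
  · rw [hf.var _ hv, h.size]
  · rw [hf.arr _ h1]; exact h.own
  · rw [hf.arr _ h2]; exact h.edge
  · rw [hf.arr _ h3]; exact h.row

/-- The set of nodes stored at offset `o` of the array of node sets. -/
def Store.nodes (s : Store) (o N : ℕ) : Set ℕ := {v | v < N ∧ s.arr aXS (o + v) ≠ 0}

/-- Count the moves of a node, and find one. -/
def attrCount : Cmd :=
  .forTo 16 (.var vN)
    (.cond (.get aEdg (.var 20 + .var 16))
      (.cond (.get aXS (.var vXO + .var 16)) (18 ::= .var 18 + 1 ;; 19 ::= .var 16) .skip)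
      .skip)

/-- Initial counters for the computation of an attractor. -/
def attrInit : Cmd :=
  .forTo 15 (.var vN)
    (18 ::= 0 ;; 20 ::= .get aRow (.var 15) ;; attrCount ;;
      .store aCh (.var 15) (.var 19) ;; .store aAtt (.var 15) 0 ;;
      .cond (.get aTgt (.var 15)) (.store aCnt (.var 15) 0)
        (.cond (neq (.get aOwn (.var 15)) (.var vPL)) (.store aCnt (.var 15) (.var 18))
          (.store aCnt (.var 15) 1)))

/-- Find a node that belongs to the attractor, and has not been added yet. -/
def attrPick : Cmd :=
  .forTo 15 (.var vN)
    (.cond (.get aXS (.var vXO + .var 15))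
      (.cond (.get aAtt (.var 15)) .skip
        (.cond (.get aCnt (.var 15)) .skip (19 ::= .var 15)))
      .skip)

/-- Update the counters of the predecessors of a new node. -/
def attrUpdate : Cmd :=
  .forTo 15 (.var vN)
    (20 ::= .get aRow (.var 15) ;;
      .cond (.get aEdg (.var 20 + .var 19))
        (.cond (.get aCnt (.var 15))
          (.cond (neq (.get aOwn (.var 15)) (.var vPL))
            (.store aCnt (.var 15) (.get aCnt (.var 15) - 1))
            (.store aCnt (.var 15) 0 ;; .store aCh (.var 15) (.var 19)))
          .skip)
        .skip)

/-- Add one node to the attractor. -/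
def attrRound : Cmd :=
  19 ::= .var vN ;; attrPick ;;
    .cond (.var vN - .var 19) (.store aAtt (.var 19) 1 ;; attrUpdate) .skip

/-- Compute the attractor of player `vPL` to `aTgt` in the subgame at offset `vXO`. -/
def attrCmd : Cmd := attrInit ;; .forTo 17 (.var vN) attrRound

variable {ps : List Cmd} {D : Board ℕ} {N : ℕ} {b : Bool} {s : Store}

theorem toNat_eq_iff {a b : Bool} : a.toNat = b.toNat ↔ a = b := by
  cases a <;> cases b <;> simp

theorem run_attrCount (hs : GraphIn D N s) {v : ℕ} (hv : v < N) (h18 : s.var 18 = 0)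
    (h20 : s.var 20 = v * N) {Z : Set ℕ} (hZ : Z = s.nodes (s.var vXO) N) :
    Run ps attrCount s (N * 6 + 2) (fun s' =>
      s'.var 18 = countP (fun w => D.edge v w ∧ w ∈ Z) N ∧
      ((∃ w ∈ Z, D.edge v w) → D.edge v (s'.var 19) ∧ s'.var 19 ∈ Z)) := by
  refine Run.forTo [18, 19] [] N 4 (fun j s' =>
      s'.var 18 = countP (fun w => D.edge v w ∧ w ∈ Z) j ∧
      (s'.var 18 ≠ 0 → D.edge v (s'.var 19) ∧ s'.var 19 ∈ Z)) rfl rfl ?_ ?_ ?_ ?_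
  · intro s' hf
    simp [hf.var, hs.size]
  · simp [h18, countP_zero]
  · rintro j hj s' hf hvj ⟨hI1, hI2⟩
    have hE := hs.edge v hv j hj
    have hZj : j ∈ Z ↔ s.arr aXS (s.var vXO + j) ≠ 0 := by
      rw [hZ]; simp [Store.nodes, hj]
    rw [countP_succ]
    refine Run.cond (fun he => Run.cond (fun hx => ?_) (fun hx => ?_)) (fun he => ?_)
    · simp [hf.var, hf.arr, hvj, h20, hE, ← hZj] at he hx
      refine Run.straight 2 rfl (by decide) ?_
      simp [Cmd.den, he, hx, hI1, hvj]
    · simp [hf.var, hf.arr, hvj, h20] at he hx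
      refine Run.straight 2 rfl (by decide) ?_
      have : j ∉ Z := by rw [hZj]; simpa using hx
      simpa [Cmd.den, this, ← hI1] using hI2
    · simp [hf.var, hf.arr, hvj, h20] at he
      refine Run.straight 3 rfl (by decide) ?_
      have : ¬ D.edge v j := by rw [← hE]; simpa using he
      simpa [Cmd.den, this, ← hI1] using hI2
  · rintro s' hf - ⟨h1, h2⟩
    refine ⟨h1, fun ⟨w, hw, he⟩ => h2 ?_⟩
    rw [h1, Ne, countP_eq_zero_iff]
    intro h
    rw [hZ] at hw h
    exact h w hw.1 ⟨he, hw⟩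

/-- Target nodes wait for nothing, own nodes for one covered move, and nodes of the opponent for all
their moves. By `htot`, the last move found by the scan is a legal default choice. -/
theorem run_attrInit (hs : GraphIn D N s) (hb : s.var vPL = b.toNat) {Z T : Set ℕ}
    (hZ : Z = s.nodes (s.var vXO) N) (htot : ∀ v ∈ Z, ∃ w ∈ Z, D.edge v w)
    (hT : T = {v | v ∈ Z ∧ s.arr aTgt v ≠ 0}) :
    Run ps attrInit s (N * (N * 6 + 12) + 2) (fun s' =>
      AttrInv D b N Z T 0 (s'.arr aAtt) (s'.arr aCnt) (s'.arr aCh)) := by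
  have hcmd : Cmd.within [16, 18, 19, 20] [35, 36, 37] attrCount = true := rfl
  refine (Run.forTo [16, 18, 19, 20] [35, 36, 37] N (N * 6 + 10) (fun j s' =>
    ∀ v < j, s'.arr aAtt v = 0 ∧ (v ∈ Z → D.edge v (s'.arr aCh v) ∧ s'.arr aCh v ∈ Z) ∧
      (s.arr aTgt v ≠ 0 → s'.arr aCnt v = 0) ∧
      (s.arr aTgt v = 0 → D.own v = b → s'.arr aCnt v = 1) ∧
      (s.arr aTgt v = 0 → D.own v ≠ b →
        s'.arr aCnt v = countP (fun w => D.edge v w ∧ w ∈ Z) N)) rfl rfl ?_ ?_ ?_ ?_)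
  · intro s' hf
    simp [hf.var, hs.size]
  · simp
  · rintro j hj s' hf hvj hI
    have hT' : N * 6 + 10 = 1 + (1 + ((N * 6 + 2) + 6)) := by ring
    rw [hT']
    refine Run.seq (Run.assign (Run.seq (Run.assign (Run.seq ?_))))
    have hs' := hs.frame hf rfl rfl
    have hrow := hs'.row j hj.le
    refine ((run_attrCount (v := j) (Z := Z) (D := D) (N := N) ⟨?_, ?_, ?_, ?_⟩ hj ?_ ?_ ?_).frame
      [16, 18, 19] [] rfl).imp ?_
    · simpa using hs'.size
    · simpa using hs'.own
    · simpa using hs'.edge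
    · simpa using hs'.row
    · simp
    · simp [hvj, hrow]
    · simp [hZ, Store.nodes, hf.var, hf.arr]
    · rintro s'' ⟨hf', h1, h2⟩
      have e13 : s''.var vPL = b.toNat := by simp [hf'.var, hf.var, hb]
      have e15 : s''.var 15 = j := by simp [hf'.var, hvj]
      have eO : s''.arr aOwn j = (D.own j).toNat := by simp [hf'.arr, hs'.own j hj]
      have eT : s''.arr aTgt = s.arr aTgt := by simp [hf'.arr, hf.arr]
      have eA : s''.arr aAtt = s'.arr aAtt := by simp [hf'.arr]
      have eC : s''.arr aCnt = s'.arr aCnt := by simp [hf'.arr]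
      have eH : s''.arr aCh = s'.arr aCh := by simp [hf'.arr]
      refine Run.straight 6 rfl (by decide) ?_
      intro v hv
      by_cases hvj' : v = j
      · subst hvj'
        simp only [Cmd.den, Expr.eval_get, Expr.eval_var, Store.setVar_arr, Store.setArr_arr,
          Store.setArr_var, e15, eT, eval_neq, Nat.reduceEqDiff, if_false, eO, e13, toNat_eq_iff]
        by_cases hc : s.arr aTgt v = 0 <;> by_cases ho : D.own v = b <;>
          simp [hc, ho, h1] <;> exact fun hv => h2 (htot v hv)
      · have := hI v (by omega)
        simp only [Cmd.den, Expr.eval_get, Expr.eval_var, Store.setVar_arr, Store.setArr_arr,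
          Store.setArr_var, e15, eT, eval_neq, Nat.reduceEqDiff, if_false, eO, e13, toNat_eq_iff]
        split_ifs <;> simpa [eA, eC, eH, hvj', e15] using this
  · rintro s' hf - hI
    have hN : ∀ v ∈ Z, v < N := by rw [hZ]; exact fun v hv => hv.1
    refine ⟨?_, ?_, ?_, ?_, ?_, ⟨fun _ => 0, ?_⟩, Or.inl (Nat.zero_le _)⟩
    · exact fun v hv h => absurd (hI v hv).1 h
    · exact fun v hv => (hI v (hN v hv)).2.1 hv
    · intro v hv hvT
      rw [hT] at hvT
      exact (hI v (hN v hv)).2.2.1 hvT.2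
    · intro v hv hvT ho
      rw [hT] at hvT
      exact Or.inl ⟨(hI v (hN v hv)).2.2.2.1 (by simpa [hv] using hvT) ho,
        fun w hw _ => (hI w (hN w hw)).1⟩
    · intro v hv hvT ho
      rw [hT] at hvT
      rw [(hI v (hN v hv)).2.2.2.2 (by simpa [hv] using hvT) ho]
      unfold countP
      congr 1
      ext w
      simp only [Finset.mem_filter, Finset.mem_range]
      exact ⟨fun h => ⟨h.1, h.2.1, h.2.2, (hI w h.1).1⟩, fun h => ⟨h.1, h.2.1, h.2.2.1⟩⟩
    · exact fun v hv h => absurd (hI v hv).1 h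

/-- The value `N` of variable 19 encodes that there is no candidate; a later candidate overwrites an
earlier one, which does not matter. -/
theorem run_attrPick (hs : GraphIn D N s) {Z : Set ℕ} (hZ : Z = s.nodes (s.var vXO) N)
    (h19 : s.var 19 = N) : Run ps attrPick s (N * 6 + 2) (fun s' =>
      (s'.var 19 < N → s'.var 19 ∈ Z ∧ s.arr aAtt (s'.var 19) = 0 ∧ s.arr aCnt (s'.var 19) = 0) ∧
      (¬ s'.var 19 < N → ∀ v ∈ Z, s.arr aAtt v = 0 → s.arr aCnt v ≠ 0)) := by
  refine Run.forTo [19] [] N 4 (fun j s' =>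
      (s'.var 19 < N → s'.var 19 ∈ Z ∧ s.arr aAtt (s'.var 19) = 0 ∧ s.arr aCnt (s'.var 19) = 0) ∧
      (¬ s'.var 19 < N → ∀ v < j, v ∈ Z → s.arr aAtt v = 0 → s.arr aCnt v ≠ 0)) rfl rfl ?_ ?_ ?_ ?_
  · intro s' hf
    simp [hf.var, hs.size]
  · simp [h19]
  · rintro j hj s' hf hvj ⟨hI1, hI2⟩
    have hZj : j ∈ Z ↔ s.arr aXS (s.var vXO + j) ≠ 0 := by
      rw [hZ]; simp [Store.nodes, hj]
    refine Run.straight 4 rfl (by decide) ?_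
    simp only [Cmd.den, Expr.eval_get, Expr.eval_var, Expr.eval_add, hf.var vXO (by simp),
      hf.arr _ (List.not_mem_nil), hvj]
    by_cases h1 : s.arr aXS (s.var vXO + j) = 0
    · simp only [h1, if_true, Store.setVar_var, Nat.reduceEqDiff, if_false]
      refine ⟨hI1, fun h v hv hvZ => ?_⟩
      rcases Nat.lt_succ_iff_lt_or_eq.1 hv with hv | rfl
      · exact hI2 h v hv hvZ
      · exact absurd h1 (hZj.1 hvZ)
    · by_cases h2 : s.arr aAtt j = 0
      · by_cases h3 : s.arr aCnt j = 0
        · simp [h1, h2, h3, hZj, hj]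
        · simp only [h1, h2, h3, if_true, Store.setVar_var, Nat.reduceEqDiff, if_false]
          refine ⟨hI1, fun h v hv hvZ => ?_⟩
          rcases Nat.lt_succ_iff_lt_or_eq.1 hv with hv | rfl
          · exact hI2 h v hv hvZ
          · exact fun _ => h3
      · simp only [h1, h2, Store.setVar_var, Nat.reduceEqDiff, if_false]
        refine ⟨hI1, fun h v hv hvZ => ?_⟩
        rcases Nat.lt_succ_iff_lt_or_eq.1 hv with hv | rfl
        · exact hI2 h v hv hvZ
        · exact fun h => absurd h h2
  · rintro s' hf - ⟨h1, h2⟩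
    refine ⟨h1, fun h v hv => h2 h v ?_ hv⟩
    rw [hZ] at hv
    exact hv.1

/-- The predecessors are found by a scan of a column of the adjacency matrix. Since an update reads
the entry that it replaces, the invariant also records that entries from `j` on are still the old
ones. -/
theorem run_attrUpdate (hs : GraphIn D N s) (hb : s.var vPL = b.toNat) {u : ℕ} (hu : u < N)
    (h19 : s.var 19 = u) : Run ps attrUpdate s (N * 8 + 2) (fun s' => ∀ v < N,
      (D.edge v u → s.arr aCnt v ≠ 0 → D.own v = b → s'.arr aCnt v = 0 ∧ s'.arr aCh v = u) ∧
      (D.edge v u → s.arr aCnt v ≠ 0 → D.own v ≠ b →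
        s'.arr aCnt v = s.arr aCnt v - 1 ∧ s'.arr aCh v = s.arr aCh v) ∧
      (¬ (D.edge v u ∧ s.arr aCnt v ≠ 0) →
        s'.arr aCnt v = s.arr aCnt v ∧ s'.arr aCh v = s.arr aCh v)) := by
  refine Run.forTo [20] [36, 37] N 6 (fun j s' => (∀ v < j,
      (D.edge v u → s.arr aCnt v ≠ 0 → D.own v = b → s'.arr aCnt v = 0 ∧ s'.arr aCh v = u) ∧
      (D.edge v u → s.arr aCnt v ≠ 0 → D.own v ≠ b →
        s'.arr aCnt v = s.arr aCnt v - 1 ∧ s'.arr aCh v = s.arr aCh v) ∧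
      (¬ (D.edge v u ∧ s.arr aCnt v ≠ 0) →
        s'.arr aCnt v = s.arr aCnt v ∧ s'.arr aCh v = s.arr aCh v)) ∧
      ∀ v, j ≤ v → s'.arr aCnt v = s.arr aCnt v ∧ s'.arr aCh v = s.arr aCh v) rfl rfl ?_ ?_ ?_ ?_
  · intro s' hf
    simp [hf.var, hs.size]
  · simp
  · rintro j hj s' hf hvj ⟨hI1, hI2⟩
    have hs' := hs.frame hf rfl rfl
    have hE := hs'.edge j hj u hu
    have h19v : s'.var 19 = u := by simp [hf.var, h19]
    refine Run.straight 6 rfl (by decide) ?_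
    simp only [Cmd.den, Expr.eval_get, Expr.eval_var, Expr.eval_add, Expr.eval_sub, Expr.eval_one,
      Expr.eval_zero, eval_neq, Store.setVar_var, Store.setVar_arr, if_true, Nat.reduceEqDiff,
      if_false, hf.var vPL (by simp), hf.var 19 (by simp), h19, hb, hvj, hs'.row j hj.le,
      hs'.own j hj, toNat_eq_iff, (hI2 j le_rfl).1]
    by_cases h1 : s'.arr aEdg (j * N + u) = 0
    · have hE' : ¬ D.edge j u := by rw [← hE]; simpa using h1
      simp only [h1, if_true, Store.setVar_arr]
      refine ⟨fun v hv => ?_, fun v hv => hI2 v (by omega)⟩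
      rcases Nat.lt_succ_iff_lt_or_eq.1 hv with hv | rfl
      · exact hI1 v hv
      · simpa [hE'] using hI2 v le_rfl
    · have hE' : D.edge j u := hE.1 h1
      by_cases h2 : s.arr aCnt j = 0
      · simp only [h1, h2, if_true, if_false, Store.setVar_arr]
        refine ⟨fun v hv => ?_, fun v hv => hI2 v (by omega)⟩
        rcases Nat.lt_succ_iff_lt_or_eq.1 hv with hv | rfl
        · exact hI1 v hv
        · simpa [h2] using hI2 v le_rfl
      · by_cases h3 : D.own j = b
        · simp only [h1, h2, h3, if_true, if_false]
          refine ⟨fun v hv => ?_, fun v hv => ?_⟩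
          · rcases Nat.lt_succ_iff_lt_or_eq.1 hv with hv | rfl
            · simpa [hv.ne, hvj] using hI1 v hv
            · simp [hE', h2, h3, hvj, h19v]
          · simpa [show v ≠ j by omega, hvj] using hI2 v (by omega)
        · simp only [h1, h2, h3, if_false]
          refine ⟨fun v hv => ?_, fun v hv => ?_⟩
          · rcases Nat.lt_succ_iff_lt_or_eq.1 hv with hv | rfl
            · simpa [hv.ne, hvj] using hI1 v hv
            · simpa [hE', h2, h3, hvj] using (hI2 v le_rfl).2
          · simpa [show v ≠ j by omega, hvj] using hI2 v (by omega)
  · rintro s' hf - ⟨h1, -⟩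
    exact h1

/-- There are `N` rounds, each with one linear search for a new node and one linear pass over its
predecessors; rounds without a candidate are idle. The initial counters cost another quadratic pass.
-/
theorem run_attrCmd (hs : GraphIn D N s) (hb : s.var vPL = b.toNat) {Z T : Set ℕ}
    (hZ : Z = s.nodes (s.var vXO) N) (htot : ∀ v ∈ Z, ∃ w ∈ Z, D.edge v w)
    (hT : T = {v | v ∈ Z ∧ s.arr aTgt v ≠ 0}) :
    Run ps attrCmd s (N * (N * 20 + 23) + 4) (fun s' =>
      Frame [15, 16, 17, 18, 19, 20] [35, 36, 37] s s' ∧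
      D.IsAttr b Z T {v | v < N ∧ s'.arr aAtt v ≠ 0} (s'.arr aCh)) := by
  have hN : ∀ v ∈ Z, v < N := by rw [hZ]; exact fun v hv => hv.1
  refine Run.frame _ _ ?_ rfl
  have hTm : N * (N * 20 + 23) + 4 = (N * (N * 6 + 12) + 2) + (N * ((N * 14 + 9) + 2) + 2) := by
    ring
  rw [hTm]
  refine Run.seq_imp ((run_attrInit hs hb hZ htot hT).frame
    [15, 16, 18, 19, 20] [35, 36, 37] rfl) ?_
  rintro s₁ ⟨hf₁, h₁⟩
  have hs₁ := hs.frame hf₁ rfl rfl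
  refine Run.forTo [15, 19, 20] [35, 36, 37] N (N * 14 + 9) (fun j s' =>
      AttrInv D b N Z T j (s'.arr aAtt) (s'.arr aCnt) (s'.arr aCh)) rfl rfl ?_ (by simpa) ?_ ?_
  · intro s' hf
    simp [hf.var, hs₁.size]
  · rintro j hj s' hf hvj hI
    have hs' := hs₁.frame hf rfl rfl
    have hTm : N * 14 + 9 = 1 + ((N * 6 + 2) + ((1 + (N * 8 + 2) + 2) + 1)) := by ring
    rw [hTm]
    refine Run.seq (Run.assign (Run.seq_imp ((run_attrPick (Z := Z) (D := D) (N := N)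
      ⟨?_, ?_, ?_, ?_⟩ ?_ ?_).frame [15, 19] [] rfl) ?_))
    · simpa using hs'.size
    · simpa using hs'.own
    · simpa using hs'.edge
    · simpa using hs'.row
    · simp [hZ, Store.nodes, hf.var, hf.arr, hf₁.var, hf₁.arr]
    · simpa using hs'.size
    · rintro s₂ ⟨hf₂, h2, h3⟩
      have eN : s₂.var vN = N := by simp [hf₂.var, hs'.size]
      have eA : s₂.arr aAtt = s'.arr aAtt := by simp [hf₂.arr]
      have eC : s₂.arr aCnt = s'.arr aCnt := by simp [hf₂.arr]
      have eH : s₂.arr aCh = s'.arr aCh := by simp [hf₂.arr]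
      refine Run.cond (fun he => ?_) (fun he => ?_)
      · simp [eN] at he
        obtain ⟨hu, hau, hcu⟩ := h2 (by omega)
        refine Run.mono (Run.seq (T₁ := 1) (T₂ := N * 8 + 2) (Run.store ?_)) (by omega)
        have hs₂ : GraphIn D N s₂ := by
          refine hs'.frame (vs := [15, 19]) (as := []) (⟨fun x hx => ?_, fun x hx => ?_⟩) rfl rfl
          · rw [hf₂.var x hx]; simp at hx; simp [hx]
          · rw [hf₂.arr x hx]; simp
        refine ((run_attrUpdate (s := s₂.setArr aAtt (s₂.var 19) 1) (D := D) (N := N) (b := b) (u := s₂.var 19) ⟨?_, ?_, ?_, ?_⟩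
          ?_ (by omega) rfl).frame [15, 20] [36, 37] rfl).imp ?_
        · simpa using hs₂.size
        · simpa using hs₂.own
        · simpa using hs₂.edge
        · simpa using hs₂.row
        · simp [hf₂.var, hf.var, hf₁.var, hb]
        · rintro s₃ ⟨hf₃, h⟩
          have eA₃ : s₃.arr aAtt = Function.update (s'.arr aAtt) (s₂.var 19) 1 := by
            simp [hf₃.arr, eA]
          simp only [Store.setVar_arr, eA₃]
          simp only [Store.setArr_arr, Nat.reduceEqDiff, if_false, eC, eH] at h
          simp only [Store.setVar_arr] at hau hcu
          exact hI.step hN hu hau hcu (fun v hv => (h v hv).1) (fun v hv => (h v hv).2.1)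
            (fun v hv => (h v hv).2.2)
      · simp [eN] at he
        refine Run.straight _ rfl (by simp [Cmd.cost]) ?_
        simp only [Cmd.den, Store.setVar_arr, eA, eC, eH]
        exact hI.idle (h3 (by omega))
  · rintro s' hf - hI
    exact hI.isAttr hN (by rw [hT]; exact fun v hv => hv.1)

end

section

/-! ## The solver for Emerson-Lei games -/

/-- The target consists of the nodes with the color at row `28`. -/
def colorTarget : Cmd :=
  .forTo 15 (.var vN) (.store aTgt (.var 15) (.get aCol (.var 28 + .var 15)))

/-- The nodes outside the attractor form the subgame of the recursive call, at offset `30`. -/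
def childSet : Cmd :=
  .forTo 15 (.var vN)
    (.cond (.get aXS (.var vXO + .var 15))
      (.store aWin (.var 15) (.var vPL) ;;
        .cond (.get aAtt (.var 15)) (.store aXS (.var 30 + .var 15) 0)
          (.store aXS (.var 30 + .var 15) 1))
      (.store aXS (.var 30 + .var 15) 0))

/-- Execute `c` for the entries of the strategy tables with memory values `25, …, 25 + 31 - 1`. -/
def tableLoop (c : Cmd) : Cmd :=
  .forTo 16 (.var 31)
    (23 ::= .var 25 + .var 16 ;; 24 ::= .get aRow (.var 23) ;; .forTo 15 (.var vN) c)

/-- Write the attractor strategy; at the target, the memory changes to the value `22`. -/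
def writeBlock : Cmd :=
  .cond (.get aAtt (.var 15))
    (.store aNxt (.var 24 + .var 15) (.get aCh (.var 15)) ;;
      .cond (.get aTgt (.var 15)) (.store aUpd (.var 24 + .var 15) (.var 22))
        (.store aUpd (.var 24 + .var 15) (.var 23)))
    .skip

/-- Swap the entries `24` and `vLV - 1` of the list of colors. -/
def swapColors : Cmd :=
  25 ::= .get aCL (.var 24) ;; .store aCL (.var 24) (.get aCL (.var vLV - 1)) ;;
    .store aCL (.var vLV - 1) (.var 25)

/-- Call the solver with one color less. -/
def recurse : Cmd :=
  (24 ::= .get aJJ (.var vLV) ;; swapColors ;; vMask ::= .var vMask - .get aPow (.var 27) ;;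
    .store aQB (.var vLV - 1) (.var 21) ;; vLV ::= .var vLV - 1) ;;
  .call 0 ;;
  (vLV ::= .var vLV + 1 ;; 24 ::= .get aJJ (.var vLV) ;; swapColors ;;
    vMask ::= .var vMask + .get aPow (.get aCL (.var 24)))

/-- The target consists of the nodes won by the player `vPL`; `26` tells whether there are any. -/
def wonTarget : Cmd :=
  26 ::= 0 ;;
  .forTo 15 (.var vN)
    (.store aTgt (.var 15) 0 ;;
      .cond (.get aXS (.var vXO + .var 15))
        (.cond (neq (.get aWin (.var 15)) (.var vPL)) .skip
          (.store aTgt (.var 15) 1 ;; 26 ::= 1))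
        .skip)

/-- Write the attractor strategy, and copy the strategy at the target from row `22`, except for the
memory values `21, …, 21 + 29 - 1`. -/
def writeWon : Cmd :=
  .cond (.get aAtt (.var 15))
    (.cond (.get aTgt (.var 15))
      (.cond ((.var 21 - .var 23) + ((.var 23 + 1) - (.var 21 + .var 29)))
        (.store aNxt (.var 24 + .var 15) (.get aNxt (.var 22 + .var 15)) ;;
          .store aUpd (.var 24 + .var 15) (.get aUpd (.var 22 + .var 15)))
        .skip)
      (.store aNxt (.var 24 + .var 15) (.get aCh (.var 15)) ;;
        .store aUpd (.var 24 + .var 15) (.var 23)))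
    .skip

/-- Remove the attractor from the subgame; it is won by `vPL`. -/
def removeWon : Cmd :=
  .forTo 15 (.var vN)
    (.cond (.get aAtt (.var 15))
      (.store aXS (.var vXO + .var 15) 0 ;; .store aWin (.var 15) (.var vPL)) .skip)

/-- The nodes of the subgame are won by `vPL`. -/
def setWinner : Cmd :=
  .forTo 15 (.var vN)
    (.cond (.get aXS (.var vXO + .var 15)) (.store aWin (.var 15) (.var vPL)) .skip)

/-- Any moves will do. -/
def writeAny : Cmd :=
  .forTo 15 (.var vN)
    (.cond (.get aXS (.var vXO + .var 15))
      (.store aNxt (.var 24 + .var 15) (.get aCh (.var 15)) ;;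
        .store aUpd (.var 24 + .var 15) (.var 23))
      .skip)

/-- Start of the treatment of the current color. -/
def stepOpen : Cmd :=
  (27 ::= .get aCL (.get aJJ (.var vLV)) ;; 28 ::= .get aRow (.var 27) ;;
    vPL ::= .get aWint (.var vMask) ;; vXO ::= .get aRow (.var vLV)) ;;
  colorTarget ;; attrCmd ;;
  (21 ::= .get aQJ (.var vLV) ;; 31 ::= .get aFact (.var vLV - 1) ;; 25 ::= .var 21 ;;
    30 ::= .get aRow (.var vLV - 1) ;;
    .cond (.var vLV - (.get aJJ (.var vLV) + 1)) (22 ::= .var 21 + .var 31)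
      (22 ::= .get aQB (.var vLV))) ;;
  childSet ;; tableLoop writeBlock

/-- Removal of the nodes won by the opponent. -/
def stepRemove : Cmd :=
  attrCmd ;;
  (21 ::= .get aQJ (.var vLV) ;; 22 ::= .get aRow (.var 21) ;; 29 ::= .get aFact (.var vLV - 1) ;;
    31 ::= .get aFact (.var vLV) ;; 25 ::= .get aQB (.var vLV)) ;;
  tableLoop writeWon ;; removeWon ;;
  (.store aJJ (.var vLV) 0 ;; .store aQJ (.var vLV) (.get aQB (.var vLV)))

/-- Conclusion of the treatment of the current color. -/
def stepClose : Cmd :=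
  (vPL ::= 1 - .get aWint (.var vMask) ;; vXO ::= .get aRow (.var vLV)) ;; wonTarget ;;
  .cond (.var 26) stepRemove
    (.store aQJ (.var vLV) (.get aQJ (.var vLV) + .get aFact (.var vLV - 1)) ;;
      .store aJJ (.var vLV) (.get aJJ (.var vLV) + 1))

/-- The nodes that remain are won by the player that wins with all colors. -/
def solveFinish : Cmd :=
  (vPL ::= .get aWint (.var vMask) ;; vXO ::= .get aRow (.var vLV)) ;; setWinner ;;
  .cond (.var vLV) .skip
    (attrCmd ;; (23 ::= .get aQB (.var vLV) ;; 24 ::= .get aRow (.var 23)) ;; writeAny)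

/-- The recursive solver. -/
def solveBody : Cmd :=
  (.store aJJ (.var vLV) 0 ;; .store aQJ (.var vLV) (.get aQB (.var vLV))) ;;
  .loop (.var vLV - .get aJJ (.var vLV)) (stepOpen ;; recurse ;; stepClose) ;; solveFinish

/-- The strategy table stored in array `a`. -/
def Store.tab (s : Store) (a N q v : ℕ) : ℕ := s.arr a (q * N + v)

theorem index_inj {N q v q' v' : ℕ} (hv : v < N) (hv' : v' < N) :
    q * N + v = q' * N + v' ↔ q = q' ∧ v = v' := by
  constructor
  · intro h
    have h1 : (v + q * N) / N = (v' + q' * N) / N := by rw [add_comm v, add_comm v', h]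
    rw [Nat.add_mul_div_right _ _ (by omega), Nat.add_mul_div_right _ _ (by omega),
      Nat.div_eq_of_lt hv, Nat.div_eq_of_lt hv'] at h1
    have : q = q' := by omega
    subst this
    omega
  · rintro ⟨rfl, rfl⟩; rfl

variable {ps : List Cmd} {N : ℕ} {s : Store}

theorem run_colorTarget (hN : s.var vN = N) : Run ps colorTarget s (N * 3 + 2) (fun s' =>
    ∀ v < N, s'.arr aTgt v = s.arr aCol (s.var 28 + v)) := by
  refine Run.forTo [] [aTgt] N 1 (fun j s' => ∀ v < j, s'.arr aTgt v = s.arr aCol (s.var 28 + v))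
    rfl rfl ?_ ?_ ?_ ?_
  · intro s' hf; simp [hf.var, hN]
  · simp
  · intro j hj s' hf hvj hI
    refine Run.straight 1 rfl (by decide) fun v hv => ?_
    rcases Nat.lt_succ_iff_lt_or_eq.1 hv with hv | rfl
    · simpa [Cmd.den, hvj, hv.ne] using hI v hv
    · simp [Cmd.den, hvj, hf.var, hf.arr]
  · exact fun s' _ _ h => h

/-- The assumption `h30` places the new row below the one that is read, so the loop does not destroy
entries that it still needs. -/
theorem run_childSet (hN : s.var vN = N) (h30 : s.var 30 + N ≤ s.var vXO) :
    Run ps childSet s (N * 6 + 2) (fun s' =>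
      (∀ v < N, s'.arr aXS (s.var 30 + v) ≠ 0 ↔ s.arr aXS (s.var vXO + v) ≠ 0 ∧ s.arr aAtt v = 0) ∧
      (∀ i, s.var 30 + N ≤ i → s'.arr aXS i = s.arr aXS i) ∧
      (∀ v < N, s.arr aXS (s.var vXO + v) ≠ 0 → s'.arr aWin v = s.var vPL) ∧
      (∀ v, ¬ (v < N ∧ s.arr aXS (s.var vXO + v) ≠ 0) → s'.arr aWin v = s.arr aWin v)) := by
  refine Run.forTo [] [aXS, aWin] N 4 (fun j s' =>
    (∀ v < j, s'.arr aXS (s.var 30 + v) ≠ 0 ↔ s.arr aXS (s.var vXO + v) ≠ 0 ∧ s.arr aAtt v = 0) ∧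
    (∀ i, s.var 30 + N ≤ i → s'.arr aXS i = s.arr aXS i) ∧
    (∀ v < j, s.arr aXS (s.var vXO + v) ≠ 0 → s'.arr aWin v = s.var vPL) ∧
    (∀ v, ¬ (v < j ∧ s.arr aXS (s.var vXO + v) ≠ 0) → s'.arr aWin v = s.arr aWin v))
    rfl rfl ?_ ?_ ?_ ?_
  · intro s' hf; simp [hf.var, hN]
  · simp
  · rintro j hj s' hf hvj ⟨h1, h2, h3, h4⟩
    have e1 : s'.arr aXS (s.var vXO + j) = s.arr aXS (s.var vXO + j) := h2 _ (by omega)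
    refine Run.straight 4 rfl (by decide) ?_
    simp only [Cmd.den, Expr.eval_get, Expr.eval_var, Expr.eval_add, hf.var vXO (by simp),
      hf.var 30 (by simp), hf.var vPL (by simp), hvj, e1, Store.setArr_arr, Nat.reduceEqDiff,
      if_false, hf.arr aAtt (by simp), Store.setVar_arr, Store.setArr_var]
    by_cases hx : s.arr aXS (s.var vXO + j) = 0
    · simp only [hx, if_true, Store.setArr_arr, Nat.reduceEqDiff, if_false, Expr.eval_zero]
      refine ⟨fun v hv => ?_, fun i hi => ?_, fun v hv hv0 => ?_, fun v hv => ?_⟩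
      · rcases Nat.lt_succ_iff_lt_or_eq.1 hv with hv | rfl
        · simpa [hv.ne] using h1 v hv
        · simp [hx]
      · simpa [show i ≠ s.var 30 + j by omega] using h2 i hi
      · rcases Nat.lt_succ_iff_lt_or_eq.1 hv with hv | rfl
        · exact h3 v hv hv0
        · exact absurd hx hv0
      · exact h4 v (fun h => hv ⟨by omega, h.2⟩)
    · simp only [hx, if_false]
      have key : ∀ x, (x ≠ 0 ↔ s.arr aAtt j = 0) →
        (∀ v < j + 1, Function.update (s'.arr aXS) (s.var 30 + j) x (s.var 30 + v) ≠ 0 ↔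
          s.arr aXS (s.var vXO + v) ≠ 0 ∧ s.arr aAtt v = 0) ∧
        (∀ i, s.var 30 + N ≤ i →
          Function.update (s'.arr aXS) (s.var 30 + j) x i = s.arr aXS i) ∧
        (∀ v < j + 1, s.arr aXS (s.var vXO + v) ≠ 0 →
          Function.update (s'.arr aWin) j (s.var vPL) v = s.var vPL) ∧
        (∀ v, ¬ (v < j + 1 ∧ s.arr aXS (s.var vXO + v) ≠ 0) →
          Function.update (s'.arr aWin) j (s.var vPL) v = s.arr aWin v) := by
        intro x hx0
        refine ⟨fun v hv => ?_, fun i hi => ?_, fun v hv hv0 => ?_, fun v hv => ?_⟩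
        · rcases Nat.lt_succ_iff_lt_or_eq.1 hv with hv | rfl
          · simpa [hv.ne] using h1 v hv
          · simpa [hx] using hx0
        · simpa [show i ≠ s.var 30 + j by omega] using h2 i hi
        · rcases Nat.lt_succ_iff_lt_or_eq.1 hv with hv | rfl
          · simpa [hv.ne] using h3 v hv hv0
          · simp
        · have : v ≠ j := by rintro rfl; exact hv ⟨by omega, hx⟩
          simpa [this] using h4 v (fun h => hv ⟨by omega, h.2⟩)
      by_cases ha : s.arr aAtt j = 0
      · simp only [ha, if_true, Store.setArr_arr, Nat.reduceEqDiff, if_false, Expr.eval_one]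
        exact key 1 (by simp [ha])
      · simp only [ha, Store.setArr_arr, Nat.reduceEqDiff, if_false, if_true, Expr.eval_zero]
        exact key 0 (by simp [ha])
  · exact fun s' _ _ h => h

/-- The premise on the body states for every row of the column `v` that its entries are either old
or already final. This permits bodies that also read other rows, such as `writeWon`. -/
theorem run_tableLoop {c : Cmd} {base cnt Tc : ℕ} (hN : s.var vN = N) (h25 : s.var 25 = base)
    (h31 : s.var 31 = cnt) (hrow : ∀ q, base ≤ q → q < base + cnt → s.arr aRow q = q * N)
    (hcw : c.within [] [aUpd, aNxt] = true) (gU gN : ℕ → ℕ → ℕ)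
    (hc : ∀ q v s', base ≤ q → q < base + cnt → v < N →
      Frame [15, 16, 23, 24] [aUpd, aNxt] s s' → s'.var 15 = v → s'.var 23 = q →
      s'.var 24 = q * N →
      (∀ q', s'.tab aUpd N q' v = s.tab aUpd N q' v ∧ s'.tab aNxt N q' v = s.tab aNxt N q' v ∨
        base ≤ q' ∧ q' < base + cnt ∧ s'.tab aUpd N q' v = gU q' v ∧ s'.tab aNxt N q' v = gN q' v) →
      s'.tab aUpd N q v = s.tab aUpd N q v → s'.tab aNxt N q v = s.tab aNxt N q v →
      Run ps c s' Tc (fun s'' =>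
        (∀ i, s''.arr aUpd i = if i = q * N + v then gU q v else s'.arr aUpd i) ∧
        (∀ i, s''.arr aNxt i = if i = q * N + v then gN q v else s'.arr aNxt i))) :
    Run ps (tableLoop c) s (cnt * (N * (Tc + 2) + 6) + 2) (fun s' => ∀ q, ∀ v < N,
      (base ≤ q ∧ q < base + cnt → s'.tab aUpd N q v = gU q v ∧ s'.tab aNxt N q v = gN q v) ∧
      (¬ (base ≤ q ∧ q < base + cnt) →
        s'.tab aUpd N q v = s.tab aUpd N q v ∧ s'.tab aNxt N q v = s.tab aNxt N q v)) := by
  have hw : c.within [15, 23, 24] [aUpd, aNxt] = true := by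
    have : ∀ c : Cmd, c.within [] [aUpd, aNxt] = true →
        c.within [15, 23, 24] [aUpd, aNxt] = true := by
      intro c
      induction c <;> simp_all [Cmd.within]
    exact this c hcw
  rw [tableLoop, show N * (Tc + 2) + 6 = 1 + (1 + (N * (Tc + 2) + 2)) + 2 by ring]
  refine Run.forTo [15, 23, 24] [aUpd, aNxt] cnt (1 + (1 + (N * (Tc + 2) + 2))) (fun j s' =>
    ∀ q, ∀ v < N,
      (base ≤ q ∧ q < base + j → s'.tab aUpd N q v = gU q v ∧ s'.tab aNxt N q v = gN q v) ∧
      (¬ (base ≤ q ∧ q < base + j) →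
        s'.tab aUpd N q v = s.tab aUpd N q v ∧ s'.tab aNxt N q v = s.tab aNxt N q v))
    (by simpa [Cmd.within, Cmd.forTo] using hw) rfl ?_ ?_ ?_ ?_
  · intro s' hf; simp [hf.var, h31]
  · exact fun q v hv => ⟨fun h => absurd h (by omega), fun _ => ⟨rfl, rfl⟩⟩
  · intro i hi s' hf hvi hI
    refine Run.seq (Run.assign (Run.seq (Run.assign ?_)))
    have e23 : s'.var 25 + s'.var 16 = base + i := by rw [hf.var 25 (by simp), h25, hvi]
    simp only [Expr.eval_var, Expr.eval_add, Expr.eval_get, Store.setVar_var, if_true,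
      Store.setVar_arr, e23, hf.arr aRow (by simp), hrow (base + i) (by omega) (by omega)]
    set s₀ := (s'.setVar 23 (base + i)).setVar 24 ((base + i) * N) with hs₀
    have hf₀ : Frame [15, 16, 23, 24] [aUpd, aNxt] s s₀ :=
      (Frame.setVar (Frame.setVar (hf.weaken rfl rfl) (by simp) _) (by simp) _)
    refine (Run.forTo [] [aUpd, aNxt] N Tc (fun j s' => ∀ q, ∀ v < N,
      (base ≤ q ∧ q < base + i ∨ q = base + i ∧ v < j →
        s'.tab aUpd N q v = gU q v ∧ s'.tab aNxt N q v = gN q v) ∧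
      (¬ (base ≤ q ∧ q < base + i ∨ q = base + i ∧ v < j) →
        s'.tab aUpd N q v = s.tab aUpd N q v ∧ s'.tab aNxt N q v = s.tab aNxt N q v))
      hcw rfl ?_ ?_ ?_ ?_)
    · intro s' hf'
      simp [hf'.var, hf₀.var, hN]
    · intro q v hv
      simpa [Store.tab, hs₀] using hI q v hv
    · intro j hj s₁ hf₁ hvj hI₁
      have hf₂ : Frame [15, 16, 23, 24] [aUpd, aNxt] s s₁ := hf₀.trans (hf₁.weaken rfl rfl)
      refine (hc (base + i) j s₁ (by omega) (by omega) hj hf₂ hvj ?_ ?_ ?_ ?_ ?_).imp ?_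
      · simp [hf₁.var, hs₀]
      · simp [hf₁.var, hs₀]
      · intro q'
        by_cases hq : base ≤ q' ∧ q' < base + i
        · exact Or.inr ⟨hq.1, by omega, (hI₁ q' j hj).1 (Or.inl hq)⟩
        · exact Or.inl ((hI₁ q' j hj).2 (by omega))
      · exact ((hI₁ (base + i) j hj).2 (by omega)).1
      · exact ((hI₁ (base + i) j hj).2 (by omega)).2
      · rintro s₂ ⟨h1, h2⟩ q v hv
        simp only [Store.tab, Store.setVar_arr, h1, h2, index_inj hv hj]
        by_cases heq : q = base + i ∧ v = j
        · simp [heq.1, heq.2]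
        · simp only [heq, if_false]
          have := hI₁ q v hv
          simp only [Store.tab] at this
          exact ⟨fun h => this.1 (by omega), fun h => this.2 (by omega)⟩
    · intro s₁ hf₁ hvN hI₁ q v hv
      have := hI₁ q v hv
      simp only [Store.tab, Store.setVar_arr] at this ⊢
      exact ⟨fun h => this.1 (by omega), fun h => this.2 (by omega)⟩
  · exact fun s' _ _ h => h

theorem run_writeBlock {base cnt x : ℕ} (hN : s.var vN = N) (h25 : s.var 25 = base)
    (h31 : s.var 31 = cnt) (hrow : ∀ q, base ≤ q → q < base + cnt → s.arr aRow q = q * N)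
    (h22 : s.var 22 = x) :
    Run ps (tableLoop writeBlock) s (cnt * (N * 6 + 6) + 2) (fun s' => ∀ q, ∀ v < N,
      (base ≤ q ∧ q < base + cnt ∧ s.arr aAtt v ≠ 0 → s'.tab aNxt N q v = s.arr aCh v ∧
        s'.tab aUpd N q v = if s.arr aTgt v = 0 then q else x) ∧
      (¬ (base ≤ q ∧ q < base + cnt ∧ s.arr aAtt v ≠ 0) →
        s'.tab aUpd N q v = s.tab aUpd N q v ∧ s'.tab aNxt N q v = s.tab aNxt N q v)) := by
  refine (run_tableLoop (Tc := 4) hN h25 h31 hrow rfl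
    (fun q v => if s.arr aAtt v = 0 then s.tab aUpd N q v else if s.arr aTgt v = 0 then q else x)
    (fun q v => if s.arr aAtt v = 0 then s.tab aNxt N q v else s.arr aCh v) ?_).imp ?_
  · intro q v s' hq hq' hv hf h15 h23 h24 _ hU hX
    refine Run.straight 4 rfl (by decide) ?_
    simp only [writeBlock, Cmd.den, Expr.eval_get, Expr.eval_var, Expr.eval_add, hf.arr aAtt (by simp), h15,
      h23, h24, hf.var 22 (by simp), h22, hf.arr aCh (by simp), hf.arr aTgt (by simp),
      Store.setArr_var, Store.setArr_arr, Nat.reduceEqDiff, if_false]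
    by_cases ha : s.arr aAtt v = 0
    · simp only [ha, if_true, Store.tab] at hU hX ⊢
      exact ⟨fun i => by split_ifs with h <;> simp [h, hU],
        fun i => by split_ifs with h <;> simp [h, hX]⟩
    · by_cases ht : s.arr aTgt v = 0 <;> simp [ha, ht, Function.update_apply]
  · intro s' h q v hv
    obtain ⟨h1, h2⟩ := h q v hv
    refine ⟨fun h => ?_, fun h => ?_⟩
    · simpa [h.2.2, and_comm] using h1 ⟨h.1, h.2.1⟩
    · by_cases hq : base ≤ q ∧ q < base + cnt
      · have ha : s.arr aAtt v = 0 := by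
          by_contra ha
          exact h ⟨hq.1, hq.2, ha⟩
        simpa [ha] using h1 hq
      · exact h2 hq

theorem run_writeWon {base cnt lo f : ℕ} (hN : s.var vN = N) (h25 : s.var 25 = base)
    (h31 : s.var 31 = cnt) (hrow : ∀ q, base ≤ q → q < base + cnt → s.arr aRow q = q * N)
    (h21 : s.var 21 = lo) (h22 : s.var 22 = lo * N) (h29 : s.var 29 = f) (hf : 0 < f) :
    Run ps (tableLoop writeWon) s (cnt * (N * 7 + 6) + 2) (fun s' => ∀ q, ∀ v < N,
      (base ≤ q ∧ q < base + cnt ∧ s.arr aAtt v ≠ 0 ∧ s.arr aTgt v = 0 →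
        s'.tab aNxt N q v = s.arr aCh v ∧ s'.tab aUpd N q v = q) ∧
      (base ≤ q ∧ q < base + cnt ∧ s.arr aAtt v ≠ 0 ∧ s.arr aTgt v ≠ 0 ∧ ¬ (lo ≤ q ∧ q < lo + f) →
        s'.tab aNxt N q v = s.tab aNxt N lo v ∧ s'.tab aUpd N q v = s.tab aUpd N lo v) ∧
      ((¬ (base ≤ q ∧ q < base + cnt ∧ s.arr aAtt v ≠ 0) ∨ s.arr aTgt v ≠ 0 ∧ lo ≤ q ∧ q < lo + f) →
        s'.tab aUpd N q v = s.tab aUpd N q v ∧ s'.tab aNxt N q v = s.tab aNxt N q v)) := by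
  have main := (run_tableLoop (ps := ps) (c := writeWon) (Tc := 5) hN h25 h31 hrow rfl
    (fun q v => if s.arr aAtt v = 0 then s.tab aUpd N q v else if s.arr aTgt v = 0 then q else
      if lo ≤ q ∧ q < lo + f then s.tab aUpd N q v else s.tab aUpd N lo v)
    (fun q v => if s.arr aAtt v = 0 then s.tab aNxt N q v else if s.arr aTgt v = 0 then s.arr aCh v
      else if lo ≤ q ∧ q < lo + f then s.tab aNxt N q v else s.tab aNxt N lo v) ?_)
  · refine main.imp ?_
    intro s' h q v hv
    obtain ⟨h1, h2⟩ := h q v hv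
    refine ⟨fun h => ?_, fun h => ?_, fun h => ?_⟩
    · simpa [h.2.2.1, h.2.2.2, and_comm] using h1 ⟨h.1, h.2.1⟩
    · simpa only [h.2.2.1, h.2.2.2.1, h.2.2.2.2, if_false, and_comm] using h1 ⟨h.1, h.2.1⟩
    · by_cases hq : base ≤ q ∧ q < base + cnt
      · rcases h with h | h
        · have ha : s.arr aAtt v = 0 := by
            by_contra ha
            exact h ⟨hq.1, hq.2, ha⟩
          simpa [ha] using h1 hq
        · have := h1 hq
          simpa only [h.1, h.2, if_true, if_false, ite_self, and_self] using this
      · exact h2 hq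
  · intro q v s' hq hq' hv hfr h15 h23 h24 hmix hU hX
    refine Run.straight 5 rfl (by decide) ?_
    simp only [writeWon, Cmd.den, Expr.eval_get, Expr.eval_var, Expr.eval_add, Expr.eval_sub, Expr.eval_one,
      hfr.arr aAtt (by simp), h15, h23, h24, hfr.var 22 (by simp), h22, hfr.var 21 (by simp), h21,
      hfr.var 29 (by simp), h29, hfr.arr aCh (by simp), hfr.arr aTgt (by simp), Store.setArr_var,
      Store.setArr_arr, Nat.reduceEqDiff, if_false]
    by_cases ha : s.arr aAtt v = 0
    · simp only [ha, if_true, Store.tab] at hU hX ⊢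
      exact ⟨fun i => by split_ifs with h <;> simp [h, hU],
        fun i => by split_ifs with h <;> simp [h, hX]⟩
    · by_cases ht : s.arr aTgt v = 0
      · simp [ha, ht, Function.update_apply]
      · by_cases hlo : lo ≤ q ∧ q < lo + f
        · have h0 : lo - q + (q + 1 - (lo + f)) = 0 := by omega
          simp only [ha, ht, hlo, h0, if_true, if_false, and_self, Store.tab] at hU hX ⊢
          exact ⟨fun i => by split_ifs with h <;> simp [h, hU],
            fun i => by split_ifs with h <;> simp [h, hX]⟩
        · have h0 : ¬ lo - q + (q + 1 - (lo + f)) = 0 := by omega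
          -- The row that is copied lies in the block exempt from copying, so it has its old values
          -- whether or not the loop has already passed it.
          have hl : s'.tab aUpd N lo v = s.tab aUpd N lo v ∧
              s'.tab aNxt N lo v = s.tab aNxt N lo v := by
            rcases hmix lo with h | h
            · exact h
            · have : lo ≤ lo ∧ lo < lo + f := by omega
              simpa only [ha, ht, this, if_false, if_true, and_self] using h.2.2
          simp only [Store.tab] at hl
          rw [if_neg ha, if_neg ht, if_neg h0]
          simp [ha, ht, hlo, Function.update_apply, hl, Store.tab]

theorem run_wonTarget (hN : s.var vN = N) : Run ps wonTarget s (N * 7 + 3) (fun s' =>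
    (∀ v < N, s'.arr aTgt v ≠ 0 ↔
      s.arr aXS (s.var vXO + v) ≠ 0 ∧ s.arr aWin v = s.var vPL) ∧
    (s'.var 26 ≠ 0 ↔ ∃ v < N, s.arr aXS (s.var vXO + v) ≠ 0 ∧ s.arr aWin v = s.var vPL)) := by
  have hT : N * 7 + 3 = 1 + (N * (5 + 2) + 2) := by ring
  rw [hT]
  refine Run.seq (Run.assign ?_)
  refine Run.forTo [26] [aTgt] N 5 (fun j s' => (∀ v < j, s'.arr aTgt v ≠ 0 ↔
      s.arr aXS (s.var vXO + v) ≠ 0 ∧ s.arr aWin v = s.var vPL) ∧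
    (s'.var 26 ≠ 0 ↔ ∃ v < j, s.arr aXS (s.var vXO + v) ≠ 0 ∧ s.arr aWin v = s.var vPL))
    rfl rfl ?_ ?_ ?_ ?_
  · intro s' hf; simp [hf.var, hN]
  · simp
  · rintro j hj s' hf hvj ⟨h1, h2⟩
    refine Run.straight 5 rfl (by decide) ?_
    have e14 : s'.var vXO = s.var vXO := by simp [hf.var]
    have e13 : s'.var vPL = s.var vPL := by simp [hf.var]
    have eX : s'.arr aXS = s.arr aXS := by simp [hf.arr]
    have eW : s'.arr aWin = s.arr aWin := by simp [hf.arr]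
    simp only [Cmd.den, Expr.eval_get, Expr.eval_var, Expr.eval_add, eval_neq, Store.setArr_var,
      Store.setArr_arr, Nat.reduceEqDiff, if_false, hvj, Expr.eval_zero, e14, e13, eX, eW]
    have aux : (∃ v < j + 1, s.arr aXS (s.var vXO + v) ≠ 0 ∧ s.arr aWin v = s.var vPL) ↔
        (∃ v < j, s.arr aXS (s.var vXO + v) ≠ 0 ∧ s.arr aWin v = s.var vPL) ∨
        (s.arr aXS (s.var vXO + j) ≠ 0 ∧ s.arr aWin j = s.var vPL) := by
      constructor
      · rintro ⟨v, hv, h⟩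
        rcases Nat.lt_succ_iff_lt_or_eq.1 hv with hv | rfl
        · exact Or.inl ⟨v, hv, h⟩
        · exact Or.inr h
      · rintro (⟨v, hv, h⟩ | h)
        · exact ⟨v, by omega, h⟩
        · exact ⟨j, by omega, h⟩
    rw [aux]
    by_cases hc : s.arr aXS (s.var vXO + j) ≠ 0 ∧ s.arr aWin j = s.var vPL
    · simp only [hc.1, hc.2, if_true, if_false]
      refine ⟨fun v hv => ?_, by simp [hc.1]⟩
      rcases Nat.lt_succ_iff_lt_or_eq.1 hv with hv | rfl
      · simpa [hv.ne, hvj] using h1 v hv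
      · simpa [hvj] using hc
    · have : ∀ a b : Store, (if s.arr aXS (s.var vXO + j) = 0 then a else
          if s.arr aWin j = s.var vPL then b else a) = a := by
        intro a b; split_ifs <;> tauto
      rw [this]
      refine ⟨fun v hv => ?_, by simpa [hc] using h2⟩
      rcases Nat.lt_succ_iff_lt_or_eq.1 hv with hv | rfl
      · simpa [hv.ne] using h1 v hv
      · simpa using hc
  · exact fun s' _ _ h => h

theorem run_removeWon (hN : s.var vN = N) : Run ps removeWon s (N * 5 + 2) (fun s' =>
    (∀ v < N, s.arr aAtt v ≠ 0 → s'.arr aXS (s.var vXO + v) = 0 ∧ s'.arr aWin v = s.var vPL) ∧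
    (∀ i, ¬ (∃ v < N, i = s.var vXO + v ∧ s.arr aAtt v ≠ 0) → s'.arr aXS i = s.arr aXS i) ∧
    (∀ v, ¬ (v < N ∧ s.arr aAtt v ≠ 0) → s'.arr aWin v = s.arr aWin v)) := by
  refine Run.forTo [] [aXS, aWin] N 3 (fun j s' =>
    (∀ v < j, s.arr aAtt v ≠ 0 → s'.arr aXS (s.var vXO + v) = 0 ∧ s'.arr aWin v = s.var vPL) ∧
    (∀ i, ¬ (∃ v < j, i = s.var vXO + v ∧ s.arr aAtt v ≠ 0) → s'.arr aXS i = s.arr aXS i) ∧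
    (∀ v, ¬ (v < j ∧ s.arr aAtt v ≠ 0) → s'.arr aWin v = s.arr aWin v)) rfl rfl ?_ ?_ ?_ ?_
  · intro s' hf; simp [hf.var, hN]
  · simp
  · rintro j hj s' hf hvj ⟨h1, h2, h3⟩
    refine Run.straight 3 rfl (by decide) ?_
    simp only [Cmd.den, Expr.eval_get, Expr.eval_var, Expr.eval_add, Store.setArr_var,
      hvj, Expr.eval_zero, hf.arr aAtt (by simp), hf.var vXO (by simp), hf.var vPL (by simp)]
    by_cases ha : s.arr aAtt j = 0
    · simp only [ha, if_true, Store.setVar_arr]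
      refine ⟨fun v hv hv0 => ?_, fun i hi => ?_, fun v hv => ?_⟩
      · rcases Nat.lt_succ_iff_lt_or_eq.1 hv with hv | rfl
        · exact h1 v hv hv0
        · exact absurd ha hv0
      · exact h2 i fun ⟨v, hv, h⟩ => hi ⟨v, by omega, h⟩
      · exact h3 v fun h => hv ⟨by omega, h.2⟩
    · simp only [ha, if_false, Store.setVar_arr, Store.setArr_arr, Nat.reduceEqDiff, if_true]
      refine ⟨fun v hv hv0 => ?_, fun i hi => ?_, fun v hv => ?_⟩
      · rcases Nat.lt_succ_iff_lt_or_eq.1 hv with hv | rfl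
        · simpa [hv.ne] using h1 v hv hv0
        · simp
      · have : i ≠ s.var vXO + j := fun h => hi ⟨j, by omega, h, ha⟩
        simpa [this] using h2 i fun ⟨v, hv, h⟩ => hi ⟨v, by omega, h⟩
      · have : v ≠ j := by rintro rfl; exact hv ⟨by omega, ha⟩
        simpa [this] using h3 v fun h => hv ⟨by omega, h.2⟩
  · exact fun s' _ _ h => h

theorem run_setWinner (hN : s.var vN = N) : Run ps setWinner s (N * 4 + 2) (fun s' =>
    ∀ v, s'.arr aWin v =
      if v < N ∧ s.arr aXS (s.var vXO + v) ≠ 0 then s.var vPL else s.arr aWin v) := by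
  refine Run.forTo [] [aWin] N 2 (fun j s' => ∀ v, s'.arr aWin v =
      if v < j ∧ s.arr aXS (s.var vXO + v) ≠ 0 then s.var vPL else s.arr aWin v) rfl rfl ?_ ?_ ?_ ?_
  · intro s' hf; simp [hf.var, hN]
  · simp
  · intro j hj s' hf hvj h
    refine Run.straight 2 rfl (by decide) fun v => ?_
    simp only [Cmd.den, Expr.eval_get, Expr.eval_var, Expr.eval_add, hvj, hf.arr aXS (by simp),
      hf.var vXO (by simp), hf.var vPL (by simp)]
    have := h v
    by_cases hvj' : v = j
    · subst hvj'
      by_cases hx : s.arr aXS (s.var vXO + v) = 0 <;> simp [hx, h]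
    · have : v < j + 1 ↔ v < j := by omega
      by_cases hx : s.arr aXS (s.var vXO + j) = 0 <;> simp [hx, h, hvj', this]
  · exact fun s' _ _ h => h

theorem run_writeAny (hN : s.var vN = N) {q : ℕ} (h23 : s.var 23 = q) (h24 : s.var 24 = q * N) :
    Run ps writeAny s (N * 5 + 2) (fun s' => ∀ q', ∀ v < N,
      (q' = q ∧ s.arr aXS (s.var vXO + v) ≠ 0 → s'.tab aNxt N q' v = s.arr aCh v ∧
        s'.tab aUpd N q' v = q) ∧
      (¬ (q' = q ∧ s.arr aXS (s.var vXO + v) ≠ 0) →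
        s'.tab aUpd N q' v = s.tab aUpd N q' v ∧ s'.tab aNxt N q' v = s.tab aNxt N q' v)) := by
  refine Run.forTo [] [aUpd, aNxt] N 3 (fun j s' => ∀ q', ∀ v < N,
      (v < j ∧ q' = q ∧ s.arr aXS (s.var vXO + v) ≠ 0 → s'.tab aNxt N q' v = s.arr aCh v ∧
        s'.tab aUpd N q' v = q) ∧
      (¬ (v < j ∧ q' = q ∧ s.arr aXS (s.var vXO + v) ≠ 0) →
        s'.tab aUpd N q' v = s.tab aUpd N q' v ∧ s'.tab aNxt N q' v = s.tab aNxt N q' v))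
      rfl rfl ?_ ?_ ?_ ?_
  · intro s' hf; simp [hf.var, hN]
  · simp [Store.tab]
  · rintro j hj s' hf hvj h
    refine Run.straight 3 rfl (by decide) ?_
    intro q' v hv
    simp only [Cmd.den, Expr.eval_get, Expr.eval_var, Expr.eval_add, hvj, hf.arr aXS (by simp),
      hf.var vXO (by simp), hf.var 24 (by simp), hf.var 23 (by simp), h23, h24,
      Store.setArr_var, hf.arr aCh (by simp)]
    have hI := h q' v hv
    simp only [Store.tab] at hI
    by_cases hx : s.arr aXS (s.var vXO + j) = 0
    · simp only [hx, if_true, Store.setVar_arr, Store.tab]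
      refine ⟨fun h => hI.1 ⟨?_, h.2⟩, fun h' => hI.2 fun h => h' ⟨by omega, h.2⟩⟩
      rcases Nat.lt_succ_iff_lt_or_eq.1 h.1 with h | rfl
      · exact h
      · exact absurd hx h.2.2
    · simp only [hx, if_false, Store.setVar_arr, Store.tab, Store.setArr_arr, Nat.reduceEqDiff,
        if_true, Function.update_apply, index_inj hv hj]
      by_cases heq : q' = q ∧ v = j
      · simp [heq.1, heq.2, hx]
      · simp only [heq, if_false]
        refine ⟨fun h => hI.1 ⟨?_, h.2⟩, fun h' => hI.2 fun h => h' ⟨by omega, h.2⟩⟩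
        rcases Nat.lt_succ_iff_lt_or_eq.1 h.1 with h' | h'
        · exact h'
        · exact absurd ⟨h.2.1, h'⟩ heq
  · exact fun s' _ _ h q' v hv => ⟨fun h' => (h q' v hv).1 ⟨hv, h'⟩,
      fun h' => (h q' v hv).2 fun h'' => h' h''.2⟩

end

/-! ### Objectives given by colors, input of the solver, start of a color -/

section

open Classical in
/-- The colors smaller than `K` that are seen infinitely often. -/
noncomputable def infColors {V : Type*} (K : ℕ) (col : ℕ → V → Prop) (π : ℕ → V) : Finset ℕ :=
  (Finset.range K).filter fun c => ∀ n, ∃ j, n ≤ j ∧ col c (π j)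

/-- The Emerson-Lei objective given by a set of sets of colors. -/
def colorObj {V : Type*} (K : ℕ) (col : ℕ → V → Prop) (F : Finset ℕ → Bool) (π : ℕ → V) : Prop :=
  F (infColors K col π) = true

theorem colorObj_prefixIndep {V : Type*} (K : ℕ) (col : ℕ → V → Prop) (F : Finset ℕ → Bool) :
    Board.PrefixIndep (colorObj K col F) := by
  intro π
  have : infColors K col (fun i => π (i + 1)) = infColors K col π := by
    ext c
    simp only [infColors, Finset.mem_filter, and_congr_right_iff]
    refine fun _ => ⟨fun h n => ?_, fun h n => ?_⟩
    · obtain ⟨j, hj, h⟩ := h n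
      exact ⟨j + 1, by omega, h⟩
    · obtain ⟨j, hj, h⟩ := h (n + 1)
      exact ⟨j - 1, by omega, by rwa [Nat.sub_add_cancel (by omega)]⟩
  rw [colorObj, colorObj, this]

/-- The memory contains the game graph, the colors of the nodes, the truth table of the objective,
and some numbers. -/
structure GameIn (D : Board ℕ) (N K : ℕ) (col : ℕ → ℕ → Prop) (F : Finset ℕ → Bool) (s : Store) :
    Prop extends GraphIn D N s where
  colors : K ≤ N
  row' : ∀ q < K.factorial, s.arr aRow q = q * N
  col : ∀ c < K, ∀ v < N, s.arr aCol (c * N + v) ≠ 0 ↔ col c v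
  fact : ∀ m ≤ K, s.arr aFact m = m.factorial
  pow : ∀ c < K, s.arr aPow c = 2 ^ c
  wint : ∀ S ⊆ Finset.range K, s.arr aWint (∑ c ∈ S, 2 ^ c) = (F S).toNat

theorem GameIn.frame {D : Board ℕ} {N K : ℕ} {col : ℕ → ℕ → Prop} {F : Finset ℕ → Bool}
    {s s' : Store} {vs as : List ℕ} (h : GameIn D N K col F s)
    (hf : Frame vs as s s') (hv : decide (vN ∉ vs) = true)
    (ha : decide (aOwn ∉ as ∧ aEdg ∉ as ∧ aRow ∉ as ∧ aCol ∉ as ∧ aFact ∉ as ∧ aPow ∉ as ∧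
      aWint ∉ as) = true) : GameIn D N K col F s' := by
  obtain ⟨h1, h2, h3, h4, h5, h6, h7⟩ := of_decide_eq_true ha
  refine ⟨h.toGraphIn.frame hf hv (by simp [h1, h2, h3]), h.colors, ?_, ?_, ?_, ?_, ?_⟩
  · rw [hf.arr _ h3]; exact h.row'
  · rw [hf.arr _ h4]; exact h.col
  · rw [hf.arr _ h5]; exact h.fact
  · rw [hf.arr _ h6]; exact h.pow
  · rw [hf.arr _ h7]; exact h.wint

/-- The first `m` entries of `cl` are the elements of `C`. -/
structure ColorList (cl : ℕ → ℕ) (m K : ℕ) (C : Finset ℕ) : Prop where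
  mem : ∀ i < m, cl i ∈ C
  inj : ∀ i < m, ∀ j < m, cl i = cl j → i = j
  card : C.card = m
  sub : C ⊆ Finset.range K

theorem ColorList.surj {cl : ℕ → ℕ} {m K : ℕ} {C : Finset ℕ} (h : ColorList cl m K C) {c : ℕ}
    (hc : c ∈ C) : ∃ i < m, cl i = c := by
  have := Finset.surj_on_of_inj_on_of_card_le (s := Finset.range m) (t := C) (fun i _ => cl i)
    (fun i hi => h.mem i (by simpa using hi))
    (fun i j hi hj he => h.inj i (by simpa using hi) j (by simpa using hj) he)
    (by simp [h.card]) c hc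
  obtain ⟨i, hi, rfl⟩ := this
  exact ⟨i, by simpa using hi, rfl⟩

theorem ColorList.le {cl : ℕ → ℕ} {m K : ℕ} {C : Finset ℕ} (h : ColorList cl m K C) : m ≤ K := by
  simpa [h.card] using Finset.card_le_card h.sub

/-- Exchange two entries. -/
def swapFun (cl : ℕ → ℕ) (i j : ℕ) : ℕ → ℕ := Function.update (Function.update cl i (cl j)) j (cl i)

/-- Repeating the swap after the recursive call restores the list of colors. -/
theorem swapFun_swapFun (cl : ℕ → ℕ) (i j : ℕ) : swapFun (swapFun cl i j) i j = cl := by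
  ext k
  simp only [swapFun, Function.update_apply]
  split_ifs <;> simp_all

/-- The treated color trades places with the last one, so the remaining colors again fill an initial
segment, and no list needs to be copied for the recursive call. -/
theorem ColorList.erase {cl : ℕ → ℕ} {m K : ℕ} {C : Finset ℕ} (h : ColorList cl (m + 1) K C)
    {j : ℕ} (hj : j < m + 1) : ColorList (swapFun cl j m) m K (C.erase (cl j)) := by
  have hi : ∀ i < m, swapFun cl j m i = cl (if i = j then m else i) := by
    intro i hi
    simp only [swapFun, Function.update_apply, hi.ne, if_false]
    split_ifs <;> rfl
  refine ⟨fun i him => ?_, fun i him i' him' he => ?_, ?_, (Finset.erase_subset _ _).trans h.sub⟩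
  · rw [hi i him, Finset.mem_erase]
    refine ⟨fun he => ?_, h.mem _ (by split_ifs <;> omega)⟩
    have := h.inj _ (by split_ifs <;> omega) _ hj he
    split_ifs at this <;> omega
  · rw [hi i him, hi i' him'] at he
    have := h.inj _ (by split_ifs <;> omega) _ (by split_ifs <;> omega) he
    split_ifs at this <;> omega
  · rw [Finset.card_erase_of_mem (h.mem j hj), h.card, Nat.add_sub_cancel]

/-- The interval of memory values `lo, …, lo + f - 1`. -/
def block (lo f : ℕ) : Set ℕ := {q | lo ≤ q ∧ q < lo + f}

/-- The winner of a node, according to the memory. -/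
def Store.winner (s : Store) (v : ℕ) : Bool := decide (s.arr aWin v = 1)

theorem Store.winner_eq {s : Store} {v : ℕ} {b : Bool} (h : s.arr aWin v = b.toNat) :
    s.winner v = b := by
  cases b <;> simp [Store.winner, h]

variable {ps : List Cmd} {D : Board ℕ} {N K : ℕ} {col : ℕ → ℕ → Prop} {F : Finset ℕ → Bool}
  {s : Store}

/-- All nodes of `Z` are provisionally given to `P`; the recursive call corrects this outside the
attractor `A`, and inside it the entry remains. At the target the memory jumps to `x`, which is the
first value of the next block, or the first value `qb` of the level after the last color: this
closes the cycle. -/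
theorem run_stepOpen {m j c lo qb x : ℕ} {P : Bool} {Z : Set ℕ}
    (hg : GameIn D N K col F s) (hm : m < K) (hLV : s.var vLV = m + 1) (hj : j ≤ m)
    (hJ : s.arr aJJ (m + 1) = j) (hc : s.arr aCL j = c) (hcK : c < K)
    (hP : s.arr aWint (s.var vMask) = P.toNat) (hZ : Z = s.nodes ((m + 1) * N) N)
    (htot : ∀ v ∈ Z, ∃ w ∈ Z, D.edge v w) (hQJ : s.arr aQJ (m + 1) = lo)
    (hQB : s.arr aQB (m + 1) = qb) (hlo : lo + m.factorial ≤ K.factorial)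
    (hx : x = if j < m then lo + m.factorial else qb) :
    Run ps stepOpen s (N * (N * 20 + 23) + 9 * N + 25 + m.factorial * (N * 6 + 6)) (fun s' =>
      Frame [13, 14, 15, 16, 17, 18, 19, 20, 21, 22, 23, 24, 25, 27, 28, 30, 31]
        [30, 32, 33, 34, 35, 36, 37, 38] s s' ∧ s'.var 27 = c ∧ s'.var 21 = lo ∧
      (∀ i, (m + 1) * N ≤ i → s'.arr aXS i = s.arr aXS i) ∧
      (∀ v ∈ Z, s'.arr aWin v = P.toNat) ∧ (∀ v, v ∉ Z → s'.arr aWin v = s.arr aWin v) ∧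
      ∃ A ch, D.IsAttr P Z {v | v ∈ Z ∧ col c v} A ch ∧ s'.nodes (m * N) N = Z \ A ∧
        ∀ q, ∀ v < N,
          (q ∈ block lo m.factorial → v ∈ A → s'.tab aNxt N q v = ch v ∧
            (col c v → s'.tab aUpd N q v = x) ∧ (¬ col c v → s'.tab aUpd N q v = q)) ∧
          (¬ (q ∈ block lo m.factorial ∧ v ∈ A) →
            s'.tab aUpd N q v = s.tab aUpd N q v ∧ s'.tab aNxt N q v = s.tab aNxt N q v)) := by
  have hKN := hg.colors
  have hT : N * (N * 20 + 23) + 9 * N + 25 + m.factorial * (N * 6 + 6) =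
      4 + ((N * 3 + 2) + ((N * (N * 20 + 23) + 4) + (11 + ((N * 6 + 2) +
        (m.factorial * (N * 6 + 6) + 2))))) := by ring
  rw [hT]
  refine Run.frame _ _ ?_ rfl
  refine Run.seq_imp ((Run.straight (Q := fun s' => s'.var 27 = c ∧ s'.var 28 = c * N ∧
    s'.var vPL = P.toNat ∧ s'.var vXO = (m + 1) * N) 4 rfl (by decide)
    ⟨by simp [Cmd.den, hLV, hJ, hc], by simp [Cmd.den, hLV, hJ, hc, hg.row c (by omega)],
      by simp [Cmd.den, hP], by simp [Cmd.den, hLV, hg.row (m + 1) (by omega)]⟩).frame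
      [13, 14, 27, 28] [] rfl) ?_
  rintro s₁ ⟨f₁, h27, h28, h13, h14⟩
  have g₁ := hg.frame f₁ rfl rfl
  refine Run.seq_imp ((run_colorTarget g₁.size).frame [15] [38] rfl) ?_
  rintro s₂ ⟨f₂, ht⟩
  have g₂ := g₁.frame f₂ rfl rfl
  have f₂' := (f₁.weaken (vs' := [13, 14, 15, 27, 28]) (as' := [38]) rfl rfl).trans
    (f₂.weaken rfl rfl)
  have eX₂ : s₂.arr aXS = s.arr aXS := by simp [f₂'.arr]
  have hZ₂ : Z = s₂.nodes (s₂.var vXO) N := by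
    rw [hZ]; simp [Store.nodes, eX₂, f₂.var, h14]
  have hT₂ : {v | v ∈ Z ∧ col c v} = {v | v ∈ Z ∧ s₂.arr aTgt v ≠ 0} := by
    ext v
    simp only [Set.mem_ofPred_eq, and_congr_right_iff]
    intro hv
    have hvN : v < N := by rw [hZ] at hv; exact hv.1
    rw [ht v hvN, h28, g₁.col c hcK v hvN]
  refine Run.seq_imp (run_attrCmd g₂.toGraphIn (b := P) (by simp [f₂.var, h13]) hZ₂ htot hT₂) ?_
  rintro s₃ ⟨f₃, hA⟩
  have g₃ := g₂.frame f₃ rfl rfl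
  have f₃' := (f₂'.weaken (vs' := [13, 14, 15, 16, 17, 18, 19, 20, 27, 28])
    (as' := [35, 36, 37, 38]) rfl rfl).trans (f₃.weaken rfl rfl)
  set A := {v | v < N ∧ s₃.arr aAtt v ≠ 0} with hAdef
  refine Run.seq_imp ((Run.straight (Q := fun s' => s'.var 21 = lo ∧ s'.var 31 = m.factorial ∧
    s'.var 25 = lo ∧ s'.var 30 = m * N ∧ s'.var 22 = x) 11 rfl (by decide) ?_).frame
      [21, 22, 25, 30, 31] [] rfl) ?_
  · have e1 : s₃.var vLV = m + 1 := by simp [f₃'.var, hLV]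
    have e2 : s₃.arr aQJ (m + 1) = lo := by simp [f₃'.arr, hQJ]
    have e3 : s₃.arr aQB (m + 1) = qb := by simp [f₃'.arr, hQB]
    have e4 : s₃.arr aJJ (m + 1) = j := by simp [f₃'.arr, hJ]
    by_cases hjm : j < m
    · have h0 : m - j ≠ 0 := by omega
      simp [Cmd.den, e1, e2, e4, g₃.fact m hm.le, g₃.row m (by omega), hx, hjm, h0]
    · have h0 : m - j = 0 := by omega
      simp [Cmd.den, e1, e2, e3, e4, g₃.fact m hm.le, g₃.row m (by omega), hx, hjm, h0]
  rintro s₄ ⟨f₄, h21, h31, h25, h30, h22⟩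
  have g₄ := g₃.frame f₄ rfl rfl
  have f₄' := (f₃'.weaken
    (vs' := [13, 14, 15, 16, 17, 18, 19, 20, 21, 22, 25, 27, 28, 30, 31])
    (as' := [35, 36, 37, 38]) rfl rfl).trans (f₄.weaken rfl rfl)
  have eX₄ : s₄.arr aXS = s.arr aXS := by simp [f₄'.arr]
  have eW₄ : s₄.arr aWin = s.arr aWin := by simp [f₄'.arr]
  have e14 : s₄.var vXO = (m + 1) * N := by simp [f₄.var, f₃.var, f₂.var, h14]
  have e13 : s₄.var vPL = P.toNat := by simp [f₄.var, f₃.var, f₂.var, h13]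
  have eA₄ : s₄.arr aAtt = s₃.arr aAtt := by simp [f₄.arr]
  refine Run.seq_imp ((run_childSet g₄.size (by rw [h30, e14, Nat.succ_mul])).frame
    [15] [30, 34] rfl) ?_
  rintro s₅ ⟨f₅, h1, h2, h3, h4⟩
  have g₅ := g₄.frame f₅ rfl rfl
  rw [h30] at h1 h2
  rw [e14] at h1 h3 h4
  rw [e13] at h3
  have hZm : ∀ v, v ∈ Z ↔ v < N ∧ s.arr aXS ((m + 1) * N + v) ≠ 0 := by rw [hZ]; exact fun v => Iff.rfl
  refine ((run_writeBlock g₅.size (base := lo) (cnt := m.factorial) (x := x) (by simp [f₅.var, h25])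
    (by simp [f₅.var, h31]) (fun q _ hq => g₅.row' q (by omega)) (by simp [f₅.var, h22])).frame
    [15, 16, 23, 24] [32, 33] rfl).imp ?_
  rintro s₆ ⟨f₆, h⟩
  have eX₆ : s₆.arr aXS = s₅.arr aXS := by simp [f₆.arr]
  have eW₆ : s₆.arr aWin = s₅.arr aWin := by simp [f₆.arr]
  refine ⟨by simp [f₆.var, f₅.var, f₄.var, f₃.var, f₂.var, h27], by simp [f₆.var, f₅.var, h21],
    fun i hi => ?_, fun v hv => ?_, fun v hv => ?_, A, s₃.arr aCh, hA, ?_, fun q v hv => ?_⟩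
  · rw [eX₆, h2 i (by rw [← Nat.succ_mul]; exact hi), eX₄]
  · rw [hZm] at hv
    rw [eW₆, h3 v hv.1 (by rw [eX₄]; exact hv.2)]
  · rw [hZm] at hv
    rw [eW₆, h4 v (by rw [eX₄]; exact hv), eW₄]
  · ext v
    simp only [Store.nodes, eX₆, Set.mem_ofPred_eq, Set.mem_sdiff, hZm, hAdef, not_and, not_not]
    refine ⟨fun hv => ?_, fun hv => ⟨hv.1.1, ?_⟩⟩
    · have := (h1 v hv.1).1 hv.2
      rw [eX₄, eA₄] at this
      exact ⟨⟨hv.1, this.1⟩, fun _ => this.2⟩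
    · rw [h1 v hv.1.1, eX₄, eA₄]
      exact ⟨hv.1.2, hv.2 hv.1.1⟩
  · have eA₅ : s₅.arr aAtt = s₃.arr aAtt := by simp [f₅.arr, eA₄]
    have eH₅ : s₅.arr aCh = s₃.arr aCh := by simp [f₅.arr, f₄.arr]
    have eT₅ : s₅.arr aTgt = s₂.arr aTgt := by simp [f₅.arr, f₄.arr, f₃.arr]
    have eU : s₅.arr aUpd = s.arr aUpd := by simp [f₅.arr, f₄'.arr]
    have eN : s₅.arr aNxt = s.arr aNxt := by simp [f₅.arr, f₄'.arr]
    obtain ⟨h5, h6⟩ := h q v hv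
    rw [eA₅, eH₅, eT₅] at h5
    rw [eA₅] at h6
    refine ⟨fun hq hvA => ?_, fun hn => ?_⟩
    · obtain ⟨h7, h8⟩ := h5 ⟨hq.1, hq.2, hvA.2⟩
      refine ⟨h7, fun hcv => ?_, fun hcv => ?_⟩
      · rw [h8, if_neg]
        rw [ht v hv, h28]
        exact (g₁.col c hcK v hv).2 hcv
      · rw [h8, if_pos]
        rw [ht v hv, h28]
        by_contra h'
        exact hcv ((g₁.col c hcK v hv).1 h')
    · obtain ⟨h7, h8⟩ := h6 (fun h' => hn ⟨⟨h'.1, h'.2.1⟩, hv, h'.2.2⟩)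
      rw [h7, h8, Store.tab, Store.tab, Store.tab, Store.tab, eU, eN]
      exact ⟨rfl, rfl⟩

end

/-! ### Recursive calls, removal of won nodes, end of the solver -/

section

/-- Variables that the solver may change. -/
abbrev solveVars : List ℕ :=
  [11, 12, 13, 14, 15, 16, 17, 18, 19, 20, 21, 22, 23, 24, 25, 26, 27, 28, 29, 30, 31]

/-- Arrays that the solver may change. -/
abbrev solveArrs : List ℕ := [30, 31, 32, 33, 34, 35, 36, 37, 38, 39, 40, 41]

/-- A call of the solver with `m` colors on the set `X` of nodes and the set `B` of memory values
has no effects except those that are intended. -/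
structure Effect (N m : ℕ) (X B : Set ℕ) (s s' : Store) : Prop where
  frame : Frame solveVars solveArrs s s'
  lv : s'.var vLV = s.var vLV
  mask : s'.var vMask = s.var vMask
  list : s'.arr aCL = s.arr aCL
  sets : ∀ i, (m + 1) * N ≤ i → s'.arr aXS i = s.arr aXS i
  jj : ∀ i, m < i → s'.arr aJJ i = s.arr aJJ i
  qj : ∀ i, m < i → s'.arr aQJ i = s.arr aQJ i
  qb : ∀ i, m < i → s'.arr aQB i = s.arr aQB i
  win : ∀ v, v ∉ X → s'.arr aWin v = s.arr aWin v
  tab : ∀ q, ∀ v < N, ¬ (q ∈ B ∧ v ∈ X) →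
    s'.tab aUpd N q v = s.tab aUpd N q v ∧ s'.tab aNxt N q v = s.tab aNxt N q v

theorem Effect.trans {N m : ℕ} {X B : Set ℕ} {s s' s'' : Store} (h : Effect N m X B s s')
    (h' : Effect N m X B s' s'') : Effect N m X B s s'' :=
  ⟨h.frame.trans h'.frame, h'.lv.trans h.lv, h'.mask.trans h.mask, h'.list.trans h.list,
    fun i hi => (h'.sets i hi).trans (h.sets i hi), fun i hi => (h'.jj i hi).trans (h.jj i hi),
    fun i hi => (h'.qj i hi).trans (h.qj i hi), fun i hi => (h'.qb i hi).trans (h.qb i hi),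
    fun v hv => (h'.win v hv).trans (h.win v hv),
    fun q v hv hn => ⟨(h'.tab q v hv hn).1.trans (h.tab q v hv hn).1,
      (h'.tab q v hv hn).2.trans (h.tab q v hv hn).2⟩⟩

theorem Effect.mono {N m m' : ℕ} {X B X' B' : Set ℕ} {s s' : Store} (h : Effect N m X B s s')
    (hm : m ≤ m') (hX : X ⊆ X') (hB : B ⊆ B') : Effect N m' X' B' s s' :=
  ⟨h.frame, h.lv, h.mask, h.list,
    fun i hi => h.sets i ((Nat.mul_le_mul_right N (by omega)).trans hi),
    fun i hi => h.jj i (by omega), fun i hi => h.qj i (by omega), fun i hi => h.qb i (by omega),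
    fun v hv => h.win v fun h => hv (hX h),
    fun q v hv hn => h.tab q v hv fun h => hn ⟨hB h.1, hX h.2⟩⟩

/-- The preconditions of a call of the solver. -/
structure Call (D : Board ℕ) (N K : ℕ) (col : ℕ → ℕ → Prop) (F : Finset ℕ → Bool) (m : ℕ)
    (C : Finset ℕ) (X : Set ℕ) (qb : ℕ) (s : Store) : Prop where
  game : GameIn D N K col F s
  lv : s.var vLV = m
  list : ColorList (s.arr aCL) m K C
  mask : s.var vMask = ∑ c ∈ C, 2 ^ c
  nodes : X = s.nodes (m * N) N
  total : ∀ v ∈ X, ∃ w ∈ X, D.edge v w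
  only : ∀ v ∈ X, ∀ c < K, col c v → c ∈ C
  base : s.arr aQB m = qb
  range : qb + m.factorial ≤ K.factorial

/-- The memory contains a solution of the subgame on `X`. -/
structure Solved (D : Board ℕ) (N K : ℕ) (col : ℕ → ℕ → Prop) (F : Finset ℕ → Bool)
    (X B : Set ℕ) (s : Store) : Prop where
  bool : ∀ v ∈ X, s.arr aWin v = (s.winner v).toNat
  sol : D.Sol (colorObj K col F) X B s.winner (s.tab aUpd N) (s.tab aNxt N)

variable {ps : List Cmd} {D : Board ℕ} {N K : ℕ} {col : ℕ → ℕ → Prop} {F : Finset ℕ → Bool}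
  {s : Store}

/-- Procedures have no local variables. Instead, the level selects the row of the node set and the
entries of `aJJ`, `aQJ`, `aQB`, so the data of level `m + 1` survive the call. The color list and
the mask are shared by all levels, and are restored afterwards with the help of the entry of `aJJ`.
-/
theorem run_recurse {m j c lo Tc : ℕ} {C : Finset ℕ} {Y : Set ℕ}
    (hcall : ∀ s C X qb, Call D N K col F m C X qb s → Run ps (.call 0) s Tc (fun s' =>
      Effect N m X (block qb m.factorial) s s' ∧ Solved D N K col F X (block qb m.factorial) s'))
    (hg : GameIn D N K col F s) (hLV : s.var vLV = m + 1) (hj : j ≤ m)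
    (hJ : s.arr aJJ (m + 1) = j) (hl : ColorList (s.arr aCL) (m + 1) K C)
    (hmask : s.var vMask = ∑ c ∈ C, 2 ^ c) (hc : s.arr aCL j = c) (h27 : s.var 27 = c)
    (h21 : s.var 21 = lo) (hlo : lo + m.factorial ≤ K.factorial) (hY : Y = s.nodes (m * N) N)
    (htot : ∀ v ∈ Y, ∃ w ∈ Y, D.edge v w) (honly : ∀ v ∈ Y, ∀ c' < K, col c' v → c' ∈ C.erase c) :
    Run ps recurse s (Tc + 13) (fun s' => Effect N m Y (block lo m.factorial) s s' ∧
      Solved D N K col F Y (block lo m.factorial) s') := by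
  have hcC : c ∈ C := hc ▸ hl.mem j (by omega)
  have hcK : c < K := by simpa using hl.sub hcC
  have hsum := Finset.sum_erase_add C (fun c => 2 ^ c) hcC
  rw [show Tc + 13 = 7 + (Tc + 6) by ring]
  refine Run.seq_imp ((Run.straight (Q := fun s' => s'.var vLV = m ∧
    s'.var vMask = ∑ c ∈ C.erase c, 2 ^ c ∧ s'.arr aCL = swapFun (s.arr aCL) j m ∧
    s'.arr aQB = Function.update (s.arr aQB) m lo) 7 rfl (by decide) ?_).frame
      [11, 12, 24, 25] [31, 40] rfl) ?_
  · simp [Cmd.den, swapColors, hLV, hJ, swapFun, h21, h27, hg.pow c hcK, hmask]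
    omega
  rintro s₁ ⟨f₁, hLV₁, hmask₁, hCL₁, hQB₁⟩
  refine Run.seq_imp (hcall s₁ (C.erase c) Y lo ⟨hg.frame f₁ rfl rfl, hLV₁, ?_, hmask₁, ?_, htot,
    honly, by simp [hQB₁], hlo⟩) ?_
  · rw [hCL₁, ← hc]; exact hl.erase (by omega)
  · rw [hY]; simp [Store.nodes, f₁.arr]
  rintro s₂ ⟨e₂, hs₂⟩
  have eJ : s₂.arr aJJ (m + 1) = j := by rw [e₂.jj _ (by omega), f₁.arr _ (by simp), hJ]
  have eL : s₂.var vLV = m := by rw [e₂.lv, hLV₁]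
  have eM : s₂.var vMask = ∑ c ∈ C.erase c, 2 ^ c := by rw [e₂.mask, hmask₁]
  have eC : s₂.arr aCL = swapFun (s.arr aCL) j m := by rw [e₂.list, hCL₁]
  have eP : s₂.arr aPow c = 2 ^ c := by
    rw [e₂.frame.arr _ (by simp), f₁.arr _ (by simp), hg.pow c hcK]
  refine ((Run.straight (Q := fun s' => s'.var vLV = m + 1 ∧
    s'.var vMask = ∑ c ∈ C, 2 ^ c ∧ s'.arr aCL = s.arr aCL) 6 rfl (by decide) ?_).frame
      [11, 12, 24, 25] [31] rfl).imp ?_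
  · have h1 : Function.update (Function.update (s₂.arr aCL) j (s₂.arr aCL m)) m (s₂.arr aCL j) =
        s.arr aCL := by rw [eC]; exact swapFun_swapFun _ _ _
    simp [Cmd.den, swapColors, eL, eJ, eM, h1, hc, eP, hsum]
  rintro s₃ ⟨f₃, hLV₃, hmask₃, hCL₃⟩
  have t3 : ∀ a, a ∉ [31] → s₃.arr a = s₂.arr a := f₃.arr
  refine ⟨⟨?_, by rw [hLV₃, hLV], by rw [hmask₃, hmask], hCL₃, fun i hi => ?_, fun i hi => ?_,
    fun i hi => ?_, fun i hi => ?_, fun v hv => ?_, fun q v hv hn => ?_⟩, ?_⟩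
  · exact ((f₁.weaken rfl rfl).trans e₂.frame).trans (f₃.weaken rfl rfl)
  · rw [t3 _ (by simp), e₂.sets i hi, f₁.arr _ (by simp)]
  · rw [t3 _ (by simp), e₂.jj i hi, f₁.arr _ (by simp)]
  · rw [t3 _ (by simp), e₂.qj i hi, f₁.arr _ (by simp)]
  · rw [t3 _ (by simp), e₂.qb i hi, hQB₁, Function.update_of_ne (by omega)]
  · rw [t3 _ (by simp), e₂.win v hv, f₁.arr _ (by simp)]
  · have := e₂.tab q v hv hn
    simpa [Store.tab, t3, f₁.arr] using this
  · have e34 : s₃.arr aWin = s₂.arr aWin := t3 _ (by simp)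
    have hw : s₃.winner = s₂.winner := by ext v; simp [Store.winner, e34]
    have hU : s₃.tab aUpd N = s₂.tab aUpd N := by ext; simp [Store.tab, t3]
    have hN : s₃.tab aNxt N = s₂.tab aNxt N := by ext; simp [Store.tab, t3]
    refine ⟨?_, ?_⟩
    · rw [hw, e34]; exact hs₂.bool
    · rw [hw, hU, hN]; exact hs₂.sol

/-- The strategy has to work from each of the `(m + 1)!` memory values of the level, but on `T` the
recursive call has filled only the rows of the small block that starts with `lo`. All other values
act on `T` like `lo`; one step later the memory lies in the small block. On the rest of the
attractor the memory does not change. -/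
theorem run_stepRemove {m lo qb : ℕ} {P : Bool} {Z T : Set ℕ}
    (hg : GameIn D N K col F s) (hm : m < K) (hLV : s.var vLV = m + 1)
    (hP : s.var vPL = P.toNat) (hXO : s.var vXO = (m + 1) * N) (hZ : Z = s.nodes ((m + 1) * N) N)
    (htot : ∀ v ∈ Z, ∃ w ∈ Z, D.edge v w) (hT : T = {v | v ∈ Z ∧ s.arr aTgt v ≠ 0})
    (hTN : ∀ v < N, s.arr aTgt v ≠ 0 → v ∈ Z)
    (hQJ : s.arr aQJ (m + 1) = lo) (hQB : s.arr aQB (m + 1) = qb)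
    (hqb : qb + (m + 1).factorial ≤ K.factorial) (hlo : lo < K.factorial) :
    Run ps stepRemove s (N * (N * 20 + 23) + 5 * N + 15 + (m + 1).factorial * (N * 7 + 6))
      (fun s' => Effect N (m + 1) Z (block qb (m + 1).factorial) s s' ∧
      s'.arr aJJ (m + 1) = 0 ∧ s'.arr aQJ (m + 1) = qb ∧ s'.arr aQB (m + 1) = qb ∧
      ∃ A ch, D.IsAttr P Z T A ch ∧ s'.nodes ((m + 1) * N) N = Z \ A ∧
        (∀ v ∈ A, s'.arr aWin v = P.toNat) ∧ (∀ v, v ∉ A → s'.arr aWin v = s.arr aWin v) ∧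
        (∀ v ∈ A, v ∉ T → ∀ q ∈ block qb (m + 1).factorial,
          s'.tab aNxt N q v = ch v ∧ s'.tab aUpd N q v = q) ∧
        (∀ v ∈ T, ∀ q ∈ block qb (m + 1).factorial, q ∉ block lo m.factorial →
          s'.tab aNxt N q v = s.tab aNxt N lo v ∧ s'.tab aUpd N q v = s.tab aUpd N lo v) ∧
        (∀ q, ∀ v < N, v ∉ A ∨ q ∉ block qb (m + 1).factorial ∨ v ∈ T ∧ q ∈ block lo m.factorial →
          s'.tab aUpd N q v = s.tab aUpd N q v ∧ s'.tab aNxt N q v = s.tab aNxt N q v)) := by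
  rw [show N * (N * 20 + 23) + 5 * N + 15 + (m + 1).factorial * (N * 7 + 6) =
    (N * (N * 20 + 23) + 4) + (5 + (((m + 1).factorial * (N * 7 + 6) + 2) + ((N * 5 + 2) + 2)))
    by ring]
  refine Run.seq_imp (run_attrCmd hg.toGraphIn hP (hXO ▸ hZ) htot hT) ?_
  rintro s₁ ⟨f₁, hA⟩
  have g₁ := hg.frame f₁ rfl rfl
  have hKN := hg.colors
  set A := {v | v < N ∧ s₁.arr aAtt v ≠ 0} with hAdef
  refine Run.seq_imp ((Run.straight (Q := fun s' => s'.var 21 = lo ∧ s'.var 22 = lo * N ∧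
    s'.var 29 = m.factorial ∧ s'.var 31 = (m + 1).factorial ∧ s'.var 25 = qb) 5 rfl (by decide)
    ?_).frame [21, 22, 25, 29, 31] [] rfl) ?_
  · have e1 : s₁.var vLV = m + 1 := by simp [f₁.var, hLV]
    have e2 : s₁.arr aQJ (m + 1) = lo := by simp [f₁.arr, hQJ]
    have e3 : s₁.arr aQB (m + 1) = qb := by simp [f₁.arr, hQB]
    have e4 : s₁.arr aRow lo = lo * N := g₁.row' _ hlo
    simp [Cmd.den, e1, e2, e3, e4, g₁.fact m (by omega), g₁.fact (m + 1) (by omega)]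
  rintro s₂ ⟨f₂, h21, h22, h29, h31, h25⟩
  have g₂ := g₁.frame f₂ rfl rfl
  refine Run.seq_imp ((run_writeWon g₂.size h25 h31 (fun q _ hq => g₂.row' q (by omega)) h21 h22
    h29 (Nat.factorial_pos m)).frame [15, 16, 23, 24] [32, 33] rfl) ?_
  rintro s₃ ⟨f₃, h3⟩
  have g₃ := g₂.frame f₃ rfl rfl
  refine Run.seq_imp ((run_removeWon g₃.size).frame [15] [30, 34] rfl) ?_
  rintro s₄ ⟨f₄, h4, h5, h6⟩
  have a2 : s₂.arr = s₁.arr := by ext a i; simp [f₂.arr]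
  have eA : s₃.arr aAtt = s₁.arr aAtt := by simp [f₃.arr, a2]
  have eT : s₁.arr aTgt = s.arr aTgt := by simp [f₁.arr]
  have e14 : s₃.var vXO = (m + 1) * N := by simp [f₃.var, f₂.var, f₁.var, hXO]
  have e13 : s₃.var vPL = P.toNat := by simp [f₃.var, f₂.var, f₁.var, hP]
  have eX : s₃.arr aXS = s.arr aXS := by simp [f₃.arr, a2, f₁.arr]
  have eW : s₃.arr aWin = s.arr aWin := by simp [f₃.arr, a2, f₁.arr]
  have eU : s₁.arr aUpd = s.arr aUpd := by simp [f₁.arr]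
  have eN : s₁.arr aNxt = s.arr aNxt := by simp [f₁.arr]
  rw [eA, e14, e13] at h4
  rw [eA, e14, eX] at h5
  rw [eA, eW] at h6
  simp only [a2, eT, Store.tab, eU, eN] at h3
  have e11 : s₄.var vLV = m + 1 := by simp [f₄.var, f₃.var, f₂.var, f₁.var, hLV]
  have eQB : s₄.arr aQB = s.arr aQB := by simp [f₄.arr, f₃.arr, a2, f₁.arr]
  have eQJ : s₄.arr aQJ = s.arr aQJ := by simp [f₄.arr, f₃.arr, a2, f₁.arr]
  have eJJ : s₄.arr aJJ = s.arr aJJ := by simp [f₄.arr, f₃.arr, a2, f₁.arr]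
  have f₄' : Frame [15, 16, 17, 18, 19, 20, 21, 22, 23, 24, 25, 29, 31]
      [30, 32, 33, 34, 35, 36, 37] s s₄ :=
    (((f₁.weaken rfl rfl).trans (f₂.weaken rfl rfl)).trans (f₃.weaken rfl rfl)).trans
      (f₄.weaken rfl rfl)
  refine ((Run.straight (Q := fun s' =>
    s'.arr aJJ = Function.update (s.arr aJJ) (m + 1) 0 ∧
    s'.arr aQJ = Function.update (s.arr aQJ) (m + 1) qb) 2 rfl (by decide) ?_).frame
      [] [39, 41] rfl).imp ?_
  · simp [Cmd.den, e11, eQB, eQJ, eJJ, hQB]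
  rintro s₅ ⟨f₅, hJ₅, hQJ₅⟩
  have f₅' : Frame [15, 16, 17, 18, 19, 20, 21, 22, 23, 24, 25, 29, 31]
      [30, 32, 33, 34, 35, 36, 37, 39, 41] s s₅ := (f₄'.weaken rfl rfl).trans (f₅.weaken rfl rfl)
  have eW₅ : s₅.arr aWin = s₄.arr aWin := by simp [f₅.arr]
  have eX₅ : s₅.arr aXS = s₄.arr aXS := by simp [f₅.arr]
  have eU₅ : s₅.arr aUpd = s₃.arr aUpd := by simp [f₅.arr, f₄.arr]
  have eN₅ : s₅.arr aNxt = s₃.arr aNxt := by simp [f₅.arr, f₄.arr]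
  have hAN : ∀ v, v ∈ A ↔ v < N ∧ s₁.arr aAtt v ≠ 0 := fun v => Iff.rfl
  have hTA : ∀ v ∈ T, v < N ∧ s.arr aTgt v ≠ 0 ∧ s₁.arr aAtt v ≠ 0 := fun v hv =>
    ⟨(hA.target hv).1, by rw [hT] at hv; exact hv.2, (hA.target hv).2⟩
  have tabs : ∀ q, ∀ v < N,
      v ∉ A ∨ q ∉ block qb (m + 1).factorial ∨ v ∈ T ∧ q ∈ block lo m.factorial →
      s₅.tab aUpd N q v = s.tab aUpd N q v ∧ s₅.tab aNxt N q v = s.tab aNxt N q v := by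
    intro q v hv hn
    simp only [Store.tab, eU₅, eN₅]
    refine (h3 q v hv).2.2 ?_
    rcases hn with hn | hn | hn
    · exact Or.inl fun h => hn ⟨hv, h.2.2⟩
    · exact Or.inl fun h => hn ⟨h.1, h.2.1⟩
    · exact Or.inr ⟨(hTA v hn.1).2.1, hn.2⟩
  refine ⟨⟨f₅'.weaken rfl rfl, by simp [f₅'.var], by simp [f₅'.var], by simp [f₅'.arr],
    fun i hi => ?_, fun i hi => ?_, fun i hi => ?_, fun i hi => by simp [f₅'.arr],
    fun v hv => ?_, fun q v hv hn => tabs q v hv ?_⟩, by simp [hJ₅], by simp [hQJ₅],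
    by simp [f₅'.arr, hQB], A, s₁.arr aCh, hA, ?_, fun v hv => ?_, fun v hv => ?_,
    fun v hv hvT q hq => ?_, fun v hv q hq hq' => ?_, tabs⟩
  · rw [eX₅, h5 i]
    rintro ⟨v, hv, rfl, -⟩
    rw [Nat.succ_mul] at hi
    omega
  · rw [hJ₅, Function.update_of_ne (by omega)]
  · rw [hQJ₅, Function.update_of_ne (by omega)]
  · rw [eW₅, h6 v fun h => hv (hA.sub h)]
  · by_contra h
    push Not at h
    exact hn ⟨h.2.1, hA.sub h.1⟩
  · ext v
    simp only [Store.nodes, eX₅, Set.mem_ofPred_eq, Set.mem_sdiff]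
    have hZv : v ∈ Z ↔ v < N ∧ s.arr aXS ((m + 1) * N + v) ≠ 0 := by rw [hZ]; exact Iff.rfl
    by_cases hvA : v ∈ A
    · simp [hvA, (h4 v hvA.1 hvA.2).1]
    · rw [h5 ((m + 1) * N + v), hZv]
      · simp [hvA]
      · rintro ⟨w, hw, he, hw'⟩
        obtain rfl : v = w := by omega
        exact hvA ⟨hw, hw'⟩
  · rw [eW₅, (h4 v hv.1 hv.2).2]
  · rw [eW₅, h6 v hv]
  · simp only [Store.tab, eU₅, eN₅]
    refine (h3 q v hv.1).1 ⟨hq.1, hq.2, hv.2, ?_⟩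
    by_contra h
    exact hvT (by rw [hT]; exact ⟨hTN v hv.1 h, h⟩)
  · simp only [Store.tab, eU₅, eN₅]
    exact (h3 q v (hTA v hv).1).2.1 ⟨hq.1, hq.2, (hTA v hv).2.2, (hTA v hv).2.1, hq'⟩

/-- For `m = 0` any legal moves inside `Z` will do. They are taken from the moves `ch` of an
attractor computation, whose target is irrelevant, since `Board.IsAttr.legal` covers all nodes. For
`m > 0` the tables have already been filled. -/
theorem run_solveFinish {m qb : ℕ} {P : Bool} {Z : Set ℕ}
    (hg : GameIn D N K col F s) (hm : m ≤ K) (hLV : s.var vLV = m)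
    (hP : s.arr aWint (s.var vMask) = P.toNat) (hZ : Z = s.nodes (m * N) N)
    (htot : ∀ v ∈ Z, ∃ w ∈ Z, D.edge v w) (hQB : s.arr aQB m = qb) (hqb : qb < K.factorial) :
    Run ps solveFinish s (N * (N * 20 + 23) + 9 * N + 13)
      (fun s' => Effect N m Z (block qb m.factorial) s s' ∧
        (∀ v ∈ Z, s'.arr aWin v = P.toNat) ∧
        (0 < m → s'.arr aUpd = s.arr aUpd ∧ s'.arr aNxt = s.arr aNxt) ∧
        (m = 0 → ∀ v ∈ Z, D.edge v (s'.tab aNxt N qb v) ∧ s'.tab aNxt N qb v ∈ Z ∧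
          s'.tab aUpd N qb v = qb)) := by
  have hKN := hg.colors
  rw [show N * (N * 20 + 23) + 9 * N + 13 =
    2 + ((N * 4 + 2) + ((N * (N * 20 + 23) + 4) + (2 + (N * 5 + 2)) + 1)) by ring]
  refine Run.seq_imp ((Run.straight (Q := fun s' => s'.var vPL = P.toNat ∧ s'.var vXO = m * N) 2 rfl
    (by decide) ?_).frame [13, 14] [] rfl) ?_
  · simp [Cmd.den, hP, hLV, hg.row m (by omega)]
  rintro s₁ ⟨f₁, h13, h14⟩
  have g₁ := hg.frame f₁ rfl rfl
  refine Run.seq_imp ((run_setWinner g₁.size).frame [15] [34] rfl) ?_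
  rintro s₂ ⟨f₂, h2⟩
  have g₂ := g₁.frame f₂ rfl rfl
  have f₂' := (f₁.weaken (vs' := [13, 14, 15]) (as' := [34]) rfl rfl).trans (f₂.weaken rfl rfl)
  have eX : s₁.arr aXS = s.arr aXS := by simp [f₁.arr]
  have eW : s₁.arr aWin = s.arr aWin := by simp [f₁.arr]
  have eX₂ : s₂.arr aXS = s.arr aXS := by simp [f₂'.arr]
  rw [h14, h13, eX, eW] at h2
  have hZv : ∀ v, v ∈ Z ↔ v < N ∧ s.arr aXS (m * N + v) ≠ 0 := by rw [hZ]; exact fun v => Iff.rfl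
  have e11 : s₂.var vLV = m := by simp [f₂'.var, hLV]
  have hwin : ∀ v ∈ Z, s₂.arr aWin v = P.toNat := fun v hv => by rw [h2, if_pos ((hZv v).1 hv)]
  have hwin' : ∀ v, v ∉ Z → s₂.arr aWin v = s.arr aWin v := fun v hv => by
    rw [h2, if_neg (fun h => hv ((hZv v).2 h))]
  refine Run.cond (fun h0 => ?_) (fun h0 => ?_)
  · simp only [Expr.eval_var, e11] at h0
    refine Run.straight _ rfl (by simp [Cmd.cost]; omega) ?_
    simp only [Cmd.den]
    refine ⟨⟨f₂'.weaken rfl rfl, by simp [f₂'.var], by simp [f₂'.var], by simp [f₂'.arr],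
      by simp [f₂'.arr], by simp [f₂'.arr], by simp [f₂'.arr], by simp [f₂'.arr], hwin',
      by simp [f₂'.arr, Store.tab]⟩, hwin, by simp [f₂'.arr], fun h => absurd h h0⟩
  · simp only [Expr.eval_var, e11] at h0
    subst h0
    have hZ₂ : Z = s₂.nodes (s₂.var vXO) N := by
      rw [hZ]; simp [Store.nodes, eX₂, f₂.var, h14]
    refine Run.seq_imp (run_attrCmd g₂.toGraphIn (b := P) (by simp [f₂.var, h13]) hZ₂ htot rfl) ?_
    rintro s₃ ⟨f₃, hA⟩
    have g₃ := g₂.frame f₃ rfl rfl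
    refine Run.seq_imp ((Run.straight (Q := fun s' => s'.var 23 = qb ∧ s'.var 24 = qb * N) 2 rfl
      (by decide) ?_).frame [23, 24] [] rfl) ?_
    · have e1 : s₃.var vLV = 0 := by simp [f₃.var, e11]
      have e2 : s₃.arr aQB 0 = qb := by simp [f₃.arr, f₂'.arr, hQB]
      simp [Cmd.den, e1, e2, g₃.row' qb hqb]
    rintro s₄ ⟨f₄, h23, h24⟩
    have g₄ := g₃.frame f₄ rfl rfl
    refine ((run_writeAny g₄.size h23 h24).frame [15] [32, 33] rfl).imp ?_
    rintro s₅ ⟨f₅, h5⟩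
    have f₅' : Frame [13, 14, 15, 16, 17, 18, 19, 20, 23, 24] [32, 33, 34, 35, 36, 37] s s₅ :=
      (((f₂'.weaken rfl rfl).trans (f₃.weaken rfl rfl)).trans (f₄.weaken rfl rfl)).trans
        (f₅.weaken rfl rfl)
    have e14 : s₄.var vXO = 0 * N := by simp [f₄.var, f₃.var, f₂.var, h14]
    have eX₄ : s₄.arr aXS = s.arr aXS := by simp [f₄.arr, f₃.arr, eX₂]
    have eH : s₄.arr aCh = s₃.arr aCh := by simp [f₄.arr]
    have eU : s₄.arr aUpd = s.arr aUpd := by simp [f₄.arr, f₃.arr, f₂'.arr]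
    have eN : s₄.arr aNxt = s.arr aNxt := by simp [f₄.arr, f₃.arr, f₂'.arr]
    have eW₅ : s₅.arr aWin = s₂.arr aWin := by simp [f₅.arr, f₄.arr, f₃.arr]
    rw [e14, eX₄, eH] at h5
    refine ⟨⟨f₅'.weaken rfl rfl, by simp [f₅'.var], by simp [f₅'.var], by simp [f₅'.arr],
      by simp [f₅'.arr], by simp [f₅'.arr], by simp [f₅'.arr], by simp [f₅'.arr], ?_, ?_⟩,
      ?_, fun h => absurd h (lt_irrefl 0), fun _ v hv => ?_⟩
    · rw [eW₅]; exact hwin'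
    · intro q v hv hn
      have := (h5 q v hv).2 (fun h => hn ⟨?_, ?_⟩)
      · simpa [Store.tab, eU, eN] using this
      · rw [h.1]; exact ⟨le_rfl, by simp⟩
      · rw [hZv]; exact ⟨hv, h.2⟩
    · rw [eW₅]; exact hwin
    · have hv' := (hZv v).1 hv
      obtain ⟨h6, h7⟩ := (h5 qb v hv'.1).1 ⟨rfl, hv'.2⟩
      rw [h6, h7]
      exact ⟨(hA.legal v hv).1, (hA.legal v hv).2, rfl⟩

end

/-! ### Correctness of the recursive solver -/

section

theorem Board.Sol.congr {V M : Type*} {D : Board V} {Φ : (ℕ → V) → Prop} {X : Set V} {B : Set M}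
    {win win' : V → Bool} {up up' : M → V → M} {nx nx' : M → V → V}
    (h : D.Sol Φ X B win up nx) (hw : ∀ v ∈ X, win' v = win v)
    (ht : ∀ v ∈ X, ∀ q ∈ B, up' q v = up q v ∧ nx' q v = nx q v) :
    D.Sol Φ X B win' up' nx' := by
  refine ⟨fun v hv q hq => ?_, fun v hv q hq => ?_, fun v hv q hq ho => ?_,
    fun v hv ho w hw' he => ?_, fun b π q hf hX hq hb => ?_⟩
  · rw [(ht v hv q hq).2]; exact h.legal v hv q hq
  · rw [(ht v hv q hq).1]; exact h.mem v hv q hq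
  · rw [(ht v hv q hq).2, hw _ (h.legal v hv q hq).2, hw v hv]
    exact h.stay v hv q hq (by rw [ho, hw v hv])
  · rw [hw v hv, hw w hw']
    exact h.trap v hv (by rwa [hw v hv] at ho) w hw' he
  · refine h.wins b π q ⟨hf.edge, fun i => ?_, fun i hi => ?_⟩ hX hq
      (fun i => by rw [← hw _ (hX i)]; exact hb i)
    · rw [hf.mem i, (ht _ (hX i) _ (hq i)).1]
    · rw [hf.move i hi, (ht _ (hX i) _ (hq i)).2]

/-- The strategy table for the memory values in `block lo f` belongs to a color that has been treated
successfully: `P` wins outside the attractor to `T`, and changes the memory to `x` at `T`. -/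
def BlockSol (D : Board ℕ) (Φ : (ℕ → ℕ) → Prop) (P : Bool) (Z T : Set ℕ) (lo f x : ℕ)
    (up nx : ℕ → ℕ → ℕ) : Prop :=
  ∃ A ch win, D.IsAttr P Z T A ch ∧ D.Sol Φ (Z \ A) (block lo f) win up nx ∧
    (∀ v ∈ Z, v ∉ A → win v = P) ∧
    ∀ v ∈ A, ∀ q ∈ block lo f, nx q v = ch v ∧ (v ∈ T → up q v = x) ∧ (v ∉ T → up q v = q)

theorem BlockSol.congr {D : Board ℕ} {Φ : (ℕ → ℕ) → Prop} {P : Bool} {Z T : Set ℕ} {lo f x : ℕ}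
    {up nx up' nx' : ℕ → ℕ → ℕ} (h : BlockSol D Φ P Z T lo f x up nx)
    (ht : ∀ v ∈ Z, ∀ q ∈ block lo f, up' q v = up q v ∧ nx' q v = nx q v) :
    BlockSol D Φ P Z T lo f x up' nx' := by
  obtain ⟨A, ch, win, h1, h2, h3, h4⟩ := h
  refine ⟨A, ch, win, h1, h2.congr (fun _ _ => rfl) (fun v hv q hq => ht v hv.1 q hq), h3,
    fun v hv q hq => ?_⟩
  rw [(ht v (h1.sub hv) q hq).1, (ht v (h1.sub hv) q hq).2]
  exact h4 v hv q hq

/-- The values of a level form consecutive blocks of length `f`, and the quotient by `f` is the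
block index required by `Board.Sol.cycle`. -/
theorem mem_block_iff {qb m f i q : ℕ} (hf : 0 < f) (hi : i < m) :
    q ∈ block qb (m * f) ∧ (q - qb) / f = i ↔ q ∈ block (qb + i * f) f := by
  have h1 : (i + 1) * f ≤ m * f := Nat.mul_le_mul_right f hi
  rw [Nat.add_mul, one_mul] at h1
  simp only [block, Set.mem_ofPred_eq]
  constructor
  · rintro ⟨⟨h2, h3⟩, h4⟩
    have h5 := Nat.div_add_mod (q - qb) f
    have h6 := Nat.mod_lt (q - qb) hf
    rw [h4, mul_comm] at h5
    omega
  · rintro ⟨h2, h3⟩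
    refine ⟨by omega, ?_⟩
    rw [Nat.div_eq_iff hf]
    omega

/-- The treatment of all colors succeeds. -/
theorem sol_of_blocks {D : Board ℕ} {Φ : (ℕ → ℕ) → Prop} {P : Bool} {Z : Set ℕ} {m f qb : ℕ}
    {T : ℕ → Set ℕ} {win : ℕ → Bool} {up nx : ℕ → ℕ → ℕ} (hΦ : Board.PrefixIndep Φ) (hf : 0 < f)
    (h : ∀ i < m + 1, BlockSol D Φ P Z (T i) (qb + i * f) f
      (if i < m then qb + (i + 1) * f else qb) up nx)
    (hwin : ∀ v ∈ Z, win v = P)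
    (hobj : ∀ π : ℕ → ℕ, (∀ i, π i ∈ Z) → (∀ i < m + 1, ∀ n, ∃ j, n ≤ j ∧ π j ∈ T i) →
      Board.Won Φ P π) :
    D.Sol Φ Z (block qb ((m + 1) * f)) win up nx := by
  choose! A ch win' h1 h2 h3 h4 using h
  have hblk : ∀ i < m + 1, {q | q ∈ block qb ((m + 1) * f) ∧ (q - qb) / f = i} =
      block (qb + i * f) f := fun i hi => by
    ext q; exact mem_block_iff hf hi
  refine Board.Sol.cycle (m := m + 1) (fun q => (q - qb) / f) hΦ ?_ h1 (win' := win') ?_ h3 hwin ?_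
    (fun π _ => hobj π)
  · intro q hq
    rw [Nat.div_lt_iff_lt_mul hf]
    have := hq.1
    have := hq.2
    omega
  · intro i hi
    rw [hblk i hi]
    exact h2 i hi
  · intro i hi v hv q hq hqi
    have hq' : q ∈ block (qb + i * f) f := (mem_block_iff hf hi).1 ⟨hq, hqi⟩
    obtain ⟨h5, h6, h7⟩ := h4 i hi v hv q hq'
    have hx : ∀ j < m + 1, qb + j * f ∈ block qb ((m + 1) * f) ∧ (qb + j * f - qb) / f = j :=
      fun j hj => (mem_block_iff hf hj).2 ⟨le_rfl, by omega⟩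
    by_cases hvT : v ∈ T i
    · refine ⟨h5, ?_, fun h => absurd hvT h, fun _ => ?_⟩ <;> rw [h6 hvT]
      · split_ifs with h
        · exact (hx (i + 1) (by omega)).1
        · simpa using (hx 0 (by omega)).1
      · split_ifs with h
        · rw [(hx (i + 1) (by omega)).2, Nat.mod_eq_of_lt (by omega)]
        -- After the last color, the cycle returns to block `0`.
        · rw [Nat.sub_self, Nat.zero_div, show i + 1 = m + 1 by omega, Nat.mod_self]
    · refine ⟨h5, ?_, fun _ => ?_, fun h => absurd h hvT⟩ <;> rw [h7 hvT]
      · exact hq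
      · exact hqi

/-- Invariant of the main loop of the solver: the nodes of `X` outside `Z` have been won by the
opponent of the player `P` that wins with all colors; the first `j` colors have been treated
successfully for the subgame on `Z`. -/
structure LoopInv (D : Board ℕ) (N K : ℕ) (col : ℕ → ℕ → Prop) (F : Finset ℕ → Bool) (m : ℕ)
    (P : Bool) (cl : ℕ → ℕ) (X : Set ℕ) (qb : ℕ) (s : Store) (Z : Set ℕ) (j : ℕ) (s' : Store) :
    Prop where
  eff : Effect N (m + 1) X (block qb (m + 1).factorial) s s'
  sub : Z ⊆ X
  nodes : Z = s'.nodes ((m + 1) * N) N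
  total : ∀ v ∈ Z, ∃ w ∈ Z, D.edge v w
  le : j ≤ m + 1
  jj : s'.arr aJJ (m + 1) = j
  qj : s'.arr aQJ (m + 1) = qb + j * m.factorial
  base : s'.arr aQB (m + 1) = qb
  blocks : ∀ i < j, BlockSol D (colorObj K col F) P Z {v | v ∈ Z ∧ col (cl i) v}
    (qb + i * m.factorial) m.factorial (if i < m then qb + (i + 1) * m.factorial else qb)
    (s'.tab aUpd N) (s'.tab aNxt N)
  ext : ∀ win up nx, (∀ v ∈ X, v ∉ Z → win v = s'.winner v ∧
      ∀ q ∈ block qb (m + 1).factorial, up q v = s'.tab aUpd N q v ∧ nx q v = s'.tab aNxt N q v) →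
    D.Sol (colorObj K col F) Z (block qb (m + 1).factorial) win up nx →
    D.Sol (colorObj K col F) X (block qb (m + 1).factorial) win up nx
  bool : ∀ v ∈ X, v ∉ Z → s'.arr aWin v = (s'.winner v).toNat

/-- Time for the treatment of a color, without the recursive call. -/
def stepTime (N m : ℕ) : ℕ :=
  (N * (N * 20 + 23) + 9 * N + 25 + m.factorial * (N * 6 + 6)) + 13 +
    (2 + (N * 7 + 3) + (N * (N * 20 + 23) + 5 * N + 15 + (m + 1).factorial * (N * 7 + 6)) + 1)

variable {ps : List Cmd} {D : Board ℕ} {N K : ℕ} {col : ℕ → ℕ → Prop} {F : Finset ℕ → Bool}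
  {s : Store}

-- One turn of the main loop. If the opponent wins something outside the attractor of `P` to the
-- current color, `Board.Sol.extend` reduces the claim for `Z` to a proper subset; the count of
-- colors restarts, because the blocks filled so far refer to the larger set. Otherwise the rows
-- just written make up the next successful block.
set_option maxHeartbeats 1600000 in
theorem run_step {m j qb Tc : ℕ} {C : Finset ℕ} {X Z : Set ℕ} {s' : Store}
    (hcall : ∀ s C X qb, Call D N K col F m C X qb s → Run ps (.call 0) s Tc (fun s' =>
      Effect N m X (block qb m.factorial) s s' ∧ Solved D N K col F X (block qb m.factorial) s'))
    (hc : Call D N K col F (m + 1) C X qb s)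
    (hI : LoopInv D N K col F m (F C) (s.arr aCL) X qb s Z j s') (hj : j < m + 1) :
    Run ps (stepOpen ;; recurse ;; stepClose) s' (stepTime N m + Tc) (fun s'' =>
      LoopInv D N K col F m (F C) (s.arr aCL) X qb s Z (j + 1) s'' ∨
      ∃ Z', (∃ u < N, u ∈ Z ∧ u ∉ Z') ∧ Z' ⊆ Z ∧
        LoopInv D N K col F m (F C) (s.arr aCL) X qb s Z' 0 s'') := by
  have hmK : m + 1 ≤ K := hc.list.le
  have g' : GameIn D N K col F s' := hc.game.frame hI.eff.frame rfl rfl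
  have eCL : s'.arr aCL = s.arr aCL := hI.eff.list
  have eLV : s'.var vLV = m + 1 := by rw [hI.eff.lv, hc.lv]
  have eM : s'.var vMask = ∑ c ∈ C, 2 ^ c := by rw [hI.eff.mask, hc.mask]
  have hcC : s.arr aCL j ∈ C := hc.list.mem j hj
  have hcK : s.arr aCL j < K := by simpa using hc.list.sub hcC
  have hfac : (m + 1).factorial = (m + 1) * m.factorial := Nat.factorial_succ m
  have hfpos := Nat.factorial_pos m
  have hjf : (j + 1) * m.factorial ≤ (m + 1) * m.factorial := Nat.mul_le_mul_right _ hj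
  rw [Nat.add_mul j 1, one_mul, ← hfac] at hjf
  have hrange := hc.range
  have hZN : ∀ v ∈ Z, v < N := fun v hv => by rw [hI.nodes] at hv; exact hv.1
  set P := F C with hPdef
  set c := s.arr aCL j with hcdef
  set lo := qb + j * m.factorial with hlodef
  set B := block qb (m + 1).factorial with hBdef
  have hlo : lo + m.factorial ≤ K.factorial := by omega
  have hsubB : block lo m.factorial ⊆ B := fun q hq => ⟨by have := hq.1; omega, by
    have := hq.2; omega⟩
  rw [show stepTime N m + Tc = (N * (N * 20 + 23) + 9 * N + 25 + m.factorial * (N * 6 + 6)) +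
    ((Tc + 13) + (2 + ((N * 7 + 3) +
      ((N * (N * 20 + 23) + 5 * N + 15 + (m + 1).factorial * (N * 7 + 6)) + 1)))) by
      unfold stepTime; ring]
  refine Run.seq_imp (run_stepOpen (P := P) (c := c) (lo := lo) (x := if j < m then lo + m.factorial
    else qb) g' (by omega) eLV (by omega) hI.jj (by rw [eCL]) hcK
    (by rw [eM, g'.wint C hc.list.sub]) hI.nodes hI.total hI.qj hI.base hlo rfl) ?_
  rintro s₁ ⟨f₁, h27, h21, hX₁, hW₁, hW₁', A, ch, hA, hY, ht₁⟩
  have g₁ := g'.frame f₁ rfl rfl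
  have hYZ : Z \ A ⊆ Z := Set.sdiff_subset
  refine Run.seq_imp (run_recurse (j := j) (c := c) (lo := lo) (C := C) (Y := Z \ A) hcall g₁
    (by simp [f₁.var, eLV]) (by omega) (by simp [f₁.arr, hI.jj])
    (by simpa [f₁.arr, eCL] using hc.list) (by simp [f₁.var, eM]) (by simp [f₁.arr, eCL, hcdef])
    h27 h21 hlo hY.symm ?_ ?_) ?_
  · rintro v ⟨hv, hvA⟩
    obtain ⟨w, hw, hwA, he⟩ := hA.total v hv hvA
    exact ⟨w, ⟨hw, hwA⟩, he⟩
  · rintro v ⟨hv, hvA⟩ c' hc' hcol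
    refine Finset.mem_erase.2 ⟨?_, hc.only v (hI.sub hv) c' hc' hcol⟩
    rintro rfl
    exact hvA (hA.target ⟨hv, hcol⟩)
  rintro s₂ ⟨e₂, hs₂⟩
  have g₂ := g₁.frame e₂.frame rfl rfl
  have e₁ : Effect N (m + 1) Z (block lo m.factorial) s' s₁ := by
    refine ⟨f₁.weaken rfl rfl, by simp [f₁.var], by simp [f₁.var], by simp [f₁.arr],
      fun i hi => hX₁ i (by rw [Nat.succ_mul] at hi; omega), by simp [f₁.arr], by simp [f₁.arr],
      by simp [f₁.arr], hW₁', fun q v hv hn => (ht₁ q v hv).2 fun h => hn ⟨h.1, hA.sub h.2⟩⟩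
  have e₁₂ : Effect N (m + 1) Z (block lo m.factorial) s' s₂ :=
    e₁.trans (e₂.mono (Nat.le_succ m) hYZ le_rfl)
  have eX₂ : ∀ i, (m + 1) * N ≤ i → s₂.arr aXS i = s'.arr aXS i := fun i hi =>
    (e₂.sets i hi).trans (hX₁ i hi)
  have nodes₂ : Z = s₂.nodes ((m + 1) * N) N := by
    rw [hI.nodes]
    ext v
    simp only [Store.nodes, Set.mem_ofPred_eq, eX₂ _ (Nat.le_add_right _ v)]
  have eJ₂ : s₂.arr aJJ (m + 1) = j := by rw [e₂.jj _ (by omega), f₁.arr _ (by simp), hI.jj]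
  have eQJ₂ : s₂.arr aQJ (m + 1) = lo := by rw [e₂.qj _ (by omega), f₁.arr _ (by simp), hI.qj]
  have eQB₂ : s₂.arr aQB (m + 1) = qb := by rw [e₂.qb _ (by omega), f₁.arr _ (by simp), hI.base]
  have eLV₂ : s₂.var vLV = m + 1 := by rw [e₁₂.lv, eLV]
  have eM₂ : s₂.arr aWint (s₂.var vMask) = P.toNat := by rw [e₁₂.mask, eM, g₂.wint C hc.list.sub]
  refine Run.seq_imp ((Run.straight (Q := fun s' => s'.var vPL = (!P).toNat ∧
    s'.var vXO = (m + 1) * N) 2 rfl (by decide) ?_).frame [13, 14] [] rfl) ?_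
  · simp [Cmd.den, eM₂, eLV₂, g₂.row (m + 1) (by have := g₂.colors; omega)]
    cases P <;> simp
  rintro s₃ ⟨f₃, h13, h14⟩
  have g₃ := g₂.frame f₃ rfl rfl
  have a₃ : s₃.arr = s₂.arr := by ext a i; simp [f₃.arr]
  refine Run.seq_imp ((run_wonTarget g₃.size).frame [15, 26] [38] rfl) ?_
  rintro s₄ ⟨f₄, h4, h26⟩
  have g₄ := g₃.frame f₄ rfl rfl
  have f₄' : Frame [13, 14, 15, 26] [38] s₂ s₄ := (f₃.weaken rfl rfl).trans (f₄.weaken rfl rfl)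
  rw [h14, h13, a₃] at h4 h26
  have hZv : ∀ v, v ∈ Z ↔ v < N ∧ s₂.arr aXS ((m + 1) * N + v) ≠ 0 := by
    intro v; conv_lhs => rw [nodes₂]
    exact Iff.rfl
  -- The program tests `aWin` on all of `Z`. Nodes of `A` carry the provisional entry for `P`, so
  -- the test finds precisely the opponent's wins in the subgame.
  have hwon : ∀ v, v ∈ Z → (s₂.arr aWin v = (!P).toNat ↔ v ∈ Z \ A ∧ s₂.winner v = !P) := by
    intro v hv
    by_cases hvA : v ∈ A
    · have : s₂.arr aWin v = P.toNat := by rw [e₂.win v (fun h => h.2 hvA), hW₁ v hv]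
      rw [this, toNat_eq_iff]
      simp [hvA]
    · rw [hs₂.bool v ⟨hv, hvA⟩, toNat_eq_iff]
      simp [hvA, hv]
  have nodes₄ : Z = s₄.nodes ((m + 1) * N) N := by
    rw [nodes₂]; simp [Store.nodes, f₄'.arr]
  have tU₄ : s₄.tab aUpd N = s₂.tab aUpd N := by ext; simp [Store.tab, f₄'.arr]
  have tN₄ : s₄.tab aNxt N = s₂.tab aNxt N := by ext; simp [Store.tab, f₄'.arr]
  have e₄ : Effect N (m + 1) Z (block lo m.factorial) s' s₄ := by
    refine e₁₂.trans ⟨f₄'.weaken rfl rfl, by simp [f₄'.var], by simp [f₄'.var], by simp [f₄'.arr],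
      by simp [f₄'.arr], by simp [f₄'.arr], by simp [f₄'.arr], by simp [f₄'.arr],
      by simp [f₄'.arr], by simp [tU₄, tN₄]⟩
  refine Run.cond (fun h0 => ?_) (fun h0 => ?_)
  · simp only [Expr.eval_var] at h0
    obtain ⟨u, huN, hu1, hu2⟩ := h26.1 h0
    have huZ : u ∈ Z := (hZv u).2 ⟨huN, hu1⟩
    have hT : {v | v ∈ Z \ A ∧ s₂.winner v = !P} = {v | v ∈ Z ∧ s₄.arr aTgt v ≠ 0} := by
      ext v
      simp only [Set.mem_ofPred_eq]
      constructor
      · rintro ⟨h1, h2⟩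
        refine ⟨h1.1, (h4 v (hZN v h1.1)).2 ⟨((hZv v).1 h1.1).2, (hwon v h1.1).2 ⟨h1, h2⟩⟩⟩
      · rintro ⟨h1, h2⟩
        exact (hwon v h1).1 ((h4 v (hZN v h1)).1 h2).2
    refine (run_stepRemove (lo := lo) (qb := qb) (P := !P) g₄ (by omega) (by simp [f₄'.var, eLV₂])
      (by simp [f₄.var, h13]) (by simp [f₄.var, h14]) nodes₄ hI.total hT
      (fun v hv h => (hZv v).2 ⟨hv, ((h4 v hv).1 h).1⟩) (by simp [f₄'.arr, eQJ₂])
      (by simp [f₄'.arr, eQB₂]) hrange (by omega)).imp ?_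
    rintro s₅ ⟨e₅, hJ₅, hQJ₅, hQB₅, A', ch', hA', nodes₅, hW₅, hW₅', t₅, t₅', t₅''⟩
    have eff₅ : Effect N (m + 1) Z B s' s₅ := (e₄.mono le_rfl le_rfl hsubB).trans e₅
    refine Or.inr ⟨Z \ A', ⟨u, huN, huZ, fun h => h.2 (hA'.target ((hwon u huZ).1 hu2))⟩,
      Set.sdiff_subset,
      hI.eff.trans (eff₅.mono le_rfl hI.sub le_rfl), Set.sdiff_subset.trans hI.sub,
      nodes₅.symm, ?_, Nat.zero_le _, hJ₅, by simpa using hQJ₅, hQB₅, fun i hi => absurd hi (by omega),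
      ?_, ?_⟩
    · rintro v ⟨hv, hvA⟩
      obtain ⟨w, hw, hwA, he⟩ := hA'.total v hv hvA
      exact ⟨w, ⟨hw, hwA⟩, he⟩
    · intro win up nx hagree hsol
      refine hI.ext win up nx (fun v hv hvZ => ?_) ?_
      · obtain ⟨h1, h2⟩ := hagree v hv fun h => hvZ h.1
        refine ⟨?_, fun q hq => ?_⟩
        · rw [h1, Store.winner, Store.winner, eff₅.win v hvZ]
        · have hvN : v < N := by have := hc.nodes ▸ hv; exact this.1
          rw [(h2 q hq).1, (h2 q hq).2]
          exact eff₅.tab q v hvN fun h => hvZ h.2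
      -- The winner is the opponent of `P`, and `Z \ A` is closed under the moves of `P`, as no node
      -- of `P` outside its attractor has a move into it.
      · refine Board.Sol.extend (b := !P) (colorObj_prefixIndep K col F) hYZ ?_ hs₂.sol hsubB hA' ?_
          ?_ ?_ hsol
        · rintro v ⟨hv, hvA⟩ ho w hw he
          refine ⟨hw, hA.trap v hv hvA ?_ w hw he⟩
          cases h1 : D.own v <;> cases h2 : P <;> simp_all
        · intro v hv
          rw [(hagree v (hI.sub (hA'.sub hv)) fun h => h.2 hv).1]
          exact Store.winner_eq (hW₅ v hv)
        · intro v hv hvw q hq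
          have hvA' : v ∈ A' := hA'.target ⟨hv, hvw⟩
          obtain ⟨h1, h2⟩ := (hagree v (hI.sub hv.1) fun h => h.2 hvA').2 q hq
          rw [h1, h2]
          -- Values of the small block keep their own rows; all others imitate `lo`.
          by_cases hq' : q ∈ block lo m.factorial
          · obtain ⟨h3, h4⟩ := t₅'' q v (hZN v hv.1) (Or.inr (Or.inr ⟨⟨hv, hvw⟩, hq'⟩))
            exact ⟨q, hq', fun _ => rfl, by rw [h3, tU₄], by rw [h4, tN₄]⟩
          · obtain ⟨h3, h4⟩ := t₅' v ⟨hv, hvw⟩ q hq hq'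
            exact ⟨lo, ⟨le_rfl, by omega⟩, fun h => absurd h hq', by rw [h4, tU₄], by rw [h3, tN₄]⟩
        · intro v hv hvT q hq
          obtain ⟨h1, h2⟩ := (hagree v (hI.sub (hA'.sub hv)) fun h => h.2 hv).2 q hq
          obtain ⟨h3, h4⟩ := t₅ v hv hvT q hq
          rw [h1, h2, h3, h4]
          exact ⟨hq, rfl⟩
    · intro v hv hvZ
      by_cases hvA : v ∈ A'
      · rw [Store.winner_eq (hW₅ v hvA), hW₅ v hvA]
      · have hvZ' : v ∉ Z := fun h => hvZ ⟨h, hvA⟩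
        rw [Store.winner, eff₅.win v hvZ']
        exact hI.bool v hv hvZ'
  · simp only [Expr.eval_var] at h0
    have hnone : ∀ v ∈ Z \ A, s₂.winner v = P := by
      intro v hv
      by_contra hne
      have : s₂.winner v = !P := by cases h1 : s₂.winner v <;> cases h2 : P <;> simp_all
      exact h26.2 ⟨v, hZN v hv.1, ((hZv v).1 hv.1).2, (hwon v hv.1).2 ⟨hv, this⟩⟩ h0
    have e1 : s₄.var vLV = m + 1 := by simp [f₄'.var, eLV₂]
    have e2 : s₄.arr aQJ (m + 1) = lo := by simp [f₄'.arr, eQJ₂]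
    have e3 : s₄.arr aJJ (m + 1) = j := by simp [f₄'.arr, eJ₂]
    refine ((Run.straight (Q := fun s' =>
      s'.arr aJJ = Function.update (s₄.arr aJJ) (m + 1) (j + 1) ∧
      s'.arr aQJ = Function.update (s₄.arr aQJ) (m + 1) (lo + m.factorial)) _ rfl
      (show 2 ≤ _ by clear_value P c lo B; omega) ?_).frame [] [39, 41] rfl).imp ?_
    · simp [Cmd.den, e1, e2, e3, g₄.fact m (by omega)]
    rintro s₅ ⟨f₅, hJ₅, hQJ₅⟩
    have tU₅ : s₅.tab aUpd N = s₂.tab aUpd N := by rw [← tU₄]; ext; simp [Store.tab, f₅.arr]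
    have tN₅ : s₅.tab aNxt N = s₂.tab aNxt N := by rw [← tN₄]; ext; simp [Store.tab, f₅.arr]
    have eff₅ : Effect N (m + 1) Z (block lo m.factorial) s' s₅ := by
      refine e₄.trans ⟨f₅.weaken rfl rfl, by simp [f₅.var], by simp [f₅.var], by simp [f₅.arr],
        by simp [f₅.arr], fun i hi => ?_, fun i hi => ?_, by simp [f₅.arr], by simp [f₅.arr],
        by simp [tU₄, tN₄, tU₅, tN₅]⟩
      · rw [hJ₅, Function.update_of_ne (by omega)]
      · rw [hQJ₅, Function.update_of_ne (by omega)]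
    have hw₅ : ∀ v, v ∉ Z → s₅.winner v = s'.winner v := fun v hv => by
      rw [Store.winner, Store.winner, eff₅.win v hv]
    refine Or.inl ⟨hI.eff.trans (eff₅.mono le_rfl hI.sub hsubB), hI.sub, ?_, hI.total, hj,
      by simp [hJ₅], ?_, ?_, fun i hi => ?_, fun win up nx hagree => hI.ext win up nx ?_,
      fun v hv hvZ => ?_⟩
    · rw [nodes₄]; simp [Store.nodes, f₅.arr]
    · rw [hQJ₅, Function.update_self, hlodef, Nat.add_mul, one_mul, add_assoc]
    · simp [f₅.arr, f₄'.arr, eQB₂]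
    -- Blocks of earlier colors survive, since this turn writes only rows of block `j`. The new
    -- block is assembled from the attractor rows and the solution found by the recursive call.
    · rcases Nat.lt_succ_iff_lt_or_eq.1 hi with hi | rfl
      · refine (hI.blocks i hi).congr fun v hv q hq => eff₅.tab q v (hZN v hv) fun h => ?_
        have h1 := h.1.1
        have h2 := hq.2
        have : (i + 1) * m.factorial ≤ j * m.factorial := Nat.mul_le_mul_right _ hi
        rw [Nat.add_mul, one_mul] at this
        omega
      · refine ⟨A, ch, s₂.winner, hA, ?_, fun v hv hvA => hnone v ⟨hv, hvA⟩, fun v hv q hq => ?_⟩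
        · rw [tU₅, tN₅]
          exact hs₂.sol
        · have hvZ := hA.sub hv
          obtain ⟨h1, h2⟩ := e₂.tab q v (hZN v hvZ) fun h => h.2.2 hv
          obtain ⟨h3, h4, h5⟩ := (ht₁ q v (hZN v hvZ)).1 hq hv
          rw [tU₅, tN₅, h1, h2]
          refine ⟨h3, fun h => ?_, fun h => h5 fun h' => h ⟨hvZ, h'⟩⟩
          rw [h4 h.2, Nat.add_mul, one_mul, hlodef, add_assoc]
    · intro v hv hvZ
      obtain ⟨h1, h2⟩ := hagree v hv hvZ
      refine ⟨by rw [h1, hw₅ v hvZ], fun q hq => ?_⟩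
      have hvN : v < N := by have := hc.nodes ▸ hv; exact this.1
      rw [(h2 q hq).1, (h2 q hq).2]
      exact eff₅.tab q v hvN fun h => hvZ h.2
    · rw [hw₅ v hvZ, eff₅.win v hvZ]
      exact hI.bool v hv hvZ

/-- Time for a call of the solver. -/
def solveTime (N : ℕ) : ℕ → ℕ
  | 0 => N * (N * 20 + 23) + 9 * N + 20
  | m + 1 => (N + 1) * (m + 1) * (stepTime N m + solveTime N m + 1) +
      (N * (N * 20 + 23) + 9 * N + 20)

-- Induction on the number of colors. When all colors have been treated successfully,
-- `sol_of_blocks` solves the nodes that remain, and the clause `ext` of the loop invariant adds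
-- those removed before.
set_option maxHeartbeats 1600000 in
theorem run_solve (hps : ps[0]? = some solveBody) (m : ℕ) : ∀ s C X qb,
    Call D N K col F m C X qb s → Run ps (.call 0) s (solveTime N m) (fun s' =>
      Effect N m X (block qb m.factorial) s s' ∧
      Solved D N K col F X (block qb m.factorial) s') := by
  induction m with
  | zero =>
    intro s C X qb hc
    have hC : C = ∅ := Finset.card_eq_zero.1 hc.list.card
    have hqb : qb < K.factorial := by have := hc.range; simp at this; omega
    rw [show solveTime N 0 = 2 + (0 * (0 + 1) + 1 + (N * (N * 20 + 23) + 9 * N + 13)) + 1 + 3 by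
      simp [solveTime]; ring]
    refine Run.mono (Run.call hps ?_) (Nat.le_add_right _ 3)
    refine Run.seq_imp ((Run.straight (Q := fun s' =>
      s'.arr aJJ = Function.update (s.arr aJJ) 0 0 ∧
      s'.arr aQJ = Function.update (s.arr aQJ) 0 qb) 2 rfl (by decide) ?_).frame
        [] [39, 41] rfl) ?_
    · simp [Cmd.den, hc.lv, hc.base]
    rintro s₁ ⟨f₁, hJ₁, hQJ₁⟩
    have g₁ := hc.game.frame f₁ rfl rfl
    refine Run.seq_imp (Run.loop (I := fun _ s' => s' = s₁) (Q := fun s' => s' = s₁) ?_ ?_ 0 rfl) ?_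
    · intro k s' h h'
      simp [h, f₁.var, hc.lv] at h'
    · exact fun k s' h _ => h
    intro s' h
    subst s'
    refine (run_solveFinish (P := F C) g₁ (Nat.zero_le _) (by simp [f₁.var, hc.lv]) ?_ ?_ hc.total
      (by simp [f₁.arr, hc.base]) hqb).imp ?_
    · rw [f₁.var _ (by simp), hc.mask, g₁.wint C hc.list.sub]
    · rw [hc.nodes]; simp [Store.nodes, f₁.arr]
    rintro s₂ ⟨e₂, hw, -, ht⟩
    have e₁ : Effect N 0 X (block qb (Nat.factorial 0)) s s₁ := by
      refine ⟨f₁.weaken rfl rfl, by simp [f₁.var], by simp [f₁.var], by simp [f₁.arr],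
        by simp [f₁.arr], fun i hi => ?_, fun i hi => ?_, by simp [f₁.arr], by simp [f₁.arr],
        by simp [f₁.arr, Store.tab]⟩
      · rw [hJ₁, Function.update_of_ne (by omega)]
      · rw [hQJ₁, Function.update_of_ne (by omega)]
    have hwin : ∀ v ∈ X, s₂.winner v = F C := fun v hv => Store.winner_eq (hw v hv)
    have hq : ∀ q ∈ block qb (Nat.factorial 0), q = qb := by
      rintro q ⟨h1, h2⟩
      simp at h2
      omega
    refine ⟨e₁.trans e₂, fun v hv => by rw [hwin v hv, hw v hv], fun v hv q hqB => ?_,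
      fun v hv q hqB => ?_, fun v hv q hqB _ => ?_, fun v hv _ w hw' _ => ?_,
      fun b π q _ hX _ hb => ?_⟩
    · rw [hq q hqB]
      exact ⟨(ht rfl v hv).1, (ht rfl v hv).2.1⟩
    · rw [hq q hqB, (ht rfl v hv).2.2]
      exact ⟨le_rfl, by simp⟩
    · rw [hq q hqB, hwin v hv, hwin _ (ht rfl v hv).2.1]
    · rw [hwin v hv, hwin w hw']
    · rw [Board.Won, ← hb 0, hwin _ (hX 0), colorObj]
      -- No color is left on `X`, so none recurs, and `C` is empty.
      have : infColors K col π = C := by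
        rw [hC, Finset.eq_empty_iff_forall_notMem]
        intro c h
        simp only [infColors, Finset.mem_filter, Finset.mem_range] at h
        obtain ⟨j, -, hj⟩ := h.2 0
        have := hc.only _ (hX j) c h.1 hj
        simp [hC] at this
      rw [this]
  | succ m ih =>
    intro s C X qb hc
    have hqb : qb < K.factorial := by
      have := hc.range; have := Nat.factorial_pos (m + 1); omega
    have hfac : (m + 1).factorial = (m + 1) * m.factorial := Nat.factorial_succ m
    have hXN : ∀ v ∈ X, v < N := fun v hv => by have := hc.nodes ▸ hv; exact this.1
    rw [show solveTime N (m + 1) = 2 + ((N + 1) * (m + 1) * (stepTime N m + solveTime N m + 1) + 1 +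
      (N * (N * 20 + 23) + 9 * N + 13)) + 1 + 3 by simp [solveTime]; ring]
    refine Run.mono (Run.call hps ?_) (Nat.le_add_right _ 3)
    refine Run.seq_imp ((Run.straight (Q := fun s' =>
      s'.arr aJJ = Function.update (s.arr aJJ) (m + 1) 0 ∧
      s'.arr aQJ = Function.update (s.arr aQJ) (m + 1) qb) 2 rfl (by decide) ?_).frame
        [] [39, 41] rfl) ?_
    · simp [Cmd.den, hc.lv, hc.base]
    rintro s₁ ⟨f₁, hJ₁, hQJ₁⟩
    have e₁ : Effect N (m + 1) X (block qb (m + 1).factorial) s s₁ := by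
      refine ⟨f₁.weaken rfl rfl, by simp [f₁.var], by simp [f₁.var], by simp [f₁.arr],
        by simp [f₁.arr], fun i hi => ?_, fun i hi => ?_, by simp [f₁.arr], by simp [f₁.arr],
        by simp [f₁.arr, Store.tab]⟩
      · rw [hJ₁, Function.update_of_ne (by omega)]
      · rw [hQJ₁, Function.update_of_ne (by omega)]
    have hI₁ : LoopInv D N K col F m (F C) (s.arr aCL) X qb s X 0 s₁ := by
      refine ⟨e₁, le_rfl, ?_, hc.total, Nat.zero_le _, by simp [hJ₁], by simp [hQJ₁],
        by simp [f₁.arr, hc.base], fun i hi => absurd hi (by omega), fun _ _ _ _ h => h,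
        fun v hv h => absurd hv h⟩
      rw [hc.nodes]; simp [Store.nodes, f₁.arr]
    -- The measure is lexicographic: a success raises `j`, and a removal takes a node from `Z`. The
    -- weight `m + 1` of a node outweighs the reset of `j`, which costs at most `m`.
    refine Run.seq_imp (Run.mono (Run.loop (Tb := stepTime N m + solveTime N m) (I := fun k s' => ∃ Z j,
      LoopInv D N K col F m (F C) (s.arr aCL) X qb s Z j s' ∧
      k = countP (fun v => v ∈ Z) N * (m + 1) + (m + 1 - j))
      (Q := fun s' => ∃ Z, LoopInv D N K col F m (F C) (s.arr aCL) X qb s Z (m + 1) s')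
      ?_ ?_ _ ⟨X, 0, hI₁, rfl⟩) ?_) ?_
    · rintro k s' ⟨Z, j, hI, rfl⟩ hne
      have hlt : j < m + 1 := by
        simp only [Expr.eval_sub, Expr.eval_var, Expr.eval_get, hI.eff.lv, hc.lv, hI.jj] at hne
        omega
      refine (run_step ih hc hI hlt).imp ?_
      rintro s'' (h | ⟨Z', ⟨u, huN, hu, hu'⟩, hZ', h⟩)
      · exact ⟨_, by omega, Z, j + 1, h, rfl⟩
      · refine ⟨_, ?_, Z', 0, h, rfl⟩
        have := countP_lt (p := fun v => v ∈ Z) (p' := fun v => v ∈ Z') (fun w _ h => hZ' h) huN hu hu'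
        have := Nat.mul_le_mul_right (m + 1) this
        rw [Nat.succ_mul] at this
        omega
    · rintro k s' ⟨Z, j, hI, rfl⟩ he
      simp only [Expr.eval_sub, Expr.eval_var, Expr.eval_get, hI.eff.lv, hc.lv, hI.jj] at he
      obtain rfl : j = m + 1 := by have := hI.le; omega
      exact ⟨Z, hI⟩
    · have := countP_le (p := fun v => v ∈ X) (N := N)
      have := Nat.mul_le_mul_right (m + 1) this
      have h2 : countP (fun v => v ∈ X) N * (m + 1) + (m + 1 - 0) ≤ (N + 1) * (m + 1) := by
        rw [Nat.add_mul]; omega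
      have := Nat.mul_le_mul_right (stepTime N m + solveTime N m + 1) h2
      omega
    rintro s₂ ⟨Z, hI⟩
    have g₂ := hc.game.frame hI.eff.frame rfl rfl
    refine (run_solveFinish (P := F C) g₂ hc.list.le (by rw [hI.eff.lv, hc.lv]) ?_ hI.nodes
      hI.total hI.base hqb).imp ?_
    · rw [hI.eff.mask, hc.mask, g₂.wint C hc.list.sub]
    rintro s₃ ⟨e₃, hw, ht, -⟩
    obtain ⟨ht1, ht2⟩ := ht (by omega)
    have tU : s₃.tab aUpd N = s₂.tab aUpd N := by ext; simp [Store.tab, ht1]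
    have tN : s₃.tab aNxt N = s₂.tab aNxt N := by ext; simp [Store.tab, ht2]
    have hwin : ∀ v ∈ Z, s₃.winner v = F C := fun v hv => Store.winner_eq (hw v hv)
    have hwin' : ∀ v, v ∉ Z → s₃.winner v = s₂.winner v := fun v hv => by
      rw [Store.winner, Store.winner, e₃.win v hv]
    refine ⟨hI.eff.trans (e₃.mono le_rfl hI.sub le_rfl), fun v hv => ?_, ?_⟩
    · by_cases hvZ : v ∈ Z
      · rw [hwin v hvZ, hw v hvZ]
      · rw [hwin' v hvZ, e₃.win v hvZ, hI.bool v hv hvZ]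
    · refine hI.ext _ _ _ (fun v hv hvZ => ⟨hwin' v hvZ, fun q hq => by rw [tU, tN]; exact ⟨rfl, rfl⟩⟩)
        ?_
      rw [tU, tN, hfac]
      refine sol_of_blocks (T := fun i => {v | v ∈ Z ∧ col (s.arr aCL i) v})
        (colorObj_prefixIndep K col F) (Nat.factorial_pos m) hI.blocks hwin ?_
      intro π hπ hinf
      -- Nodes of `X` have no colors outside `C`. Hence if all listed colors recur, the recurring
      -- colors are exactly those of `C`, and `P` was chosen as the winner for this set.
      have : infColors K col π = C := by
        ext c
        simp only [infColors, Finset.mem_filter, Finset.mem_range]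
        constructor
        · rintro ⟨hcK, h⟩
          obtain ⟨j, -, hj⟩ := h 0
          exact hc.only _ (hI.sub (hπ j)) c hcK hj
        · intro hcC
          obtain ⟨i, hi, rfl⟩ := hc.list.surj hcC
          refine ⟨by simpa using hc.list.sub hcC, fun n => ?_⟩
          obtain ⟨j, h1, h2⟩ := hinf i hi n
          exact ⟨j, h1, h2.2⟩
      rw [Board.Won, colorObj, this]

end

section

/-! ## Formulas and colors -/

/-- The operators whose atoms are violated by events that occur infinitely often. -/
def TempOp.Neg : TempOp → Prop
  | .GF => False
  | .FG => True
  | .F => False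
  | .G => True

/-- The operator of Emerson-Lei games that replaces the operator. -/
def TempOp.toEL : TempOp → TempOp
  | .FG => .FG
  | _ => .GF

namespace MPFormula

variable {Γ : Type*}

/-- The event occurs in the formula. -/
def Has (φ : MPFormula Γ) (a : Γ) : Prop := ∃ o, φ.Occurs o a

/-- The event occurs in a negative atom of the formula. -/
def Neg (φ : MPFormula Γ) (a : Γ) : Prop := ∃ o, φ.Occurs o a ∧ o.Neg

/-- The value of the formula, if `S` is the set of events that satisfy the positive atoms and violate
the negative atoms. -/
def val (S : Set Γ) : MPFormula Γ → Prop
  | tt => True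
  | ff => False
  | atom o a => a ∈ S ↔ ¬ o.Neg
  | and p q => p.val S ∧ q.val S
  | or p q => p.val S ∨ q.val S

theorem sat_iff_val {w : ℕ → Set Γ} {S : Set Γ} {φ : MPFormula Γ}
    (h : ∀ o a, φ.Occurs o a → (o.Holds w a ↔ (a ∈ S ↔ ¬ o.Neg))) : φ.Sat w ↔ φ.val S := by
  induction φ with
  | tt => rfl
  | ff => rfl
  | atom o a => exact h o a ⟨rfl, rfl⟩
  | and p q hp hq =>
    exact and_congr (hp fun o a ho => h o a (Or.inl ho)) (hq fun o a ho => h o a (Or.inr ho))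
  | or p q hp hq =>
    exact or_congr (hp fun o a ho => h o a (Or.inl ho)) (hq fun o a ho => h o a (Or.inr ho))

/-- The polarity is that of the original operator, even where the atom turns into `GF`: for an atom
`G a`, membership in `S` means violation in both games. -/
theorem toEL_sat_iff_val {w : ℕ → Set Γ} {S : Set Γ} {φ : MPFormula Γ}
    (h : ∀ o a, φ.Occurs o a →
      (o.toEL.Holds w a ↔ (a ∈ S ↔ ¬ o.Neg))) :
    φ.toEL.Sat w ↔ φ.val S := by
  induction φ with
  | tt => rfl
  | ff => rfl
  | atom o a =>
    have := h o a ⟨rfl, rfl⟩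
    cases o <;> exact this
  | and p q hp hq =>
    exact and_congr (hp fun o a ho => h o a (Or.inl ho)) (hq fun o a ho => h o a (Or.inr ho))
  | or p q hp hq =>
    exact or_congr (hp fun o a ho => h o a (Or.inl ho)) (hq fun o a ho => h o a (Or.inr ho))

/-- This is where uniqueness of atoms matters: polarity becomes a property of the event, and one
color per event suffices. -/
theorem UniqueEvents.neg_iff {φ : MPFormula Γ} (hφ : φ.UniqueEvents) {o : TempOp} {a : Γ}
    (h : φ.Occurs o a) : φ.Neg a ↔ o.Neg :=
  ⟨fun ⟨o', h1, h2⟩ => hφ a o o' h h1 ▸ h2, fun h' => ⟨o, h, h'⟩⟩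

end MPFormula

theorem TempOp.holds_GF {Γ : Type*} {w : ℕ → Set Γ} {a : Γ} :
    TempOp.GF.Holds w a ↔ ∀ n, ∃ j, n ≤ j ∧ a ∈ w j :=
  ⟨fun h n => (h n).imp fun _ hj => ⟨hj.1.le, hj.2⟩, fun h i => (h (i + 1)).imp fun _ hj => hj⟩

theorem TempOp.holds_FG {Γ : Type*} {w : ℕ → Set Γ} {a : Γ} :
    TempOp.FG.Holds w a ↔ ¬ ∀ n, ∃ j, n ≤ j ∧ a ∉ w j := by
  push Not
  exact ⟨fun ⟨i, h⟩ => ⟨i + 1, h⟩, fun ⟨n, h⟩ => ⟨n, fun j hj => h j hj.le⟩⟩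

/-- The boolean that stands for a player. -/
def Player.bool : Player → Bool
  | .sys => true
  | .env => false

namespace MPGame

variable {V Γ : Type*}

/-- The event takes the value that does no harm to positive atoms, and violates negative atoms. -/
def Hit (G : MPGame V Γ) (a : Γ) (v : V) : Prop := a ∈ G.label v ↔ ¬ G.formula.Neg a

/-- Counted in hits, the four operators differ only in polarity and in the question asked: `GF` and
`FG` ask for infinitely many hits, `F` and `G` for at least one, and the negative operators demand
the answer no. -/
theorem sat_iff {G : MPGame V Γ} (hφ : G.formula.UniqueEvents) {π : ℕ → V} {S : Set Γ}
    (hEL : ∀ a ∈ G.formula.elEvents, a ∈ S ↔ ∀ n, ∃ j, n ≤ j ∧ G.Hit a (π j))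
    (hL : ∀ a ∈ G.formula.fEvents ∪ G.formula.gEvents, a ∈ S ↔ ∃ j, G.Hit a (π j)) :
    (G.formula.Sat fun i => G.label (π i)) ↔ G.formula.val S := by
  refine MPFormula.sat_iff_val fun o a h => ?_
  have hn := hφ.neg_iff h
  cases o with
  | GF =>
    rw [hEL a (Or.inl h), TempOp.holds_GF]
    simp [Hit, hn, TempOp.Neg]
  | FG =>
    rw [hEL a (Or.inr h), TempOp.holds_FG]
    simp [Hit, hn, TempOp.Neg]
  | F =>
    rw [hL a (Or.inl h)]
    simp [Hit, hn, TempOp.Neg, TempOp.Holds]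
  | G =>
    rw [hL a (Or.inr h)]
    simp [Hit, hn, TempOp.Neg, TempOp.Holds]

/-- A hit of a local event means presence for `F` and absence for `G`; both persist from some point
on. Local events can thus be treated as colors on the arena itself. -/
theorem HasLocalMemory.hit_iff {G : MPGame V Γ} (hG : G.HasLocalMemory)
    (hφ : G.formula.UniqueEvents) {π : ℕ → V} (hπ : G.IsPlay π) {a : Γ}
    (ha : a ∈ G.formula.fEvents ∪ G.formula.gEvents) :
    (∃ j, G.Hit a (π j)) ↔ ∀ n, ∃ j, n ≤ j ∧ G.Hit a (π j) := by
  refine ⟨fun h n => ?_, fun h => (h 0).imp fun j hj => hj.2⟩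
  rcases ha with ha | ha
  · have hn : ¬ G.formula.Neg a := fun h => (hφ.neg_iff ha).1 h
    simp only [Hit, hn, not_false_eq_true, iff_true] at h ⊢
    obtain ⟨i, hi⟩ := ((hG π hπ).1 a ha).1 h
    exact ⟨i + n + 1, by omega, hi _ (by omega)⟩
  · have hn : G.formula.Neg a := (hφ.neg_iff ha).2 trivial
    simp only [Hit, hn, not_true_eq_false, iff_false] at h ⊢
    obtain ⟨i, hi⟩ := ((hG π hπ).2 a ha).1 h
    exact ⟨i + n + 1, by omega, hi _ (by omega)⟩

open Classical in
/-- The game graph. -/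
noncomputable def board (G : MPGame V Γ) : Board V := ⟨fun v => decide (v ∈ G.sysNodes), G.edge⟩

theorem owns_iff (G : MPGame V Γ) (P : Player) (v : V) : G.Owns P v ↔ G.board.own v = P.bool := by
  cases P <;> simp [Arena.Owns, board, Player.bool]

theorem winningPlay_iff (G : MPGame V Γ) (P : Player) (π : ℕ → V) :
    G.WinningPlay π P ↔ ((G.formula.Sat fun i => G.label (π i)) ↔ P.bool = true) := by
  cases P <;> simp [WinningPlay, Player.bool]

/-- Two strategies can be played against each other. -/
theorem exists_play {A : Arena V} (σ : Strategy A .sys) (σ' : Strategy A .env) (v : V) :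
    ∃ π : ℕ → V, A.IsPlay π ∧ π 0 = v ∧ σ.Compatible π ∧ σ'.Compatible π := by
  classical
  let mv : List V → V → V := fun h v => if A.Owns .sys v then σ.move h v else σ'.move h v
  -- The state consists of the history before the current node and of this node, in the form in
  -- which strategies take them.
  let H : ℕ → List V × V := fun i => Nat.rec ([], v) (fun _ p => (p.1 ++ [p.2], mv p.1 p.2)) i
  have hH : ∀ i, H (i + 1) = ((H i).1 ++ [(H i).2], mv (H i).1 (H i).2) := fun i => rfl
  have hist : ∀ i, (List.range i).map (fun j => (H j).2) = (H i).1 := by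
    intro i
    induction i with
    | zero => rfl
    | succ i ih => rw [List.range_succ, List.map_append, ih, hH]; rfl
  refine ⟨fun i => (H i).2, fun i => ?_, rfl, fun i hi => ?_, fun i hi => ?_⟩
  · change A.edge (H i).2 (H (i + 1)).2
    rw [hH]
    by_cases ho : A.Owns .sys (H i).2
    · simp only [mv, if_pos ho]; exact σ.legal _ _ ho
    · simp only [mv, if_neg ho]; exact σ'.legal _ _ ho
  · rw [hist]
    change (H (i + 1)).2 = _
    rw [hH]
    exact if_pos hi
  · rw [hist]
    change (H (i + 1)).2 = _
    rw [hH]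
    exact if_neg hi

theorem winRegion_disjoint {G : MPGame V Γ} {v : V} (h : v ∈ G.winRegion .sys)
    (h' : v ∈ G.winRegion .env) : False := by
  obtain ⟨σ, hσ⟩ := h
  obtain ⟨σ', hσ'⟩ := h'
  obtain ⟨π, h1, h2, h3, h4⟩ := exists_play σ σ' v
  exact hσ' π h1 h2 h4 (hσ π h1 h2 h3)

/-- If every node has a winner according to `win`, then `win` describes the winning regions. -/
theorem mem_winRegion_iff {G : MPGame V Γ} {win : V → Bool}
    (h : ∀ P v, win v = P.bool → v ∈ G.winRegion P) {P : Player} {v : V} :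
    v ∈ G.winRegion P ↔ win v = P.bool := by
  refine ⟨fun hv => ?_, h P v⟩
  cases P with
  | sys =>
    by_contra hne
    exact winRegion_disjoint hv (h .env v (by simpa [Player.bool] using hne))
  | env =>
    by_contra hne
    exact winRegion_disjoint (h .sys v (by simpa [Player.bool] using hne)) hv

end MPGame

theorem MemStrategy.exists_run {V M : Type*} {A : Arena V} {P : Player} {τ : MemStrategy A P M}
    {π : ℕ → V} (h : τ.toStrategy.Compatible π) : ∃ q : ℕ → M, q 0 = τ.init ∧
      (∀ i, q (i + 1) = τ.upd (q i) (π i)) ∧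
      ∀ i, A.Owns P (π i) → π (i + 1) = τ.next (q i) (π i) := by
  refine ⟨fun i => ((List.range i).map π).foldl τ.upd τ.init, rfl, fun i => ?_, fun i hi => h i hi⟩
  simp [List.range_succ]

/-- A joint strategy wins the nodes that it claims. -/
theorem Board.Sol.won {V M : Type*} {D : Board V} {Φ : (ℕ → V) → Prop} {X : Set V} {B : Set M}
    {win : V → Bool} {up : M → V → M} {nx : M → V → V} (h : D.Sol Φ X B win up nx) {b : Bool}
    {π : ℕ → V} {q : ℕ → M} (hf : D.Follows b up nx π q) (hX : ∀ i, π i ∈ X) (hq : q 0 ∈ B)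
    (hb : win (π 0) = b) : Board.Won Φ b π := by
  have hqB : ∀ i, q i ∈ B := by
    intro i
    induction i with
    | zero => exact hq
    | succ i ih => rw [hf.mem]; exact h.mem _ (hX i) _ ih
  refine h.wins b π q hf hX hqB fun i => ?_
  induction i with
  | zero => exact hb
  | succ i ih =>
    by_cases ho : D.own (π i) = b
    · rw [hf.move i ho, h.stay _ (hX i) _ (hqB i) (by rw [ho, ih]), ih]
    · rw [h.trap _ (hX i) (by rwa [ih]) _ (hX (i + 1)) (hf.edge i), ih]

end

section

/-! ## Joint strategies for Emerson-Lei objectives -/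

open Classical in
/-- A memory from which the solver finds a solution. -/
noncomputable def solverStore (D : Board ℕ) (N K : ℕ) (col : ℕ → ℕ → Prop) (F : Finset ℕ → Bool)
    (X : Set ℕ) : Store where
  var
    | vN => N
    | vLV => K
    | vMask => ∑ c ∈ Finset.range K, 2 ^ c
    | _ => 0
  arr
    | aOwn => fun i => (D.own i).toNat
    | aEdg => fun i => if D.edge (i / N) (i % N) then 1 else 0
    | aRow => fun i => i * N
    | aCol => fun i => if col (i / N) (i % N) then 1 else 0
    | aFact => fun i => i.factorial
    | aPow => fun i => 2 ^ i
    | aWint => fun i => (F i.bitIndices.toFinset).toNat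
    | aXS => fun i => if ∃ v ∈ X, i = K * N + v then 1 else 0
    | aCL => fun i => i
    | _ => fun _ => 0

/-- The verified program doubles as an existence proof: started from a memory prepared by hand, it
ends with tables that solve the subgame on `X`. -/
theorem exists_sol_nat (D : Board ℕ) (n K : ℕ) (col : ℕ → ℕ → Prop) (F : Finset ℕ → Bool)
    {X : Set ℕ} (hX : ∀ v ∈ X, v < n) (htot : ∀ v ∈ X, ∃ w ∈ X, D.edge v w) :
    ∃ win up nx, D.Sol (colorObj K col F) X (block 0 K.factorial) win up nx := by
  -- The solver wants at least as many nodes as colors (`GameIn.colors`). The additional numbers lie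
  -- outside `X` and do no harm.
  set N := max n K
  have hXN : ∀ v ∈ X, v < N := fun v hv => (hX v hv).trans_le (le_max_left _ _)
  have hidx : ∀ v w : ℕ, w < N → (v * N + w) / N = v ∧ (v * N + w) % N = w := by
    intro v w hw
    rw [mul_comm]
    exact ⟨by rw [Nat.mul_add_div (by omega), Nat.div_eq_of_lt hw, add_zero],
      by rw [Nat.mul_add_mod, Nat.mod_eq_of_lt hw]⟩
  have hcall : Call D N K col F K (Finset.range K) X 0 (solverStore D N K col F X) := by
    refine ⟨⟨⟨rfl, fun _ _ => rfl, fun v _ w hw => ?_, fun _ _ => rfl⟩, le_max_right _ _,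
      fun _ _ => rfl, fun c _ v hv => ?_, fun _ _ => rfl, fun _ _ => rfl, fun S _ => ?_⟩, rfl,
      ⟨fun i hi => by simpa using! hi, fun _ _ _ _ h => h, by simp, le_rfl⟩, rfl, ?_, htot,
      fun _ _ c hc _ => by simpa using hc, rfl, by simp⟩
    · simp [solverStore, hidx v w hw]
    · simp [solverStore, hidx c v hv]
    · simp [solverStore]
    · ext v
      simp only [Store.nodes, solverStore, Set.mem_ofPred_eq, Nat.add_left_cancel_iff]
      constructor
      · exact fun hv => ⟨hXN v hv, by simp [hv]⟩
      · rintro ⟨-, h⟩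
        simpa using h
  obtain ⟨s', t, -, -, -, hs⟩ := run_solve (ps := [solveBody]) rfl K _ _ _ _ hcall
  exact ⟨_, _, _, hs.sol⟩

/-- Transport along a numbering of the nodes; the objective refers to colors only, so it is not
affected. -/
theorem exists_sol {V : Type*} [Finite V] (D : Board V) (K : ℕ) (col : ℕ → V → Prop)
    (F : Finset ℕ → Bool) {X : Set V} (htot : ∀ v ∈ X, ∃ w ∈ X, D.edge v w) :
    ∃ win, ∃ up : ℕ → V → ℕ, ∃ nx,
      D.Sol (colorObj K col F) X {q | q < K.factorial} win up nx := by
  classical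
  obtain ⟨n, ⟨e⟩⟩ := Finite.exists_equiv_fin V
  let f : V → ℕ := fun v => e v
  have hf : Function.Injective f := Fin.val_injective.comp e.injective
  let D' : Board ℕ := ⟨fun i => decide (∃ v, f v = i ∧ D.own v = true),
    fun i j => ∃ v w, f v = i ∧ f w = j ∧ D.edge v w⟩
  have hown : ∀ v, D'.own (f v) = D.own v := fun v => by
    simp [D', hf.eq_iff]
  have hedge : ∀ v j, D'.edge (f v) j ↔ ∃ w, f w = j ∧ D.edge v w := fun v j => by
    simp [D', hf.eq_iff]
  have hedge' : ∀ v w, D'.edge (f v) (f w) ↔ D.edge v w := fun v w => by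
    simp [D', hf.eq_iff]
  obtain ⟨win, up, nx, h⟩ := exists_sol_nat D' n K (fun c i => ∃ v, f v = i ∧ col c v) F
    (X := f '' X) (by rintro _ ⟨v, -, rfl⟩; exact (e v).2) (by
      rintro _ ⟨v, hv, rfl⟩
      obtain ⟨w, hw, he⟩ := htot v hv
      exact ⟨f w, ⟨w, hw, rfl⟩, (hedge' v w).2 he⟩)
  have hB : block 0 K.factorial = {q | q < K.factorial} := by ext; simp [block]
  rw [hB] at h
  -- The moves of the solution are numbers; for nodes of `X` they are numbers of nodes of `X`, which
  -- are chosen here.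
  have hnx : ∀ v ∈ X, ∀ q < K.factorial, ∃ w ∈ X, f w = nx q (f v) ∧ D.edge v w := by
    intro v hv q hq
    obtain ⟨h1, w, hw, h2⟩ := h.legal (f v) ⟨v, hv, rfl⟩ q hq
    rw [← h2, hedge'] at h1
    exact ⟨w, hw, h2, h1⟩
  choose! nx' hnx' using hnx
  refine ⟨fun v => win (f v), fun q v => up q (f v), fun q v => nx' v q, fun v hv q hq => ?_,
    fun v hv q hq => h.mem _ ⟨v, hv, rfl⟩ q hq, fun v hv q hq ho => ?_, fun v hv ho w hw he => ?_,
    fun b π q hF hπ hq hb => ?_⟩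
  · exact ⟨(hnx' v hv q hq).2.2, (hnx' v hv q hq).1⟩
  · simp only [(hnx' v hv q hq).2.1]
    exact h.stay _ ⟨v, hv, rfl⟩ q hq (by rw [hown, ho])
  · exact h.trap _ ⟨v, hv, rfl⟩ (by rwa [hown]) _ ⟨w, hw, rfl⟩ ((hedge' v w).2 he)
  · have := h.wins b (fun i => f (π i)) q ⟨fun i => (hedge' _ _).2 (hF.edge i), hF.mem,
      fun i hi => ?_⟩ (fun i => ⟨_, hπ i, rfl⟩) hq hb
    · simpa [Board.Won, colorObj, infColors, hf.eq_iff] using this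
    · rw [hF.move i (by rwa [hown] at hi), (hnx' _ (hπ i) _ (hq i)).2.1]

/-- Games with Emerson-Lei objectives are determined, and winning strategies need at most `K!` memory
values. -/
theorem MPGame.solved_of_colorObj {V Γ : Type*} [Finite V] (G : MPGame V Γ) (K : ℕ)
    (col : ℕ → V → Prop) (F : Finset ℕ → Bool)
    (hobj : ∀ π, G.IsPlay π → ((G.formula.Sat fun i => G.label (π i)) ↔ colorObj K col F π)) :
    ∃ win, ∃ up : ℕ → V → ℕ, ∃ nx,
      G.board.Sol (fun π => G.formula.Sat fun i => G.label (π i)) Set.univ {q | q < K.factorial}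
        win up nx ∧ ∀ P, (∀ v, v ∈ G.winRegion P ↔ win v = P.bool) ∧
        G.MemoryAtMost P K.factorial := by
  obtain ⟨win, up, nx, h⟩ := exists_sol G.board K col F (X := Set.univ) (fun v _ => by
    obtain ⟨w, hw⟩ := G.total v
    exact ⟨w, trivial, hw⟩)
  let τ : ∀ P, MemStrategy G.toArena P (Fin K.factorial) := fun P => {
    init := ⟨0, Nat.factorial_pos K⟩
    upd := fun q v => ⟨up q v, h.mem v trivial q q.2⟩
    next := fun q v => nx q v
    legal := fun q v _ => (h.legal v trivial q q.2).1 }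
  have hw : ∀ P v, win v = P.bool → G.Wins (τ P).toStrategy v := by
    intro P v hv π hπ h0 hc
    obtain ⟨q, hq0, hq, hm⟩ := MemStrategy.exists_run hc
    rw [G.winningPlay_iff, hobj π hπ]
    refine h.won (π := π) (q := fun i => (q i).val) ⟨hπ, fun i => ?_, fun i hi => ?_⟩
      (fun _ => trivial) (q 0).2 (h0 ▸ hv)
    · rw [hq]
    · exact hm i ((G.owns_iff P _).2 hi)
  have hreg : ∀ P v, v ∈ G.winRegion P ↔ win v = P.bool := fun P v =>
    MPGame.mem_winRegion_iff fun P v hv => ⟨_, hw P v hv⟩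
  refine ⟨win, up, nx, ⟨h.legal, h.mem, h.stay, h.trap, fun b π q hf hX hq hb => ?_⟩,
    fun P => ⟨hreg P, _, le_rfl, τ P, fun v hv => hw P v ((hreg P v).1 hv)⟩⟩
  have := h.wins b π q hf hX hq hb
  rwa [Board.Won, ← hobj π hf.edge] at this

/-! ## Colors for events -/

/-- The color of the event `a ∈ E` is `idx a`. -/
def eventCol {V Γ : Type*} (E : Set Γ) (idx : Γ → ℕ) (p : Γ → V → Prop) (c : ℕ) (v : V) : Prop :=
  ∃ a ∈ E, idx a = c ∧ p a v

theorem mem_infColors_eventCol {V Γ : Type*} {E : Set Γ} {idx : Γ → ℕ} {p : Γ → V → Prop} {K : ℕ}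
    (hinj : Set.InjOn idx E) (hK : ∀ a ∈ E, idx a < K) {a : Γ} (ha : a ∈ E) {π : ℕ → V} :
    idx a ∈ infColors K (eventCol E idx p) π ↔ ∀ n, ∃ j, n ≤ j ∧ p a (π j) := by
  simp only [infColors, Finset.mem_filter, Finset.mem_range, hK a ha, true_and]
  have : ∀ v, eventCol E idx p (idx a) v ↔ p a v := fun v =>
    ⟨fun ⟨b, hb, he, h⟩ => hinj hb ha he ▸ h, fun h => ⟨a, ha, rfl, h⟩⟩
  simp only [this]

theorem exists_index {Γ : Type*} [Finite Γ] (E : Set Γ) :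
    ∃ idx : Γ → ℕ, Set.InjOn idx E ∧ ∀ a ∈ E, idx a < E.ncard := by
  classical
  let e : E ≃ Fin E.ncard := Finite.equivFinOfCardEq (by rfl)
  refine ⟨fun a => if h : a ∈ E then e ⟨a, h⟩ else 0, fun a ha b hb h => ?_, fun a ha => ?_⟩
  · simp only [ha, hb, dite_true] at h
    simpa using e.injective (Fin.ext h)
  · simp [ha]

end

section

/-! ## The Emerson-Lei game of a Manna-Pnueli game -/

theorem MPFormula.val_congr {Γ : Type*} {φ : MPFormula Γ} {S S' : Set Γ}
    (h : ∀ a, φ.Has a → (a ∈ S ↔ a ∈ S')) : φ.val S ↔ φ.val S' := by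
  induction φ with
  | tt => rfl
  | ff => rfl
  | atom o a => simp only [val, h a ⟨o, rfl, rfl⟩]
  | and p q hp hq =>
    exact and_congr (hp fun a ⟨o, ho⟩ => h a ⟨o, Or.inl ho⟩) (hq fun a ⟨o, ho⟩ => h a ⟨o, Or.inr ho⟩)
  | or p q hp hq =>
    exact or_congr (hp fun a ⟨o, ho⟩ => h a ⟨o, Or.inl ho⟩) (hq fun a ⟨o, ho⟩ => h a ⟨o, Or.inr ho⟩)

namespace MPFormula

open Classical in
/-- The truth table of a formula, for the given colors. -/
noncomputable def table {Γ : Type*} (φ : MPFormula Γ) (idx : Γ → ℕ) (T : Finset ℕ) : Bool :=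
  decide (φ.val {a | idx a ∈ T})

open Classical in
theorem table_eq_true {Γ : Type*} {φ : MPFormula Γ} {idx : Γ → ℕ} {T : Finset ℕ} :
    φ.table idx T = true ↔ φ.val {a | idx a ∈ T} := decide_eq_true_iff

variable {Γ : Type*} {φ : MPFormula Γ}

theorem has_iff {a : Γ} : φ.Has a ↔ a ∈ φ.elEvents ∪ (φ.fEvents ∪ φ.gEvents) := by
  simp only [elEvents, fEvents, gEvents, Set.mem_union, Set.mem_ofPred_eq]
  constructor
  · rintro ⟨o, ho⟩
    cases o <;> tauto
  · rintro ((h | h) | (h | h)) <;> exact ⟨_, h⟩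

theorem UniqueEvents.disjoint (hφ : φ.UniqueEvents) {a : Γ} (h : a ∈ φ.elEvents)
    (h' : a ∈ φ.fEvents ∪ φ.gEvents) : False := by
  rcases h with h | h <;> rcases h' with h' | h' <;> simpa using hφ a _ _ h h'

theorem UniqueEvents.localEvents_eq (hφ : φ.UniqueEvents) :
    φ.localEvents = φ.fEvents ∪ φ.gEvents := by
  ext a
  simp only [localEvents, Set.mem_sdiff, and_iff_left_iff_imp]
  exact fun h h' => hφ.disjoint h' h

theorem UniqueEvents.ncard_has [Finite Γ] (hφ : φ.UniqueEvents) :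
    {a | φ.Has a}.ncard = φ.numEL + φ.numLocal := by
  rw [numEL, numLocal, hφ.localEvents_eq, ← Set.ncard_union_eq]
  · congr 1
    ext a
    exact has_iff
  · rw [Set.disjoint_left]
    exact fun a h h' => hφ.disjoint h h'

end MPFormula

namespace MPGame

variable {V Γ : Type*} {G : MPGame V Γ}

/-- The local event has occurred (or been missed), according to the memory. -/
def Flag (G : MPGame V Γ) (a : Γ) (L : G.LocalMemory) : Prop := a ∈ L.1 ↔ ¬ G.formula.Neg a

/-- The event belongs to the node, or to its memory. -/
def Seen (G : MPGame V Γ) (a : Γ) (x : V × G.LocalMemory) : Prop :=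
  (a ∈ G.formula.elEvents ∧ G.Hit a x.1) ∨
    (a ∈ G.formula.fEvents ∪ G.formula.gEvents ∧ G.Flag a x.2)

/-- Adding an `F`-event and deleting a `G`-event are the same operation up to polarity: the flag is
joined with the hit at the node that is left. -/
theorem flag_updMemory (hφ : G.formula.UniqueEvents) {a : Γ}
    (ha : a ∈ G.formula.fEvents ∪ G.formula.gEvents) (v : V) (L : G.LocalMemory) :
    G.Flag a (G.updMemory v L) ↔ G.Flag a L ∨ G.Hit a v := by
  rcases ha with ha | ha
  · have h1 : a ∉ G.formula.gEvents := fun h => by simpa using hφ a _ _ ha h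
    have h2 : ¬ G.formula.Neg a := fun h => (hφ.neg_iff ha).1 h
    simp [Flag, Hit, updMemory, ha, h1, h2]
  · have h1 : a ∉ G.formula.fEvents := fun h => by simpa using hφ a _ _ ha h
    have h2 : G.formula.Neg a := (hφ.neg_iff ha).2 trivial
    simp [Flag, Hit, updMemory, ha, h1, h2]
    tauto

theorem not_flag_initMemory (hφ : G.formula.UniqueEvents) {a : Γ}
    (ha : a ∈ G.formula.fEvents ∪ G.formula.gEvents) : ¬ G.Flag a G.initMemory := by
  rcases ha with ha | ha
  · have h1 : a ∉ G.formula.gEvents := fun h => by simpa using hφ a _ _ ha h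
    have h2 : ¬ G.formula.Neg a := fun h => (hφ.neg_iff ha).1 h
    simp [Flag, initMemory, h1, h2]
  · have h2 : G.formula.Neg a := (hφ.neg_iff ha).2 trivial
    simp [Flag, initMemory, ha, h2]

theorem localMemory_ext {L L' : G.LocalMemory}
    (h : ∀ a ∈ G.formula.fEvents ∪ G.formula.gEvents, G.Flag a L ↔ G.Flag a L') : L = L' := by
  refine Subtype.ext (Set.ext fun a => ?_)
  by_cases ha : a ∈ G.formula.fEvents ∪ G.formula.gEvents
  · have := h a ha
    simp only [Flag] at this
    tauto
  · exact ⟨fun h => absurd (L.2 h) ha, fun h => absurd (L'.2 h) ha⟩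

/-- The update uses the node that is left, so the flag at position `i` records the hits strictly
before `i`. -/
theorem flag_play (hφ : G.formula.UniqueEvents) {ρ : ℕ → V × G.LocalMemory}
    (hρ : G.elGame.IsPlay ρ) {a : Γ} (ha : a ∈ G.formula.fEvents ∪ G.formula.gEvents) (i : ℕ) :
    G.Flag a (ρ i).2 ↔ G.Flag a (ρ 0).2 ∨ ∃ j < i, G.Hit a (ρ j).1 := by
  induction i with
  | zero => simp
  | succ i ih =>
    rw [(hρ i).2, flag_updMemory hφ ha, ih]
    constructor
    · rintro ((h | ⟨j, hj, h⟩) | h)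
      · exact Or.inl h
      · exact Or.inr ⟨j, by omega, h⟩
      · exact Or.inr ⟨i, by omega, h⟩
    · rintro (h | ⟨j, hj, h⟩)
      · exact Or.inl (Or.inl h)
      · rcases Nat.lt_succ_iff_lt_or_eq.1 hj with hj | rfl
        · exact Or.inl (Or.inr ⟨j, hj, h⟩)
        · exact Or.inr h

theorem flag_mono (hφ : G.formula.UniqueEvents) {ρ : ℕ → V × G.LocalMemory}
    (hρ : G.elGame.IsPlay ρ) {a : Γ} (ha : a ∈ G.formula.fEvents ∪ G.formula.gEvents) {i j : ℕ}
    (hij : i ≤ j) (h : G.Flag a (ρ i).2) : G.Flag a (ρ j).2 := by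
  rw [flag_play hφ hρ ha] at h ⊢
  exact h.imp_right fun ⟨l, hl, h⟩ => ⟨l, by omega, h⟩

theorem seen_of_el (hφ : G.formula.UniqueEvents) {a : Γ} (ha : a ∈ G.formula.elEvents)
    {x : V × G.LocalMemory} : G.Seen a x ↔ G.Hit a x.1 :=
  ⟨fun h => h.elim (fun h => h.2) fun h => (hφ.disjoint ha h.1).elim, fun h => Or.inl ⟨ha, h⟩⟩

theorem seen_of_local (hφ : G.formula.UniqueEvents) {a : Γ}
    (ha : a ∈ G.formula.fEvents ∪ G.formula.gEvents)
    {x : V × G.LocalMemory} : G.Seen a x ↔ G.Flag a x.2 :=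
  ⟨fun h => h.elim (fun h => (hφ.disjoint h.1 ha).elim) fun h => h.2, fun h => Or.inr ⟨ha, h⟩⟩

/-- Flags are never lowered, so one raised flag stays raised. -/
theorem seen_often_iff (hφ : G.formula.UniqueEvents) {ρ : ℕ → V × G.LocalMemory}
    (hρ : G.elGame.IsPlay ρ) {a : Γ} (ha : a ∈ G.formula.fEvents ∪ G.formula.gEvents) :
    (∀ n, ∃ j, n ≤ j ∧ G.Seen a (ρ j)) ↔ ∃ j, G.Flag a (ρ j).2 := by
  simp only [seen_of_local hφ ha]
  exact ⟨fun h => (h 0).imp fun j hj => hj.2, fun ⟨j, hj⟩ n =>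
    ⟨j + n, by omega, flag_mono hφ hρ ha (by omega) hj⟩⟩

/-- In the augmented arena, `Seen` takes the role of hits: labels decide for Emerson-Lei events, and
the memory decides for local events. The label of `elGame` mixes both without conflict because the
two kinds of events are disjoint. -/
theorem elGame_sat_iff (hφ : G.formula.UniqueEvents) {ρ : ℕ → V × G.LocalMemory}
    (hρ : G.elGame.IsPlay ρ) : (G.elGame.formula.Sat fun i => G.elGame.label (ρ i)) ↔
      G.formula.val {a | ∀ n, ∃ j, n ≤ j ∧ G.Seen a (ρ j)} := by
  have hel : ∀ a ∈ G.formula.elEvents, ∀ x, a ∈ G.elGame.label x ↔ a ∈ G.label x.1 := by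
    intro a ha x
    simp only [elGame, Set.mem_union, Set.mem_inter_iff, ha, and_true, or_iff_left_iff_imp]
    exact fun h => (hφ.disjoint ha (x.2.2 h)).elim
  have hlo : ∀ a ∈ G.formula.fEvents ∪ G.formula.gEvents, ∀ x, a ∈ G.elGame.label x ↔ a ∈ x.2.1 := by
    intro a ha x
    simp only [elGame, Set.mem_union, Set.mem_inter_iff, or_iff_right_iff_imp]
    exact fun h => (hφ.disjoint h.2 ha).elim
  refine MPFormula.toEL_sat_iff_val fun o a h => ?_
  have hn := hφ.neg_iff h
  cases o with
  | GF =>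
    simp only [TempOp.toEL, TempOp.holds_GF, hel a (Or.inl h), Set.mem_ofPred_eq,
      seen_of_el hφ (Or.inl h), Hit, hn, TempOp.Neg, not_false_eq_true, iff_true]
  | FG =>
    simp only [TempOp.toEL, TempOp.holds_FG, hel a (Or.inr h), Set.mem_ofPred_eq,
      seen_of_el hφ (Or.inr h), Hit, hn, TempOp.Neg, not_true_eq_false, iff_false]
  | F =>
    have ha : a ∈ G.formula.fEvents ∪ G.formula.gEvents := Or.inl h
    simp only [TempOp.toEL, TempOp.holds_GF, hlo a ha, Set.mem_ofPred_eq,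
      seen_of_local hφ ha, Flag, hn, TempOp.Neg, not_false_eq_true, iff_true]
  | G =>
    have ha : a ∈ G.formula.fEvents ∪ G.formula.gEvents := Or.inr h
    simp only [TempOp.toEL, TempOp.holds_GF, hlo a ha, Set.mem_ofPred_eq,
      seen_often_iff hφ hρ ha, Flag, hn, TempOp.Neg, not_true_eq_false, iff_false, not_exists,
      not_not]
    -- For a `G`-event the new atom says that the memory contains it infinitely often. A deleted
    -- event never returns, so this amounts to containing it always.
    refine ⟨fun h' j => ?_, fun h' n => ⟨n, le_rfl, h' n⟩⟩
    by_contra hj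
    obtain ⟨i, hi, hi'⟩ := h' j
    have hj' : G.Flag a (ρ j).2 := by simp [Flag, hn, TempOp.Neg, hj]
    have := flag_mono hφ hρ ha hi hj'
    simp [Flag, hn, TempOp.Neg, hi'] at this

theorem elGame_sat_shift (hφ : G.formula.UniqueEvents) {ρ : ℕ → V × G.LocalMemory}
    (hρ : G.elGame.IsPlay ρ) (n : ℕ) :
    (G.elGame.formula.Sat fun i => G.elGame.label (ρ (i + n))) ↔
      G.elGame.formula.Sat fun i => G.elGame.label (ρ i) := by
  have hρ' : G.elGame.IsPlay fun i => ρ (i + n) := fun i => by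
    have := hρ (i + n)
    rwa [add_right_comm] at this
  rw [elGame_sat_iff hφ hρ, elGame_sat_iff hφ hρ']
  refine MPFormula.val_congr fun a _ => ⟨fun h m => ?_, fun h m => ?_⟩
  · obtain ⟨j, hj, h⟩ := h m
    exact ⟨j + n, by omega, h⟩
  · obtain ⟨j, hj, h⟩ := h (m + n)
    exact ⟨j - n, by omega, by rwa [Nat.sub_add_cancel (by omega)]⟩

/-- The initial memory has no flags raised, so a flag gets raised at some time iff the event is hit
at some time; the delay by one step is irrelevant. -/
theorem sat_iff_elGame_sat (hφ : G.formula.UniqueEvents) {ρ : ℕ → V × G.LocalMemory}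
    (hρ : G.elGame.IsPlay ρ) (h0 : (ρ 0).2 = G.initMemory) :
    (G.formula.Sat fun i => G.label (ρ i).1) ↔
      G.elGame.formula.Sat fun i => G.elGame.label (ρ i) := by
  rw [elGame_sat_iff hφ hρ]
  refine sat_iff hφ (π := fun i => (ρ i).1) (fun a ha => ?_) fun a ha => ?_
  · simp only [Set.mem_ofPred_eq, seen_of_el hφ ha]
  · simp only [Set.mem_ofPred_eq, seen_often_iff hφ hρ ha]
    constructor
    · rintro ⟨j, hj⟩
      rw [flag_play hφ hρ ha, h0] at hj
      obtain ⟨i, -, hi⟩ := hj.resolve_left (not_flag_initMemory hφ ha)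
      exact ⟨i, hi⟩
    · rintro ⟨j, hj⟩
      exact ⟨j + 1, (flag_play hφ hρ ha _).2 (Or.inr ⟨j, by omega, hj⟩)⟩

/-- The Emerson-Lei game is determined, and winning strategies need few memory values. -/
theorem elGame_solved [Finite V] [Finite Γ] (hφ : G.formula.UniqueEvents) :
    ∃ win, ∃ up : ℕ → V × G.LocalMemory → ℕ, ∃ nx,
      G.elGame.board.Sol (fun ρ => G.elGame.formula.Sat fun i => G.elGame.label (ρ i)) Set.univ
        {q | q < (G.formula.numEL + G.formula.numLocal).factorial} win up nx ∧
      ∀ P, (∀ x, x ∈ G.elGame.winRegion P ↔ win x = P.bool) ∧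
        G.elGame.MemoryAtMost P (G.formula.numEL + G.formula.numLocal).factorial := by
  obtain ⟨idx, h1, h2⟩ := exists_index {a | G.formula.Has a}
  rw [hφ.ncard_has] at h2
  refine solved_of_colorObj G.elGame _ (eventCol {a | G.formula.Has a} idx G.Seen)
    (G.formula.table idx) fun ρ hρ => ?_
  rw [elGame_sat_iff hφ hρ, colorObj, MPFormula.table_eq_true]
  refine MPFormula.val_congr fun a ha => ?_
  rw [Set.mem_ofPred_eq, Set.mem_ofPred_eq, mem_infColors_eventCol h1 h2 ha]

/-- Hits of local events serve as colors on the original arena, because there one hit is as good as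
infinitely many. -/
theorem memoryAtMost_of_hasLocalMemory [Finite V] [Finite Γ] (hφ : G.formula.UniqueEvents)
    (hG : G.HasLocalMemory) (P : Player) :
    G.MemoryAtMost P (G.formula.numEL + G.formula.numLocal).factorial := by
  obtain ⟨idx, h1, h2⟩ := exists_index {a | G.formula.Has a}
  rw [hφ.ncard_has] at h2
  obtain ⟨_, _, _, -, h⟩ := solved_of_colorObj G _ (eventCol {a | G.formula.Has a} idx G.Hit)
    (G.formula.table idx) fun π hπ => by
      rw [colorObj, MPFormula.table_eq_true]
      refine sat_iff hφ (fun a ha => ?_) fun a ha => ?_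
      · exact mem_infColors_eventCol h1 h2 (MPFormula.has_iff.2 (Or.inl ha))
      · rw [hG.hit_iff hφ hπ ha]
        exact mem_infColors_eventCol h1 h2 (MPFormula.has_iff.2 (Or.inr ha))
  exact (h P).2

/-! ### Strategies for the game from strategies for its Emerson-Lei game -/

/-- Remember the local events. -/
def _root_.MannaPnueli.MemStrategy.withLocal {P : Player} {M : Type*}
    (τ : MemStrategy G.elGame.toArena P M) : MemStrategy G.toArena P (M × G.LocalMemory) where
  init := (τ.init, G.initMemory)
  upd q v := (τ.upd q.1 (v, q.2), G.updMemory v q.2)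
  next q v := (τ.next q.1 (v, q.2)).1
  legal q v hv := (τ.legal q.1 (v, q.2) (by cases P <;> exact hv)).1

/-- The second memory component always equals the memory coordinate of the augmented arena, so a
play of `G` lifts to a play there that is compatible with `τ`. -/
theorem wins_withLocal (hφ : G.formula.UniqueEvents) {P : Player} {M : Type*}
    {τ : MemStrategy G.elGame.toArena P M} {v : V}
    (h : G.elGame.Wins τ.toStrategy (v, G.initMemory)) : G.Wins τ.withLocal.toStrategy v := by
  intro π hπ h0 hc
  obtain ⟨q, hq0, hq, hm⟩ := MemStrategy.exists_run hc
  let ρ : ℕ → V × G.LocalMemory := fun i => (π i, (q i).2)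
  have hρ : G.elGame.IsPlay ρ := fun i => ⟨hπ i, by simp only [ρ, hq]; rfl⟩
  have hmem : ∀ i, ((List.range i).map ρ).foldl τ.upd τ.init = (q i).1 := by
    intro i
    induction i with
    | zero => rw [hq0]; rfl
    | succ i ih =>
      rw [List.range_succ, List.map_append, List.foldl_append, ih, hq]
      rfl
  have hw := h ρ hρ (by simp only [ρ, h0, hq0]; rfl) fun i hi => by
    have ho : G.elGame.Owns P (ρ i) := hi
    have hi' : G.Owns P (π i) := by cases P <;> exact hi
    change ρ (i + 1) = τ.next (((List.range i).map ρ).foldl τ.upd τ.init) (ρ i)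
    rw [hmem]
    refine Prod.ext (hm i hi') ?_
    rw [(τ.legal (q i).1 (ρ i) ho).2]
    exact (hρ i).2
  rw [winningPlay_iff] at hw ⊢
  rw [← hw]
  exact sat_iff_elGame_sat hφ hρ (by simp only [ρ, hq0]; rfl)

theorem memoryAtMost_of_memStrategy {P : Player} {M : Type*} [Finite M] {B : ℕ}
    (hM : Nat.card M ≤ B) (τ : MemStrategy G.toArena P M)
    (h : ∀ v ∈ G.winRegion P, G.Wins τ.toStrategy v) : G.MemoryAtMost P B := by
  let e : M ≃ Fin (Nat.card M) := Finite.equivFin M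
  let τ' : MemStrategy G.toArena P (Fin (Nat.card M)) :=
    ⟨e τ.init, fun q v => e (τ.upd (e.symm q) v), fun q v => τ.next (e.symm q) v,
      fun q v hv => τ.legal _ v hv⟩
  have hf : ∀ (l : List V) (q : M), l.foldl τ'.upd (e q) = e (l.foldl τ.upd q) := by
    intro l
    induction l with
    | nil => intro q; rfl
    | cons v l ih =>
      intro q
      rw [List.foldl_cons, List.foldl_cons, ← ih]
      simp [τ']
  have heq : τ'.toStrategy = τ.toStrategy := by
    simp only [MemStrategy.toStrategy, Strategy.mk.injEq]
    ext l v
    simp only [show τ'.init = e τ.init from rfl, hf]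
    simp [τ']
  exact ⟨_, hM, τ', fun v hv => by rw [heq]; exact h v hv⟩

/-- Strategies are transferred only from the Emerson-Lei game to `G`, but for both players; as the
Emerson-Lei game is determined, this settles every node. -/
theorem mem_winRegion_iff_elGame [Finite V] [Finite Γ] (hφ : G.formula.UniqueEvents) (P : Player)
    (v : V) : v ∈ G.winRegion P ↔ (v, G.initMemory) ∈ G.elGame.winRegion P := by
  obtain ⟨win, _, _, -, h⟩ := G.elGame_solved hφ
  rw [(h P).1]
  refine mem_winRegion_iff (win := fun v => win (v, G.initMemory)) fun P v hv => ?_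
  obtain ⟨m, -, τ, hτ⟩ := (h P).2
  exact ⟨_, wins_withLocal hφ (hτ _ (((h P).1 _).2 hv))⟩

end MPGame

end

section

/-! ## Memory of winning strategies in Manna-Pnueli games -/

/-- The attractor is the union of its stages, and the rank is the first stage that contains the
node. Finiteness is needed at nodes of the opponent, whose successors have to lie in a common stage.
-/
theorem Board.exists_isAttr {V : Type*} [Finite V] (D : Board V) (b : Bool) {Z T : Set V}
    (hT : T ⊆ Z) (htot : ∀ v ∈ Z, ∃ w ∈ Z, D.edge v w) : ∃ A ch, D.IsAttr b Z T A ch := by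
  classical
  obtain ⟨R, hR0, hR⟩ : ∃ R : ℕ → Set V, R 0 = T ∧ ∀ n v, v ∈ R (n + 1) ↔ v ∈ R n ∨ (v ∈ Z ∧
      ((D.own v = b ∧ ∃ w ∈ Z, D.edge v w ∧ w ∈ R n) ∨
        (D.own v ≠ b ∧ ∀ w ∈ Z, D.edge v w → w ∈ R n))) :=
    ⟨fun n => Nat.rec T (fun _ S => S ∪ {v | v ∈ Z ∧
      ((D.own v = b ∧ ∃ w ∈ Z, D.edge v w ∧ w ∈ S) ∨
        (D.own v ≠ b ∧ ∀ w ∈ Z, D.edge v w → w ∈ S))}) n, rfl, fun _ _ => Iff.rfl⟩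
  have hmono : Monotone R := monotone_nat_of_le_succ fun n v hv => (hR n v).2 (Or.inl hv)
  have hsub : ∀ n, R n ⊆ Z := by
    intro n
    induction n with
    | zero => exact hR0 ▸ hT
    | succ n ih =>
      intro v hv
      rcases (hR n v).1 hv with h | h
      exacts [ih h, h.1]
  have hrk : ∀ v, (∃ n, v ∈ R n) → v ∉ T →
      (D.own v = b → ∃ w ∈ Z, D.edge v w ∧ (∃ n, w ∈ R n) ∧
        sInf {n | w ∈ R n} < sInf {n | v ∈ R n}) ∧
      (D.own v ≠ b → ∀ w ∈ Z, D.edge v w → (∃ n, w ∈ R n) ∧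
        sInf {n | w ∈ R n} < sInf {n | v ∈ R n}) := by
    intro v hv hvT
    have h1 : v ∈ R (sInf {n | v ∈ R n}) := Nat.sInf_mem hv
    have h2 : ∀ n < sInf {n | v ∈ R n}, v ∉ R n := fun n hn => Nat.notMem_of_lt_sInf hn
    generalize sInf {n | v ∈ R n} = m at h1 h2
    cases m with
    | zero => exact absurd (hR0 ▸ h1) hvT
    | succ m =>
      have h3 := ((hR m v).1 h1).resolve_left (h2 m (by omega))
      refine ⟨fun ho => ?_, fun ho w hw he => ?_⟩
      · rcases h3.2 with ⟨-, w, hw, he, h4⟩ | h4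
        · exact ⟨w, hw, he, ⟨m, h4⟩, Nat.lt_succ_of_le (Nat.sInf_le h4)⟩
        · exact absurd ho h4.1
      · rcases h3.2 with h4 | ⟨-, h4⟩
        · exact absurd h4.1 ho
        · exact ⟨⟨m, h4 w hw he⟩, Nat.lt_succ_of_le (Nat.sInf_le (h4 w hw he))⟩
  have hch : ∀ v : V, ∃ w : V, (v ∈ Z → D.edge v w ∧ w ∈ Z) ∧ ((∃ n, v ∈ R n) → v ∉ T → D.own v = b →
      (∃ n, w ∈ R n) ∧ sInf {n | w ∈ R n} < sInf {n | v ∈ R n}) := by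
    intro v
    by_cases h : (∃ n, v ∈ R n) ∧ v ∉ T ∧ D.own v = b
    · obtain ⟨w, hw, he, h4⟩ := (hrk v h.1 h.2.1).1 h.2.2
      exact ⟨w, fun _ => ⟨he, hw⟩, fun _ _ _ => h4⟩
    · by_cases hv : v ∈ Z
      · obtain ⟨w, hw, he⟩ := htot v hv
        exact ⟨w, fun _ => ⟨he, hw⟩, fun h1 h2 h3 => absurd ⟨h1, h2, h3⟩ h⟩
      · exact ⟨v, fun h => absurd h hv, fun h1 h2 h3 => absurd ⟨h1, h2, h3⟩ h⟩
  choose ch hch using hch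
  refine ⟨{v | ∃ n, v ∈ R n}, ch, fun v ⟨n, hv⟩ => hsub n hv, fun v hv => ⟨0, hR0.symm ▸ hv⟩, ?_, ?_,
    fun v hv => (hch v).1 hv, fun v => sInf {n | v ∈ R n}, fun v hv hvT =>
      ⟨fun ho => (hch v).2 hv hvT ho, fun ho w hw he => (hrk v hv hvT).2 ho w hw he⟩⟩
  · rintro v hv hvA ho w hw he ⟨n, hn⟩
    exact hvA ⟨n + 1, (hR n v).2 (Or.inr ⟨hv, Or.inl ⟨ho, w, hw, he, hn⟩⟩)⟩
  · intro v hv hvA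
    by_contra! hcon
    have hall : ∀ w ∈ Z, D.edge v w → ∃ n, w ∈ R n := fun w hw he => by
      by_contra h
      exact hcon w hw h he
    by_cases ho : D.own v = b
    · obtain ⟨w, hw, he⟩ := htot v hv
      obtain ⟨n, hn⟩ := hall w hw he
      exact hvA ⟨n + 1, (hR n v).2 (Or.inr ⟨hv, Or.inl ⟨ho, w, hw, he, hn⟩⟩)⟩
    · choose! f hf using hall
      obtain ⟨n, hn⟩ := (Set.finite_range f).bddAbove
      exact hvA ⟨n + 1, (hR n v).2 (Or.inr ⟨hv, Or.inr ⟨ho, fun w hw he =>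
        hmono (hn ⟨w, rfl⟩) (hf w hw he)⟩⟩)⟩

/-- One more local event doubles the left side and multiplies the right side by `k + d + 1`. For `k
≥ 1` this is enough from `d = 0` on; for `k = 0` the induction starts with `16 ≤ 24`. -/
theorem two_pow_mul_factorial_le {k d : ℕ} (h : d = 0 ∨ 1 ≤ k ∨ 4 ≤ d) :
    2 ^ d * k.factorial ≤ (k + d).factorial := by
  rcases h with rfl | h | h
  · simp
  · induction d with
    | zero => simp
    | succ d ih =>
      rw [← add_assoc, Nat.factorial_succ, pow_succ, mul_right_comm, mul_comm]
      exact Nat.mul_le_mul (by omega) ih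
  · rcases Nat.eq_zero_or_pos k with rfl | hk
    · induction d, h using Nat.le_induction with
      | base => decide
      | succ d hd ih =>
        rw [← add_assoc, Nat.factorial_succ, pow_succ, mul_right_comm, mul_comm]
        exact Nat.mul_le_mul (by omega) ih
    · clear h
      induction d with
      | zero => simp
      | succ d ih =>
        rw [← add_assoc, Nat.factorial_succ, pow_succ, mul_right_comm, mul_comm]
        exact Nat.mul_le_mul (by omega) ih

namespace MPGame

variable {V Γ : Type*} {G : MPGame V Γ}

/-- A play from some point on has the same memory values. -/
theorem exists_memory_const [Finite Γ] (hφ : G.formula.UniqueEvents) {ρ : ℕ → V × G.LocalMemory}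
    (hρ : G.elGame.IsPlay ρ) : ∃ n, ∀ i, n ≤ i → (ρ i).2 = (ρ n).2 := by
  have h : ∀ a, ∃ n, ∀ j, G.Hit a (ρ j).1 → ∃ j < n, G.Hit a (ρ j).1 := by
    intro a
    by_cases h : ∃ j, G.Hit a (ρ j).1
    · obtain ⟨j, hj⟩ := h
      exact ⟨j + 1, fun _ _ => ⟨j, by omega, hj⟩⟩
    · exact ⟨0, fun j hj => absurd ⟨j, hj⟩ h⟩
  choose f hf using h
  obtain ⟨n, hn⟩ := (Set.finite_range f).bddAbove
  refine ⟨n, fun i hi => localMemory_ext fun a ha => ⟨fun h => ?_, flag_mono hφ hρ ha hi⟩⟩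
  rw [flag_play hφ hρ ha] at h ⊢
  refine h.imp_right fun ⟨j, _, h⟩ => ?_
  obtain ⟨l, hl, h⟩ := hf a j h
  exact ⟨l, hl.trans_le (hn ⟨a, rfl⟩), h⟩

/-- The objective, if the memory always has the value `L`. -/
noncomputable def layerObj (G : MPGame V Γ) (idx : Γ → ℕ) (L : G.LocalMemory) :
    (ℕ → V × G.LocalMemory) → Prop :=
  open Classical in
  colorObj G.formula.numEL (eventCol G.formula.elEvents idx fun a x => G.Hit a x.1)
    fun T => decide (G.formula.val ({a | a ∈ G.formula.elEvents ∧ idx a ∈ T} ∪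
      {a | a ∈ G.formula.fEvents ∪ G.formula.gEvents ∧ G.Flag a L}))

/-- As long as the memory is constant, local atoms are constants, and only the Emerson-Lei events
need colors. Hence the factorial of `k` alone in `exists_layered_sol`. -/
theorem elGame_sat_iff_layerObj (hφ : G.formula.UniqueEvents) {idx : Γ → ℕ}
    (h1 : Set.InjOn idx G.formula.elEvents) (h2 : ∀ a ∈ G.formula.elEvents, idx a < G.formula.numEL)
    {ρ : ℕ → V × G.LocalMemory} (hρ : G.elGame.IsPlay ρ) {L : G.LocalMemory}
    (hL : ∀ i, (ρ i).2 = L) :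
    (G.elGame.formula.Sat fun i => G.elGame.label (ρ i)) ↔ G.layerObj idx L ρ := by
  rw [elGame_sat_iff hφ hρ]
  refine Iff.trans ?_ (@decide_eq_true_iff _ (_)).symm
  refine MPFormula.val_congr fun a ha => ?_
  simp only [Set.mem_union, Set.mem_ofPred_eq]
  rcases MPFormula.has_iff.1 ha with ha | ha
  · simp only [seen_of_el hφ ha, mem_infColors_eventCol h1 h2 ha, ha, true_and]
    rw [or_iff_left fun h => hφ.disjoint ha h.1]
  · have h3 : a ∉ G.formula.elEvents := fun h => hφ.disjoint h ha
    rw [seen_often_iff hφ hρ ha]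
    simp only [hL, exists_const, h3, false_and, false_or]
    exact ⟨fun h => ⟨ha, h⟩, fun h => h.2⟩

/-- On its winning region in the Emerson-Lei game, a player wins with a strategy that solves each of
the layers, which consist of the nodes with the same memory for the local events. -/
theorem exists_layered_sol [Finite V] [Finite Γ] (hφ : G.formula.UniqueEvents) (b : Bool)
    {win : V × G.LocalMemory → Bool} {f₀ : ℕ} {up₀ : ℕ → V × G.LocalMemory → ℕ}
    {nx₀ : ℕ → V × G.LocalMemory → V × G.LocalMemory} (hf₀ : 0 < f₀)
    (h₀ : G.elGame.board.Sol (fun ρ => G.elGame.formula.Sat fun i => G.elGame.label (ρ i)) Set.univ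
      {q | q < f₀} win up₀ nx₀) :
    ∃ up : ℕ → V × G.LocalMemory → ℕ, ∃ nx,
      G.elGame.board.Sol (fun ρ => G.elGame.formula.Sat fun i => G.elGame.label (ρ i))
        {x | win x = b} {q | q < G.formula.numEL.factorial} (fun _ => b) up nx := by
  classical
  set D := G.elGame.board with hD
  obtain ⟨idx, h1, h2⟩ := exists_index G.formula.elEvents
  have hedge : ∀ x y, D.edge x y → y.2 = G.updMemory x.1 x.2 := fun x y h => h.2
  have htot : ∀ x ∈ {x | win x = b}, ∃ y ∈ {x | win x = b}, D.edge x y := by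
    intro x hx
    by_cases ho : D.own x = b
    · exact ⟨_, (h₀.stay x trivial 0 hf₀ (ho.trans hx.symm)).trans hx, (h₀.legal x trivial 0 hf₀).1⟩
    · obtain ⟨y, hy⟩ := G.elGame.total x
      exact ⟨y, (h₀.trap x trivial (by rwa [hx]) y trivial hy).trans hx, hy⟩
  -- From the nodes of the target every move changes the layer. This can happen only finitely often,
  -- so attracting the play to them is harmless, and it needs no memory.
  obtain ⟨A, ch, hA⟩ := D.exists_isAttr b (Z := {x | win x = b})
    (T := {x | win x = b ∧ G.updMemory x.1 x.2 ≠ x.2}) (fun x hx => hx.1) htot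
  have hAT : ∀ x, win x = b → x ∉ A → G.updMemory x.1 x.2 = x.2 := fun x hx hxA => by
    by_contra h
    exact hxA (hA.target ⟨hx, h⟩)
  let R : G.LocalMemory → Set (V × G.LocalMemory) := fun L => {x | win x = b ∧ x ∉ A ∧ x.2 = L}
  have hsol : ∀ L, ∃ win', ∃ up : ℕ → V × G.LocalMemory → ℕ, ∃ nx,
      D.Sol (G.layerObj idx L) (R L) {q | q < G.formula.numEL.factorial} win' up nx := by
    refine fun L => exists_sol D _ _ _ ?_
    rintro x ⟨hx, hxA, rfl⟩
    obtain ⟨y, hy, hyA, he⟩ := hA.total x hx hxA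
    exact ⟨y, ⟨hy, hyA, (hedge _ _ he).trans (hAT x hx hxA)⟩, he⟩
  choose win' up nx hsol using hsol
  have hk := Nat.factorial_pos G.formula.numEL
  -- the player wins all layers
  have hwin : ∀ L, ∀ x ∈ R L, win' L x = b := by
    intro L x hx
    by_contra hne
    have hb : win' L x = !b := by cases b <;> simpa using hne
    -- If the opponent won a node of the layer, its layer strategy could be played against the
    -- winning strategy of `b` for the whole game. The play would never leave the layer, since `b`
    -- has no move into `A` inside its winning region, and both players would win it.
    obtain ⟨S, hS0, hS⟩ : ∃ S : ℕ → ℕ × ℕ × (V × G.LocalMemory), S 0 = (0, 0, x) ∧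
        ∀ i, S (i + 1) = (up₀ (S i).1 (S i).2.2, up L (S i).2.1 (S i).2.2,
          if D.own (S i).2.2 = b then nx₀ (S i).1 (S i).2.2 else nx L (S i).2.1 (S i).2.2) :=
      ⟨fun i => Nat.rec (0, 0, x) (fun _ s => (up₀ s.1 s.2.2, up L s.2.1 s.2.2,
        if D.own s.2.2 = b then nx₀ s.1 s.2.2 else nx L s.2.1 s.2.2)) i, rfl, fun _ => rfl⟩
    have key : ∀ i, (S i).2.2 ∈ R L ∧ (S i).1 < f₀ ∧ (S i).2.1 < G.formula.numEL.factorial := by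
      intro i
      induction i with
      | zero => rw [hS0]; exact ⟨hx, hf₀, hk⟩
      | succ i ih =>
        obtain ⟨h3, h4, h5⟩ := ih
        rw [hS]
        refine ⟨?_, h₀.mem _ trivial _ h4, (hsol L).mem _ h3 _ h5⟩
        by_cases ho : D.own (S i).2.2 = b
        · simp only [if_pos ho]
          have h6 := (h₀.legal (S i).2.2 trivial _ h4).1
          have h7 := (h₀.stay _ trivial _ h4 (ho.trans h3.1.symm)).trans h3.1
          exact ⟨h7, hA.trap _ h3.1 h3.2.1 ho _ h7 h6,
            ((hedge _ _ h6).trans (hAT _ h3.1 h3.2.1)).trans h3.2.2⟩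
        · simp only [if_neg ho]
          exact ((hsol L).legal _ h3 _ h5).2
    have hplay : ∀ i, D.edge (S i).2.2 (S (i + 1)).2.2 := by
      intro i
      obtain ⟨h3, h4, h5⟩ := key i
      rw [hS]
      by_cases ho : D.own (S i).2.2 = b
      · simp only [if_pos ho]
        exact (h₀.legal (S i).2.2 trivial _ h4).1
      · simp only [if_neg ho]
        exact ((hsol L).legal _ h3 _ h5).1
    have w1 := h₀.won (b := b) (π := fun i => (S i).2.2) (q := fun i => (S i).1)
      ⟨hplay, fun i => by rw [hS], fun i hi => by rw [hS]; exact if_pos hi⟩ (fun _ => trivial)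
      (key 0).2.1 (key 0).1.1
    have w2 := (hsol L).won (b := !b) (π := fun i => (S i).2.2) (q := fun i => (S i).2.1)
      ⟨hplay, fun i => by rw [hS], fun i hi => by
        rw [hS]; exact if_neg (by rw [hi]; cases b <;> simp)⟩ (fun i => (key i).1)
      (key 0).2.2 (by rw [hS0]; exact hb)
    rw [Board.Won] at w1 w2
    rw [elGame_sat_iff_layerObj hφ h1 h2 hplay fun i => (key i).1.2.2] at w1
    rw [w1] at w2
    cases b <;> simp at w2
  refine ⟨fun q x => if x ∈ A then q else up x.2 q x, fun q x => if x ∈ A then ch x else nx x.2 q x,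
    fun x hx q hq => ?_, fun x hx q hq => ?_, fun _ _ _ _ _ => rfl, fun _ _ _ _ _ _ => rfl,
    fun b' ρ q hf hX hq hb => ?_⟩
  · by_cases hxA : x ∈ A
    · simp only [if_pos hxA]
      exact hA.legal x hx
    · simp only [if_neg hxA]
      have := (hsol x.2).legal x ⟨hx, hxA, rfl⟩ q hq
      exact ⟨this.1, this.2.1⟩
  · by_cases hxA : x ∈ A
    · simp only [if_pos hxA]
      exact hq
    · simp only [if_neg hxA]
      exact (hsol x.2).mem x ⟨hx, hxA, rfl⟩ q hq
  · obtain rfl : b = b' := hb 0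
    have hρ : G.elGame.IsPlay ρ := hf.edge
    -- Once the memory is constant, the target of the attractor is not met any more, so the play is
    -- outside `A` and follows the strategy of a single layer.
    obtain ⟨n, hn⟩ := exists_memory_const hφ hρ
    have hT : ∀ i, n ≤ i → ρ i ∉ {x | win x = b ∧ G.updMemory x.1 x.2 ≠ x.2} := by
      rintro i hi ⟨-, h⟩
      apply h
      rw [← hedge _ _ (hf.edge i), hn _ hi, hn _ (by omega)]
    have hnA : ∀ i, n ≤ i → ρ i ∉ A := by
      intro i hi hiA
      obtain ⟨j, hj, hjT⟩ := hA.reach hf.edge hX (n := i) (fun l _ hl _ ho => by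
        rw [hf.move l ho, if_pos hl]) hiA
      exact hT j (by omega) hjT
    have hR : ∀ i, ρ (i + n) ∈ R (ρ n).2 := fun i =>
      ⟨hX _, hnA _ (by omega), hn _ (by omega)⟩
    have hfs := hf.shift n
    have w := (hsol (ρ n).2).won (b := b) (π := fun i => ρ (i + n)) (q := fun i => q (i + n))
      ⟨hfs.edge, fun i => by
        rw [hfs.mem i, if_neg (hR i).2.1, (hR i).2.2], fun i hi => by
        rw [hfs.move i hi, if_neg (hR i).2.1, (hR i).2.2]⟩ hR (hq _)
      (hwin _ _ (hR 0))
    rw [Board.Won] at w ⊢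
    rw [← w, ← elGame_sat_shift hφ hρ n]
    exact elGame_sat_iff_layerObj hφ h1 h2 hfs.edge fun i => (hR i).2.2

/-- A strategy of player `P` that is given on a region that the other player cannot leave. -/
theorem exists_memStrategy_of_sol {W : Set V} {P : Player} {f : ℕ} {up : ℕ → V → ℕ}
    {nx : ℕ → V → V} (hf : 0 < f)
    (h : G.board.Sol (fun π => G.formula.Sat fun i => G.label (π i)) W {q | q < f}
      (fun _ => P.bool) up nx)
    (htrap : ∀ v ∈ W, G.board.own v ≠ P.bool → ∀ w, G.edge v w → w ∈ W) :
    ∃ τ : MemStrategy G.toArena P (Fin f), ∀ v ∈ W, G.Wins τ.toStrategy v := by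
  classical
  choose succ hsucc using G.total
  let τ : MemStrategy G.toArena P (Fin f) := {
    init := ⟨0, hf⟩
    upd := fun q v => if hv : v ∈ W then ⟨up q v, h.mem v hv q q.2⟩ else q
    next := fun q v => if v ∈ W then nx q v else succ v
    legal := fun q v _ => by
      by_cases hv : v ∈ W
      · rw [if_pos hv]
        exact (h.legal v hv q q.2).1
      · rw [if_neg hv]
        exact hsucc v }
  refine ⟨τ, fun v hv π hπ h0 hc => ?_⟩
  obtain ⟨q, hq0, hq, hm⟩ := MemStrategy.exists_run hc
  have hW : ∀ i, π i ∈ W := by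
    intro i
    induction i with
    | zero => rwa [h0]
    | succ i ih =>
      by_cases ho : G.board.own (π i) = P.bool
      · rw [hm i ((G.owns_iff P _).2 ho)]
        simp only [τ, if_pos ih]
        exact (h.legal _ ih _ (q i).2).2
      · exact htrap _ ih ho _ (hπ i)
  rw [G.winningPlay_iff]
  refine h.won (π := π) (q := fun i => (q i).val) ⟨hπ, fun i => ?_, fun i hi => ?_⟩
    hW (q 0).2 rfl
  · simp only [hq, τ, dif_pos (hW i)]
  · rw [hm i ((G.owns_iff P _).2 hi)]
    simp only [τ, if_pos (hW i)]

theorem exists_compatible_play {A : Arena V} {P : Player} (σ : Strategy A P) (v : V) :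
    ∃ π : ℕ → V, A.IsPlay π ∧ π 0 = v ∧ σ.Compatible π := by
  choose succ hsucc using A.total
  cases P with
  | sys =>
    obtain ⟨π, h1, h2, h3, -⟩ := exists_play σ ⟨fun _ => succ, fun _ v _ => hsucc v⟩ v
    exact ⟨π, h1, h2, h3⟩
  | env =>
    obtain ⟨π, h1, h2, -, h3⟩ := exists_play ⟨fun _ => succ, fun _ v _ => hsucc v⟩ σ v
    exact ⟨π, h1, h2, h3⟩

/-- If there is just one local event, and there are no other events, then memory is not needed. -/
theorem memoryAtMost_one [Finite V] [Finite Γ] (hφ : G.formula.UniqueEvents) (P : Player) {a : Γ}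
    (ha : ∀ c, G.formula.Has c ↔ c = a) (haL : a ∈ G.formula.fEvents ∪ G.formula.gEvents)
    {up : ℕ → V × G.LocalMemory → ℕ} {nx : ℕ → V × G.LocalMemory → V × G.LocalMemory}
    (h : G.elGame.board.Sol (fun ρ => G.elGame.formula.Sat fun i => G.elGame.label (ρ i))
      (G.elGame.winRegion P) {q | q < 1} (fun _ => P.bool) up nx)
    (htrap : ∀ x ∈ G.elGame.winRegion P, G.elGame.board.own x ≠ P.bool →
      ∀ y, G.elGame.edge x y → y ∈ G.elGame.winRegion P) : G.MemoryAtMost P 1 := by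
  classical
  choose succ hsucc using G.total
  have hz : (0 : ℕ) ∈ {q : ℕ | q < 1} := by simp
  have hloc : ∀ c ∈ G.formula.fEvents ∪ G.formula.gEvents, c = a := fun c hc =>
    (ha c).1 (MPFormula.has_iff.2 (Or.inr hc))
  -- With a single local event there are just two memory values.
  have hflag : ∀ L : G.LocalMemory, L ≠ G.initMemory → G.Flag a L := by
    intro L hL
    by_contra hn
    refine hL (localMemory_ext fun c hc => ?_)
    rw [hloc c hc]
    exact iff_of_false hn (not_flag_initMemory hφ haL)
  -- As soon as the event has been hit, the truth value of the formula is fixed, whatever comes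
  -- after.
  have hval : ∀ ρ, G.elGame.IsPlay ρ → (∃ i, G.Flag a (ρ i).2) →
      ((G.elGame.formula.Sat fun i => G.elGame.label (ρ i)) ↔ G.formula.val {a}) := by
    intro ρ hρ hi
    rw [elGame_sat_iff hφ hρ]
    refine MPFormula.val_congr fun c hc => ?_
    obtain rfl := (ha c).1 hc
    rw [Set.mem_ofPred_eq, seen_often_iff hφ hρ haL]
    simpa using hi
  let τ : MemStrategy G.toArena P (Fin 1) := {
    init := 0
    upd := fun _ _ => 0
    next := fun _ v => if (v, G.initMemory) ∈ G.elGame.winRegion P then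
      (nx 0 (v, G.initMemory)).1 else succ v
    legal := fun _ v _ => by
      by_cases hv : (v, G.initMemory) ∈ G.elGame.winRegion P
      · rw [if_pos hv]
        exact (h.legal _ hv 0 hz).1.1
      · rw [if_neg hv]
        exact hsucc v }
  refine ⟨1, le_rfl, τ, fun v hv π hπ h0 hc => ?_⟩
  rw [mem_winRegion_iff_elGame hφ] at hv
  obtain ⟨q, hq0, hq, hm⟩ := MemStrategy.exists_run hc
  obtain ⟨L, hL0, hL⟩ : ∃ L : ℕ → G.LocalMemory, L 0 = G.initMemory ∧
      ∀ i, L (i + 1) = G.updMemory (π i) (L i) :=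
    ⟨fun i => Nat.rec G.initMemory (fun i L => G.updMemory (π i) L) i, rfl, fun _ => rfl⟩
  let ρ : ℕ → V × G.LocalMemory := fun i => (π i, L i)
  have hρ : G.elGame.IsPlay ρ := fun i => ⟨hπ i, hL i⟩
  rw [winningPlay_iff, show (fun i => G.label (π i)) = fun i => G.label (ρ i).1 from rfl,
    sat_iff_elGame_sat hφ hρ hL0]
  have hmv : ∀ i, ρ i ∈ G.elGame.winRegion P → L i = G.initMemory →
      G.elGame.board.own (ρ i) = P.bool → ρ (i + 1) = nx 0 (ρ i) := by
    intro i hi hLi ho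
    have hρi : ρ i = (π i, G.initMemory) := by rw [← hLi]
    rw [hρi] at hi
    refine Prod.ext ?_ ?_
    · change π (i + 1) = _
      rw [hm i ((G.owns_iff P _).2 ho)]
      simp only [τ, if_pos hi, hρi]
    · have := (h.legal _ hi 0 hz).1.2
      rw [hρi, this, ← hLi]
      exact hL i
  -- While the flag is down, the play follows `nx`. When the flag goes up, the play is still in the
  -- winning region; a play produced by some winning strategy from there is won by `P`, and the play
  -- at hand has the same truth value, so the later moves need no care.
  by_cases hall : ∀ i, ρ i ∈ G.elGame.winRegion P ∧ L i = G.initMemory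
  · refine h.won (π := ρ) (q := fun _ => 0) ⟨hρ, fun i => ?_, fun i ho => hmv i (hall i).1 (hall i).2 ho⟩
      (fun i => (hall i).1) hz rfl
    have := h.mem _ (hall i).1 0 hz
    simpa [eq_comm] using this
  · obtain ⟨j, hj, hjL⟩ : ∃ j, ρ j ∈ G.elGame.winRegion P ∧ L j ≠ G.initMemory := by
      by_contra! hcon
      refine hall fun i => ?_
      induction i with
      | zero => exact ⟨by simpa only [ρ, h0, hL0] using hv, hL0⟩
      | succ i ih =>
        have hW : ρ (i + 1) ∈ G.elGame.winRegion P := by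
          by_cases ho : G.elGame.board.own (ρ i) = P.bool
          · rw [hmv i ih.1 ih.2 ho]
            exact (h.legal _ ih.1 0 hz).2
          · exact htrap _ ih.1 ho _ (hρ i)
        exact ⟨hW, hcon _ hW⟩
    obtain ⟨σ, hσ⟩ := hj
    obtain ⟨ρ', h1, h2, h3⟩ := exists_compatible_play σ (ρ j)
    have := hσ ρ' h1 h2 h3
    rw [winningPlay_iff, hval ρ' h1 ⟨0, by rw [h2]; exact hflag _ hjL⟩] at this
    rw [hval ρ hρ ⟨j, hflag _ hjL⟩, this]

theorem card_localMemory [Finite Γ] (hφ : G.formula.UniqueEvents) :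
    Nat.card G.LocalMemory = 2 ^ G.formula.numLocal := by
  rw [MPFormula.numLocal, hφ.localEvents_eq]
  exact Set.ncard_powerset _ (Set.toFinite _)

/-- The layer strategy with `k!` values, combined with the `2 ^ d` values for local events, meets
the bound except for `k = 0` and `d` from 1 to 3. Of these, `d = 1` is rescued by
`memoryAtMost_one`. -/
theorem memoryAtMost [Finite V] [Finite Γ] (hφ : G.formula.UniqueEvents) (P : Player)
    (hkd : ¬ (G.formula.numEL = 0 ∧ (G.formula.numLocal = 2 ∨ G.formula.numLocal = 3))) :
    G.MemoryAtMost P (G.formula.numEL + G.formula.numLocal).factorial := by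
  obtain ⟨win, up₀, nx₀, h₀, hwin⟩ := G.elGame_solved hφ
  obtain ⟨up, nx, h⟩ := exists_layered_sol hφ P.bool (Nat.factorial_pos _) h₀
  have hW : {x | win x = P.bool} = G.elGame.winRegion P := by
    ext x
    exact ((hwin P).1 x).symm
  rw [hW] at h
  have htrap : ∀ x ∈ G.elGame.winRegion P, G.elGame.board.own x ≠ P.bool →
      ∀ y, G.elGame.edge x y → y ∈ G.elGame.winRegion P := by
    intro x hx ho y hy
    rw [(hwin P).1] at hx ⊢
    rw [← hx]
    exact h₀.trap x trivial (by rwa [hx]) y trivial hy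
  by_cases h1 : G.formula.numEL = 0 ∧ G.formula.numLocal = 1
  · have hel : G.formula.elEvents = ∅ := (Set.ncard_eq_zero (Set.toFinite _)).1 h1.1
    obtain ⟨a, ha⟩ := Set.ncard_eq_one.1 h1.2
    rw [hφ.localEvents_eq] at ha
    rw [h1.1, Nat.factorial_zero] at h
    rw [h1.1, h1.2]
    refine memoryAtMost_one hφ P (a := a) (fun c => ?_) (ha ▸ rfl) h htrap
    rw [MPFormula.has_iff, hel, ha]
    simp
  · obtain ⟨τ, hτ⟩ := exists_memStrategy_of_sol (Nat.factorial_pos _) h htrap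
    refine memoryAtMost_of_memStrategy ?_ τ.withLocal fun v hv =>
      wins_withLocal hφ (hτ _ ((mem_winRegion_iff_elGame hφ P v).1 hv))
    rw [Nat.card_prod, card_localMemory hφ, Nat.card_eq_fintype_card, Fintype.card_fin, mul_comm]
    exact two_pow_mul_factorial_le (by omega)

end MPGame

end

section

/-! ## The bounds in exponential form -/

theorem factorial_le_pow_of_le {K n : ℕ} (h : K ≤ n) : K.factorial ≤ n ^ K :=
  (Nat.factorial_le_pow K).trans (Nat.pow_le_pow_left h K)

/-- The factorial costs another `n ^ K`, and `2 * K + 2 ≤ 4 * K` because `K ≥ 1`. -/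
theorem factorial_mul_pow_le {n K : ℕ} (hn : 2 ≤ n) (hK : K ≤ n) (hK' : 1 ≤ K) :
    K.factorial * n ^ (K + 2) ≤ n ^ (4 * K) :=
  calc K.factorial * n ^ (K + 2) ≤ n ^ K * n ^ (K + 2) :=
        Nat.mul_le_mul_right _ (factorial_le_pow_of_le hK)
    _ = n ^ (2 * K + 2) := by ring
    _ ≤ n ^ (4 * K) := Nat.pow_le_pow_right (by omega) (by omega)

theorem pow_eq_two_rpow {n : ℕ} (hn : 2 ≤ n) (e : ℕ) :
    ((n ^ e : ℕ) : ℝ) = (2 : ℝ) ^ ((e : ℝ) * Real.logb 2 n) := by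
  have hn0 : (0 : ℝ) < n := by exact_mod_cast (by omega : 0 < n)
  rw [mul_comm, Real.rpow_mul (by norm_num), Real.rpow_logb (by norm_num) (by norm_num) hn0]
  push_cast
  rw [Real.rpow_natCast]

theorem one_le_logb {n : ℕ} (hn : 2 ≤ n) : 1 ≤ Real.logb 2 n := by
  rw [Real.le_logb_iff_rpow_le (by norm_num) (by exact_mod_cast (by omega : 0 < n)), Real.rpow_one]
  exact_mod_cast hn

theorem bounds_exponential : ∃ C : ℝ, ∀ n k d : ℕ, 2 ≤ n → k + d ≤ n → 1 ≤ k + d →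
    (1 ≤ d → (((k + d).factorial * (n * 2 ^ d) ^ (k + d + 2) : ℕ) : ℝ) ≤
      (2 : ℝ) ^ (C * ((d : ℝ) * ((k : ℝ) + d) * Real.logb 2 n))) ∧
    (((k + d).factorial * n ^ (k + d + 2) : ℕ) : ℝ) ≤
      (2 : ℝ) ^ (C * (((k : ℝ) + d) * Real.logb 2 n)) := by
  -- Four comes from `factorial_mul_pow_le`, and three from the power of two, as `k + d + 2 ≤ 3 * (k
  -- + d)`.
  refine ⟨7, fun n k d hn hK hK' => ?_⟩
  have hl := one_le_logb hn
  have hKc : ((k + d : ℕ) : ℝ) = (k : ℝ) + d := by push_cast; ring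
  have hK1 : (1 : ℝ) ≤ (k : ℝ) + d := by rw [← hKc]; exact_mod_cast hK'
  have h1 := factorial_mul_pow_le hn hK hK'
  have hKl : 0 ≤ ((k : ℝ) + d) * Real.logb 2 n := by positivity
  have h4 : (((4 * (k + d) : ℕ)) : ℝ) * Real.logb 2 n = 4 * (((k : ℝ) + d) * Real.logb 2 n) := by
    push_cast; ring
  refine ⟨fun hd => ?_, ?_⟩
  · have hd1 : (1 : ℝ) ≤ d := by exact_mod_cast hd
    have h2 : (k + d).factorial * (n * 2 ^ d) ^ (k + d + 2) ≤
        n ^ (4 * (k + d)) * 2 ^ (3 * (d * (k + d))) :=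
      calc (k + d).factorial * (n * 2 ^ d) ^ (k + d + 2)
          = ((k + d).factorial * n ^ (k + d + 2)) * 2 ^ (d * (k + d + 2)) := by
            rw [mul_pow, ← pow_mul]; ring
        _ ≤ n ^ (4 * (k + d)) * 2 ^ (3 * (d * (k + d))) := by
            refine Nat.mul_le_mul h1 (Nat.pow_le_pow_right (by omega) ?_)
            rw [mul_left_comm]
            exact Nat.mul_le_mul_left d (by omega)
    calc (((k + d).factorial * (n * 2 ^ d) ^ (k + d + 2) : ℕ) : ℝ)
        ≤ ((n ^ (4 * (k + d)) * 2 ^ (3 * (d * (k + d))) : ℕ) : ℝ) := by exact_mod_cast h2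
      _ = (2 : ℝ) ^ (4 * (((k : ℝ) + d) * Real.logb 2 n) + 3 * ((d : ℝ) * ((k : ℝ) + d))) := by
          rw [Real.rpow_add (by norm_num), Nat.cast_mul, pow_eq_two_rpow hn, h4]
          congr 1
          rw [← hKc]
          exact_mod_cast (Real.rpow_natCast 2 (3 * (d * (k + d)))).symm
      _ ≤ _ := by
          refine Real.rpow_le_rpow_of_exponent_le (by norm_num) ?_
          have h5 : ((k : ℝ) + d) * Real.logb 2 n ≤ d * (((k : ℝ) + d) * Real.logb 2 n) :=
            le_mul_of_one_le_left hKl hd1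
          have h6 : (d : ℝ) * ((k : ℝ) + d) ≤ d * ((k : ℝ) + d) * Real.logb 2 n :=
            le_mul_of_one_le_right (by positivity) hl
          rw [← mul_assoc] at h5
          linarith
  · calc (((k + d).factorial * n ^ (k + d + 2) : ℕ) : ℝ) ≤ ((n ^ (4 * (k + d)) : ℕ) : ℝ) := by
          exact_mod_cast h1
      _ = (2 : ℝ) ^ (4 * (((k : ℝ) + d) * Real.logb 2 n)) := by rw [pow_eq_two_rpow hn, h4]
      _ ≤ _ := Real.rpow_le_rpow_of_exponent_le (by norm_num) (by linarith)

end

section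

/-! ## The product with the memory for local events, with natural numbers as nodes -/

/-- Bit `c` of `l` is set. -/
def BitOf (l c : ℕ) : Prop := l / 2 ^ c % 2 = 1

theorem bitOf_sum {S : Finset ℕ} {c : ℕ} : BitOf (∑ i ∈ S, 2 ^ i) c ↔ c ∈ S := by
  rw [BitOf]
  conv_rhs => rw [← Finset.toFinset_bitIndices_sum_two_pow S]
  rw [List.mem_toFinset, Nat.mem_bitIndices, Nat.testBit_eq_decide_div_mod_eq, decide_eq_true_iff]

theorem sum_two_pow_lt {S : Finset ℕ} {K : ℕ} (h : S ⊆ Finset.range K) : ∑ i ∈ S, 2 ^ i < 2 ^ K :=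
  (Finset.sum_le_sum_of_subset h).trans_lt (Nat.geomSum_lt le_rfl (by simp))

namespace MPGame

variable {n g : ℕ}

/-- The color of a node. -/
def hitColor (G : MPGame (Fin n) (Fin g)) (idx : Fin g → ℕ) (c v : ℕ) : Prop :=
  ∃ a : Fin g, G.formula.Has a ∧ idx a = c ∧ ∃ w : Fin n, w.val = v ∧ G.Hit a w

open Classical in
/-- The update of the memory for local events. -/
noncomputable def bitUpd (G : MPGame (Fin n) (Fin g)) (idx : Fin g → ℕ) (dd l v : ℕ) : ℕ :=
  ∑ c ∈ (Finset.range dd).filter (fun c => BitOf l c ∨ G.hitColor idx c v), 2 ^ c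

/-- The colors of the nodes of the product. -/
def prodCol (G : MPGame (Fin n) (Fin g)) (idx : Fin g → ℕ) (dd c x : ℕ) : Prop :=
  c < dd ∧ BitOf (x / n) c ∨ dd ≤ c ∧ G.hitColor idx c (x % n)

open Classical in
/-- The product of the game graph with the memory for local events. -/
noncomputable def prodBoard (G : MPGame (Fin n) (Fin g)) (idx : Fin g → ℕ) (dd : ℕ) : Board ℕ where
  own x := decide (∃ v : Fin n, x % n = v.val ∧ v ∈ G.sysNodes)
  edge x y := (∃ v w : Fin n, x % n = v.val ∧ y % n = w.val ∧ G.edge v w) ∧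
    y / n = G.bitUpd idx dd (x / n) (x % n)

variable {G : MPGame (Fin n) (Fin g)} {idx : Fin g → ℕ} {K dd : ℕ}

theorem bitUpd_lt (l v : ℕ) : G.bitUpd idx dd l v < 2 ^ dd := by
  classical exact sum_two_pow_lt (Finset.filter_subset _ _)

theorem bitOf_bitUpd {c l v : ℕ} (hc : c < dd) :
    BitOf (G.bitUpd idx dd l v) c ↔ BitOf l c ∨ G.hitColor idx c v := by
  classical
  rw [bitUpd, bitOf_sum, Finset.mem_filter, Finset.mem_range, and_iff_right hc]

theorem index_div {l v : ℕ} (hv : v < n) : (l * n + v) / n = l := by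
  rw [mul_comm, Nat.mul_add_div (by omega), Nat.div_eq_of_lt hv, add_zero]

theorem index_mod {l v : ℕ} (hv : v < n) : (l * n + v) % n = v := by
  rw [mul_comm, Nat.mul_add_mod, Nat.mod_eq_of_lt hv]

theorem hitColor_iff (hinj : Set.InjOn idx {a | G.formula.Has a}) {a : Fin g}
    (ha : G.formula.Has a) (v : Fin n) : G.hitColor idx (idx a) v ↔ G.Hit a v := by
  constructor
  · rintro ⟨b, hb, he, w, hw, h⟩
    rwa [← hinj hb ha he, ← Fin.ext hw]
  · exact fun h => ⟨a, ha, rfl, v, rfl, h⟩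

theorem bitOf_play {π : ℕ → Fin n} {l : ℕ → ℕ} (h0 : l 0 = 0)
    (hl : ∀ i, l (i + 1) = G.bitUpd idx dd (l i) (π i)) {c : ℕ} (hc : c < dd) (i : ℕ) :
    BitOf (l i) c ↔ ∃ j < i, G.hitColor idx c (π j) := by
  induction i with
  | zero => simp [h0, BitOf]
  | succ i ih =>
    rw [hl, bitOf_bitUpd hc, ih]
    constructor
    · rintro (⟨j, hj, h⟩ | h)
      exacts [⟨j, by omega, h⟩, ⟨i, by omega, h⟩]
    · rintro ⟨j, hj, h⟩
      rcases Nat.lt_succ_iff_lt_or_eq.1 hj with hj | rfl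
      exacts [Or.inl ⟨j, hj, h⟩, Or.inr h]

/-- The indices of the events are distinct and smaller than `K`; just the indices of local events
may be smaller than `dd`, and those of all local events are, unless the arena has memory for local
events. -/
structure IndexFor (G : MPGame (Fin n) (Fin g)) (idx : Fin g → ℕ) (K dd : ℕ) : Prop where
  inj : Set.InjOn idx {a | G.formula.Has a}
  lt : ∀ a, G.formula.Has a → idx a < K
  el : ∀ a ∈ G.formula.elEvents, dd ≤ idx a
  loc : ∀ a ∈ G.formula.fEvents ∪ G.formula.gEvents, idx a < dd ∨ G.HasLocalMemory
  le : dd ≤ K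

/-- Local events with an index below `dd` are read off their bits, which stay set once they are set.
For the others `IndexFor.loc` supplies memory in the arena, so that infinitely many hits may stand
for one. -/
theorem sat_iff_prod (hφ : G.formula.UniqueEvents) (hi : IndexFor G idx K dd) {π : ℕ → Fin n}
    (hπ : G.IsPlay π) {l : ℕ → ℕ} (h0 : l 0 = 0)
    (hl : ∀ i, l (i + 1) = G.bitUpd idx dd (l i) (π i)) :
    (G.formula.Sat fun i => G.label (π i)) ↔
      colorObj K (G.prodCol idx dd) (G.formula.table idx) (fun i => l i * n + (π i).val) := by
  rw [colorObj, MPFormula.table_eq_true]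
  have hcol : ∀ c i, G.prodCol idx dd c (l i * n + (π i).val) ↔
      c < dd ∧ BitOf (l i) c ∨ dd ≤ c ∧ G.hitColor idx c (π i).val := fun c i => by
    rw [prodCol, index_div (π i).2, index_mod (π i).2]
  have hmem : ∀ a, G.formula.Has a → (idx a ∈ infColors K (G.prodCol idx dd)
      (fun i => l i * n + (π i).val) ↔ ∀ m, ∃ j, m ≤ j ∧
        (idx a < dd ∧ BitOf (l j) (idx a) ∨ dd ≤ idx a ∧ G.Hit a (π j))) := fun a ha => by
    simp only [infColors, Finset.mem_filter, Finset.mem_range, hi.lt a ha, true_and, hcol,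
      hitColor_iff hi.inj ha]
  refine sat_iff hφ (fun a ha => ?_) fun a ha => ?_
  · have ha' : G.formula.Has a := MPFormula.has_iff.2 (Or.inl ha)
    have h1 := hi.el a ha
    rw [Set.mem_ofPred_eq, hmem a ha']
    simp [h1, h1.not_gt]
  · have ha' : G.formula.Has a := MPFormula.has_iff.2 (Or.inr ha)
    rw [Set.mem_ofPred_eq, hmem a ha']
    by_cases h1 : idx a < dd
    · simp only [h1, h1.not_ge, true_and, false_and, or_false, bitOf_play h0 hl h1,
        hitColor_iff hi.inj ha']
      constructor
      · intro h
        obtain ⟨j, -, i, -, hj⟩ := h 0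
        exact ⟨i, hj⟩
      · rintro ⟨i, h⟩ m
        exact ⟨m + i + 1, by omega, i, by omega, h⟩
    · rw [((hi.loc a ha).resolve_left h1).hit_iff hφ hπ ha]
      simp [h1, not_lt.1 h1]

/-- The memory after the end of the computation. -/
structure Output (n K dd : ℕ) (lup : ℕ → ℕ) (win : ℕ → Bool)
    (up nx : ℕ → ℕ → ℕ) (s : Store) : Prop where
  win : ∀ v < n, s.arr 0 v = (win v).toNat
  size : ∀ P, s.var (outSize P) = K.factorial * 2 ^ dd
  upd : ∀ P, ∀ q < K.factorial, ∀ x < 2 ^ dd * n,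
    s.arr (outUpd P) (q * (2 ^ dd * n) + x) = up q x * 2 ^ dd + lup x
  next : ∀ P, ∀ q < K.factorial, ∀ x < 2 ^ dd * n,
    s.arr (outNext P) (q * (2 ^ dd * n) + x) = nx q x % n

/-- A memory value `μ` combines the value `μ / 2 ^ dd` of the strategy for the product with the bit
mask `μ % 2 ^ dd`. The initial value `0` is admissible: its mask records no hits, and the strategy
for the product may start with any value. -/
theorem solutionIn_of_output (hn : 0 < n) (hφ : G.formula.UniqueEvents) (hi : IndexFor G idx K dd)
    {win : ℕ → Bool} {up nx : ℕ → ℕ → ℕ}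
    (h : (G.prodBoard idx dd).Sol (colorObj K (G.prodCol idx dd) (G.formula.table idx))
      {x | x < 2 ^ dd * n} {q | q < K.factorial} win up nx) {s : Store}
    (hs : Output n K dd (fun x => G.bitUpd idx dd (x / n) (x % n)) win up nx s) :
    G.SolutionIn (K.factorial * 2 ^ dd) s := by
  have hM : 0 < 2 ^ dd := Nat.two_pow_pos dd
  have hq : ∀ μ < K.factorial * 2 ^ dd, μ / 2 ^ dd < K.factorial := fun μ hμ =>
    (Nat.div_lt_iff_lt_mul hM).2 hμ
  have hx : ∀ μ v, v < n → μ % 2 ^ dd * n + v < 2 ^ dd * n := fun μ v hv => by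
    have : (μ % 2 ^ dd + 1) * n ≤ 2 ^ dd * n := Nat.mul_le_mul_right n (Nat.mod_lt μ hM)
    rw [Nat.add_mul, one_mul] at this
    omega
  -- The entry for `μ` and `v` has the same address as the entry for the strategy value and the
  -- product node that correspond to them, so the tables are translated cell by cell.
  have hidx : ∀ μ v, μ * n + v = μ / 2 ^ dd * (2 ^ dd * n) + (μ % 2 ^ dd * n + v) := fun μ v => by
    conv_lhs => rw [← Nat.div_add_mod μ (2 ^ dd)]
    ring
  have hupd : ∀ P, ∀ μ < K.factorial * 2 ^ dd, ∀ v < n, s.arr (outUpd P) (μ * n + v) =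
      up (μ / 2 ^ dd) (μ % 2 ^ dd * n + v) * 2 ^ dd + G.bitUpd idx dd (μ % 2 ^ dd) v := by
    intro P μ hμ v hv
    rw [hidx, hs.upd P _ (hq μ hμ) _ (hx μ v hv), index_div hv, index_mod hv]
  have hnext : ∀ P, ∀ μ < K.factorial * 2 ^ dd, ∀ v < n, s.arr (outNext P) (μ * n + v) =
      nx (μ / 2 ^ dd) (μ % 2 ^ dd * n + v) % n := by
    intro P μ hμ v hv
    rw [hidx, hs.next P _ (hq μ hμ) _ (hx μ v hv)]
  let τ : ∀ P, MemStrategy G.toArena P (Fin (s.var (outSize P))) := fun P => {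
    init := ⟨0, by rw [hs.size]; positivity⟩
    upd := fun μ v => ⟨s.arr (outUpd P) (μ * n + v), by
      have hμ := μ.2.trans_eq (hs.size P)
      refine lt_of_lt_of_eq ?_ (hs.size P).symm
      rw [hupd P μ hμ v v.2]
      have h1 : up _ _ < _ := h.mem _ (hx μ v v.2) _ (hq μ hμ)
      have h2 := Nat.mul_le_mul_right (2 ^ dd) (Nat.succ_le_of_lt h1)
      rw [Nat.succ_mul] at h2
      have := G.bitUpd_lt (idx := idx) (dd := dd) (μ % 2 ^ dd) v
      omega⟩
    next := fun μ v => ⟨s.arr (outNext P) (μ * n + v), by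
      have hμ := μ.2.trans_eq (hs.size P)
      rw [hnext P μ hμ v v.2]
      exact Nat.mod_lt _ hn⟩
    legal := fun μ v _ => by
      have hμ := μ.2.trans_eq (hs.size P)
      obtain ⟨⟨v', w, h1, h2, h3⟩, -⟩ := (h.legal _ (hx μ v v.2) _ (hq μ hμ)).1
      rw [index_mod v.2] at h1
      rw [← hnext P μ hμ v v.2] at h2
      have e1 : v = v' := Fin.ext h1
      subst e1
      have e2 : (⟨_, h2 ▸ w.2⟩ : Fin n) = w := Fin.ext h2
      rw [← e2] at h3
      exact h3 }
  have hw : ∀ P (v : Fin n), win v = P.bool → G.Wins (τ P).toStrategy v := by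
    intro P v hv π hπ h0 hc
    obtain ⟨μ, hμ0, hμ, hm⟩ := MemStrategy.exists_run hc
    have hlt : ∀ i, (μ i).val < K.factorial * 2 ^ dd := fun i => by
      exact (μ i).2.trans_eq (hs.size P)
    have hstep : ∀ i, (μ (i + 1)).val = up ((μ i).val / 2 ^ dd) ((μ i).val % 2 ^ dd * n + π i) *
        2 ^ dd + G.bitUpd idx dd ((μ i).val % 2 ^ dd) (π i) := fun i => by
      rw [← hupd P _ (hlt i) _ (π i).2, hμ]
    have hmod : ∀ i, (μ (i + 1)).val % 2 ^ dd = G.bitUpd idx dd ((μ i).val % 2 ^ dd) (π i) :=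
      fun i => by rw [hstep, index_mod (bitUpd_lt _ _)]
    have hl0 : (μ 0).val % 2 ^ dd = 0 := by rw [hμ0]; exact Nat.zero_mod _
    rw [winningPlay_iff, sat_iff_prod hφ hi hπ (l := fun i => (μ i).val % 2 ^ dd) hl0 hmod]
    have hedge : ∀ i, (G.prodBoard idx dd).edge ((μ i).val % 2 ^ dd * n + π i)
        ((μ (i + 1)).val % 2 ^ dd * n + π (i + 1)) := fun i => by
      refine ⟨⟨π i, π (i + 1), index_mod (π i).2, index_mod (π (i + 1)).2, hπ i⟩, ?_⟩
      rw [index_div (π (i + 1)).2, index_div (π i).2, index_mod (π i).2, hmod]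
    refine h.won (q := fun i => (μ i).val / 2 ^ dd) ⟨hedge, fun i => ?_, fun i hi => ?_⟩
      (fun i => hx _ _ (π i).2) (hq _ (hlt 0)) ?_
    · rw [hstep, index_div (bitUpd_lt _ _)]
    · have ho : G.Owns P (π i) := by
        rw [owns_iff, ← hi]
        simp only [board, prodBoard, index_mod (π i).2, decide_eq_decide]
        exact ⟨fun h => ⟨_, rfl, h⟩, fun ⟨w, h1, h2⟩ => Fin.ext h1 ▸ h2⟩
      have h1 : (π (i + 1)).val = nx ((μ i).val / 2 ^ dd) ((μ i).val % 2 ^ dd * n + π i) % n := by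
        rw [← hnext P _ (hlt i) _ (π i).2, hm i ho]
      have h2 := (h.legal _ (hx (μ i) _ (π i).2) _ (hq _ (hlt i))).1.2
      rw [index_div (π i).2, index_mod (π i).2, ← hmod] at h2
      rw [h1, ← h2]
      exact Nat.div_add_mod' _ n
    · simp only [hl0, zero_mul, zero_add, h0]
      exact hv
  have hreg : ∀ P (v : Fin n), v ∈ G.winRegion P ↔ win v = P.bool := fun P v =>
    mem_winRegion_iff (win := fun v : Fin n => win v) fun P v hv => ⟨_, hw P v hv⟩
  refine ⟨fun v => ?_, fun P => ⟨(hs.size P).le, τ P, rfl, fun _ _ => rfl, fun _ _ _ => rfl,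
    fun v hv => hw P v ((hreg P v).1 hv)⟩⟩
  rw [hreg, hreg, hs.win v v.2]
  cases win v <;> simp [Player.bool]

end MPGame

end

section

/-! ## The colors of the events -/

/-- Find the operators of the events. -/
def scanKinds : Cmd :=
  .forTo 40 (.var 2) (.cond (.get 3 (.var 40) - .const 3)
    (.store aKind (.get 4 (.var 40)) (.get 3 (.var 40))) .skip)

/-- Append the events with the property `e` to the list of events. -/
def collect (e : Expr) : Cmd :=
  .forTo 40 (.var 1) (.cond e
    (.store aEv (.var vK) (.var 40) ;; .store aIdx (.var 40) (.var vK) ;; vK ::= .var vK + 1) .skip)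

/-- Enumerate the events of the formula, with the local events first. -/
def findColors : Cmd :=
  scanKinds ;; collect (.get aKind (.var 40) - .const 5) ;; vLoc ::= .var vK ;;
    collect ((.get aKind (.var 40) - .const 3) - ((.get aKind (.var 40) - .const 5) +
      ((.get aKind (.var 40) - .const 5) + (.get aKind (.var 40) - .const 5))))

/-- Effect of an entry of the formula on the operators of the events. -/
def kindStep (f : ℕ → ℕ) (p : ℕ × ℕ) : ℕ → ℕ := if p.1 - 3 = 0 then f else Function.update f p.2 p.1

/-- If an event occurs repeatedly, the last occurrence decides. Hence only some operator of the
event is claimed here; uniqueness identifies it in `run_findColors`. -/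
theorem MPFormula.kindStep_code {g : ℕ} (φ : MPFormula (Fin g)) (f : ℕ → ℕ) (a : Fin g) :
    φ.code.foldl kindStep f a = f a ∧ ¬ φ.Has a ∨
      ∃ o, φ.Occurs o a ∧ φ.code.foldl kindStep f a = o.code := by
  have two : ∀ (p q : MPFormula (Fin g)) (k : ℕ), k - 3 = 0 →
      (∀ f : ℕ → ℕ, p.code.foldl kindStep f a = f a ∧ ¬ p.Has a ∨
        ∃ o, p.Occurs o a ∧ p.code.foldl kindStep f a = o.code) →
      (∀ f : ℕ → ℕ, q.code.foldl kindStep f a = f a ∧ ¬ q.Has a ∨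
        ∃ o, q.Occurs o a ∧ q.code.foldl kindStep f a = o.code) → ∀ f : ℕ → ℕ,
      (p.code ++ q.code ++ [(k, 0)]).foldl kindStep f a = f a ∧
        ¬ (∃ o, p.Occurs o a ∨ q.Occurs o a) ∨ ∃ o, (p.Occurs o a ∨ q.Occurs o a) ∧
        (p.code ++ q.code ++ [(k, 0)]).foldl kindStep f a = o.code := by
    intro p q k hk hp hq f
    simp only [List.foldl_append, List.foldl_cons, List.foldl_nil, kindStep, hk, if_true]
    rcases hq (p.code.foldl kindStep f) with ⟨h1, h2⟩ | ⟨o, h1, h2⟩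
    · rcases hp f with ⟨h3, h4⟩ | ⟨o, h3, h4⟩
      · refine Or.inl ⟨h1.trans h3, ?_⟩
        rintro ⟨o, h | h⟩
        exacts [h4 ⟨o, h⟩, h2 ⟨o, h⟩]
      · exact Or.inr ⟨o, Or.inl h3, h1.trans h4⟩
    · exact Or.inr ⟨o, Or.inr h1, h2⟩
  induction φ generalizing f with
  | tt => exact Or.inl ⟨rfl, fun ⟨_, h⟩ => h⟩
  | ff => exact Or.inl ⟨rfl, fun ⟨_, h⟩ => h⟩
  | atom o b =>
    have ho : o.code - 3 ≠ 0 := by cases o <;> decide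
    by_cases h : a = b
    · subst h
      exact Or.inr ⟨o, ⟨rfl, rfl⟩, by simp [code, kindStep, ho]⟩
    · refine Or.inl ⟨?_, fun ⟨_, h'⟩ => h h'.2⟩
      have : (a : ℕ) ≠ b := fun h' => h (Fin.ext h')
      simp [code, kindStep, ho, this]
  | and p q hp hq => exact two p q 2 rfl hp hq f
  | or p q hp hq => exact two p q 3 rfl hp hq f

theorem List.take_succ_getD {α : Type*} (l : List α) (d : α) {j : ℕ} (hj : j < l.length) :
    l.take (j + 1) = l.take j ++ [l.getD j d] := by
  rw [List.take_succ_eq_append_getElem hj, List.getD_eq_getElem _ _ hj]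

theorem MPFormula.length_code {g : ℕ} (φ : MPFormula (Fin g)) : φ.code.length = φ.size := by
  induction φ with
  | tt => rfl
  | ff => rfl
  | atom => rfl
  | and p q hp hq => simp [code, size, hp, hq, add_assoc]
  | or p q hp hq => simp [code, size, hp, hq, add_assoc]

variable {ps : List Cmd} {s : Store} {n g : ℕ}

/-- The memory contains the game. -/
structure InputIn (G : MPGame (Fin n) (Fin g)) (s : Store) : Prop where
  nodes : s.var 0 = n
  events : s.var 1 = g
  size : s.var 2 = G.formula.size
  own : ∀ v : Fin n, s.arr 0 v = bit (v ∈ G.sysNodes)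
  edge : ∀ v w : Fin n, s.arr 1 (v.val * n + w) = bit (G.edge v w)
  label : ∀ (v : Fin n) (a : Fin g), s.arr 2 (v.val * g + a) = bit (a ∈ G.label v)
  op : ∀ i, s.arr 3 i = (G.formula.code.getD i (0, 0)).1
  event : ∀ i, s.arr 4 i = (G.formula.code.getD i (0, 0)).2

theorem InputIn.frame {G : MPGame (Fin n) (Fin g)} {s s' : Store} {vs as : List ℕ}
    (h : InputIn G s) (hf : Frame vs as s s') (hv : decide (0 ∉ vs ∧ 1 ∉ vs ∧ 2 ∉ vs) = true)
    (ha : decide (0 ∉ as ∧ 1 ∉ as ∧ 2 ∉ as ∧ 3 ∉ as ∧ 4 ∉ as) = true) : InputIn G s' := by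
  obtain ⟨v0, v1, v2⟩ := of_decide_eq_true hv
  obtain ⟨a0, a1, a2, a3, a4⟩ := of_decide_eq_true ha
  refine ⟨?_, ?_, ?_, ?_, ?_, ?_, ?_, ?_⟩
  · rw [hf.var _ v0, h.nodes]
  · rw [hf.var _ v1, h.events]
  · rw [hf.var _ v2, h.size]
  · rw [hf.arr _ a0]; exact h.own
  · rw [hf.arr _ a1]; exact h.edge
  · rw [hf.arr _ a2]; exact h.label
  · rw [hf.arr _ a3]; exact h.op
  · rw [hf.arr _ a4]; exact h.event

theorem inputIn_input (G : MPGame (Fin n) (Fin g)) : InputIn G G.input := by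
  have two : ∀ {m : ℕ} (p : Fin n → Fin m → Prop) (v : Fin n) (w : Fin m),
      (∃ (v' : Fin n) (w' : Fin m), v.val * m + w = v'.val * m + w' ∧ p v' w') ↔ p v w := by
    intro m p v w
    refine ⟨fun ⟨v', w', h, hp⟩ => ?_, fun h => ⟨v, w, rfl, h⟩⟩
    have h1 := congrArg (· / m) h
    have h2 := congrArg (· % m) h
    simp only [MPGame.index_div w.2, MPGame.index_div w'.2, MPGame.index_mod w.2,
      MPGame.index_mod w'.2] at h1 h2
    rwa [Fin.ext h1, Fin.ext h2]
  refine ⟨rfl, rfl, rfl, fun v => ?_, fun v w => ?_, fun v a => ?_, fun _ => rfl, fun _ => rfl⟩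
  · change bit _ = bit _
    congr 1
    exact propext ⟨fun ⟨w, h1, h2⟩ => Fin.ext h1 ▸ h2, fun h => ⟨v, rfl, h⟩⟩
  · change bit _ = bit _
    congr 1
    exact propext (two G.edge v w)
  · change bit _ = bit _
    congr 1
    exact propext (two (fun v a => a ∈ G.label v) v a)

theorem run_scanKinds {G : MPGame (Fin n) (Fin g)} (h : InputIn G s) :
    Run ps scanKinds s (G.formula.size * 4 + 2) fun s' =>
      s'.arr aKind = G.formula.code.foldl kindStep (s.arr aKind) := by
  refine Run.forTo [] [aKind] _ 2 (fun j s' => s'.arr aKind =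
    (G.formula.code.take j).foldl kindStep (s.arr aKind)) rfl rfl (fun s' hf => ?_) (by simp) ?_ ?_
  · rw [Expr.eval_var, hf.var _ (by simp), h.size]
  · intro j hj s' hf hv hI
    have h' := h.frame hf rfl rfl
    refine Run.straight 2 rfl (by decide) ?_
    rw [← MPFormula.length_code] at hj
    rw [List.take_succ_getD _ (0, 0) hj, List.foldl_append, ← hI]
    simp only [Cmd.den, Expr.eval_sub, Expr.eval_get, Expr.eval_var, Expr.eval_const, hv, h'.op,
      h'.event, List.foldl_cons, List.foldl_nil, kindStep]
    split_ifs <;> simp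
  · intro s' hf hv hI
    rw [hI, ← MPFormula.length_code, List.take_length]

/-- On the new entries `aEv` and `aIdx` are inverse to each other, and older entries survive, so a
second run can append to the list. -/
theorem run_collect {e : Expr} {p : ℕ → Prop} {k : ℕ} (hk : s.var vK = k) (hg : s.var 1 = g)
    (he : ∀ s', Frame [40, vK] [aEv, aIdx] s s' → (e.eval s' ≠ 0 ↔ p (s'.var 40))) :
    Run ps (collect e) s (g * 6 + 2) fun s' => s'.var vK = k + countP p g ∧
      (∀ a < g, p a → k ≤ s'.arr aIdx a ∧ s'.arr aIdx a < k + countP p g ∧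
        s'.arr aEv (s'.arr aIdx a) = a) ∧
      (∀ c, k ≤ c → c < k + countP p g → ∃ a < g, p a ∧ s'.arr aEv c = a ∧ s'.arr aIdx a = c) ∧
      (∀ c < k, s'.arr aEv c = s.arr aEv c) ∧
      ∀ a, ¬ (a < g ∧ p a) → s'.arr aIdx a = s.arr aIdx a := by
  refine Run.forTo [vK] [aEv, aIdx] _ 4 (fun j s' => s'.var vK = k + countP p j ∧
      (∀ a < j, p a → k ≤ s'.arr aIdx a ∧ s'.arr aIdx a < k + countP p j ∧
        s'.arr aEv (s'.arr aIdx a) = a) ∧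
      (∀ c, k ≤ c → c < k + countP p j → ∃ a < j, p a ∧ s'.arr aEv c = a ∧ s'.arr aIdx a = c) ∧
      (∀ c < k, s'.arr aEv c = s.arr aEv c) ∧
      ∀ a, ¬ (a < j ∧ p a) → s'.arr aIdx a = s.arr aIdx a) rfl rfl (fun s' hf => ?_) ?_ ?_
      (fun s' _ _ hI => hI)
  · rw [Expr.eval_var, hf.var _ (by simp), hg]
  · simp only [Store.setVar_var, Store.setVar_arr, countP_zero, add_zero]
    refine ⟨by simpa using hk, fun a ha => absurd ha (by omega), fun c h1 h2 => by omega,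
      fun _ _ => by simp, fun _ _ => by simp⟩
  · rintro j hj s' hf hv ⟨h1, h2, h3, h4, h5⟩
    have hp := he s' hf
    rw [hv] at hp
    refine Run.cond (T := 3) (fun h0 => ?_) (fun h0 => ?_)
    · have hpj := hp.1 h0
      refine Run.straight 3 rfl (by decide) ?_
      simp only [Cmd.den, Expr.eval_var, Expr.eval_add, Expr.eval_one, Store.setVar_var,
        Store.setArr_var, Store.setVar_arr, Store.setArr_arr, countP_succ, hpj, if_true, h1, hv]
      norm_num
      refine ⟨by ring, fun a ha hpa => ?_, fun c hc hc' => ?_, fun c hc => ?_, fun a ha => ?_⟩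
      · rcases Nat.lt_or_eq_of_le ha with ha' | rfl
        · obtain ⟨h6, h7, h8⟩ := h2 a ha' hpa
          rw [Function.update_of_ne ha'.ne, Function.update_of_ne h7.ne]
          exact ⟨h6, by omega, h8⟩
        · simp only [Function.update_self]
          exact ⟨by omega, by omega, trivial⟩
      · by_cases hcc : c = k + countP p j
        · subst hcc
          exact ⟨j, by omega, hpj, by simp, by simp⟩
        · obtain ⟨a, ha, hpa, h6, h7⟩ := h3 c hc (by omega)
          refine ⟨a, by omega, hpa, ?_, ?_⟩
          · rw [Function.update_of_ne hcc, h6]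
          · rw [Function.update_of_ne ha.ne, h7]
      · rw [Function.update_of_ne (by omega), h4 c hc]
      · have : a ≠ j := by rintro rfl; exact ha (by omega) hpj
        rw [Function.update_of_ne this]
        exact h5 a fun h => ha (by omega) h.2
    · have hpj : ¬ p j := fun h => hp.2 h h0
      refine (Run.skip ?_).mono (by omega)
      simp only [Store.setVar_var, Store.setVar_arr, countP_succ, hpj, if_false, add_zero]
      refine ⟨by simpa using h1, fun a ha hpa => ?_, fun c hc hc' => ?_, h4, fun a ha => ?_⟩
      · refine h2 a ?_ hpa
        rcases Nat.lt_succ_iff_lt_or_eq.1 ha with ha' | rfl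
        exacts [ha', absurd hpa hpj]
      · obtain ⟨a, ha, h⟩ := h3 c hc hc'
        exact ⟨a, by omega, h⟩
      · exact h5 a fun h => ha ⟨by omega, h.2⟩

/-- The memory contains the enumeration of the events. -/
structure ColorsIn (G : MPGame (Fin n) (Fin g)) (s : Store) : Prop where
  colors : s.var vK = G.formula.numEL + G.formula.numLocal
  locals : s.var vLoc = G.formula.numLocal
  kind : ∀ (a : Fin g) o, G.formula.Occurs o a → s.arr aKind a = o.code
  idx : ∀ a : Fin g, G.formula.Has a →
    s.arr aIdx a < G.formula.numEL + G.formula.numLocal ∧ s.arr aEv (s.arr aIdx a) = a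
  el : ∀ a ∈ G.formula.elEvents, G.formula.numLocal ≤ s.arr aIdx a.val
  loc : ∀ a ∈ G.formula.fEvents ∪ G.formula.gEvents, s.arr aIdx a.val < G.formula.numLocal
  ev : ∀ c < G.formula.numEL + G.formula.numLocal, ∃ a : Fin g, G.formula.Has a ∧
    s.arr aEv c = a ∧ s.arr aIdx a = c

theorem ColorsIn.frame {G : MPGame (Fin n) (Fin g)} {s s' : Store} {vs as : List ℕ}
    (h : ColorsIn G s) (hf : Frame vs as s s') (hv : decide (vK ∉ vs ∧ vLoc ∉ vs) = true)
    (ha : decide (aKind ∉ as ∧ aEv ∉ as ∧ aIdx ∉ as) = true) : ColorsIn G s' := by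
  obtain ⟨v0, v1⟩ := of_decide_eq_true hv
  obtain ⟨a0, a1, a2⟩ := of_decide_eq_true ha
  refine ⟨?_, ?_, ?_, ?_, ?_, ?_, ?_⟩
  · rw [hf.var _ v0, h.colors]
  · rw [hf.var _ v1, h.locals]
  · rw [hf.arr _ a0]; exact h.kind
  · rw [hf.arr _ a1, hf.arr _ a2]; exact h.idx
  · rw [hf.arr _ a2]; exact h.el
  · rw [hf.arr _ a2]; exact h.loc
  · rw [hf.arr _ a1, hf.arr _ a2]; exact h.ev

theorem countP_congr {p q : ℕ → Prop} {N : ℕ} (h : ∀ i < N, p i ↔ q i) :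
    countP p N = countP q N := by
  induction N with
  | zero => rw [countP_zero, countP_zero]
  | succ N ih =>
    rw [countP_succ, countP_succ, ih fun i hi => h i (Nat.lt_succ_of_lt hi),
      propext (h N (Nat.lt_succ_self N))]

theorem countP_fin {g : ℕ} (E : Set (Fin g)) : countP (fun i => ∃ a ∈ E, a.val = i) g = E.ncard := by
  classical
  rw [← Set.ncard_image_of_injective E Fin.val_injective, countP, ← Set.ncard_coe_finset]
  congr 1
  ext i
  simp only [Finset.coe_filter, Finset.mem_range, Set.mem_ofPred_eq, Set.mem_image]
  exact ⟨fun h => h.2, fun ⟨a, ha, h⟩ => ⟨h ▸ a.2, a, ha, h⟩⟩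

/-- Local events are collected first: the colors below `d` are those that may get a bit in the
product. -/
theorem run_findColors {G : MPGame (Fin n) (Fin g)} (hφ : G.formula.UniqueEvents)
    (h : InputIn G s) (h0 : s.var vK = 0) (hK : ∀ i, s.arr aKind i = 0) :
    Run ps findColors s (G.formula.size * 4 + g * 12 + 7) (ColorsIn G) := by
  rw [show G.formula.size * 4 + g * 12 + 7 =
    (G.formula.size * 4 + 2) + ((g * 6 + 2) + (1 + (g * 6 + 2))) by ring]
  refine Run.seq_imp ((run_scanKinds h).frame [40] [aKind] rfl) ?_
  rintro s₁ ⟨f₁, hk₁⟩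
  have hkind : ∀ (a : Fin g) o, G.formula.Occurs o a → s₁.arr aKind a = o.code := by
    intro a o ho
    rcases G.formula.kindStep_code (s.arr aKind) a with h1 | ⟨o', h1, h2⟩
    · exact absurd ⟨o, ho⟩ h1.2
    · rw [hk₁, h2, hφ a o o' ho h1]
  have hkind' : ∀ a : Fin g, ¬ G.formula.Has a → s₁.arr aKind a = 0 := by
    intro a ha
    rcases G.formula.kindStep_code (s.arr aKind) a with h1 | ⟨o', h1, h2⟩
    · rw [hk₁, h1.1, hK]
    · exact absurd ⟨o', h1⟩ ha
  have hel : ∀ a : Fin g, (s₁.arr aKind a = 4 ∨ s₁.arr aKind a = 5) ↔ a ∈ G.formula.elEvents := by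
    intro a
    constructor
    · intro hk
      by_contra hn
      by_cases ha : G.formula.Has a
      · rcases (MPFormula.has_iff.1 ha).resolve_left hn with h1 | h1 <;>
          · have := hkind a _ h1
            simp only [TempOp.code] at this
            omega
      · have := hkind' a ha
        omega
    · rintro (h1 | h1)
      exacts [Or.inl (hkind a _ h1), Or.inr (hkind a _ h1)]
  have hloc : ∀ a : Fin g, 5 < s₁.arr aKind a ↔ a ∈ G.formula.localEvents := by
    intro a
    rw [hφ.localEvents_eq]
    constructor
    · intro hk
      by_contra hn
      by_cases ha : G.formula.Has a
      · have := (hel a).2 ((MPFormula.has_iff.1 ha).resolve_right hn)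
        omega
      · have := hkind' a ha
        omega
    · rintro (h1 | h1) <;>
      · have := hkind a _ h1
        simp only [TempOp.code] at this
        omega
  have hle : ∀ a : Fin g, s₁.arr aKind a < 8 ∧ (s₁.arr aKind a = 0 ∨ 4 ≤ s₁.arr aKind a) := by
    intro a
    by_cases ha : G.formula.Has a
    · obtain ⟨o, ho⟩ := ha
      rw [hkind a o ho]
      cases o <;> simp [TempOp.code]
    · simp [hkind' a ha]
  have hin₁ := h.frame f₁ rfl rfl
  refine Run.seq_imp ((run_collect (g := g) (k := 0) (p := fun i => ¬ (s₁.arr aKind i - 5 = 0))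
    (by simp [f₁.var, h0]) hin₁.events fun s' hf => ?_).frame [40, vK] [aEv, aIdx] rfl) ?_
  · simp [hf.arr]
  rintro s₂ ⟨f₂, c1, c2, c3, -, -⟩
  have hd : countP (fun i => ¬ (s₁.arr aKind i - 5 = 0)) g = G.formula.numLocal := by
    rw [MPFormula.numLocal, ← countP_fin]
    refine countP_congr fun i hi => ?_
    constructor
    · exact fun h => ⟨⟨i, hi⟩, (hloc ⟨i, hi⟩).1 (show 5 < s₁.arr aKind i by omega), rfl⟩
    · rintro ⟨a, ha, rfl⟩
      have := (hloc a).2 ha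
      omega
  simp only [hd, zero_add, zero_le, true_and] at c1 c2 c3
  refine Run.seq (Run.assign ?_)
  -- Among the possible values 0, 4, 5, 6, 7 of `κ`, the truncated difference `(κ - 3) - 3 * (κ -
  -- 5)` is positive just for 4 and 5, the codes of `GF` and `FG`.
  have hpe : ∀ i < g, ¬ ((s₁.arr aKind i - 3) - ((s₁.arr aKind i - 5) + ((s₁.arr aKind i - 5) +
      (s₁.arr aKind i - 5))) = 0) ↔ ∃ a ∈ G.formula.elEvents, a.val = i := by
    intro i hi
    have h1 := hle ⟨i, hi⟩
    simp only at h1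
    constructor
    · exact fun h => ⟨⟨i, hi⟩, (hel ⟨i, hi⟩).1 (by simp only; omega), rfl⟩
    · rintro ⟨a, ha, rfl⟩
      have := (hel a).2 ha
      omega
  have hk : countP (fun i => ¬ ((s₁.arr aKind i - 3) - ((s₁.arr aKind i - 5) +
      ((s₁.arr aKind i - 5) + (s₁.arr aKind i - 5))) = 0)) g = G.formula.numEL := by
    rw [MPFormula.numEL, ← countP_fin]
    exact countP_congr hpe
  refine ((run_collect (g := g) (k := G.formula.numLocal)
    (p := fun i => ¬ ((s₁.arr aKind i - 3) - ((s₁.arr aKind i - 5) + ((s₁.arr aKind i - 5) +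
      (s₁.arr aKind i - 5))) = 0)) (by simp [c1])
    (by simp [f₂.var, hin₁.events]) fun s' hf => ?_).frame [40, vK] [aEv, aIdx] rfl).imp ?_
  · simp [hf.arr, f₂.arr]
  rintro s₄ ⟨f₄, d1, d2, d3, d4, d5⟩
  simp only [hk, Store.setVar_arr] at d1 d2 d3 d4 d5
  have hK₄ : s₄.arr aKind = s₁.arr aKind := by simp [f₄.arr, f₂.arr]
  have el₄ : ∀ a ∈ G.formula.elEvents, G.formula.numLocal ≤ s₄.arr aIdx a.val ∧
      s₄.arr aIdx a.val < G.formula.numLocal + G.formula.numEL ∧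
      s₄.arr aEv (s₄.arr aIdx a.val) = a := fun a ha =>
    d2 a a.2 ((hpe a a.2).2 ⟨a, ha, rfl⟩)
  have loc₄ : ∀ a ∈ G.formula.fEvents ∪ G.formula.gEvents,
      s₄.arr aIdx a.val < G.formula.numLocal ∧ s₄.arr aEv (s₄.arr aIdx a.val) = a := by
    intro a ha
    have ha' := ha
    rw [← hφ.localEvents_eq, ← hloc] at ha'
    obtain ⟨h1, h2⟩ := c2 a a.2 (by omega)
    rw [d5 a fun h => ?_, d4 _ h1]
    · exact ⟨h1, h2⟩
    · obtain ⟨b, hb, hba⟩ := (hpe a a.2).1 h.2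
      rw [Fin.ext hba] at hb
      exact hφ.disjoint hb ha
  refine ⟨by rw [d1, add_comm], ?_, fun a o ho => by rw [hK₄]; exact hkind a o ho, fun a ha => ?_,
    fun a ha => (el₄ a ha).1, fun a ha => (loc₄ a ha).1, fun c hc => ?_⟩
  · rw [f₄.var _ (by simp)]
    simp [c1]
  · rcases MPFormula.has_iff.1 ha with ha | ha
    · have := el₄ a ha
      exact ⟨by omega, this.2.2⟩
    · have := loc₄ a ha
      exact ⟨by omega, this.2⟩
  · by_cases hcd : c < G.formula.numLocal
    · obtain ⟨a, ha, h1, h2, h3⟩ := c3 c trivial hcd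
      have hal : (⟨a, ha⟩ : Fin g) ∈ G.formula.localEvents := (hloc ⟨a, ha⟩).1 (by simp only; omega)
      rw [hφ.localEvents_eq] at hal
      refine ⟨⟨a, ha⟩, MPFormula.has_iff.2 (Or.inr hal), ?_, ?_⟩
      · rw [d4 c hcd, h2]
      · rw [d5 a fun h => ?_, h3]
        obtain ⟨b, hb, rfl⟩ := (hpe a ha).1 h.2
        exact hφ.disjoint hb hal
    · obtain ⟨a, ha, h1, h2, h3⟩ := d3 c (by omega) (by omega)
      obtain ⟨b, hb, rfl⟩ := (hpe a ha).1 h1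
      exact ⟨b, MPFormula.has_iff.2 (Or.inl hb), h2, h3⟩

end

section

/-! ## Arithmetic tables -/

variable {ps : List Cmd} {s : Store}

/-- Store the powers of two. -/
def powTable : Cmd :=
  .store aPow 0 1 ;; .forTo 40 (.var vK) (.store aPow (.var 40 + 1)
    (.get aPow (.var 40) + .get aPow (.var 40)))

theorem run_powTable {K : ℕ} (hK : s.var vK = K) :
    Run ps powTable s (K * 3 + 3) fun s' => ∀ c ≤ K, s'.arr aPow c = 2 ^ c := by
  rw [show K * 3 + 3 = 1 + (K * (1 + 2) + 2) by ring]
  refine Run.seq (Run.store ?_)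
  refine Run.forTo [] [aPow] _ 1 (fun j s' => ∀ c ≤ j, s'.arr aPow c = 2 ^ c) rfl rfl
    (fun s' hf => ?_) ?_ ?_ (fun s' _ _ hI => hI)
  · rw [Expr.eval_var, hf.var _ (by simp)]
    exact hK
  · intro c hc
    obtain rfl : c = 0 := by omega
    simp
  · intro j hj s' hf hv hI
    refine Run.store fun c hc => ?_
    simp only [Expr.eval_add, Expr.eval_var, Expr.eval_get, Expr.eval_one, hv, Store.setVar_arr,
      Store.setArr_arr, if_true]
    rcases Nat.lt_or_eq_of_le hc with hc | rfl
    · rw [Function.update_of_ne hc.ne, hI c (by omega)]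
    · rw [Function.update_self, hI j le_rfl]
      ring

/-- Store the first `e` multiples of `x` in the array `a`. -/
def mulTable (a : ℕ) (e x : Expr) : Cmd :=
  48 ::= 0 ;; .forTo 40 e (.store a (.var 40) (.var 48) ;; 48 ::= .var 48 + x)

theorem run_mulTable {a k m : ℕ} {e x : Expr}
    (he : ∀ s', Frame [40, 48] [a] s s' → e.eval s' = k)
    (hx : ∀ s', Frame [40, 48] [a] s s' → x.eval s' = m) :
    Run ps (mulTable a e x) s (k * 4 + 3) fun s' => ∀ i < k, s'.arr a i = i * m := by
  rw [show k * 4 + 3 = 1 + (k * (2 + 2) + 2) by ring]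
  refine Run.seq (Run.assign ?_)
  have h1 : Frame [40, 48] [a] s (s.setVar 48 0) := (Frame.refl _ _ _).setVar (by simp) _
  refine Run.forTo [48] [a] _ 2 (fun j s' => s'.var 48 = j * m ∧ ∀ i < j, s'.arr a i = i * m)
    (by simp [Cmd.within]) rfl (fun s' hf => he s' (h1.trans hf)) (by simp) ?_ (fun s' _ _ hI => hI.2)
  rintro j hj s' hf hv ⟨h2, h3⟩
  refine Run.straight 2 rfl le_rfl ⟨?_, fun i hi => ?_⟩
  · have := hx _ ((h1.trans hf).setArr (a := a) (by simp) j (j * m))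
    simp [Cmd.den, hv, h2, this]
    ring
  · simp only [Cmd.den, Expr.eval_var, Expr.eval_add, Store.setVar_arr, Store.setArr_arr, if_true,
      hv, h2]
    rcases Nat.lt_succ_iff_lt_or_eq.1 hi with hi | rfl
    · rw [Function.update_of_ne hi.ne, h3 i hi]
    · rw [Function.update_self]

/-- Store the factorials. -/
def factTable : Cmd :=
  .store aFact 0 1 ;; .forTo 40 (.var vK) (48 ::= 0 ;;
    .forTo 41 (.var 40 + 1) (48 ::= .var 48 + .get aFact (.var 40)) ;;
    .store aFact (.var 40 + 1) (.var 48))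

/-- Each factorial is a repeated sum of the previous one; the quadratic total is negligible. -/
theorem run_factTable {K : ℕ} (hK : s.var vK = K) :
    Run ps factTable s (K * (K * 3 + 6) + 3) fun s' => ∀ m ≤ K, s'.arr aFact m = m.factorial := by
  rw [show K * (K * 3 + 6) + 3 = 1 + (K * ((1 + ((K * (1 + 2) + 2) + 1)) + 2) + 2) by ring]
  refine Run.seq (Run.store ?_)
  refine Run.forTo [41, 48] [aFact] _ _ (fun j s' => ∀ m ≤ j, s'.arr aFact m = m.factorial) rfl rfl
    (fun s' hf => ?_) ?_ ?_ (fun s' _ _ hI => hI)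
  · rw [Expr.eval_var, hf.var _ (by simp)]
    exact hK
  · intro c hc
    obtain rfl : c = 0 := by omega
    simp
  · intro j hj s' hf hv hI
    refine Run.seq (Run.assign ?_)
    refine Run.seq_imp ((((Run.forTo [48] [] (j + 1) 1
      (fun i s'' => s''.var 48 = i * j.factorial) (Q := fun s'' =>
        s''.var 48 = (j + 1) * j.factorial) rfl rfl (fun s'' hf' => ?_) (by simp) ?_
        (fun _ _ _ h => h)).mono ?_)).frame [41, 48] [] rfl) ?_
    · simp [hf'.var, hv]
    · intro i hi s'' hf' hv' hI'
      refine Run.assign ?_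
      have := hI j le_rfl
      simp [hI', hf'.var, hf'.arr, hv, this]
      ring
    · have : (j + 1) * (1 + 2) ≤ K * (1 + 2) := Nat.mul_le_mul_right _ hj
      omega
    · rintro s₂ ⟨hf₂, h2⟩
      refine Run.store fun m hm => ?_
      simp only [Expr.eval_add, Expr.eval_var, Expr.eval_one, Store.setVar_arr, Store.setArr_arr,
        if_true, h2, hf₂.var 40 (by simp), hf₂.arr aFact (by simp), Store.setVar_var, hv]
      norm_num
      rcases Nat.lt_or_eq_of_le hm with hm | rfl
      · rw [Function.update_of_ne hm.ne, hI m (by omega)]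
      · rw [Function.update_self, Nat.factorial_succ]

/-- Store halves and parities. -/
def halfTable : Cmd :=
  48 ::= 0 ;; 49 ::= 0 ;; .forTo 40 (.var vPK) (.store aHalf (.var 40) (.var 48) ;;
    .store aPar (.var 40) (.var 49) ;;
    .cond (.var 49) (48 ::= .var 48 + 1 ;; 49 ::= 0) (49 ::= 1))

/-- Counting up with a toggled bit yields quotients and remainders by two, so that masks can later
be taken apart by table lookups. -/
theorem run_halfTable {k : ℕ} (hk : s.var vPK = k) :
    Run ps halfTable s (k * 7 + 4) fun s' =>
      ∀ i < k, s'.arr aHalf i = i / 2 ∧ s'.arr aPar i = i % 2 := by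
  rw [show k * 7 + 4 = 1 + (1 + (k * (5 + 2) + 2)) by ring]
  refine Run.seq (Run.assign (Run.seq (Run.assign ?_)))
  refine Run.forTo [48, 49] [aHalf, aPar] _ 5 (fun j s' => s'.var 48 = j / 2 ∧ s'.var 49 = j % 2 ∧
    ∀ i < j, s'.arr aHalf i = i / 2 ∧ s'.arr aPar i = i % 2) rfl rfl (fun s' hf => ?_) (by simp) ?_
    (fun s' _ _ hI => hI.2.2)
  · simp [hf.var, hk]
  · rintro j hj s' hf hv ⟨h1, h2, h3⟩
    have key : ∀ i < j + 1, Function.update (s'.arr aHalf) j (j / 2) i = i / 2 ∧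
        Function.update (s'.arr aPar) j (j % 2) i = i % 2 := by
      intro i hi
      rcases Nat.lt_succ_iff_lt_or_eq.1 hi with hi | rfl
      · rw [Function.update_of_ne hi.ne, Function.update_of_ne hi.ne]
        exact h3 i hi
      · simp
    refine Run.straight 5 rfl (by decide) ?_
    rcases Nat.mod_two_eq_zero_or_one j with hj2 | hj2
    · simp only [Cmd.den, Expr.eval_var, Store.setArr_var, hv, h1, h2, hj2, if_true]
      refine ⟨by simp [h1]; omega, by simp; omega, fun i hi => ?_⟩
      have := key i hi
      rw [hj2] at this
      simpa using this
    · simp only [Cmd.den, Expr.eval_var, Store.setArr_var, hv, h1, h2, hj2, one_ne_zero, if_false]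
      refine ⟨by simp [h1]; omega, by simp; omega, fun i hi => ?_⟩
      have := key i hi
      rw [hj2] at this
      simpa using this

/-- Compute all arithmetic tables. -/
def numbers : Cmd :=
  powTable ;; vM ::= .get aPow (.var vDD) ;; vPK ::= .get aPow (.var vK) ;;
    mulTable aRN (.var vM + .var 0 + 1) (.var 0) ;; vN ::= .get aRN (.var vM) ;;
    mulTable aRG (.var 0) (.var 1) ;; factTable ;;
    mulTable aRow (.get aFact (.var vK) + .var vN + 1) (.var vN) ;;
    mulTable aRowM (.get aFact (.var vK) + 1) (.var vM) ;; halfTable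

/-- The memory contains the arithmetic tables. -/
structure NumbersIn (n g K dd : ℕ) (s : Store) : Prop where
  colors : s.var vK = K
  locals : s.var vDD = dd
  layers : s.var vM = 2 ^ dd
  sets : s.var vPK = 2 ^ K
  size : s.var vN = 2 ^ dd * n
  pow : ∀ c ≤ K, s.arr aPow c = 2 ^ c
  mulN : ∀ i ≤ 2 ^ dd + n, s.arr aRN i = i * n
  mulG : ∀ i < n, s.arr aRG i = i * g
  fact : ∀ m ≤ K, s.arr aFact m = m.factorial
  row : ∀ i ≤ K.factorial + 2 ^ dd * n, s.arr aRow i = i * (2 ^ dd * n)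
  rowM : ∀ i ≤ K.factorial, s.arr aRowM i = i * 2 ^ dd
  half : ∀ i < 2 ^ K, s.arr aHalf i = i / 2
  par : ∀ i < 2 ^ K, s.arr aPar i = i % 2

theorem NumbersIn.frame {n g K dd : ℕ} {s s' : Store} {vs as : List ℕ}
    (h : NumbersIn n g K dd s) (hf : Frame vs as s s')
    (hv : [vK, vDD, vM, vPK, vN].all (fun x => !decide (x ∈ vs)) = true)
    (ha : [aPow, aRN, aRG, aFact, aRow, aRowM, aHalf, aPar].all (fun x => !decide (x ∈ as)) = true) :
    NumbersIn n g K dd s' := by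
  simp only [List.all_cons, List.all_nil, Bool.and_true, Bool.and_eq_true, Bool.not_eq_true',
    decide_eq_false_iff_not] at hv ha
  obtain ⟨v1, v2, v3, v4, v5⟩ := hv
  obtain ⟨a1, a2, a3, a4, a5, a6, a7, a8⟩ := ha
  constructor
  · rw [hf.var _ v1, h.colors]
  · rw [hf.var _ v2, h.locals]
  · rw [hf.var _ v3, h.layers]
  · rw [hf.var _ v4, h.sets]
  · rw [hf.var _ v5, h.size]
  · rw [hf.arr _ a1]; exact h.pow
  · rw [hf.arr _ a2]; exact h.mulN
  · rw [hf.arr _ a3]; exact h.mulG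
  · rw [hf.arr _ a4]; exact h.fact
  · rw [hf.arr _ a5]; exact h.row
  · rw [hf.arr _ a6]; exact h.rowM
  · rw [hf.arr _ a7]; exact h.half
  · rw [hf.arr _ a8]; exact h.par

theorem run_numbers {n g K dd : ℕ} (h0 : s.var 0 = n) (h1 : s.var 1 = g) (hK : s.var vK = K)
    (hd : s.var vDD = dd) (hdK : dd ≤ K) :
    Run ps numbers s ((K * 3 + 3) + (1 + (1 + (((2 ^ dd + n + 1) * 4 + 3) + (1 + ((n * 4 + 3) +
      ((K * (K * 3 + 6) + 3) + (((K.factorial + 2 ^ dd * n + 1) * 4 + 3) +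
      (((K.factorial + 1) * 4 + 3) + (2 ^ K * 7 + 4)))))))))) (NumbersIn n g K dd) := by
  refine Run.seq_imp ((run_powTable hK).frame [40] [aPow] rfl) ?_
  rintro s₁ ⟨f₁, pow⟩
  refine Run.seq (Run.assign (Run.seq (Run.assign ?_)))
  simp only [Expr.eval_get, Expr.eval_var, Store.setVar_var, Store.setVar_arr, f₁.var vDD (by simp),
    f₁.var vK (by simp), hK, hd, pow dd hdK]
  norm_num
  rw [pow K le_rfl]
  set s₂ := (s₁.setVar vM (2 ^ dd)).setVar vPK (2 ^ K) with hs₂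
  have f₂ : Frame [40, vM, vPK] [aPow] s s₂ :=
    ((f₁.weaken rfl rfl).setVar (by simp) _).setVar (by simp) _
  have m₂ : s₂.var vM = 2 ^ dd := by simp [hs₂]
  have k₂ : s₂.var vPK = 2 ^ K := by simp [hs₂]
  have p₂ : s₂.arr aPow = s₁.arr aPow := rfl
  clear_value s₂
  refine Run.seq_imp ((run_mulTable (k := 2 ^ dd + n + 1) (m := n) (fun s' hf => ?_)
    fun s' hf => ?_).frame [40, 48] [aRN] rfl) ?_
  · simp [hf.var, m₂, f₂.var, h0]
  · simp [hf.var, f₂.var, h0]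
  rintro s₃ ⟨f₃, mulN⟩
  refine Run.seq (Run.assign ?_)
  rw [Expr.eval_get, Expr.eval_var, f₃.var _ (by simp), m₂, mulN _ (by omega)]
  set s₄ := s₃.setVar vN (2 ^ dd * n) with hs₄
  have f₄ : Frame [40, 48, vN] [aRN] s₂ s₄ := (f₃.weaken rfl rfl).setVar (by simp) _
  have n₄ : s₄.var vN = 2 ^ dd * n := by simp [hs₄]
  have p₄ : s₄.arr aRN = s₃.arr aRN := rfl
  clear_value s₄
  have g₄ : Frame [40, 48, vM, vPK, vN] [aPow, aRN] s s₄ := (f₂.weaken rfl rfl).trans (f₄.weaken rfl rfl)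
  refine Run.seq_imp ((run_mulTable (k := n) (m := g) (fun s' hf => ?_)
    fun s' hf => ?_).frame [40, 48] [aRG] rfl) ?_
  · simp [hf.var, g₄.var, h0]
  · simp [hf.var, g₄.var, h1]
  rintro s₅ ⟨f₅, mulG⟩
  refine Run.seq_imp ((run_factTable (K := K) ?_).frame [40, 41, 48] [aFact] rfl) ?_
  · rw [f₅.var _ (by simp), g₄.var _ (by simp), hK]
  rintro s₆ ⟨f₆, fact⟩
  have f₄₆ : Frame [40, 41, 48] [aRG, aFact] s₄ s₆ := (f₅.weaken rfl rfl).trans (f₆.weaken rfl rfl)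
  have hK₆ : s₆.var vK = K := by rw [f₄₆.var _ (by simp), g₄.var _ (by simp), hK]
  refine Run.seq_imp ((run_mulTable (k := K.factorial + 2 ^ dd * n + 1) (m := 2 ^ dd * n)
    (fun s' hf => ?_) fun s' hf => ?_).frame [40, 48] [aRow] rfl) ?_
  · simp [hf.var, hf.arr, hK₆, fact, f₄₆.var, n₄]
  · simp [hf.var, f₄₆.var, n₄]
  rintro s₇ ⟨f₇, row⟩
  refine Run.seq_imp ((run_mulTable (k := K.factorial + 1) (m := 2 ^ dd)
    (fun s' hf => ?_) fun s' hf => ?_).frame [40, 48] [aRowM] rfl) ?_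
  · simp [hf.var, hf.arr, f₇.var, f₇.arr, hK₆, fact]
  · simp [hf.var, f₇.var, f₄₆.var, f₄.var, m₂]
  rintro s₈ ⟨f₈, rowM⟩
  refine ((run_halfTable (k := 2 ^ K) ?_).frame [40, 48, 49] [aHalf, aPar] rfl).imp ?_
  · simp [f₈.var, f₇.var, f₄₆.var, f₄.var, k₂]
  rintro s₉ ⟨f₉, half⟩
  constructor
  · simp [f₉.var, f₈.var, f₇.var, hK₆]
  · simp [f₉.var, f₈.var, f₇.var, f₄₆.var, g₄.var, hd]
  · simp [f₉.var, f₈.var, f₇.var, f₄₆.var, f₄.var, m₂]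
  · simp [f₉.var, f₈.var, f₇.var, f₄₆.var, f₄.var, k₂]
  · simp [f₉.var, f₈.var, f₇.var, f₄₆.var, n₄]
  · rw [f₉.arr _ (by simp), f₈.arr _ (by simp), f₇.arr _ (by simp), f₄₆.arr _ (by simp),
      f₄.arr _ (by simp), p₂]
    exact pow
  · rw [f₉.arr _ (by simp), f₈.arr _ (by simp), f₇.arr _ (by simp), f₄₆.arr _ (by simp), p₄]
    exact fun i hi => mulN i (by omega)
  · rw [f₉.arr _ (by simp), f₈.arr _ (by simp), f₇.arr _ (by simp), f₆.arr _ (by simp)]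
    exact mulG
  · rw [f₉.arr _ (by simp), f₈.arr _ (by simp), f₇.arr _ (by simp)]
    exact fact
  · rw [f₉.arr _ (by simp), f₈.arr _ (by simp)]
    exact fun i hi => row i (by omega)
  · rw [f₉.arr _ (by simp)]
    exact fun i hi => rowM i (by omega)
  · exact fun i hi => (half i hi).1
  · exact fun i hi => (half i hi).2

end

section

/-! ## The nodes of the product -/

theorem bit_congr {p q : Prop} (h : p ↔ q) : bit p = bit q := by rw [propext h]

theorem bit_eq_zero {p : Prop} : bit p = 0 ↔ ¬ p := by
  unfold bit
  split_ifs with h <;> simp [h]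

theorem bit_true {p : Prop} (h : p) : bit p = 1 := if_pos h

theorem bit_false {p : Prop} (h : ¬ p) : bit p = 0 := if_neg h

theorem bit_eq_toNat {p : Prop} [Decidable p] : bit p = (decide p).toNat := by
  by_cases h : p <;> simp [bit, h]

/-- Negate the bit `x` for the operators `FG` and `G`. -/
def flip (k : Expr) (x : ℕ) : Cmd :=
  .cond (k - .const 4) (.cond (k - .const 5) (.cond (k - .const 6) (x ::= 1 - .var x) .skip)
    (x ::= 1 - .var x)) .skip

/-- The nested tests tell the codes 4 to 7 apart; the negation takes place for 5 and 7, the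
operators of negative polarity. -/
theorem run_flip {ps : List Cmd} {s : Store} {Q : Store → Prop} {k : Expr} {x : ℕ} {o : TempOp}
    {p : Prop} (hk : k.eval s = o.code) (hx : s.var x = bit p)
    (h : Q (s.setVar x (bit (p ↔ ¬ o.Neg)))) : Run ps (flip k x) s 4 Q := by
  refine Run.straight 4 rfl le_rfl ?_
  have h0 : (s.setVar x (bit p)) = s := by
    rw [Store.setVar, ← hx, Function.update_eq_self]
  have h1 : 1 - bit p = bit (¬ p) := by
    by_cases hp : p <;> simp [bit, hp]
  cases o <;> simp [flip, Cmd.den, hk, TempOp.code, TempOp.Neg, h0, hx, h1] at h ⊢ <;> exact h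

namespace MPGame

theorem bitUpd_succ {n g : ℕ} {G : MPGame (Fin n) (Fin g)} {idx : Fin g → ℕ} {j l v : ℕ} :
    G.bitUpd idx (j + 1) l v = G.bitUpd idx j l v +
      bit (BitOf l j ∨ G.hitColor idx j v) * 2 ^ j := by
  unfold bitUpd bit
  rw [Finset.range_add_one, Finset.filter_insert]
  split_ifs with h
  · rw [Finset.sum_insert (by simp), one_mul, add_comm]
  · rw [zero_mul, add_zero]

end MPGame

variable {ps : List Cmd} {s : Store} {n g K dd : ℕ} {G : MPGame (Fin n) (Fin g)} {idx : Fin g → ℕ}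

/-- The memory contains the game, the colors of the events, and the arithmetic tables. -/
structure Setup (G : MPGame (Fin n) (Fin g)) (idx : Fin g → ℕ) (K dd : ℕ) (s : Store) :
    Prop where
  uniq : G.formula.UniqueEvents
  input : InputIn G s
  num : NumbersIn n g K dd s
  le : dd ≤ K
  inj : Set.InjOn idx {a | G.formula.Has a}
  index : ∀ a : Fin g, s.arr aIdx a = idx a
  lt : ∀ a, G.formula.Has a → idx a < K
  ev : ∀ c < K, ∃ a o, G.formula.Occurs o a ∧ idx a = c ∧ s.arr aEv c = a.val ∧
    s.arr aKind a = o.code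

theorem Setup.frame {s s' : Store} {vs as : List ℕ} (h : Setup G idx K dd s) (hf : Frame vs as s s')
    (hv : [0, 1, 2, vK, vDD, vM, vPK, vN].all (fun x => !decide (x ∈ vs)) = true)
    (ha : [0, 1, 2, 3, 4, aPow, aRN, aRG, aFact, aRow, aRowM, aHalf, aPar, aEv, aIdx, aKind].all
      (fun x => !decide (x ∈ as)) = true) : Setup G idx K dd s' := by
  simp only [List.all_cons, List.all_nil, Bool.and_true, Bool.and_eq_true, Bool.not_eq_true',
    decide_eq_false_iff_not] at hv ha
  obtain ⟨v1, v2, v3, v4, v5, v6, v7, v8⟩ := hv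
  obtain ⟨a1, a2, a3, a4, a5, a6, a7, a8, a9, b1, b2, b3, b4, b5, b6, b7⟩ := ha
  refine ⟨h.uniq, h.input.frame hf (by simp [*]) (by simp [*]), h.num.frame hf (by simp [*])
    (by simp [*]), h.le, h.inj, ?_, h.lt, ?_⟩
  · rw [hf.arr _ b6]; exact h.index
  · rw [hf.arr _ b5, hf.arr _ b7]; exact h.ev

/-- Compute the colors and the memory update of a node of the product. -/
def nodeColors : Cmd :=
  .forTo 41 (.var vK) (52 ::= .get 2 (.get aRG (.var 48) + .get aEv (.var 41)) ;;
    flip (.get aKind (.get aEv (.var 41))) 52 ;;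
    .cond (.var vDD - .var 41)
      (.store aCol (.get aRow (.var 41) + .var 40) (.get aPar (.var 50)) ;;
        .cond (.get aPar (.var 50) + .var 52) (51 ::= .var 51 + .get aPow (.var 41)) .skip ;;
        50 ::= .get aHalf (.var 50))
      (.store aCol (.get aRow (.var 41) + .var 40) (.var 52)))

/-- The mask is consumed bit by bit. Local events with a bit are colored by the old bit, while the
hit at the node enters the new mask; from color `dd` on there are no bits to consume, whence `j ≤
dd` and `min j dd` in the invariant. -/
theorem run_nodeColors (hS : Setup G idx K dd s) {x : ℕ} (hn : 0 < n) (hx : x < 2 ^ dd * n)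
    (hKg : K ≤ 2 ^ dd * n) (h40 : s.var 40 = x) (h48 : s.var 48 = x % n)
    (h50 : s.var 50 = x / n) (h51 : s.var 51 = 0) :
    Run ps nodeColors s (K * 12 + 2) fun s' =>
      s'.var 51 = G.bitUpd idx dd (x / n) (x % n) ∧
      (∀ c < K, s'.arr aCol (c * (2 ^ dd * n) + x) = bit (G.prodCol idx dd c x)) ∧
      ∀ i, (∀ c < K, i ≠ c * (2 ^ dd * n) + x) → s'.arr aCol i = s.arr aCol i := by
  have hl : x / n < 2 ^ dd := (Nat.div_lt_iff_lt_mul hn).2 hx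
  have hv : x % n < n := Nat.mod_lt _ hn
  have hlK : x / n < 2 ^ K := hl.trans_le (Nat.pow_le_pow_right (by omega) hS.le)
  refine Run.forTo [50, 51, 52] [aCol] K 10 (fun j s' => (j ≤ dd → s'.var 50 = x / n / 2 ^ j) ∧
      s'.var 51 = G.bitUpd idx (min j dd) (x / n) (x % n) ∧
      (∀ c < j, s'.arr aCol (c * (2 ^ dd * n) + x) = bit (G.prodCol idx dd c x)) ∧
      ∀ i, (∀ c < K, i ≠ c * (2 ^ dd * n) + x) → s'.arr aCol i = s.arr aCol i) rfl rfl
    (fun s' hf => ?_) ?_ ?_ ?_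
  · rw [Expr.eval_var, hf.var _ (by simp), hS.num.colors]
  · refine ⟨by simp [h50], by simp [h51, MPGame.bitUpd], by simp, by simp⟩
  · rintro j hj s' hf h41 ⟨i1, i2, i3, i4⟩
    have hS' := hS.frame hf rfl rfl
    obtain ⟨a, o, ho, hia, hev, hkind⟩ := hS'.ev j hj
    have hhit : G.hitColor idx j (x % n) ↔ (a ∈ G.label ⟨x % n, hv⟩ ↔ ¬ o.Neg) := by
      rw [← hia, MPGame.hitColor_iff hS.inj ⟨o, ho⟩ ⟨x % n, hv⟩, MPGame.Hit, hS.uniq.neg_iff ho]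
    have e40 : s'.var 40 = x := by rw [hf.var _ (by simp), h40]
    have e48 : s'.var 48 = x % n := by rw [hf.var _ (by simp), h48]
    have hcol : ∀ p : Prop, (p ↔ G.prodCol idx dd j x) →
        (∀ c < j + 1, Function.update (s'.arr aCol) (j * (2 ^ dd * n) + x) (bit p)
          (c * (2 ^ dd * n) + x) = bit (G.prodCol idx dd c x)) ∧
        ∀ i, (∀ c < K, i ≠ c * (2 ^ dd * n) + x) →
          Function.update (s'.arr aCol) (j * (2 ^ dd * n) + x) (bit p) i = s.arr aCol i := by
      intro p hp
      refine ⟨fun c hc => ?_, fun i hi => ?_⟩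
      · rcases Nat.lt_succ_iff_lt_or_eq.1 hc with hc | rfl
        · rw [Function.update_of_ne, i3 c hc]
          rw [Ne, index_inj hx hx]
          omega
        · rw [Function.update_self, propext hp]
      · rw [Function.update_of_ne (hi j hj), i4 i hi]
    refine Run.seq (T₁ := 1) (T₂ := 9) (Run.assign (Run.seq (T₁ := 4) (T₂ := 5) (run_flip (o := o)
      (p := a ∈ G.label ⟨x % n, hv⟩) ?_ ?_ (Run.cond (T := 4) (fun h => ?_) (fun h => ?_)))))
    · simp [hev, hkind, h41]
    · simp only [Expr.eval_get, Expr.eval_add, Expr.eval_var, e48, h41, hev, hS'.num.mulG _ hv,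
        Store.setVar_var, if_true]
      exact hS'.input.label ⟨x % n, hv⟩ a
    · have hjd : j < dd := by
        simp [hS'.num.locals, h41] at h
        omega
      have hcur : x / n / 2 ^ j < 2 ^ K := (Nat.div_le_self _ _).trans_lt hlK
      have hpar : x / n / 2 ^ j % 2 = bit (BitOf (x / n) j) := by
        unfold bit BitOf
        split_ifs <;> omega
      have hor : (bit (BitOf (x / n) j) = 0 ∧ bit (a ∈ G.label ⟨x % n, hv⟩ ↔ ¬ o.Neg) = 0) ↔
          ¬ (BitOf (x / n) j ∨ G.hitColor idx j (x % n)) := by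
        rw [bit_eq_zero, bit_eq_zero, hhit]
        tauto
      obtain ⟨c1, c2⟩ := hcol _ (show BitOf (x / n) j ↔ G.prodCol idx dd j x by
        simp [MPGame.prodCol, hjd, hjd.not_ge])
      rw [min_eq_left hjd.le] at i2
      rw [min_eq_left (Nat.succ_le_of_lt hjd), MPGame.bitUpd_succ]
      refine Run.straight 4 rfl le_rfl ?_
      have r1 := hS'.num.row j (by omega)
      have r2 := hS'.num.half _ hcur
      have r3 := hS'.num.par _ hcur
      have r4 := hS'.num.pow j hj.le
      have hstep : x / n / 2 ^ (j + 1) = x / n / 2 ^ j / 2 := by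
        rw [pow_succ, ← Nat.div_div_eq_div_mul]
      have i1' := i1 hjd.le
      simp only [hstep]
      generalize x / n / 2 ^ j = u at *
      by_cases hb : BitOf (x / n) j ∨ G.hitColor idx j (x % n)
      · have := hor.not_left.2 hb
        simp [Cmd.den, e40, h41, i1', i2, r1, r2, r3, r4, hpar, this, bit_true hb,
          Nat.succ_le_of_lt hjd]
        exact ⟨fun c hc => c1 c (by omega), c2⟩
      · have := hor.2 hb
        rw [this.1] at c1 c2
        simp [Cmd.den, e40, h41, i1', i2, r1, r2, r3, hpar, this, bit_false hb,
          Nat.succ_le_of_lt hjd]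
        exact ⟨fun c hc => c1 c (by omega), c2⟩
    · have hjd : dd ≤ j := by
        simp [hS'.num.locals, h41] at h
        omega
      obtain ⟨c1, c2⟩ := hcol _ (show (a ∈ G.label ⟨x % n, hv⟩ ↔ ¬ o.Neg) ↔ G.prodCol idx dd j x by
        simp [MPGame.prodCol, hjd, hjd.not_gt, hhit])
      have r1 := hS'.num.row j (by omega)
      rw [min_eq_right hjd] at i2
      rw [min_eq_right (hjd.trans j.le_succ)]
      refine Run.straight 4 rfl (by decide) ⟨fun h => absurd h (by omega), ?_⟩
      simp [Cmd.den, e40, h41, i2, r1]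
      exact ⟨fun c hc => c1 c (by omega), c2⟩
  · rintro s' hf - ⟨-, i2, i3, i4⟩
    rw [min_eq_right hS.le] at i2
    exact ⟨i2, i3, i4⟩

end

section

/-! ## The graph of the product -/

variable {ps : List Cmd} {s : Store} {n g K dd : ℕ} {G : MPGame (Fin n) (Fin g)} {idx : Fin g → ℕ}

/-- Compute the owners and the colors of the nodes of the product. -/
def nodes : Cmd :=
  48 ::= 0 ;; 49 ::= 0 ;; .forTo 40 (.var vN) (.store aNode (.var 40) (.var 48) ;;
    .store aLay (.var 40) (.var 49) ;; .store aOwn (.var 40) (.get 0 (.var 48)) ;;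
    50 ::= .var 49 ;; 51 ::= 0 ;; nodeColors ;; .store aLupd (.var 40) (.var 51) ;;
    48 ::= .var 48 + 1 ;; .cond (.var 0 - .var 48) .skip (48 ::= 0 ;; 49 ::= .var 49 + 1))

/-- The memory contains the data of the node `x` of the product. -/
structure NodeIn (G : MPGame (Fin n) (Fin g)) (idx : Fin g → ℕ) (K dd x : ℕ) (s : Store) :
    Prop where
  node : s.arr aNode x = x % n
  lay : s.arr aLay x = x / n
  own : s.arr aOwn x = ((G.prodBoard idx dd).own x).toNat
  upd : s.arr aLupd x = G.bitUpd idx dd (x / n) (x % n)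
  col : ∀ c < K, s.arr aCol (c * (2 ^ dd * n) + x) = bit (G.prodCol idx dd c x)

theorem NodeIn.frame {x : ℕ} {s s' : Store} {vs as : List ℕ} (h : NodeIn G idx K dd x s)
    (hf : Frame vs as s s')
    (ha : [aNode, aLay, aOwn, aLupd, aCol].all (fun x => !decide (x ∈ as)) = true) :
    NodeIn G idx K dd x s' := by
  simp only [List.all_cons, List.all_nil, Bool.and_true, Bool.and_eq_true, Bool.not_eq_true',
    decide_eq_false_iff_not] at ha
  obtain ⟨a1, a2, a3, a4, a5⟩ := ha
  constructor
  · rw [hf.arr _ a1, h.node]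
  · rw [hf.arr _ a2, h.lay]
  · rw [hf.arr _ a3, h.own]
  · rw [hf.arr _ a4, h.upd]
  · rw [hf.arr _ a5]; exact h.col

/-- The program enumerates the product by incrementing the node with a carry into the layer, and so
needs no division. -/
theorem succ_div_mod {n j : ℕ} (hn : 0 < n) : j % n + 1 < n ∧ (j + 1) % n = j % n + 1 ∧
    (j + 1) / n = j / n ∨ j % n + 1 = n ∧ (j + 1) % n = 0 ∧ (j + 1) / n = j / n + 1 := by
  have h1 := Nat.div_add_mod j n
  have h2 := Nat.mod_lt j hn
  rcases Nat.lt_or_eq_of_le (Nat.succ_le_of_lt h2) with h | h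
  · refine Or.inl ⟨h, ?_⟩
    have : j + 1 = j / n * n + (j % n + 1) := by rw [mul_comm]; omega
    rw [this, MPGame.index_div h, MPGame.index_mod h]
    exact ⟨rfl, rfl⟩
  · refine Or.inr ⟨h, ?_⟩
    have : j + 1 = (j / n + 1) * n + 0 := by rw [add_mul, mul_comm]; omega
    rw [this, MPGame.index_div hn, MPGame.index_mod hn]
    exact ⟨rfl, rfl⟩

theorem run_nodes (hS : Setup G idx K dd s) (hn : 0 < n) (hKg : K ≤ 2 ^ dd * n) :
    Run ps nodes s (2 ^ dd * n * (K * 12 + 14) + 4) fun s' =>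
      ∀ x < 2 ^ dd * n, NodeIn G idx K dd x s' := by
  rw [show 2 ^ dd * n * (K * 12 + 14) + 4 = 1 + (1 + (2 ^ dd * n * ((1 + (1 + (1 + (1 + (1 +
    ((K * 12 + 2) + 5)))))) + 2) + 2)) by ring]
  refine Run.seq (Run.assign (Run.seq (Run.assign ?_)))
  have f₀ : Frame [48, 49] [] s ((s.setVar 48 (Expr.eval s 0)).setVar 49
      (Expr.eval (s.setVar 48 (Expr.eval s 0)) 0)) :=
    ((Frame.refl _ _ _).setVar (by simp) _).setVar (by simp) _
  have hS₀ := hS.frame f₀ rfl rfl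
  refine Run.forTo [41, 48, 49, 50, 51, 52] [aNode, aLay, aOwn, aCol, aLupd] _ _ (fun j s' =>
    s'.var 48 = j % n ∧ s'.var 49 = j / n ∧ ∀ x < j, NodeIn G idx K dd x s') rfl rfl
    (fun s' hf => ?_) (by simp) ?_ (fun s' _ _ hI => hI.2.2)
  · rw [Expr.eval_var, hf.var _ (by simp), hS₀.num.size]
  rintro j hj s' hf h40 ⟨i1, i2, i3⟩
  have hS' := hS₀.frame hf rfl rfl
  have hv : j % n < n := Nat.mod_lt _ hn
  refine Run.seq (Run.store (Run.seq (Run.store (Run.seq (Run.store (Run.seq (Run.assign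
    (Run.seq (Run.assign ?_)))))))))
  set s₁ := Store.setVar _ _ _ with hs₁
  have f₁ : Frame [50, 51] [aNode, aLay, aOwn] s' s₁ := (((((Frame.refl _ _ _).setArr
    (by simp) _ _).setArr (by simp) _ _).setArr (by simp) _ _).setVar (by simp) _).setVar (by simp) _
  have h1 : s₁.arr aNode = Function.update (s'.arr aNode) j (j % n) := by simp [hs₁, h40, i1]
  have h2 : s₁.arr aLay = Function.update (s'.arr aLay) j (j / n) := by simp [hs₁, h40, i2]
  have h3 : s₁.arr aOwn = Function.update (s'.arr aOwn) j (((G.prodBoard idx dd).own j).toNat) := by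
    have h4 := hS'.input.own ⟨j % n, hv⟩
    simp only at h4
    have h5 : (∃ v : Fin n, j % n = v ∧ v ∈ G.sysNodes) ↔ (⟨j % n, hv⟩ : Fin n) ∈ G.sysNodes :=
      ⟨fun ⟨v, h5, h6⟩ => by
        have : v = ⟨j % n, hv⟩ := Fin.ext h5.symm
        exact this ▸ h6, fun h => ⟨_, rfl, h⟩⟩
    have h6 : s'.arr 0 (j % n) = ((G.prodBoard idx dd).own j).toNat := by
      rw [h4, ← bit_congr h5]
      classical exact bit_eq_toNat
    simp [hs₁, h40, i1, h6]
  have h50 : s₁.var 50 = j / n := by simp [hs₁, i2]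
  have h51 : s₁.var 51 = 0 := by simp [hs₁]
  clear_value s₁
  refine Run.seq_imp ((run_nodeColors (hS'.frame f₁ rfl rfl) (x := j) hn hj hKg
    (by simp [f₁.var, h40]) (by simp [f₁.var, i1]) h50 h51).frame [41, 50, 51, 52] [aCol] rfl) ?_
  rintro s₂ ⟨f₂, c1, c2, c3⟩
  have h40₂ : s₂.var 40 = j := by simp [f₂.var, f₁.var, h40]
  have h48₂ : s₂.var 48 = j % n := by simp [f₂.var, f₁.var, i1]
  have h49₂ : s₂.var 49 = j / n := by simp [f₂.var, f₁.var, i2]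
  have h0₂ : s₂.var 0 = n := by simp [f₂.var, f₁.var, hS'.input.nodes]
  have key : ∀ s₃ : Store, s₃.arr aNode = s₂.arr aNode → s₃.arr aLay = s₂.arr aLay →
      s₃.arr aOwn = s₂.arr aOwn → s₃.arr aCol = s₂.arr aCol → s₃.arr aLupd =
      Function.update (s₂.arr aLupd) j (G.bitUpd idx dd (j / n) (j % n)) → ∀ x < j + 1,
      NodeIn G idx K dd x s₃ := by
    intro s₃ e1 e2 e3 e4 e5 x hx
    rw [f₂.arr _ (by simp), h1] at e1
    rw [f₂.arr _ (by simp), h2] at e2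
    rw [f₂.arr _ (by simp), h3] at e3
    rw [f₂.arr _ (by simp), f₁.arr _ (by simp)] at e5
    rcases Nat.lt_succ_iff_lt_or_eq.1 hx with hx | rfl
    · have := i3 x hx
      constructor
      · rw [e1, Function.update_of_ne hx.ne, this.node]
      · rw [e2, Function.update_of_ne hx.ne, this.lay]
      · rw [e3, Function.update_of_ne hx.ne, this.own]
      · rw [e5, Function.update_of_ne hx.ne, this.upd]
      · intro c hc
        rw [e4, c3, f₁.arr _ (by simp), this.col c hc]
        intro c' hc'
        rw [Ne, index_inj (hx.trans hj) hj]
        omega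
    · constructor
      · rw [e1, Function.update_self]
      · rw [e2, Function.update_self]
      · rw [e3, Function.update_self]
      · rw [e5, Function.update_self]
      · rw [e4]; exact c2
  refine Run.straight 5 rfl le_rfl ?_
  simp only [Cmd.den, Expr.eval_var, Expr.eval_add, Expr.eval_sub, Expr.eval_one, Expr.eval_zero,
    Store.setVar_var, Store.setArr_var, h40₂, h48₂, h49₂, h0₂, c1]
  rcases succ_div_mod (j := j) hn with ⟨e1, e2, e3⟩ | ⟨e1, e2, e3⟩
  · have : n - (j % n + 1) ≠ 0 := by omega
    norm_num
    rw [if_neg (by omega)]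
    refine ⟨by simp [e2], by simp [e3, h49₂], ?_⟩
    refine fun x hx => key _ ?_ ?_ ?_ ?_ ?_ x (by omega) <;> simp
  · norm_num
    rw [if_pos (by omega)]
    refine ⟨by simp [e2], by simp [e3], ?_⟩
    refine fun x hx => key _ ?_ ?_ ?_ ?_ ?_ x (by omega) <;> simp

/-- Compute the edges of the product. -/
def edges : Cmd :=
  .forTo 40 (.var vN) (.forTo 41 (.var vN) (
    .cond ((.get aLay (.var 41) - .get aLupd (.var 40)) +
      (.get aLupd (.var 40) - .get aLay (.var 41)))
      (.store aEdg (.get aRow (.var 40) + .var 41) 0)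
      (.store aEdg (.get aRow (.var 40) + .var 41)
        (.get 1 (.get aRN (.get aNode (.var 40)) + .get aNode (.var 41))))))

theorem run_edges (hS : Setup G idx K dd s) (hn : 0 < n)
    (hN : ∀ x < 2 ^ dd * n, NodeIn G idx K dd x s) :
    Run ps edges s (2 ^ dd * n * (2 ^ dd * n * 4 + 4) + 2) fun s' =>
      ∀ x < 2 ^ dd * n, ∀ y < 2 ^ dd * n,
        s'.arr aEdg (x * (2 ^ dd * n) + y) = bit ((G.prodBoard idx dd).edge x y) := by
  refine Run.forTo [41] [aEdg] _ _ (fun i s' => ∀ x < i, ∀ y < 2 ^ dd * n,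
    s'.arr aEdg (x * (2 ^ dd * n) + y) = bit ((G.prodBoard idx dd).edge x y)) rfl rfl
    (fun s' hf => ?_) (by simp) ?_ (fun s' _ _ hI => hI)
  · rw [Expr.eval_var, hf.var _ (by simp), hS.num.size]
  rintro i hi s' hf h40 hI
  refine Run.forTo [] [aEdg] _ 2 (fun j s' => (∀ x < i, ∀ y < 2 ^ dd * n,
    s'.arr aEdg (x * (2 ^ dd * n) + y) = bit ((G.prodBoard idx dd).edge x y)) ∧ ∀ y < j,
    s'.arr aEdg (i * (2 ^ dd * n) + y) = bit ((G.prodBoard idx dd).edge i y)) rfl rfl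
    (fun s'' hf' => ?_) ⟨hI, by simp⟩ ?_ ?_
  · rw [Expr.eval_var, hf'.var _ (by simp), hf.var _ (by simp), hS.num.size]
  · rintro j hj s₁ hf₁ h41 ⟨i1, i2⟩
    have f₁ : Frame [40, 41] [aEdg] s s₁ := hf.trans (hf₁.weaken rfl rfl)
    have hS₁ := hS.frame f₁ rfl rfl
    have ni := (hN i hi).frame f₁ rfl
    have nj := (hN j hj).frame f₁ rfl
    have e40 : s₁.var 40 = i := by rw [hf₁.var _ (by simp), h40]
    have r1 := hS₁.num.row i (by omega)
    have hvi : i % n < n := Nat.mod_lt _ hn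
    have hvj : j % n < n := Nat.mod_lt _ hn
    have r2 := hS₁.num.mulN (i % n) (hvi.le.trans (Nat.le_add_left _ _))
    have r3 := hS₁.input.edge ⟨i % n, hvi⟩ ⟨j % n, hvj⟩
    simp only at r3
    have hedge : (G.prodBoard idx dd).edge i j ↔ G.edge ⟨i % n, hvi⟩ ⟨j % n, hvj⟩ ∧
        j / n = G.bitUpd idx dd (i / n) (i % n) := by
      refine and_congr_left fun _ => ⟨?_, fun h => ⟨_, _, rfl, rfl, h⟩⟩
      rintro ⟨v, w, h1, h2, h⟩
      have e1 : v = ⟨i % n, hvi⟩ := Fin.ext h1.symm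
      have e2 : w = ⟨j % n, hvj⟩ := Fin.ext h2.symm
      rwa [e1, e2] at h
    have key : ∀ f : ℕ → ℕ, f = Function.update (s₁.arr aEdg) (i * (2 ^ dd * n) + j)
        (bit ((G.prodBoard idx dd).edge i j)) → (∀ x < i, ∀ y < 2 ^ dd * n,
        f (x * (2 ^ dd * n) + y) = bit ((G.prodBoard idx dd).edge x y)) ∧ ∀ y < j + 1,
        f (i * (2 ^ dd * n) + y) = bit ((G.prodBoard idx dd).edge i y) := by
      rintro f rfl
      refine ⟨fun x hx y hy => ?_, fun y hy => ?_⟩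
      · rw [Function.update_of_ne, i1 x hx y hy]
        rw [Ne, index_inj hy hj]
        omega
      · rcases Nat.lt_succ_iff_lt_or_eq.1 hy with hy | rfl
        · rw [Function.update_of_ne (by omega), i2 y hy]
        · rw [Function.update_self]
    refine Run.cond (T := 1) (fun h => ?_) (fun h => ?_)
    · refine Run.store (key _ ?_)
      have : ¬ (G.prodBoard idx dd).edge i j := by
        rw [hedge]
        simp [e40, h41, ni.upd, nj.lay] at h
        omega
      simp [e40, h41, r1, bit_false this]
    · refine Run.store (key _ ?_)
      have : (G.prodBoard idx dd).edge i j ↔ G.edge ⟨i % n, hvi⟩ ⟨j % n, hvj⟩ := by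
        rw [hedge, and_iff_left]
        simp [e40, h41, ni.upd, nj.lay] at h
        omega
      simp [e40, h41, r1, r2, r3, ni.node, nj.node, bit_congr this]
  · rintro s₁ - - ⟨i1, i2⟩ x hx y hy
    simp only [Store.setVar_arr]
    rcases Nat.lt_succ_iff_lt_or_eq.1 hx with hx | rfl
    exacts [i1 x hx y hy, i2 y hy]

end

section

/-! ## The truth table of the formula -/

/-- Effect of an entry of the formula on the stack of truth values. -/
def evalStep (b : ℕ → ℕ → ℕ) (S : ℕ × (ℕ → ℕ)) (p : ℕ × ℕ) : ℕ × (ℕ → ℕ) :=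
  match p.1 with
  | 0 => (S.1 + 1, Function.update S.2 S.1 1)
  | 1 => (S.1 + 1, Function.update S.2 S.1 0)
  | 2 => (S.1 - 1, if S.2 (S.1 - 1) = 0 then Function.update S.2 (S.1 - 1 - 1) 0 else S.2)
  | 3 => (S.1 - 1, if S.2 (S.1 - 1) = 0 then S.2 else Function.update S.2 (S.1 - 1 - 1) 1)
  | o + 4 => (S.1 + 1, Function.update S.2 S.1 (b (o + 4) p.2))

/-- A subformula pushes its value and leaves the stack below untouched; the latter is needed for the
left operand, which waits while the right one is evaluated. -/
theorem MPFormula.evalStep_code {g : ℕ} {b : ℕ → ℕ → ℕ} {T : Set (Fin g)} (φ : MPFormula (Fin g))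
    (hb : ∀ o a, φ.Occurs o a → b o.code a = bit (a ∈ T ↔ ¬ o.Neg)) (S : ℕ × (ℕ → ℕ)) :
    (φ.code.foldl (evalStep b) S).1 = S.1 + 1 ∧
    (φ.code.foldl (evalStep b) S).2 S.1 = bit (φ.val T) ∧
    ∀ i < S.1, (φ.code.foldl (evalStep b) S).2 i = S.2 i := by
  induction φ generalizing S with
  | tt =>
    refine ⟨rfl, by simp [code, evalStep, val, bit], fun i hi => ?_⟩
    simp [code, evalStep, hi.ne]
  | ff =>
    refine ⟨rfl, by simp [code, evalStep, val, bit], fun i hi => ?_⟩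
    simp [code, evalStep, hi.ne]
  | atom o a =>
    have h := hb o a ⟨rfl, rfl⟩
    cases o <;> exact ⟨rfl, by simpa [code, evalStep, val, TempOp.code] using h,
      fun i hi => by simp [code, evalStep, TempOp.code, hi.ne]⟩
  | and p q hp hq =>
    obtain ⟨p1, p2, p3⟩ := hp (fun o a h => hb o a (Or.inl h)) S
    obtain ⟨q1, q2, q3⟩ := hq (fun o a h => hb o a (Or.inr h)) (p.code.foldl (evalStep b) S)
    simp only [code, List.foldl_append, List.foldl_cons, List.foldl_nil]
    set S₁ := p.code.foldl (evalStep b) S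
    set S₂ := q.code.foldl (evalStep b) S₁
    have h1 := q3 S.1 (by omega)
    rw [p1] at q1 q2
    refine ⟨by simp [evalStep, q1], ?_, fun i hi => ?_⟩
    · by_cases hv : q.val T
      · rw [bit_true hv] at q2
        simp [evalStep, q1, q2, h1, p2, val, hv]
      · simp [evalStep, q1, q2, val, hv, bit]
    · have h2 := (q3 i (by omega)).trans (p3 i hi)
      simp only [evalStep, q1]
      split_ifs
      · rw [Function.update_of_ne (by omega), h2]
      · rw [h2]
  | or p q hp hq =>
    obtain ⟨p1, p2, p3⟩ := hp (fun o a h => hb o a (Or.inl h)) S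
    obtain ⟨q1, q2, q3⟩ := hq (fun o a h => hb o a (Or.inr h)) (p.code.foldl (evalStep b) S)
    simp only [code, List.foldl_append, List.foldl_cons, List.foldl_nil]
    set S₁ := p.code.foldl (evalStep b) S
    set S₂ := q.code.foldl (evalStep b) S₁
    have h1 := q3 S.1 (by omega)
    rw [p1] at q1 q2
    refine ⟨by simp [evalStep, q1], ?_, fun i hi => ?_⟩
    · by_cases hv : q.val T
      · simp [evalStep, q1, q2, val, hv, bit]
      · rw [bit_false hv] at q2
        simp [evalStep, q1, q2, h1, p2, val, hv]
    · have h2 := (q3 i (by omega)).trans (p3 i hi)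
      simp only [evalStep, q1]
      split_ifs
      · rw [h2]
      · rw [Function.update_of_ne (by omega), h2]

/-- Process an entry of the formula; variable 51 is the height of the stack. -/
def evalEntry : Cmd :=
  52 ::= .get 3 (.var 41) ;;
  .cond (.var 52)
    (.cond (.var 52 - 1)
      (.cond (.var 52 - .const 2)
        (.cond (.var 52 - .const 3)
          (53 ::= .get aBits (.get aIdx (.get 4 (.var 41))) ;; flip (.var 52) 53 ;;
            .store aStk (.var 51) (.var 53) ;; 51 ::= .var 51 + 1)
          (51 ::= .var 51 - 1 ;; .cond (.get aStk (.var 51)) (.store aStk (.var 51 - 1) 1) .skip))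
        (51 ::= .var 51 - 1 ;; .cond (.get aStk (.var 51)) .skip (.store aStk (.var 51 - 1) 0)))
      (.store aStk (.var 51) 0 ;; 51 ::= .var 51 + 1))
    (.store aStk (.var 51) 1 ;; 51 ::= .var 51 + 1)

/-- Store the truth table of the formula. -/
def truth : Cmd :=
  .forTo 40 (.var vPK) (50 ::= .var 40 ;;
    .forTo 41 (.var vK) (.store aBits (.var 41) (.get aPar (.var 50)) ;; 50 ::= .get aHalf (.var 50)) ;;
    51 ::= 0 ;; .forTo 41 (.var 2) evalEntry ;; .store aWint (.var 40) (.get aStk 0))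

variable {ps : List Cmd} {s : Store} {n g K dd : ℕ} {G : MPGame (Fin n) (Fin g)} {idx : Fin g → ℕ}

theorem MPFormula.code_cases {g : ℕ} (φ : MPFormula (Fin g)) :
    ∀ p ∈ φ.code, p.1 < 4 ∨ ∃ o a, φ.Occurs o a ∧ p = (o.code, a.val) := by
  induction φ with
  | tt => simp [code]
  | ff => simp [code]
  | atom o a => simpa [code] using Or.inr ⟨o, a, ⟨rfl, rfl⟩, rfl, rfl⟩
  | and p q hp hq =>
    intro x hx
    simp only [code, List.mem_append, List.mem_singleton] at hx
    rcases hx with (hx | hx) | rfl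
    · exact (hp x hx).imp_right fun ⟨o, a, h, e⟩ => ⟨o, a, Or.inl h, e⟩
    · exact (hq x hx).imp_right fun ⟨o, a, h, e⟩ => ⟨o, a, Or.inr h, e⟩
    · simp
  | or p q hp hq =>
    intro x hx
    simp only [code, List.mem_append, List.mem_singleton] at hx
    rcases hx with (hx | hx) | rfl
    · exact (hp x hx).imp_right fun ⟨o, a, h, e⟩ => ⟨o, a, Or.inl h, e⟩
    · exact (hq x hx).imp_right fun ⟨o, a, h, e⟩ => ⟨o, a, Or.inr h, e⟩
    · simp

/-- Value of an atom, if `B` contains the colors. -/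
noncomputable def atomValue (B : ℕ → ℕ) (I : ℕ → ℕ) (o a : ℕ) : ℕ :=
  if o = 5 ∨ o = 7 then 1 - B (I a) else B (I a)

theorem run_evalEntry {i : ℕ} (hS : Setup G idx K dd s) (hi : i < G.formula.code.length)
    (h41 : s.var 41 = i) :
    Run ps evalEntry s 12 fun s' => (s'.var 51, s'.arr aStk) =
      evalStep (atomValue (s.arr aBits) (s.arr aIdx)) (s.var 51, s.arr aStk)
        (G.formula.code.getD i (0, 0)) := by
  have h3 := hS.input.op i
  have h4 := hS.input.event i
  have hc := G.formula.code_cases (G.formula.code.getD i (0, 0)) (by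
    rw [List.getD_eq_getElem _ _ hi]
    exact List.getElem_mem hi)
  generalize G.formula.code.getD i (0, 0) = p at *
  obtain ⟨p1, p2⟩ := p
  simp only at h3 h4 hc
  refine Run.straight 12 rfl (by decide) ?_
  rcases hc with hc | ⟨o, a, ho, hp⟩
  · have : p1 = 0 ∨ p1 = 1 ∨ p1 = 2 ∨ p1 = 3 := by omega
    rcases this with rfl | rfl | rfl | rfl
    · simp [evalEntry, Cmd.den, evalStep, h41, h3]
    · simp [evalEntry, Cmd.den, evalStep, h41, h3]
    · by_cases h : s.arr aStk (s.var 51 - 1) = 0 <;>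
        simp [evalEntry, Cmd.den, evalStep, h41, h3, h]
    · by_cases h : s.arr aStk (s.var 51 - 1) = 0 <;>
        simp [evalEntry, Cmd.den, evalStep, h41, h3, h]
  · obtain ⟨rfl, rfl⟩ := Prod.mk.inj hp
    cases o <;> simp [evalEntry, flip, Cmd.den, evalStep, h41, h3, h4, TempOp.code, atomValue]

/-- Each of the `2 ^ K` sets of colors costs one evaluation of the formula, which is the origin of
the summand with the size of the formula. In return, the solver finds the winner for its set of
colors by a single access. -/
theorem run_truth (hS : Setup G idx K dd s) :
    Run ps truth s (2 ^ K * (K * 4 + G.formula.size * 14 + 9) + 2) fun s' =>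
      ∀ l < 2 ^ K, s'.arr aWint l = bit (G.formula.val {a | BitOf l (idx a)}) := by
  refine Run.forTo [41, 50, 51, 52, 53] [aBits, aStk, aWint] _ (K * 4 + G.formula.size * 14 + 7)
    (fun j s' => ∀ l < j, s'.arr aWint l = bit (G.formula.val {a | BitOf l (idx a)})) rfl rfl
    (fun s' hf => ?_) (by simp) ?_ (fun s' _ _ hI => hI)
  · rw [Expr.eval_var, hf.var _ (by simp), hS.num.sets]
  intro j hj s' hf h40 hI
  have hS' := hS.frame hf rfl rfl
  rw [show K * 4 + G.formula.size * 14 + 7 =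
    1 + ((K * (2 + 2) + 2) + (1 + ((G.formula.size * (12 + 2) + 2) + 1))) by ring]
  refine Run.seq (Run.assign ?_)
  have f₁ : Frame [50] [] s' (s'.setVar 50 (Expr.eval s' (.var 40))) :=
    (Frame.refl _ _ _).setVar (by simp) _
  refine Run.seq_imp ((Run.forTo [50] [aBits] K 2 (fun c s' => s'.var 50 = j / 2 ^ c ∧
    ∀ i < c, s'.arr aBits i = j / 2 ^ i % 2) (Q := fun s' => ∀ i < K,
      s'.arr aBits i = j / 2 ^ i % 2) rfl rfl (fun s'' hf' => ?_) (by simp [h40]) ?_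
      (fun s' _ _ hI => hI.2)).frame [41, 50] [aBits] rfl) ?_
  · simp [hf'.var, hS'.num.colors]
  · rintro c hc s'' hf' h41 ⟨i1, i2⟩
    have hS'' := (hS'.frame f₁ rfl rfl).frame hf' rfl rfl
    have hlt : j / 2 ^ c < 2 ^ K := (Nat.div_le_self _ _).trans_lt hj
    have r1 := hS''.num.half _ hlt
    have r2 := hS''.num.par _ hlt
    have hstep : j / 2 ^ (c + 1) = j / 2 ^ c / 2 := by rw [pow_succ, ← Nat.div_div_eq_div_mul]
    refine Run.straight 2 rfl le_rfl ⟨?_, fun i hi => ?_⟩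
    · rw [hstep]
      generalize j / 2 ^ c = u at *
      simp [Cmd.den, i1, r1]
    · rcases Nat.lt_succ_iff_lt_or_eq.1 hi with hi | rfl
      · simp [Cmd.den, h41, hi.ne, i2 i hi]
      · simp only [Cmd.den, Expr.eval_var, Expr.eval_get, Store.setVar_arr, Store.setArr_arr, h41,
          if_true, Function.update_self, i1, r2]
  rintro s₂ ⟨f₂, hbits⟩
  refine Run.seq (Run.assign ?_)
  set s₃ := s₂.setVar 51 (Expr.eval s₂ 0) with hs₃
  have f₃ : Frame [41, 50, 51] [aBits] s' s₃ :=
    ((f₁.weaken rfl rfl).trans (f₂.weaken rfl rfl)).setVar (by simp) _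
  have hbits₃ : s₃.arr aBits = s₂.arr aBits := rfl
  have h51 : s₃.var 51 = 0 := by simp [hs₃]
  clear_value s₃
  have hS₃ := hS'.frame f₃ rfl rfl
  refine Run.seq_imp ((Run.forTo [51, 52, 53] [aStk] G.formula.size 12 (fun i s'' =>
    (s''.var 51, s''.arr aStk) = (G.formula.code.take i).foldl
      (evalStep (atomValue (s₃.arr aBits) (s₃.arr aIdx))) (0, s₃.arr aStk))
    (Q := fun s'' => (s''.var 51, s''.arr aStk) = G.formula.code.foldl
      (evalStep (atomValue (s₃.arr aBits) (s₃.arr aIdx))) (0, s₃.arr aStk)) rfl rfl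
    (fun s'' hf' => ?_) (by simp [h51]) ?_ ?_).frame [41, 51, 52, 53] [aStk] rfl) ?_
  · rw [Expr.eval_var, hf'.var _ (by simp), hS₃.input.size]
  · intro i hi s'' hf' h41 hI'
    rw [← MPFormula.length_code] at hi
    refine (run_evalEntry (hS₃.frame hf' rfl rfl) hi h41).imp fun s₄ h₄ => ?_
    rw [List.take_succ_getD _ (0, 0) hi, List.foldl_append, ← hI', List.foldl_cons, List.foldl_nil,
      ← hf'.arr aBits (by simp), ← hf'.arr aIdx (by simp), ← h₄]
    simp
  · intro s'' _ _ hI'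
    rw [hI', ← MPFormula.length_code, List.take_length]
  rintro s₄ ⟨f₄, h₄⟩
  have hb : ∀ o a, G.formula.Occurs o a → atomValue (s₃.arr aBits) (s₃.arr aIdx) o.code a =
      bit (a ∈ {a | BitOf j (idx a)} ↔ ¬ o.Neg) := by
    intro o a ho
    rw [atomValue, hS₃.index, hbits₃, hbits _ (hS.lt a ⟨o, ho⟩)]
    have : j / 2 ^ idx a % 2 = bit (BitOf j (idx a)) := by
      unfold bit BitOf
      split_ifs <;> omega
    rw [this]
    by_cases hb : BitOf j (idx a) <;> cases o <;> simp [TempOp.code, TempOp.Neg, bit, hb]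
  obtain ⟨-, e2, -⟩ := G.formula.evalStep_code hb (0, s₃.arr aStk)
  rw [← h₄] at e2
  simp only at e2
  have h40₄ : s₄.var 40 = j := by simp [f₄.var, f₃.var, h40]
  refine Run.store fun l hl => ?_
  rcases Nat.lt_succ_iff_lt_or_eq.1 hl with hl | rfl
  · simp [h40₄, hl.ne, f₄.arr, f₃.arr, hI l hl]
  · simp [h40₄, e2]

end

section

/-! ## The program -/

variable {ps : List Cmd} {s : Store} {n g K dd : ℕ} {G : MPGame (Fin n) (Fin g)} {idx : Fin g → ℕ}

/-- Prepare the call of the solver for the whole product. -/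
def prepare : Cmd :=
  vMask ::= .var vPK - 1 ;; vLV ::= .var vK ;; .forTo 40 (.var vK) (.store aCL (.var 40) (.var 40)) ;;
    .forTo 40 (.var vN) (.store aXS (.get aRow (.var vK) + .var 40) 1)

/-- The whole product is a legitimate subgame: a successor in the arena always extends to the
product, since its layer is determined by the node that is left. -/
theorem run_prepare (hS : Setup G idx K dd s) (hn : 0 < n) (hKg : K ≤ 2 ^ dd * n)
    (hN : ∀ x < 2 ^ dd * n, NodeIn G idx K dd x s)
    (hE : ∀ x < 2 ^ dd * n, ∀ y < 2 ^ dd * n,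
      s.arr aEdg (x * (2 ^ dd * n) + y) = bit ((G.prodBoard idx dd).edge x y))
    (hW : ∀ l < 2 ^ K, s.arr aWint l = bit (G.formula.val {a | BitOf l (idx a)}))
    (hQ : s.arr aQB K = 0) :
    Run ps prepare s (K * 3 + 2 ^ dd * n * 3 + 6) (Call (G.prodBoard idx dd) (2 ^ dd * n) K
      (G.prodCol idx dd) (G.formula.table idx) K (Finset.range K) {x | x < 2 ^ dd * n} 0) := by
  rw [show K * 3 + 2 ^ dd * n * 3 + 6 = 1 + (1 + ((K * (1 + 2) + 2) +
    (2 ^ dd * n * (1 + 2) + 2))) by ring]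
  have hsum : ∑ c ∈ Finset.range K, 2 ^ c = 2 ^ K - 1 := by
    rw [Nat.geomSum_eq le_rfl]
    simp
  refine Run.seq (Run.assign (Run.seq (Run.assign ?_)))
  set s₁ := Store.setVar _ _ _ with hs₁
  have f₁ : Frame [vMask, vLV] [] s s₁ :=
    ((Frame.refl _ _ _).setVar (by simp) _).setVar (by simp) _
  have h1 : s₁.var vMask = ∑ c ∈ Finset.range K, 2 ^ c := by
    rw [hsum]
    simp [hs₁, hS.num.sets]
  have h2 : s₁.var vLV = K := by simp [hs₁, hS.num.colors]
  clear_value s₁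
  refine Run.seq_imp ((Run.forTo [] [aCL] K 1 (fun j s' => ∀ i < j, s'.arr aCL i = i)
    (Q := fun s' => ∀ i < K, s'.arr aCL i = i) rfl rfl (fun s' hf => ?_) (by simp) ?_
    (fun s' _ _ hI => hI)).frame [40] [aCL] rfl) ?_
  · rw [Expr.eval_var, hf.var _ (by simp), f₁.var _ (by simp), hS.num.colors]
  · intro j hj s' hf h40 hI
    refine Run.store fun i hi => ?_
    rcases Nat.lt_succ_iff_lt_or_eq.1 hi with hi | rfl
    · simp [h40, hi.ne, hI i hi]
    · simp [h40]
  rintro s₂ ⟨f₂, hcl⟩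
  have g₂ : Frame [vMask, vLV, 40] [aCL] s s₂ := (f₁.weaken rfl rfl).trans (f₂.weaken rfl rfl)
  have hS₂ := hS.frame g₂ rfl rfl
  have hrow := hS₂.num.row K (by omega)
  refine ((Run.forTo [] [aXS] (2 ^ dd * n) 1
    (fun j s' => ∀ x < j, s'.arr aXS (K * (2 ^ dd * n) + x) = 1)
    (Q := fun s' => ∀ x < 2 ^ dd * n, s'.arr aXS (K * (2 ^ dd * n) + x) = 1) rfl rfl
    (fun s' hf => ?_) (by simp) ?_ (fun s' _ _ hI => hI)).frame [40] [aXS] rfl).imp ?_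
  · rw [Expr.eval_var, hf.var _ (by simp), hS₂.num.size]
  · intro j hj s' hf h40 hI
    refine Run.store fun i hi => ?_
    have e1 : s'.var vK = K := by rw [hf.var _ (by simp), hS₂.num.colors]
    have e2 : s'.arr aRow K = K * (2 ^ dd * n) := by rw [hf.arr _ (by simp), hrow]
    rcases Nat.lt_succ_iff_lt_or_eq.1 hi with hi | rfl
    · simp [h40, e1, e2, hi.ne, hI i hi]
    · simp [h40, e1, e2]
  rintro s₃ ⟨f₃, hxs⟩
  have f : Frame [vMask, vLV, 40] [aCL, aXS] s s₃ := (g₂.weaken rfl rfl).trans (f₃.weaken rfl rfl)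
  have hS₃ := hS.frame f rfl rfl
  have hKM : K ≤ K.factorial + 2 ^ dd * n := by omega
  refine ⟨⟨⟨hS₃.num.size, fun x hx => ((hN x hx).frame f rfl).own, fun x hx y hy => ?_,
    fun x hx => hS₃.num.row x (by omega)⟩, hKg, fun q hq => hS₃.num.row q (by omega),
    fun c hc x hx => ?_, hS₃.num.fact, fun c hc => hS₃.num.pow c hc.le, fun S hSK => ?_⟩, ?_,
    ⟨fun i hi => ?_, fun i hi j hj h => ?_, by simp, le_rfl⟩, ?_, ?_, fun x hx => ?_,
    fun _ _ c hc _ => by simpa using hc, ?_, by simp⟩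
  · rw [f.arr _ (by simp), hE x hx y hy, Ne, bit_eq_zero, not_not]
  · rw [((hN x hx).frame f rfl).col c hc, Ne, bit_eq_zero, not_not]
  · rw [f.arr _ (by simp), hW _ (sum_two_pow_lt hSK), MPFormula.table]
    simp only [bitOf_sum]
    classical exact bit_eq_toNat
  · rw [f₃.var _ (by simp), f₂.var _ (by simp), h2]
  · rw [f₃.arr _ (by simp), hcl i hi]
    simpa using hi
  · rwa [f₃.arr _ (by simp), hcl i hi, hcl j hj] at h
  · rw [f₃.var _ (by simp), f₂.var _ (by simp), h1]
  · ext x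
    exact ⟨fun h => ⟨h, by rw [hxs x h]; simp⟩, fun h => h.1⟩
  · have hv : x % n < n := Nat.mod_lt _ hn
    obtain ⟨w, hw⟩ := G.total ⟨x % n, hv⟩
    have hu := G.bitUpd_lt (idx := idx) (dd := dd) (x / n) (x % n)
    refine ⟨G.bitUpd idx dd (x / n) (x % n) * n + w, ?_, ⟨_, w, rfl, ?_, hw⟩, ?_⟩
    · have := Nat.mul_le_mul_right n (Nat.succ_le_of_lt hu)
      rw [Nat.succ_mul] at this
      have := w.2
      rw [Set.mem_ofPred_eq]
      omega
    · rw [MPGame.index_mod w.2]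
    · rw [MPGame.index_div w.2]
  · rw [f.arr _ (by simp), hQ]

/-- Write the strategies for the game. -/
def output : Cmd :=
  .forTo 40 (.get aFact (.var vK)) (.forTo 41 (.var vN) (
    48 ::= .get aRow (.var 40) + .var 41 ;;
    49 ::= .get aRowM (.get aUpd (.var 48)) + .get aLupd (.var 41) ;;
    .store 1 (.var 48) (.var 49) ;; .store 3 (.var 48) (.var 49) ;;
    49 ::= .get aNode (.get aNxt (.var 48)) ;;
    .store 2 (.var 48) (.var 49) ;; .store 4 (.var 48) (.var 49))) ;;
  .forTo 40 (.var 0) (.store 0 (.var 40) (.get aWin (.var 40))) ;;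
  0 ::= .get aRowM (.get aFact (.var vK)) ;; 1 ::= .var 0

/-- Both players receive the same tables, because the joint strategy has an entry for every node.
The arrays of the input may be overwritten, as everything that is still read has been copied
elsewhere. -/
theorem run_output (hS : Setup G idx K dd s)
    (hN : ∀ x < 2 ^ dd * n, NodeIn G idx K dd x s)
    (hup : ∀ q < K.factorial, ∀ x < 2 ^ dd * n, s.tab aUpd (2 ^ dd * n) q x < K.factorial)
    (hnx : ∀ q < K.factorial, ∀ x < 2 ^ dd * n, s.tab aNxt (2 ^ dd * n) q x < 2 ^ dd * n)
    (hwin : ∀ x < 2 ^ dd * n, s.arr aWin x = (s.winner x).toNat) :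
    Run ps output s (K.factorial * (2 ^ dd * n * 9 + 4) + n * 3 + 6)
      (MPGame.Output n K dd (fun x => G.bitUpd idx dd (x / n) (x % n)) s.winner
        (s.tab aUpd (2 ^ dd * n)) (s.tab aNxt (2 ^ dd * n))) := by
  set A : ℕ → ℕ → ℕ := fun q x =>
    s.tab aUpd (2 ^ dd * n) q x * 2 ^ dd + G.bitUpd idx dd (x / n) (x % n) with hA
  set B : ℕ → ℕ → ℕ := fun q x => s.tab aNxt (2 ^ dd * n) q x % n with hB
  let W : ℕ → ℕ → Store → Prop := fun q x s' =>
    s'.arr 1 (q * (2 ^ dd * n) + x) = A q x ∧ s'.arr 3 (q * (2 ^ dd * n) + x) = A q x ∧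
    s'.arr 2 (q * (2 ^ dd * n) + x) = B q x ∧ s'.arr 4 (q * (2 ^ dd * n) + x) = B q x
  rw [show K.factorial * (2 ^ dd * n * 9 + 4) + n * 3 + 6 =
    (K.factorial * (((2 ^ dd * n) * (7 + 2) + 2) + 2) + 2) + ((n * (1 + 2) + 2) + 2) by ring]
  refine Run.seq_imp ((Run.forTo [41, 48, 49] [1, 2, 3, 4] K.factorial _ (fun i s' =>
    ∀ q < i, ∀ x < 2 ^ dd * n, W q x s') (Q := fun s' => ∀ q < K.factorial, ∀ x < 2 ^ dd * n, W q x s')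
    rfl rfl (fun s' hf => ?_) (by simp) ?_ (fun _ _ _ h => h)).frame [40, 41, 48, 49] [1, 2, 3, 4]
    rfl) ?_
  · simp [hf.var, hf.arr, hS.num.colors, hS.num.fact]
  · intro i hi s' hf h40 hI
    refine Run.forTo [48, 49] [1, 2, 3, 4] _ 7 (fun j s' => (∀ q < i, ∀ x < 2 ^ dd * n, W q x s') ∧
      ∀ x < j, W i x s') rfl rfl (fun s'' hf' => ?_) ⟨hI, by simp⟩ ?_ ?_
    · rw [Expr.eval_var, hf'.var _ (by simp), hf.var _ (by simp), hS.num.size]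
    · rintro j hj s₁ hf₁ h41 ⟨i1, i2⟩
      have f₁ : Frame [40, 41, 48, 49] [1, 2, 3, 4] s s₁ := hf.trans (hf₁.weaken rfl rfl)
      have e40 : s₁.var 40 = i := by rw [hf₁.var _ (by simp), h40]
      have r1 : s₁.arr aRow i = i * (2 ^ dd * n) := by
        rw [f₁.arr _ (by simp), hS.num.row i (by omega)]
      have r2 : s₁.arr aUpd = s.arr aUpd := f₁.arr _ (by simp)
      have r3 : s₁.arr aNxt = s.arr aNxt := f₁.arr _ (by simp)
      have r4 : s₁.arr aRowM (s.arr aUpd (i * (2 ^ dd * n) + j)) =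
          s.arr aUpd (i * (2 ^ dd * n) + j) * 2 ^ dd := by
        rw [f₁.arr _ (by simp)]
        exact hS.num.rowM _ (hup i hi j hj).le
      have r5 : s₁.arr aLupd j = G.bitUpd idx dd (j / n) (j % n) := by
        rw [f₁.arr _ (by simp), (hN j hj).upd]
      have r6 : s₁.arr aNode (s.arr aNxt (i * (2 ^ dd * n) + j)) =
          s.arr aNxt (i * (2 ^ dd * n) + j) % n := by
        rw [f₁.arr _ (by simp)]
        exact (hN _ (hnx i hi j hj)).node
      have key : ∀ s₂ : Store, s₂.arr 1 = Function.update (s₁.arr 1) (i * (2 ^ dd * n) + j) (A i j) →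
          s₂.arr 3 = Function.update (s₁.arr 3) (i * (2 ^ dd * n) + j) (A i j) →
          s₂.arr 2 = Function.update (s₁.arr 2) (i * (2 ^ dd * n) + j) (B i j) →
          s₂.arr 4 = Function.update (s₁.arr 4) (i * (2 ^ dd * n) + j) (B i j) →
          (∀ q < i, ∀ x < 2 ^ dd * n, W q x s₂) ∧ ∀ x < j + 1, W i x s₂ := by
        intro s₂ k1 k2 k3 k4
        simp only [W, k1, k2, k3, k4]
        refine ⟨fun q hq x hx => ?_, fun x hx => ?_⟩
        · have : q * (2 ^ dd * n) + x ≠ i * (2 ^ dd * n) + j := by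
            rw [Ne, index_inj hx hj]
            omega
          simp only [Function.update_of_ne this]
          exact i1 q hq x hx
        · rcases Nat.lt_succ_iff_lt_or_eq.1 hx with hx | rfl
          · have : i * (2 ^ dd * n) + x ≠ i * (2 ^ dd * n) + j := by omega
            simp only [Function.update_of_ne this]
            exact i2 x hx
          · simp
      refine Run.straight 7 rfl (by decide) (key _ ?_ ?_ ?_ ?_) <;>
        simp [Cmd.den, e40, h41, r1, r2, r3, r4, r5, r6, hA, hB, Store.tab]
    · rintro s'' - - ⟨i1, i2⟩ q hq x hx
      rcases Nat.lt_succ_iff_lt_or_eq.1 hq with hq | rfl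
      exacts [i1 q hq x hx, i2 x hx]
  rintro s₁ ⟨f₁, hW⟩
  refine Run.seq_imp ((Run.forTo [] [0] n 1 (fun j s' => ∀ v < j, s'.arr 0 v = s.arr aWin v)
    (Q := fun s' => ∀ v < n, s'.arr 0 v = s.arr aWin v) rfl rfl (fun s' hf => ?_) (by simp) ?_
    (fun s' _ _ hI => hI)).frame [40] [0] rfl) ?_
  · rw [Expr.eval_var, hf.var _ (by simp), f₁.var _ (by simp), hS.input.nodes]
  · intro j hj s' hf h40 hI
    refine Run.store fun i hi => ?_
    rcases Nat.lt_succ_iff_lt_or_eq.1 hi with hi | rfl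
    · simp [h40, hi.ne, hI i hi]
    · simp [h40, hf.arr, f₁.arr]
  rintro s₂ ⟨f₂, hw⟩
  have f : Frame [40, 41, 48, 49] [0, 1, 2, 3, 4] s s₂ :=
    (f₁.weaken rfl rfl).trans (f₂.weaken rfl rfl)
  have e1 : s₂.arr aRowM (s₂.arr aFact (s₂.var vK)) = K.factorial * 2 ^ dd := by
    rw [f.var _ (by simp), f.arr _ (by simp), f.arr _ (by simp), hS.num.colors,
      hS.num.fact K le_rfl, hS.num.rowM _ le_rfl]
  have hN0 : ∀ v < n, v < 2 ^ dd * n := fun v hv =>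
    hv.trans_le (Nat.le_mul_of_pos_left n (Nat.two_pow_pos dd))
  refine Run.straight 2 rfl le_rfl ?_
  simp only [Cmd.den, Expr.eval_get, Expr.eval_var, e1]
  refine ⟨fun v hv => ?_, fun P => ?_, fun P q hq x hx => ?_, fun P q hq x hx => ?_⟩
  · simp only [Store.setVar_arr]
    rw [hw v hv, hwin v (hN0 v hv)]
  · cases P <;> simp [MPGame.outSize]
  · obtain ⟨w1, w2, w3, w4⟩ := hW q hq x hx
    cases P <;> simp [MPGame.outUpd, f₂.arr, w1, w2, hA]
  · obtain ⟨w1, w2, w3, w4⟩ := hW q hq x hx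
    cases P <;> simp [MPGame.outNext, f₂.arr, w3, w4, hB]

end

section

/-! ## Solving games -/

/-- The program that solves games, with memory for as many local events as given by `e`. -/
def solver (e : Expr) : Program where
  main := findColors ;; vDD ::= e ;; numbers ;; nodes ;; edges ;; truth ;; prepare ;; .call 0 ;; output
  procs := [solveBody]

/-- Time that the solver needs. -/
def totalTime (n g K dd z : ℕ) : ℕ :=
  (z * 4 + g * 12 + 7) + (1 + (((K * 3 + 3) + (1 + (1 + (((2 ^ dd + n + 1) * 4 + 3) + (1 +
    ((n * 4 + 3) + ((K * (K * 3 + 6) + 3) + (((K.factorial + 2 ^ dd * n + 1) * 4 + 3) +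
    (((K.factorial + 1) * 4 + 3) + (2 ^ K * 7 + 4)))))))))) +
    ((2 ^ dd * n * (K * 12 + 14) + 4) + ((2 ^ dd * n * (2 ^ dd * n * 4 + 4) + 2) +
    ((2 ^ K * (K * 4 + z * 14 + 9) + 2) + ((K * 3 + 2 ^ dd * n * 3 + 6) +
    (solveTime (2 ^ dd * n) K + (K.factorial * (2 ^ dd * n * 9 + 4) + n * 3 + 6))))))))

theorem MPGame.numEL_add_numLocal_le {n g : ℕ} {G : MPGame (Fin n) (Fin g)}
    (hφ : G.formula.UniqueEvents) : G.formula.numEL + G.formula.numLocal ≤ g := by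
  rw [← hφ.ncard_has]
  exact (Set.ncard_le_card _).trans_eq (by simp)

/-- The number `dd` of local events with bits is all that distinguishes the general algorithm from
the one for arenas with memory. The premise `he` lets the program determine it at run time, after
the events have been classified. -/
theorem MPGame.solvedWithin_solver {n g : ℕ} {G : MPGame (Fin n) (Fin g)} {e : Expr} {dd : ℕ}
    (hn : 0 < n) (hgn : g ≤ n) (hφ : G.formula.UniqueEvents)
    (he : ∀ s, ColorsIn G s → e.eval s = dd) (hdd : dd ≤ G.formula.numLocal)
    (hloc : G.formula.numLocal ≤ dd ∨ G.HasLocalMemory) :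
    G.SolvedWithin (solver e) ((G.formula.numEL + G.formula.numLocal).factorial * 2 ^ dd)
      (totalTime n g (G.formula.numEL + G.formula.numLocal) dd G.formula.size) := by
  have hKg := numEL_add_numLocal_le hφ
  suffices h : Run (solver e).procs (solver e).main G.input
      (totalTime n g (G.formula.numEL + G.formula.numLocal) dd G.formula.size)
      (G.SolutionIn ((G.formula.numEL + G.formula.numLocal).factorial * 2 ^ dd)) by
    obtain ⟨s, t, h1, h2, h3⟩ := h
    exact ⟨s, t, h1, h2, h3⟩
  have hps : (solver e).procs[0]? = some solveBody := rfl
  have hN0 : n ≤ 2 ^ dd * n := Nat.le_mul_of_pos_left n (Nat.two_pow_pos dd)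
  refine Run.seq_imp ((run_findColors hφ (inputIn_input G) rfl fun _ => rfl).frame [40, vK, vLoc]
    [aKind, aEv, aIdx] rfl) ?_
  rintro s₁ ⟨f₁, hC⟩
  have hin := (inputIn_input G).frame f₁ rfl rfl
  set idx : Fin g → ℕ := fun a => s₁.arr aIdx a with hidx
  have hinj : Set.InjOn idx {a | G.formula.Has a} := by
    intro a ha b hb hab
    have h1 := (hC.idx a ha).2
    have h2 := (hC.idx b hb).2
    have hab : s₁.arr aIdx a = s₁.arr aIdx b := hab
    rw [hab, h2] at h1
    exact Fin.ext h1.symm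
  have hi : IndexFor G idx (G.formula.numEL + G.formula.numLocal) dd :=
    ⟨hinj, fun a ha => (hC.idx a ha).1, fun a ha => hdd.trans (hC.el a ha),
      fun a ha => hloc.imp_left fun h => (hC.loc a ha).trans_le h, by omega⟩
  generalize hK : G.formula.numEL + G.formula.numLocal = K at *
  refine Run.seq (Run.assign ?_)
  rw [he s₁ hC]
  have f₂ : Frame [vDD] [] s₁ (s₁.setVar vDD dd) := (Frame.refl _ _ _).setVar (by simp) _
  have hin₂ := hin.frame f₂ rfl rfl
  have hC₂ := hC.frame f₂ rfl rfl
  refine Run.seq_imp ((run_numbers (n := n) (g := g) (K := K) hin₂.nodes hin₂.events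
    (by rw [hC₂.colors, hK]) (by simp) hi.le).frame [vM, vPK, vN, 40, 41, 48, 49]
    [aPow, aRN, aRG, aFact, aRow, aRowM, aHalf, aPar] rfl) ?_
  rintro s₃ ⟨f₃, hnum⟩
  have hC₃ := hC₂.frame f₃ rfl rfl
  have hS : Setup G idx K dd s₃ := by
    refine ⟨hφ, hin₂.frame f₃ rfl rfl, hnum, hi.le, hinj, fun a => ?_, hi.lt, fun c hc => ?_⟩
    · rw [f₃.arr _ (by simp), f₂.arr _ (by simp)]
    · obtain ⟨a, ⟨o, ho⟩, h1, h2⟩ := hC₃.ev c (by omega)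
      refine ⟨a, o, ho, ?_, h1, hC₃.kind a o ho⟩
      rw [f₃.arr _ (by simp), f₂.arr _ (by simp)] at h2
      exact h2
  refine Run.seq_imp ((run_nodes hS hn (by omega)).frame [40, 41, 48, 49, 50, 51, 52]
    [aNode, aLay, aOwn, aCol, aLupd] rfl) ?_
  rintro s₄ ⟨f₄, hN₄⟩
  have hS₄ := hS.frame f₄ rfl rfl
  refine Run.seq_imp ((run_edges hS₄ hn hN₄).frame [40, 41] [aEdg] rfl) ?_
  rintro s₅ ⟨f₅, hE₅⟩
  have hS₅ := hS₄.frame f₅ rfl rfl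
  refine Run.seq_imp ((run_truth hS₅).frame [40, 41, 50, 51, 52, 53] [aBits, aStk, aWint] rfl) ?_
  rintro s₆ ⟨f₆, hW₆⟩
  have hS₆ := hS₅.frame f₆ rfl rfl
  have hN₆ := fun x hx => ((hN₄ x hx).frame f₅ rfl).frame f₆ rfl
  refine Run.seq_imp ((run_prepare hS₆ hn (by omega) hN₆ (by rw [f₆.arr _ (by simp)]; exact hE₅) hW₆
    ?_).frame [vMask, vLV, 40] [aCL, aXS] rfl) ?_
  · rw [f₆.arr _ (by simp), f₅.arr _ (by simp), f₄.arr _ (by simp), f₃.arr _ (by simp),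
      f₂.arr _ (by simp), f₁.arr _ (by simp)]
    rfl
  rintro s₇ ⟨f₇, hcall⟩
  refine Run.seq_imp (run_solve hps K _ _ _ _ hcall) ?_
  rintro s₈ ⟨heff, hsol⟩
  have hS₈ := (hS₆.frame f₇ rfl rfl).frame heff.frame rfl rfl
  have hN₈ := fun x hx => ((hN₆ x hx).frame f₇ rfl).frame heff.frame rfl
  have hB : block 0 K.factorial = {q | q < K.factorial} := by ext; simp [block]
  have hsol' := hsol.sol
  rw [hB] at hsol'
  exact (run_output hS₈ hN₈ (fun q hq x hx => hsol'.mem x hx q hq)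
    (fun q hq x hx => (hsol'.legal x hx q hq).2) hsol.bool).imp fun s₉ h₉ =>
      solutionIn_of_output hn hφ hi hsol' h₉

/-! ## Time bounds -/

/-- The second summand on the left is slack that pays for the work of a level besides its recursive
calls. With `X = N + 1`, this work is at most `101 * (m + 1)! * X ^ 3`, and the slack of the new
level is at most the same amount because `X ≥ 2`; together they use up the slack provided by the `X
* (m + 1)` calls. For `m = 0` the constant is `222 = 20 + 202`. -/
theorem solveTime_le {N m : ℕ} (hm : m ≤ N) (hN : 1 ≤ N) :
    solveTime N m + 202 * (m.factorial * (N + 1) ^ 2) ≤ 222 * (m.factorial * (N + 1) ^ (m + 2)) := by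
  induction m with
  | zero =>
    change N * (N * 20 + 23) + 9 * N + 20 + 202 * (1 * (N + 1) ^ 2) ≤ 222 * (1 * (N + 1) ^ 2)
    nlinarith
  | succ m ih =>
    have ih := ih (by omega)
    set X := N + 1 with hX
    set P := X ^ (m + 2) with hP
    set f := m.factorial with hf
    have hfpos : 1 ≤ f := Nat.factorial_pos m
    have hstep : stepTime N m ≤ 67 * X ^ 2 + 13 * ((m + 1) * f * X) := by
      unfold stepTime
      rw [Nat.factorial_succ, ← hf, hX]
      have h1 : f * (N * 6 + 6) ≤ 6 * ((m + 1) * f * (N + 1)) := by nlinarith [Nat.zero_le (m * f * (N + 1))]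
      have h2 : (m + 1) * f * (N * 7 + 6) ≤ 7 * ((m + 1) * f * (N + 1)) := by
        nlinarith [Nat.zero_le ((m + 1) * f)]
      nlinarith
    have h1 : (m + 1) * f * X * X ≤ X ^ 3 * f * 1 := by
      have : m + 1 ≤ X := by omega
      calc (m + 1) * f * X * X ≤ X * f * X * X := by gcongr
        _ = X ^ 3 * f * 1 := by ring
    rw [solveTime, Nat.factorial_succ, ← hf, show m + 1 + 2 = (m + 2) + 1 by ring, pow_succ X (m + 2),
      ← hP]
    have h2 : N * (N * 20 + 23) + 9 * N + 20 ≤ 20 * X ^ 2 := by rw [hX]; nlinarith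
    have hX2 : 2 ≤ X := by omega
    have h3 : 2 * X ^ 2 ≤ X ^ 3 := by
      rw [pow_succ X 2, mul_comm]
      gcongr
    have h4 : X ^ 2 ≤ X ^ 3 := by omega
    have h5 : X ≤ X ^ 3 := Nat.le_self_pow (by omega) X
    calc X * (m + 1) * (stepTime N m + solveTime N m + 1) + (N * (N * 20 + 23) + 9 * N + 20) +
          202 * ((m + 1) * f * X ^ 2)
        ≤ X * (m + 1) * (67 * X ^ 2 + 13 * ((m + 1) * f * X) + solveTime N m + 1) + 20 * X ^ 2 +
          202 * ((m + 1) * f * X ^ 2) := by gcongr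
      _ = X * (m + 1) * solveTime N m + (m + 1) * (67 * X ^ 3 + 13 * ((m + 1) * f * X * X) + X) +
          20 * X ^ 2 + 202 * ((m + 1) * f * X ^ 2) := by ring
      _ ≤ X * (m + 1) * solveTime N m + (m + 1) * (67 * (X ^ 3 * f) + 13 * (X ^ 3 * f * 1) + X ^ 3 * f) +
          20 * ((m + 1) * (X ^ 3 * f)) + 101 * ((m + 1) * f * X ^ 3) := by
        have h6 : X ^ 3 ≤ X ^ 3 * f := Nat.le_mul_of_pos_right _ hfpos
        have h7 : X ^ 3 * f ≤ (m + 1) * (X ^ 3 * f) := Nat.le_mul_of_pos_left _ (by omega)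
        have h8 : 202 * ((m + 1) * f * X ^ 2) ≤ 101 * ((m + 1) * f * X ^ 3) := by
          calc 202 * ((m + 1) * f * X ^ 2) = 101 * ((m + 1) * f * (2 * X ^ 2)) := by ring
            _ ≤ _ := by gcongr
        have h9 : 67 * X ^ 3 + 13 * ((m + 1) * f * X * X) + X ≤
          67 * (X ^ 3 * f) + 13 * (X ^ 3 * f * 1) + X ^ 3 * f := by omega
        have := Nat.mul_le_mul_left (m + 1) h9
        omega
      _ = X * (m + 1) * (solveTime N m + 202 * (f * X ^ 2)) := by ring
      _ ≤ X * (m + 1) * (222 * (f * P)) := by gcongr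
      _ = 222 * ((m + 1) * f * (P * X)) := by ring

/-- The quotient is `(1 + 1 / N) ^ (K + 2)`, at most `e ^ 3` since `K + 2 ≤ 3 * N`, and `e < 3`. -/
theorem succ_pow_le {N K : ℕ} (hK : K ≤ N) (hN : 1 ≤ N) :
    (N + 1) ^ (K + 2) ≤ 27 * N ^ (K + 2) := by
  have hN' : (0 : ℝ) < N := by exact_mod_cast hN
  have h1 : (1 + 1 / (N : ℝ)) ^ (K + 2) ≤ 27 := by
    calc (1 + 1 / (N : ℝ)) ^ (K + 2) ≤ (Real.exp (1 / N)) ^ (K + 2) := by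
          gcongr
          rw [add_comm]
          exact Real.add_one_le_exp _
      _ = Real.exp ((K + 2) / N) := by
          rw [← Real.exp_nat_mul]
          congr 1
          push_cast
          ring
      _ ≤ Real.exp (3 * 1) := by
          gcongr
          rw [div_le_iff₀ hN']
          have h1 : (K : ℝ) ≤ N := by exact_mod_cast hK
          have h2 : (1 : ℝ) ≤ N := by exact_mod_cast hN
          linarith
      _ = (Real.exp 1) ^ 3 := by rw [← Real.exp_nat_mul]; norm_num
      _ ≤ 3 ^ 3 := by
          gcongr
          exact (Real.exp_one_lt_d9.trans (by norm_num)).le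
      _ = 27 := by norm_num
  have h2 : ((N : ℝ) + 1) ^ (K + 2) ≤ 27 * N ^ (K + 2) := by
    calc ((N : ℝ) + 1) ^ (K + 2) = (1 + 1 / (N : ℝ)) ^ (K + 2) * N ^ (K + 2) := by
          rw [← mul_pow]
          congr 1
          field_simp
      _ ≤ _ := by gcongr
  exact_mod_cast h2

theorem two_pow_le_factorial (K : ℕ) : 2 ^ K ≤ 2 * K.factorial := by
  induction K with
  | zero => simp
  | succ K ih =>
    rcases K with - | K
    · simp
    · rw [Nat.factorial_succ, pow_succ]
      nlinarith

/-- The solver contributes `222 * 27 = 5994`, and the other phases fit into the remainder. The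
products are bounded one by one and then generalized to variables, so that the final sum is linear.
-/
theorem totalTime_le {n g K dd z : ℕ} (hn : 0 < n) (hg : g ≤ n) (hK : K ≤ g) :
    totalTime n g K dd z ≤
      7000 * (K.factorial * (n * 2 ^ dd) ^ (K + 2) + 2 ^ K * z) := by
  have hM : 1 ≤ 2 ^ dd := Nat.one_le_two_pow
  have hW := two_pow_le_factorial K
  have hW1 : 1 ≤ 2 ^ K := Nat.one_le_two_pow
  have hF : 1 ≤ K.factorial := Nat.factorial_pos K
  unfold totalTime
  rw [mul_comm n (2 ^ dd)]
  have hnN : n ≤ 2 ^ dd * n := Nat.le_mul_of_pos_left n hM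
  have hMN : 2 ^ dd ≤ 2 ^ dd * n := Nat.le_mul_of_pos_right _ hn
  generalize 2 ^ dd * n = N at *
  generalize 2 ^ dd = M at *
  have hs := solveTime_le (N := N) (m := K) (by omega) (by omega)
  have hs' : K.factorial * (N + 1) ^ (K + 2) ≤ K.factorial * (27 * N ^ (K + 2)) :=
    Nat.mul_le_mul_left _ (succ_pow_le (by omega) (by omega))
  have hX : K.factorial * N ^ 2 ≤ K.factorial * N ^ (K + 2) :=
    Nat.mul_le_mul_left _ (Nat.pow_le_pow_right (by omega) (by omega))
  have e1 : K.factorial * (27 * N ^ (K + 2)) = 27 * (K.factorial * N ^ (K + 2)) := by ring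
  generalize K.factorial * N ^ (K + 2) = Y at *
  generalize solveTime N K = S at *
  generalize K.factorial = F at *
  generalize 2 ^ K = W at *
  have x1 : N ≤ N * N := Nat.le_mul_of_pos_left N (by omega)
  have x2 : N * N ≤ F * N ^ 2 := by rw [pow_two]; exact Nat.le_mul_of_pos_left _ hF
  have x3 : F * N ≤ F * N ^ 2 := by rw [pow_two]; exact Nat.mul_le_mul_left _ x1
  have x4 : F ≤ F * N := Nat.le_mul_of_pos_right _ (by omega)
  have x5 : K * K ≤ N * N := Nat.mul_le_mul (by omega) (by omega)
  have x6 : N * K ≤ N * N := Nat.mul_le_mul_left _ (by omega)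
  have x7 : W * K ≤ 2 * (F * N) := by
    calc W * K ≤ 2 * F * N := Nat.mul_le_mul hW (by omega)
      _ = _ := by ring
  have x8 : z ≤ W * z := Nat.le_mul_of_pos_left _ hW1
  have y1 : K * (K * 3 + 6) = 3 * (K * K) + 6 * K := by ring
  have y2 : N * (K * 12 + 14) = 12 * (N * K) + 14 * N := by ring
  have y3 : N * (N * 4 + 4) = 4 * (N * N) + 4 * N := by ring
  have y4 : W * (K * 4 + z * 14 + 9) = 4 * (W * K) + 14 * (W * z) + 9 * W := by ring
  have y5 : F * (N * 9 + 4) = 9 * (F * N) + 4 * F := by ring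
  rw [y1, y2, y3, y4, y5]
  generalize F * N ^ 2 = X at *
  generalize F * N = FN at *
  generalize N * N = NN at *
  generalize N * K = NK at *
  generalize K * K = KK at *
  generalize W * K = WK at *
  generalize W * z = Wz at *
  omega

theorem MPGame.SolvedWithin.mono {n g : ℕ} {G : MPGame (Fin n) (Fin g)} {p : Program} {B T T' : ℕ}
    (h : G.SolvedWithin p B T) (hT : T ≤ T') : G.SolvedWithin p B T' := by
  obtain ⟨s, t, h1, h2, h3⟩ := h
  exact ⟨s, t, h1, h2.trans hT, h3⟩

/-- For small formulas, `2 ^ K ≤ 2 * K!` and `|φ| ≤ 2 * n ^ 2` bound the second summand by four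
times the first, so five times the constant `7000` is enough in both cases. -/
theorem MPGame.solvedWithin {n g : ℕ} {G : MPGame (Fin n) (Fin g)} {e : Expr} {K dd : ℕ}
    (hn : 0 < n) (hgn : g ≤ n) (hφ : G.formula.UniqueEvents)
    (hK : G.formula.numEL + G.formula.numLocal = K)
    (he : ∀ s, ColorsIn G s → e.eval s = dd) (hdd : dd ≤ G.formula.numLocal)
    (hloc : G.formula.numLocal ≤ dd ∨ G.HasLocalMemory) :
    G.SolvedWithin (solver e) (K.factorial * 2 ^ dd)
      (35000 * (K.factorial * (n * 2 ^ dd) ^ (K + 2) + 2 ^ K * G.formula.size)) ∧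
    (G.formula.size ≤ 2 * n ^ 2 → G.SolvedWithin (solver e) (K.factorial * 2 ^ dd)
      (35000 * (K.factorial * (n * 2 ^ dd) ^ (K + 2)))) := by
  have h := solvedWithin_solver hn hgn hφ he hdd hloc
  have hT := totalTime_le (dd := dd) (z := G.formula.size) hn hgn (numEL_add_numLocal_le hφ)
  rw [hK] at h hT
  refine ⟨h.mono (hT.trans (Nat.mul_le_mul_right _ (by norm_num))), fun hz => h.mono (hT.trans ?_)⟩
  have h1 : 2 ^ K * G.formula.size ≤ 4 * (K.factorial * (n * 2 ^ dd) ^ (K + 2)) := by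
    have h3 : n ^ 2 ≤ (n * 2 ^ dd) ^ 2 :=
      Nat.pow_le_pow_left (Nat.le_mul_of_pos_right n (Nat.two_pow_pos dd)) 2
    have h4 : (n * 2 ^ dd) ^ 2 ≤ (n * 2 ^ dd) ^ (K + 2) :=
      Nat.pow_le_pow_right (by positivity) (by omega)
    calc 2 ^ K * G.formula.size ≤ 2 * K.factorial * (2 * (n * 2 ^ dd) ^ (K + 2)) :=
          Nat.mul_le_mul (two_pow_le_factorial K) (hz.trans (Nat.mul_le_mul_left 2 (h3.trans h4)))
      _ = _ := by ring
  omega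

end

end MannaPnueli

theorem mainTheorem2 :
    -- solving Manna-Pnueli games
    (∃ (p : Program) (C : ℕ), ∀ (n g k d : ℕ) (G : MPGame (Fin n) (Fin g)),
      0 < n → g ≤ n → G.formula.UniqueEvents →
      G.formula.numEL = k → G.formula.numLocal = d →
        G.SolvedWithin p ((k + d).factorial * 2 ^ d)
          (C * ((k + d).factorial * (n * 2 ^ d) ^ (k + d + 2) + 2 ^ (k + d) * G.formula.size)) ∧
        (G.formula.size ≤ 2 * n ^ 2 →
          G.SolvedWithin p ((k + d).factorial * 2 ^ d)
            (C * ((k + d).factorial * (n * 2 ^ d) ^ (k + d + 2))))) ∧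
    -- solving Manna-Pnueli games over arenas that have memory for local events
    (∃ (p : Program) (C : ℕ), ∀ (n g k d : ℕ) (G : MPGame (Fin n) (Fin g)),
      0 < n → g ≤ n → G.formula.UniqueEvents → G.HasLocalMemory →
      G.formula.numEL = k → G.formula.numLocal = d →
        G.SolvedWithin p (k + d).factorial
          (C * ((k + d).factorial * n ^ (k + d + 2) + 2 ^ (k + d) * G.formula.size)) ∧
        (G.formula.size ≤ 2 * n ^ 2 →
          G.SolvedWithin p (k + d).factorial
            (C * ((k + d).factorial * n ^ (k + d + 2))))) ∧
    -- the bounds in exponential form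
    (∃ C : ℝ, ∀ n k d : ℕ, 2 ≤ n → k + d ≤ n → 1 ≤ k + d →
      (1 ≤ d → (((k + d).factorial * (n * 2 ^ d) ^ (k + d + 2) : ℕ) : ℝ) ≤
        (2 : ℝ) ^ (C * ((d : ℝ) * ((k : ℝ) + d) * Real.logb 2 n))) ∧
      (((k + d).factorial * n ^ (k + d + 2) : ℕ) : ℝ) ≤
        (2 : ℝ) ^ (C * (((k : ℝ) + d) * Real.logb 2 n))) ∧
    -- correctness of the reduction and memory of winning strategies
    (∀ (V Γ : Type*) [Finite V] [Finite Γ] (k d : ℕ) (G : MPGame V Γ) (P : Player),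
      G.formula.UniqueEvents → G.formula.numEL = k → G.formula.numLocal = d →
        (∀ v, v ∈ G.winRegion P ↔ (v, G.initMemory) ∈ G.elGame.winRegion P) ∧
        G.elGame.MemoryAtMost P (k + d).factorial ∧
        (G.HasLocalMemory → G.MemoryAtMost P (k + d).factorial) ∧
        (¬ (k = 0 ∧ (d = 2 ∨ d = 3)) → G.MemoryAtMost P (k + d).factorial)) := by
  -- Variable 44 is `vLoc`, so the first program gives bits to all local events that it finds; the
  -- second one gives bits to none.
  refine ⟨⟨solver (.var 44), 35000, ?_⟩, ⟨solver (.const 0), 35000, ?_⟩, bounds_exponential, ?_⟩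
  · rintro n g k d G hn hg hφ rfl rfl
    exact MPGame.solvedWithin hn hg hφ rfl (fun s hs => hs.locals) le_rfl (Or.inl le_rfl)
  · rintro n g k d G hn hg hφ hG rfl rfl
    simpa using MPGame.solvedWithin (dd := 0) hn hg hφ rfl (fun _ _ => rfl) (Nat.zero_le _)
      (Or.inr hG)
  · rintro V Γ _ _ k d G P hφ rfl rfl
    obtain ⟨_, _, _, -, h⟩ := MPGame.elGame_solved hφ
    exact ⟨MPGame.mem_winRegion_iff_elGame hφ P, (h P).2,
      fun hG => MPGame.memoryAtMost_of_hasLocalMemory hφ hG P, MPGame.memoryAtMost hφ P⟩
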